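/- Let $(M^4,g)$ be an oriented smooth Riemannian $4$-manifold, let $S$ be an oriented smooth surface without boundary, and let $f:S\to M$ be a smooth minimal immersion, i.e. its second fundamental form is trace-free for the induced metric $f^*g$. Let $\nabla$ and $K(\cdot,\cdot)$ be the Levi-Civita connection and the sectional curvature of $g$, let $dA_S$ be the area measure of $f^*g$, and let $(\cdot)^N,(\cdot)^\top$ be the normal and tangential projections in $T_{f(p)}M$. On the normal bundle $\nu$ let $\nabla^\bot_X\sigma=(\nabla_X\sigma)^N$ and $R^\bot(X,Y)Z=\nabla^\bot_X\nabla^\bot_YZ-\nabla^\bot_Y\nabla^\bot_XZ-\nabla^\bot_{[X,Y]}Z$. For $p\in S$ let $e_1,e_2$ be a positively oriented orthonormal basis of $T_pS$ and $e_3,e_4$ an orthonormal basis of $\nu_p$ such that $e_1,e_2,e_3,e_4$ is positively oriented in $M$ (tangent vectors of $S$ being identified with their images under $df$). Put $Ie_1=e_2$, $Ie_2=-e_1$, $Je_3=e_4$, $Je_4=-e_3$ and $K^\bot=\langle R^\bot(e_1,e_2)e_4,e_3\rangle$; these do not depend on the choice of the bases. For a normal section $\sigma$ and a unit vector $e\in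 T_pS$ put $$\|\bar\partial^\bot\sigma\|^2=\tfrac12\|\nabla^\bot_e\sigma+\nabla^\bot_{Ie}(J\sigma)\|^2,\qquad A^\sigma(X)=-(\nabla_X\sigma)^\top,\qquad \|A^\sigma\|^2=\|A^\sigma(e)\|^2+\|A^\sigma(Ie)\|^2 .$$ Let $\sigma$ be a smooth normal section that vanishes outside a compact set $K\subseteq S$ (if $S$ is closed, $K=S$ and $\sigma$ is arbitrary). A variation of $f$ in the direction $\sigma$ is a family of maps $F_t:S\to M$ with $F_0=f$ and $\partial_tF_t|_{t=0}=\sigma$ that, for all sufficiently small $|t|$, depends smoothly on $(t,p)$ and satisfies $F_t=f$ outside $K$. Such variations exist, and for every one of them the function $t\mapsto\operatorname{Area}(F_t|_K)$, where the area is that of the pulled-back form $F_t^*g$, is twice differentiable at $t=0$, with second derivative $$\delta^2(\sigma)=\int_S\Big\{2\|\bar\partial^\bot\sigma\|^2+\big[K^\bot-K(\sigma,e)-K(\sigma,Ie)\big]\|\sigma\|^2-\|A^\sigma\|^2\Big\}\,dA_S ,$$ where at each point $p$ of $S$ the vector $e$ is any unit vector in $T_pS$, the integrand is integrable, and $K(\sigma,\cdot)\|\sigma\|^2$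 is read as $0$ where $\sigma=0$. -/

import Mathlib

open Set Filter Topology MeasureTheory
open scoped Manifold ContDiff

noncomputable section

namespace SurfaceVariation

/-- The Euclidean space on which `n`-dimensional manifolds are modelled. -/
abbrev Euc (n : ℕ) : Type := EuclideanSpace ℝ (Fin n)

/-- The standard basis vectors of `ℝⁿ`. -/
def stdVec {n : ℕ} (i : Fin n) : Euc n := EuclideanSpace.single i 1

/-- The tangent space at `x` of an `n`-dimensional manifold. -/
abbrev Tan (n : ℕ) {M : Type*} [TopologicalSpace M] [ChartedSpace (Euc n) M] (x : M) : Type :=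
  TangentSpace (𝓡 n) x

/-- Smooth Riemannian metrics on an `n`-dimensional manifold. -/
abbrev SmoothMetric (n : ℕ) (M : Type*) [TopologicalSpace M] [ChartedSpace (Euc n) M]
    [IsManifold (𝓡 n) ∞ M] : Type _ :=
  Bundle.ContMDiffRiemannianMetric (𝓡 n) ∞ (Euc n) (fun x : M => TangentSpace (𝓡 n) x)

/-! ### Tangent vectors in charts -/

section Charts

/-- The components of a tangent vector `u` at `x` in the chart `chartAt q`. -/
def toChart {n : ℕ} {M : Type*} [TopologicalSpace M] [ChartedSpace (Euc n) M]
    [IsManifold (𝓡 n) ∞ M] (q x : M) (u : Tan n x) : Euc n :=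
  (trivializationAt (Euc n) (fun x : M => TangentSpace (𝓡 n) x) q ⟨x, u⟩).2

/-- The tangent vector at `x` whose components in the chart `chartAt q` are `v`
(for `x` in the domain of this chart). -/
def ofChart {n : ℕ} {M : Type*} [TopologicalSpace M] [ChartedSpace (Euc n) M]
    [IsManifold (𝓡 n) ∞ M] (q x : M) (v : Euc n) : Tan n x :=
  (trivializationAt (Euc n) (fun x : M => TangentSpace (𝓡 n) x) q).symm x v

/-- The extension of a tangent vector at `q` to a vector field near `q` which has constant
components in the chart `chartAt q`. -/
def extendVec {n : ℕ} {M : Type*} [TopologicalSpace M] [ChartedSpace (Euc n) M]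
    [IsManifold (𝓡 n) ∞ M] (q : M) (u : Tan n q) (x : M) : Tan n x :=
  ofChart q x (toChart q q u)

end Charts

/-! ### Orientations -/

/-- `v` is a basis belonging to the orientation `o`. -/
def IsPositiveBasis {n : ℕ} {V : Type*} [AddCommGroup V] [Module ℝ V]
    (o : Orientation ℝ V (Fin n)) (v : Fin n → V) : Prop :=
  ∃ b : Module.Basis (Fin n) ℝ V, (⇑b : Fin n → V) = v ∧ b.orientation = o

/-- An orientation of an `n`-dimensional manifold: an orientation of each tangent space such that
the coordinate frame of every chart has locally constant sign. -/
structure ManifoldOrientation (n : ℕ) (M : Type*) [TopologicalSpace M] [ChartedSpace (Euc n) M]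
    [IsManifold (𝓡 n) ∞ M] where
  /-- the orientation of the tangent space at a point -/
  orient : ∀ x : M, Orientation ℝ (Tan n x) (Fin n)
  locally_constant : ∀ q : M, ∀ᶠ x in 𝓝 q,
    (IsPositiveBasis (orient x) (fun i => ofChart q x (stdVec i)) ↔
      IsPositiveBasis (orient q) (fun i => ofChart q q (stdVec i)))

/-! ### The Levi-Civita connection and the curvature of a Riemannian metric -/

section Riemannian

/-- The coefficients `g(u, v)` of the metric at the point with coordinates `y` in the chart
`chartAt q`, for `u`, `v` given by their components in this chart. -/
def chartMetric {n : ℕ} {M : Type*} [TopologicalSpace M] [ChartedSpace (Euc n) M]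
    [IsManifold (𝓡 n) ∞ M] (g : SmoothMetric n M) (q : M) (y u v : Euc n) : ℝ :=
  g.inner ((chartAt (Euc n) q).symm y) (ofChart q _ u) (ofChart q _ v)

/-- The derivative in the direction `w` of the metric coefficient `g(u, v)`, for `u`, `v` constant
in the chart. -/
def chartMetricDeriv {n : ℕ} {M : Type*} [TopologicalSpace M] [ChartedSpace (Euc n) M]
    [IsManifold (𝓡 n) ∞ M] (g : SmoothMetric n M) (q : M) (y w u v : Euc n) : ℝ :=
  fderiv ℝ (fun z => chartMetric g q z u v) y w

/-- The Christoffel symbols `Γ(u, v)` of the Levi-Civita connection in the chart `chartAt q`, at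
the point with coordinates `y`:
`Γ(u, v)ᵏ = ½ ∑ₗ gᵏˡ (D_u g(v, eₗ) + D_v g(u, eₗ) - D_{eₗ} g(u, v))`. -/
def christoffel {n : ℕ} {M : Type*} [TopologicalSpace M] [ChartedSpace (Euc n) M]
    [IsManifold (𝓡 n) ∞ M] (g : SmoothMetric n M) (q : M) (y u v : Euc n) : Euc n :=
  ∑ k : Fin n, (∑ l : Fin n,
    (Matrix.of fun i j : Fin n => chartMetric g q y (stdVec i) (stdVec j))⁻¹ k l *
      (1 / 2 * (chartMetricDeriv g q y u v (stdVec l) + chartMetricDeriv g q y v u (stdVec l)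
        - chartMetricDeriv g q y (stdVec l) u v))) • stdVec k

/-- The Riemann curvature tensor
`R(u, v)w = ∇_u ∇_v w - ∇_v ∇_u w - ∇_{[u, v]} w` at `q`, computed for vector fields that are
constant in the chart `chartAt q`. -/
def curvature {n : ℕ} {M : Type*} [TopologicalSpace M] [ChartedSpace (Euc n) M]
    [IsManifold (𝓡 n) ∞ M] (g : SmoothMetric n M) (q : M) (u v w : Tan n q) : Tan n q :=
  let y : Euc n := chartAt (Euc n) q q
  let Γ : Euc n → Euc n → Euc n → Euc n := christoffel g q
  let a := toChart q q u
  let b := toChart q q v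
  let c := toChart q q w
  ofChart q q
    (fderiv ℝ (fun z => Γ z b c) y a - fderiv ℝ (fun z => Γ z a c) y b
      + Γ y a (Γ y b c) - Γ y b (Γ y a c))

/-- The sectional curvature of the plane spanned by `u` and `v`. -/
def sectional {n : ℕ} {M : Type*} [TopologicalSpace M] [ChartedSpace (Euc n) M]
    [IsManifold (𝓡 n) ∞ M] (g : SmoothMetric n M) (q : M) (u v : Tan n q) : ℝ :=
  g.inner q (curvature g q u v v) u /
    (g.inner q u u * g.inner q v v - g.inner q u v ^ 2)

end Riemannian

/-! ### Maps from a surface into a Riemannian 4-manifold -/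

section Surface

/-- The bilinear form `f^* g` on the tangent spaces of the surface. -/
def pullForm {S M : Type*} [TopologicalSpace S] [ChartedSpace (Euc 2) S]
    [TopologicalSpace M] [ChartedSpace (Euc 4) M] [IsManifold (𝓡 4) ∞ M]
    (g : SmoothMetric 4 M) (f : S → M) (p : S) (X Y : Tan 2 p) : ℝ :=
  g.inner (f p) (mfderiv (𝓡 2) (𝓡 4) f p X) (mfderiv (𝓡 2) (𝓡 4) f p Y)

/-- A vector field along `f`, that is a section of `f^* TM`, is smooth. -/
def SmoothAlong {S M : Type*} [TopologicalSpace S] [ChartedSpace (Euc 2) S]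
    [TopologicalSpace M] [ChartedSpace (Euc 4) M] [IsManifold (𝓡 4) ∞ M]
    (f : S → M) (V : ∀ p : S, Tan 4 (f p)) : Prop :=
  ContMDiff (𝓡 2) (𝓡 4).tangent ∞ (fun p => (⟨f p, V p⟩ : TangentBundle (𝓡 4) M))

/-- The vector `w ∈ T_{f(p)} M` is normal to the surface. -/
def IsNormal {S M : Type*} [TopologicalSpace S] [ChartedSpace (Euc 2) S]
    [TopologicalSpace M] [ChartedSpace (Euc 4) M] [IsManifold (𝓡 4) ∞ M]
    (g : SmoothMetric 4 M) (f : S → M) (p : S) (w : Tan 4 (f p)) : Prop :=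
  ∀ X : Tan 2 p, g.inner (f p) w (mfderiv (𝓡 2) (𝓡 4) f p X) = 0

/-- The covariant derivative `∇_X V` of a vector field `V` along `f`, for the connection on
`f^* TM` induced by the Levi-Civita connection of `g`. In the chart of `M` at `f p` it is
`D_X V + Γ(df X, V)`. -/
def covAlong {S M : Type*} [TopologicalSpace S] [ChartedSpace (Euc 2) S]
    [TopologicalSpace M] [ChartedSpace (Euc 4) M] [IsManifold (𝓡 4) ∞ M]
    (g : SmoothMetric 4 M) (f : S → M) (V : ∀ p : S, Tan 4 (f p)) (p : S) (X : Tan 2 p) :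
    Tan 4 (f p) :=
  let D : Euc 4 := mfderiv (𝓡 2) 𝓘(ℝ, Euc 4) (fun q : S => toChart (f p) (f q) (V q)) p X
  ofChart (f p) (f p)
    (D + christoffel g (f p) (chartAt (Euc 4) (f p) (f p))
          (toChart (f p) (f p) (mfderiv (𝓡 2) (𝓡 4) f p X))
          (toChart (f p) (f p) (V p)))

/-- The normal component of a vector of `T_{f(p)} M`: the normal vector that differs from it by
a vector tangent to the surface. -/
def normalPart {S M : Type*} [TopologicalSpace S] [ChartedSpace (Euc 2) S]
    [TopologicalSpace M] [ChartedSpace (Euc 4) M] [IsManifold (𝓡 4) ∞ M]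
    (g : SmoothMetric 4 M) (f : S → M) (p : S) (v : Tan 4 (f p)) : Tan 4 (f p) :=
  Classical.epsilon fun w : Tan 4 (f p) =>
    IsNormal g f p w ∧ ∃ X : Tan 2 p, v - w = mfderiv (𝓡 2) (𝓡 4) f p X

/-- The normal connection `∇^⊥_X ν = (∇_X ν)^N`. -/
def normalCov {S M : Type*} [TopologicalSpace S] [ChartedSpace (Euc 2) S]
    [TopologicalSpace M] [ChartedSpace (Euc 4) M] [IsManifold (𝓡 4) ∞ M]
    (g : SmoothMetric 4 M) (f : S → M) (ν : ∀ p : S, Tan 4 (f p)) (p : S) (X : Tan 2 p) :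
    Tan 4 (f p) :=
  normalPart g f p (covAlong g f ν p X)

/-- The second fundamental form `B(X, Y) = (∇_X df(Y))^N`. -/
def secondForm {S M : Type*} [TopologicalSpace S] [ChartedSpace (Euc 2) S]
    [IsManifold (𝓡 2) ∞ S]
    [TopologicalSpace M] [ChartedSpace (Euc 4) M] [IsManifold (𝓡 4) ∞ M]
    (g : SmoothMetric 4 M) (f : S → M) (p : S) (X Y : Tan 2 p) : Tan 4 (f p) :=
  normalPart g f p
    (covAlong g f (fun q => mfderiv (𝓡 2) (𝓡 4) f q (extendVec p Y q)) p X)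

/-- The shape operator `A^ν(X) = -(∇_X ν)^⊤` in the normal direction `ν`, with values in the
tangent plane of the surface, considered as a subspace of `T_{f(p)} M`. -/
def shapeOperator {S M : Type*} [TopologicalSpace S] [ChartedSpace (Euc 2) S]
    [TopologicalSpace M] [ChartedSpace (Euc 4) M] [IsManifold (𝓡 4) ∞ M]
    (g : SmoothMetric 4 M) (f : S → M) (ν : ∀ p : S, Tan 4 (f p)) (p : S) (X : Tan 2 p) :
    Tan 4 (f p) :=
  -(covAlong g f ν p X - normalCov g f ν p X)

/-- `f` is a smooth minimal immersion: a smooth immersion whose second fundamental form is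
trace-free for the induced metric. -/
structure IsMinimalImmersion {S M : Type*} [TopologicalSpace S] [ChartedSpace (Euc 2) S]
    [IsManifold (𝓡 2) ∞ S]
    [TopologicalSpace M] [ChartedSpace (Euc 4) M] [IsManifold (𝓡 4) ∞ M]
    (g : SmoothMetric 4 M) (f : S → M) : Prop where
  smooth : ContMDiff (𝓡 2) (𝓡 4) ∞ f
  immersion : ∀ p : S, Function.Injective (mfderiv (𝓡 2) (𝓡 4) f p)
  minimal : ∀ (p : S) (X Y : Tan 2 p),
    pullForm g f p X X = 1 → pullForm g f p Y Y = 1 → pullForm g f p X Y = 0 →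
      secondForm g f p X X + secondForm g f p Y Y = 0

/-- The curvature of the normal bundle for vector fields `X`, `Y` on the surface and a normal
field `Z`: `R^⊥(X, Y)Z = ∇^⊥_X ∇^⊥_Y Z - ∇^⊥_Y ∇^⊥_X Z - ∇^⊥_{[X, Y]} Z`. -/
def normalCurvatureField {S M : Type*} [TopologicalSpace S] [ChartedSpace (Euc 2) S]
    [TopologicalSpace M] [ChartedSpace (Euc 4) M] [IsManifold (𝓡 4) ∞ M]
    (g : SmoothMetric 4 M) (f : S → M) (X Y : ∀ p : S, Tan 2 p) (Z : ∀ p : S, Tan 4 (f p)) (p : S) :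
    Tan 4 (f p) :=
  normalCov g f (fun q => normalCov g f Z q (Y q)) p (X p)
    - normalCov g f (fun q => normalCov g f Z q (X q)) p (Y p)
    - normalCov g f Z p (VectorField.mlieBracket (𝓡 2) X Y p)

/-- The value `R^⊥(u, v)z` of the curvature tensor of the normal bundle on vectors at `p`, obtained
by extending `u`, `v` and the normal vector `z` to smooth fields near `p`. -/
def normalCurvature {S M : Type*} [TopologicalSpace S] [ChartedSpace (Euc 2) S]
    [IsManifold (𝓡 2) ∞ S]
    [TopologicalSpace M] [ChartedSpace (Euc 4) M] [IsManifold (𝓡 4) ∞ M]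
    (g : SmoothMetric 4 M) (f : S → M) (p : S) (u v : Tan 2 p) (z : Tan 4 (f p)) : Tan 4 (f p) :=
  normalCurvatureField g f (extendVec p u) (extendVec p v)
    (fun q => normalPart g f q (extendVec (f p) z (f q))) p

/-! ### Oriented adapted frames, the complex structures and the curvature `K^⊥` -/

/-- `e₁, e₂` is a positively oriented basis of `T_p S`, orthonormal for the induced metric. -/
def IsTangentFrame {S M : Type*} [TopologicalSpace S] [ChartedSpace (Euc 2) S]
    [IsManifold (𝓡 2) ∞ S]
    [TopologicalSpace M] [ChartedSpace (Euc 4) M] [IsManifold (𝓡 4) ∞ M]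
    (oS : ManifoldOrientation 2 S) (g : SmoothMetric 4 M) (f : S → M) (p : S) (e₁ e₂ : Tan 2 p) :
    Prop :=
  pullForm g f p e₁ e₁ = 1 ∧ pullForm g f p e₂ e₂ = 1 ∧ pullForm g f p e₁ e₂ = 0 ∧
    IsPositiveBasis (oS.orient p) ![e₁, e₂]

/-- `e₁, e₂` is an oriented orthonormal basis of `T_p S` and `e₃, e₄` is an orthonormal basis of
the normal space such that `e₁, e₂, e₃, e₄` gives the orientation of `M`; thus `e₃, e₄` is
positively oriented for the induced orientation of the normal bundle. -/
def IsAdaptedFrame {S M : Type*} [TopologicalSpace S] [ChartedSpace (Euc 2) S]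
    [IsManifold (𝓡 2) ∞ S]
    [TopologicalSpace M] [ChartedSpace (Euc 4) M] [IsManifold (𝓡 4) ∞ M]
    (oS : ManifoldOrientation 2 S) (oM : ManifoldOrientation 4 M) (g : SmoothMetric 4 M) (f : S → M)
    (p : S) (e₁ e₂ : Tan 2 p) (e₃ e₄ : Tan 4 (f p)) : Prop :=
  IsTangentFrame oS g f p e₁ e₂ ∧ IsNormal g f p e₃ ∧ IsNormal g f p e₄ ∧
    g.inner (f p) e₃ e₃ = 1 ∧ g.inner (f p) e₄ e₄ = 1 ∧ g.inner (f p) e₃ e₄ = 0 ∧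
    IsPositiveBasis (oM.orient (f p))
      ![mfderiv (𝓡 2) (𝓡 4) f p e₁, mfderiv (𝓡 2) (𝓡 4) f p e₂, e₃, e₄]

/-- The complex structure `I` of the surface: `I e₁ = e₂`, `I e₂ = -e₁` for an oriented orthonormal
basis of `T_p S` (the result does not depend on the basis). -/
def tangentI {S M : Type*} [TopologicalSpace S] [ChartedSpace (Euc 2) S]
    [IsManifold (𝓡 2) ∞ S]
    [TopologicalSpace M] [ChartedSpace (Euc 4) M] [IsManifold (𝓡 4) ∞ M]
    (oS : ManifoldOrientation 2 S) (g : SmoothMetric 4 M) (f : S → M) (p : S) (X : Tan 2 p) : Tan 2 p :=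
  Classical.epsilon fun Y : Tan 2 p => ∃ e₁ e₂ : Tan 2 p, IsTangentFrame oS g f p e₁ e₂ ∧
    Y = pullForm g f p X e₁ • e₂ - pullForm g f p X e₂ • e₁

/-- The complex structure `J` of the normal bundle: `J e₃ = e₄`, `J e₄ = -e₃` for a positively
oriented orthonormal basis of the normal space (the result does not depend on the basis). -/
def normalJ {S M : Type*} [TopologicalSpace S] [ChartedSpace (Euc 2) S]
    [IsManifold (𝓡 2) ∞ S]
    [TopologicalSpace M] [ChartedSpace (Euc 4) M] [IsManifold (𝓡 4) ∞ M]
    (oS : ManifoldOrientation 2 S) (oM : ManifoldOrientation 4 M) (g : SmoothMetric 4 M) (f : S → M)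
    (p : S) (v : Tan 4 (f p)) : Tan 4 (f p) :=
  Classical.epsilon fun w : Tan 4 (f p) => ∃ (e₁ e₂ : Tan 2 p) (e₃ e₄ : Tan 4 (f p)),
    IsAdaptedFrame oS oM g f p e₁ e₂ e₃ e₄ ∧
      w = g.inner (f p) v e₃ • e₄ - g.inner (f p) v e₄ • e₃

/-- The curvature `K^⊥ = ⟨R^⊥(e₁, e₂)e₄, e₃⟩` of the normal bundle, for an oriented adapted
orthonormal frame (the result does not depend on the frame). -/
def normalK {S M : Type*} [TopologicalSpace S] [ChartedSpace (Euc 2) S]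
    [IsManifold (𝓡 2) ∞ S]
    [TopologicalSpace M] [ChartedSpace (Euc 4) M] [IsManifold (𝓡 4) ∞ M]
    (oS : ManifoldOrientation 2 S) (oM : ManifoldOrientation 4 M) (g : SmoothMetric 4 M) (f : S → M)
    (p : S) : ℝ :=
  Classical.epsilon fun k : ℝ => ∃ (e₁ e₂ : Tan 2 p) (e₃ e₄ : Tan 4 (f p)),
    IsAdaptedFrame oS oM g f p e₁ e₂ e₃ e₄ ∧
      k = g.inner (f p) (normalCurvature g f p e₁ e₂ e₄) e₃

/-- `‖∂̄^⊥σ‖² = ½ ‖∇^⊥_e σ + ∇^⊥_{Ie} (Jσ)‖²` for a unit tangent vector `e` at `p`. -/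
def dbarSq {S M : Type*} [TopologicalSpace S] [ChartedSpace (Euc 2) S]
    [IsManifold (𝓡 2) ∞ S]
    [TopologicalSpace M] [ChartedSpace (Euc 4) M] [IsManifold (𝓡 4) ∞ M]
    (oS : ManifoldOrientation 2 S) (oM : ManifoldOrientation 4 M) (g : SmoothMetric 4 M) (f : S → M)
    (σ : ∀ p : S, Tan 4 (f p)) (p : S) (e : Tan 2 p) : ℝ :=
  let w : Tan 4 (f p) := normalCov g f σ p e
    + normalCov g f (fun q => normalJ oS oM g f q (σ q)) p (tangentI oS g f p e)
  1 / 2 * g.inner (f p) w w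

/-- `‖A^σ‖² = ‖A^σ(e)‖² + ‖A^σ(Ie)‖²` for a unit tangent vector `e` at `p`. -/
def shapeSq {S M : Type*} [TopologicalSpace S] [ChartedSpace (Euc 2) S]
    [IsManifold (𝓡 2) ∞ S]
    [TopologicalSpace M] [ChartedSpace (Euc 4) M] [IsManifold (𝓡 4) ∞ M]
    (oS : ManifoldOrientation 2 S) (g : SmoothMetric 4 M) (f : S → M)
    (σ : ∀ p : S, Tan 4 (f p)) (p : S) (e : Tan 2 p) : ℝ :=
  g.inner (f p) (shapeOperator g f σ p e) (shapeOperator g f σ p e)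
    + g.inner (f p) (shapeOperator g f σ p (tangentI oS g f p e))
        (shapeOperator g f σ p (tangentI oS g f p e))

/-! ### Area and its second variation -/

/-- The area measure on the domain of the chart `chartAt q` of a field `h` of bilinear forms on the
surface: the image under the inverse chart of `√(det h(∂ᵢ, ∂ⱼ)) dx¹ dx²`. -/
def chartAreaMeasure {S : Type*} [TopologicalSpace S] [ChartedSpace (Euc 2) S]
    [IsManifold (𝓡 2) ∞ S] [MeasurableSpace S]
    (h : ∀ p : S, Tan 2 p → Tan 2 p → ℝ) (q : S) : Measure S :=
  ((volume.restrict (chartAt (Euc 2) q).target).withDensity fun y : Euc 2 =>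
      ENNReal.ofReal (Real.sqrt (Matrix.det (Matrix.of fun i j : Fin 2 =>
        h ((chartAt (Euc 2) q).symm y) (ofChart q _ (stdVec i)) (ofChart q _ (stdVec j)))))).map
    (chartAt (Euc 2) q).symm

/-- The area measure of a field `h` of bilinear forms on the surface. For continuous positive
semidefinite `h` on a second countable surface the measures in the supremum are, by the change of
variables formula, the restrictions of one measure to the chart domains, and the supremum is this
measure. -/
def areaMeasure {S : Type*} [TopologicalSpace S] [ChartedSpace (Euc 2) S]
    [IsManifold (𝓡 2) ∞ S] [MeasurableSpace S]
    (h : ∀ p : S, Tan 2 p → Tan 2 p → ℝ) : Measure S :=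
  ⨆ q : S, chartAreaMeasure h q

/-- The area, counted with multiplicity, of the image of `K ⊆ S` under the map `u : S → M`. -/
def area {S M : Type*} [TopologicalSpace S] [ChartedSpace (Euc 2) S]
    [IsManifold (𝓡 2) ∞ S] [MeasurableSpace S]
    [TopologicalSpace M] [ChartedSpace (Euc 4) M] [IsManifold (𝓡 4) ∞ M]
    (g : SmoothMetric 4 M) (K : Set S) (u : S → M) : ℝ :=
  (areaMeasure (pullForm g u) K).toReal

/-- `F` (restricted to small times) is a smooth variation of `f`, fixed outside `K`, with initial
velocity the vector field `σ` along `f`. -/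
structure IsVariation {S M : Type*} [TopologicalSpace S] [ChartedSpace (Euc 2) S]
    [TopologicalSpace M] [ChartedSpace (Euc 4) M]
    (f : S → M) (K : Set S) (σ : ∀ p : S, Tan 4 (f p)) (F : ℝ → S → M) : Prop where
  initial : F 0 = f
  velocity : ∀ p : S,
    (⟨F 0 p, mfderiv 𝓘(ℝ, ℝ) (𝓡 4) (fun t : ℝ => F t p) 0 (1 : ℝ)⟩ : TangentBundle (𝓡 4) M)
      = ⟨f p, σ p⟩
  smooth_and_fixed : ∃ ε : ℝ, 0 < ε ∧
    ContMDiffOn (𝓘(ℝ, ℝ).prod (𝓡 2)) (𝓡 4) ∞ (fun z : ℝ × S => F z.1 z.2)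
      (Ioo (-ε) ε ×ˢ (univ : Set S)) ∧
    ∀ t ∈ Ioo (-ε) ε, ∀ p ∉ K, F t p = f p

/-- `a` is twice differentiable at `t`, with second derivative `c`. -/
def HasSecondDerivAt (a : ℝ → ℝ) (c t : ℝ) : Prop :=
  ∃ a' : ℝ → ℝ, (∀ᶠ s in 𝓝 t, HasDerivAt a (a' s) s) ∧ HasDerivAt a' c t

/-- `c` is the second variation `δ²(σ)` of area at `f` in the direction `σ` (a field along `f`
vanishing outside `K`): there are variations of `f` fixed outside `K` with initial velocity `σ`,
and the second derivative of the area at time `0` along each of them is `c`. -/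
def IsSecondVariation {S M : Type*} [TopologicalSpace S] [ChartedSpace (Euc 2) S]
    [IsManifold (𝓡 2) ∞ S] [MeasurableSpace S]
    [TopologicalSpace M] [ChartedSpace (Euc 4) M] [IsManifold (𝓡 4) ∞ M]
    (g : SmoothMetric 4 M) (f : S → M) (K : Set S) (σ : ∀ p : S, Tan 4 (f p)) (c : ℝ) : Prop :=
  (∃ F : ℝ → S → M, IsVariation f K σ F) ∧
    ∀ F : ℝ → S → M, IsVariation f K σ F → HasSecondDerivAt (fun t => area g K (F t)) c 0

end Surface

end SurfaceVariation

end

open SurfaceVariation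

set_option linter.unusedSectionVars false

namespace SurfaceVariation

/-! ### Calculus of a Riemannian metric on an open set of a normed space -/

/-! Let T be the time direction, σ = ∂_T F at time 0 and Z = ∇_T T the covariant acceleration. Near
a given point take coordinate vectors a, b whose images under df are orthonormal there.
Torsion-freeness, ∇_T dF(a) = ∇_a T, and the Ricci identity give the second time derivative of the
area density √(det of the Gram matrix) in terms of ∇σ, the curvature and ∇Z
(`fderiv_fderiv_sqrt_gramDet`). For normal σ on a minimal surface the first variation vanishes
pointwise and the shape operator of σ is symmetric and trace-free. The terms quadratic in ∇σ then
collapse to |∇^⊥σ|² − |A^σ|², and since the mean curvature vanishes, the terms in Z are the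
divergence of its tangential part Z^⊤ (`fderiv_tangential`). This is the classical formula up to an
exact term.

The passage to ∂̄ adds a second exact term. In an oriented normal frame the normal connection is d +
θ·J, J is parallel, and K^⊥ = −dθ(e₁, e₂). With x = ⟨∇^⊥_{e₁}σ, e₃⟩⟨∇^⊥_{e₂}σ, e₄⟩ − ⟨∇^⊥_{e₁}σ,
e₄⟩⟨∇^⊥_{e₂}σ, e₃⟩ one has 2‖∂̄^⊥σ‖² = |∇^⊥σ|² − 2x, while the one-form α = ⟨∇σ, Jσ⟩ satisfies
dα(e₁, e₂) = 2x − K^⊥|σ|² (`exists_integrand_eq`). So the integrand Q of the theorem is the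
classical one minus dα(e₁, e₂), and dα is the divergence of α rotated by a quarter turn. Altogether
the second time derivative of the density is (Q + div W) times the density, where W = Z^⊤ + α(e₂)e₁
− α(e₁)e₂. The identity is proved at a point in its own chart (`exists_deriv_deriv_pairArea`) and
carried to every chart by the Piola identity (`deriv_deriv_areaDensity`).

Globally, W is C¹ and vanishes outside K. A partition of unity with sum 1 on K and the divergence
theorem in each chart show that div W integrates to zero (`sum_integral_mul_div2_eq_zero`).
Differentiating under the integral sign then gives the formula (`hasSecondDerivAt_area`). Solved for
Q, the same identity shows that Q is continuous and vanishes off K, hence is integrable. Variations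
with a prescribed initial velocity are built by finitely many displacements, each inside one chart
of M (`exists_isVariation`). -/

lemma two_le_infty : (2 : WithTop ℕ∞) ≤ ∞ :=
  WithTop.coe_le_coe.2 (le_top : (2 : ℕ∞) ≤ ⊤)

/-- A smooth Riemannian metric on an open subset of a normed space, with its Levi-Civita
connection. -/
structure LocalMetric (E : Type*) [NormedAddCommGroup E] [NormedSpace ℝ E] where
  dom : Set E
  isOpen_dom : IsOpen dom
  G : E → E →L[ℝ] E →L[ℝ] ℝ
  Γ : E → E →L[ℝ] E →L[ℝ] E
  smooth_G : ContDiffOn ℝ ∞ G dom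
  smooth_Γ : ContDiffOn ℝ ∞ Γ dom
  G_symm : ∀ y ∈ dom, ∀ u v, G y u v = G y v u
  G_pos : ∀ y ∈ dom, ∀ u, u ≠ 0 → 0 < G y u u
  -- Torsion-freeness and metric compatibility determine Γ (see `koszul`). With these two properties
  -- as data, no later computation involves the inverse of G.
  Γ_symm : ∀ y ∈ dom, ∀ u v, Γ y u v = Γ y v u
  compat : ∀ y ∈ dom, ∀ w u v, fderiv ℝ G y w u v = G y (Γ y w u) v + G y u (Γ y w v)

namespace LocalMetric

variable {E X : Type*} [NormedAddCommGroup E] [NormedSpace ℝ E]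
  [NormedAddCommGroup X] [NormedSpace ℝ X] (L : LocalMetric E)

/-- The covariant derivative in the direction `a` of a field `V` along the map `Φ`. -/
noncomputable def cov (Φ V : X → E) (a : X) (x : X) : E :=
  fderiv ℝ V x a + L.Γ (Φ x) (fderiv ℝ Φ x a) (V x)

/-- The Riemann curvature tensor. -/
noncomputable def curv (y : E) (a b c : E) : E :=
  fderiv ℝ L.Γ y a b c - fderiv ℝ L.Γ y b a c + L.Γ y a (L.Γ y b c) - L.Γ y b (L.Γ y a c)

lemma differentiableAt_G {y : E} (hy : y ∈ L.dom) : DifferentiableAt ℝ L.G y :=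
  ((L.smooth_G y hy).contDiffAt (L.isOpen_dom.mem_nhds hy)).differentiableAt (by simp)

lemma differentiableAt_Γ {y : E} (hy : y ∈ L.dom) : DifferentiableAt ℝ L.Γ y :=
  ((L.smooth_Γ y hy).contDiffAt (L.isOpen_dom.mem_nhds hy)).differentiableAt (by simp)

variable {L} {Φ V W : X → E} {x : X}

/-- Metric compatibility along a map: the derivative falling on the coefficients G is split by
`compat` into exactly the two Γ-terms that complete the derivatives of V and W. -/
lemma fderiv_inner (hx : Φ x ∈ L.dom) (hΦ : DifferentiableAt ℝ Φ x)
    (hV : DifferentiableAt ℝ V x) (hW : DifferentiableAt ℝ W x) (a : X) :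
    fderiv ℝ (fun z => L.G (Φ z) (V z) (W z)) x a =
      L.G (Φ x) (L.cov Φ V a x) (W x) + L.G (Φ x) (V x) (L.cov Φ W a x) := by
  have h1 : HasFDerivAt (fun z => L.G (Φ z)) ((fderiv ℝ L.G (Φ x)).comp (fderiv ℝ Φ x)) x :=
    HasFDerivAt.comp (g := L.G) x (L.differentiableAt_G hx).hasFDerivAt hΦ.hasFDerivAt
  have h2 := (h1.clm_apply hV.hasFDerivAt).clm_apply hW.hasFDerivAt
  rw [h2.fderiv]
  simp only [cov, _root_.add_apply, ContinuousLinearMap.coe_comp, Function.comp,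
    ContinuousLinearMap.flip_apply, map_add, L.compat _ hx]
  ring

/-- Torsion-freeness along a map: second derivatives of Φ commute and Γ is symmetric. With one
direction being time, it turns the time derivative of a tangent vector into the spatial derivative
of the velocity. -/
lemma cov_fderiv_comm (hx : Φ x ∈ L.dom) (hΦ : ContDiffAt ℝ ∞ Φ x) (a b : X) :
    L.cov Φ (fun z => fderiv ℝ Φ z b) a x = L.cov Φ (fun z => fderiv ℝ Φ z a) b x := by
  have hd : DifferentiableAt ℝ (fderiv ℝ Φ) x :=
    (hΦ.fderiv_right (m := 1) (by norm_cast)).differentiableAt (by simp)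
  have hs : IsSymmSndFDerivAt ℝ Φ x := hΦ.isSymmSndFDerivAt (by simpa using two_le_infty)
  have e (c d : X) : fderiv ℝ (fun z => fderiv ℝ Φ z c) x d = fderiv ℝ (fderiv ℝ Φ) x d c := by
    rw [fderiv_clm_apply hd (differentiableAt_const c)]; simp
  simp only [cov, e]
  rw [hs.eq, L.Γ_symm _ hx]

lemma cov_congr (h : V =ᶠ[𝓝 x] W) (a : X) : L.cov Φ V a x = L.cov Φ W a x := by
  simp only [cov, h.fderiv_eq, h.eq_of_nhds]

lemma cov_add (hV : DifferentiableAt ℝ V x) (hW : DifferentiableAt ℝ W x) (a : X) :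
    L.cov Φ (fun z => V z + W z) a x = L.cov Φ V a x + L.cov Φ W a x := by
  simp only [cov]
  rw [show (fun z => V z + W z) = V + W from rfl, fderiv_add hV hW]
  simp only [_root_.add_apply, map_add]
  abel

lemma cov_smul {c : X → ℝ} (hc : DifferentiableAt ℝ c x) (hV : DifferentiableAt ℝ V x) (a : X) :
    L.cov Φ (fun z => c z • V z) a x = c x • L.cov Φ V a x + fderiv ℝ c x a • V x := by
  simp only [cov]
  rw [fderiv_fun_smul hc hV]
  simp only [_root_.add_apply, map_smul, smul_add, _root_.smul_apply,
    ContinuousLinearMap.smulRight_apply]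
  abel

lemma cov_add_dir (a b : X) : L.cov Φ V (a + b) x = L.cov Φ V a x + L.cov Φ V b x := by
  simp only [cov, map_add, _root_.add_apply]; abel

lemma cov_smul_dir (c : ℝ) (a : X) : L.cov Φ V (c • a) x = c • L.cov Φ V a x := by
  simp only [cov, map_smul, _root_.smul_apply, smul_add]

lemma contDiffOn_cov {O : Set X} (hO : IsOpen O) (hm : MapsTo Φ O L.dom)
    (hΦ : ContDiffOn ℝ ∞ Φ O) (hV : ContDiffOn ℝ ∞ V O) (a : X) :
    ContDiffOn ℝ ∞ (L.cov Φ V a) O := by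
  have h1 : ContDiffOn ℝ ∞ (fun z => L.Γ (Φ z)) O := L.smooth_Γ.comp hΦ hm
  have h2 := (hΦ.fderiv_of_isOpen hO (m := ∞) (by simp)).clm_apply (contDiffOn_const (c := a))
  have h3 := (hV.fderiv_of_isOpen hO (m := ∞) (by simp)).clm_apply (contDiffOn_const (c := a))
  exact h3.add ((h1.clm_apply h2).clm_apply hV)

lemma contDiffOn_inner {O : Set X} (hm : MapsTo Φ O L.dom)
    (hΦ : ContDiffOn ℝ ∞ Φ O) (hV : ContDiffOn ℝ ∞ V O) (hW : ContDiffOn ℝ ∞ W O) :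
    ContDiffOn ℝ ∞ (fun z => L.G (Φ z) (V z) (W z)) O :=
  ((L.smooth_G.comp hΦ hm).clm_apply hV).clm_apply hW

/-- The Ricci identity. -/
lemma cov_cov_sub (hx : Φ x ∈ L.dom) (hΦ : ContDiffAt ℝ ∞ Φ x) (hV : ContDiffAt ℝ ∞ V x)
    (a b : X) :
    L.cov Φ (L.cov Φ V b) a x - L.cov Φ (L.cov Φ V a) b x =
      L.curv (Φ x) (fderiv ℝ Φ x a) (fderiv ℝ Φ x b) (V x) := by
  have hd : DifferentiableAt ℝ (fderiv ℝ Φ) x :=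
    (hΦ.fderiv_right (m := 1) (by norm_cast)).differentiableAt (by simp)
  have hs : IsSymmSndFDerivAt ℝ Φ x := hΦ.isSymmSndFDerivAt (by simpa using two_le_infty)
  have hd' : DifferentiableAt ℝ (fderiv ℝ V) x :=
    (hV.fderiv_right (m := 1) (by norm_cast)).differentiableAt (by simp)
  have hs' : IsSymmSndFDerivAt ℝ V x := hV.isSymmSndFDerivAt (by simpa using two_le_infty)
  have hΦd : DifferentiableAt ℝ Φ x := hΦ.differentiableAt (by simp)
  have hVd : DifferentiableAt ℝ V x := hV.differentiableAt (by simp)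
  have h1 : HasFDerivAt (fun z => L.Γ (Φ z)) ((fderiv ℝ L.Γ (Φ x)).comp (fderiv ℝ Φ x)) x :=
    HasFDerivAt.comp (g := L.Γ) x (L.differentiableAt_Γ hx).hasFDerivAt hΦd.hasFDerivAt
  -- In the commutator the second derivatives of V and Φ cancel by symmetry. Of the rest, the terms
  -- with one derivative of V and one Γ pair off, leaving the derivatives of Γ and the products of
  -- two Γ's.
  have key (c d : X) : fderiv ℝ (L.cov Φ V c) x d =
      fderiv ℝ (fderiv ℝ V) x d c + fderiv ℝ L.Γ (Φ x) (fderiv ℝ Φ x d) (fderiv ℝ Φ x c) (V x)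
        + L.Γ (Φ x) (fderiv ℝ (fderiv ℝ Φ) x d c) (V x)
        + L.Γ (Φ x) (fderiv ℝ Φ x c) (fderiv ℝ V x d) := by
    have h2 := hd.hasFDerivAt.clm_apply (hasFDerivAt_const c x)
    have h3 := hd'.hasFDerivAt.clm_apply (hasFDerivAt_const c x)
    have h4 := h3.add ((h1.clm_apply h2).clm_apply hVd.hasFDerivAt)
    have h5 : HasFDerivAt (L.cov Φ V c) _ x := h4
    rw [h5.fderiv]
    simp only [_root_.add_apply, ContinuousLinearMap.coe_comp, Function.comp,
      ContinuousLinearMap.flip_apply, _root_.zero_apply, map_zero, zero_add]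
    abel
  have e (c d : X) : L.cov Φ (L.cov Φ V c) d x = fderiv ℝ (L.cov Φ V c) x d +
    L.Γ (Φ x) (fderiv ℝ Φ x d) (L.cov Φ V c x) := rfl
  rw [e, e, key, key]
  simp only [cov, curv, map_add]
  rw [hs.eq a b, hs'.eq a b]
  abel

/-- The curvature operators are skew-symmetric. -/
lemma curv_skew {y : E} (hy : y ∈ L.dom) (a b c d : E) :
    L.G y (L.curv y a b c) d = - L.G y c (L.curv y a b d) := by
  have hid : ContDiffOn ℝ ∞ (fun z : E => z) L.dom := contDiffOn_id
  have hmem : L.dom ∈ 𝓝 y := L.isOpen_dom.mem_nhds hy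
  have hc (c : E) : ContDiffOn ℝ ∞ (fun _ : E => c) L.dom := contDiffOn_const
  have hcov (c a : E) : ContDiffOn ℝ ∞ (L.cov (fun z : E => z) (fun _ => c) a) L.dom :=
    contDiffOn_cov L.isOpen_dom (fun z hz => hz) hid (hc c) a
  have dif {f : E → E} (hf : ContDiffOn ℝ ∞ f L.dom) {z : E} (hz : z ∈ L.dom) :
      DifferentiableAt ℝ f z :=
    ((hf z hz).contDiffAt (L.isOpen_dom.mem_nhds hz)).differentiableAt (by simp)
  have hin : ContDiffOn ℝ ∞ (fun z => L.G z c d) L.dom :=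
    contDiffOn_inner (Φ := fun z => z) (fun z hz => hz) hid (hc c) (hc d)
  have hs : IsSymmSndFDerivAt ℝ (fun z => L.G z c d) y :=
    (hin.contDiffAt hmem).isSymmSndFDerivAt (by simpa using two_le_infty)
  have hdd : DifferentiableAt ℝ (fderiv ℝ (fun z => L.G z c d)) y :=
    ((hin.contDiffAt hmem).fderiv_right (m := 1) (by norm_cast)).differentiableAt (by simp)
  -- For constant c, d the Hessian of the function G(c, d) is expanded by `fderiv_inner`. Its
  -- symmetry in a, b cancels the mixed products, and the Ricci identity turns what remains into the
  -- skewness of the curvature.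
  have h2 (a b : E) : fderiv ℝ (fderiv ℝ (fun z => L.G z c d)) y a b =
      L.G y (L.cov (fun z => z) (L.cov (fun z => z) (fun _ => c) b) a y) d
      + L.G y (L.cov (fun z => z) (fun _ => c) b y) (L.cov (fun z => z) (fun _ => d) a y)
      + (L.G y (L.cov (fun z => z) (fun _ => c) a y) (L.cov (fun z => z) (fun _ => d) b y)
      + L.G y c (L.cov (fun z => z) (L.cov (fun z => z) (fun _ => d) b) a y)) := by
    have e1 : fderiv ℝ (fderiv ℝ (fun z => L.G z c d)) y a b =
        fderiv ℝ (fun z => fderiv ℝ (fun z => L.G z c d) z b) y a := by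
      rw [fderiv_clm_apply hdd (differentiableAt_const b)]; simp
    have e2 : (fun z => fderiv ℝ (fun z => L.G z c d) z b) =ᶠ[𝓝 y]
        (fun z => L.G z (L.cov (fun z => z) (fun _ => c) b z) d) +
        (fun z => L.G z c (L.cov (fun z => z) (fun _ => d) b z)) := by
      filter_upwards [hmem] with z hz
      exact fderiv_inner (Φ := fun z => z) (V := fun _ => c) (W := fun _ => d) hz
        differentiableAt_id (differentiableAt_const _) (differentiableAt_const _) b
    have d1 : DifferentiableAt ℝ (fun z => L.G z (L.cov (fun z => z) (fun _ => c) b z) d) y :=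
      ((contDiffOn_inner (Φ := fun z => z) (fun z hz => hz) hid (hcov c b) (hc d)).contDiffAt
        hmem).differentiableAt (by simp)
    have d2 : DifferentiableAt ℝ (fun z => L.G z c (L.cov (fun z => z) (fun _ => d) b z)) y :=
      ((contDiffOn_inner (Φ := fun z => z) (fun z hz => hz) hid (hc c) (hcov d b)).contDiffAt
        hmem).differentiableAt (by simp)
    rw [e1, e2.fderiv_eq, fderiv_add d1 d2, _root_.add_apply,
      fderiv_inner (Φ := fun z => z) hy differentiableAt_id (dif (hcov c b) hy)
        (differentiableAt_const d),
      fderiv_inner (Φ := fun z => z) hy differentiableAt_id (differentiableAt_const c)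
        (dif (hcov d b) hy)]
  have hR (c : E) := cov_cov_sub (L := L) (Φ := fun z : E => z) (V := fun _ => c) (x := y) hy
    contDiffAt_id contDiffAt_const a b
  have h3 := hs.eq a b
  rw [h2, h2] at h3
  have hRc := hR c
  have hRd := hR d
  simp only [fderiv_fun_id, ContinuousLinearMap.id_apply] at hRc hRd
  rw [← hRc, ← hRd]
  simp only [map_sub, _root_.sub_apply]
  linarith

end LocalMetric

/-! ### Gram determinants and the derivatives of the area density. -/

namespace LocalMetric

variable {E X Y : Type*} [NormedAddCommGroup E] [NormedSpace ℝ E]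
  [NormedAddCommGroup X] [NormedSpace ℝ X] [NormedAddCommGroup Y] [NormedSpace ℝ Y]
  {L : LocalMetric E}

/-- The chain rule for covariant differentiation; it serves to restrict fields on space-time to a
time slice or to the path of one point. -/
lemma cov_comp {Φ V : X → E} {ι : Y → X} {y : Y} (hΦ : DifferentiableAt ℝ Φ (ι y))
    (hV : DifferentiableAt ℝ V (ι y)) (hι : DifferentiableAt ℝ ι y) (a : Y) :
    L.cov (fun z => Φ (ι z)) (fun z => V (ι z)) a y = L.cov Φ V (fderiv ℝ ι y a) (ι y) := by
  simp only [cov]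
  rw [fderiv_fun_comp y hΦ hι, fderiv_fun_comp y hV hι]
  rfl

/-- The Gram matrix of a pair of directions. -/
noncomputable def gram (L : LocalMetric E) (Φ : X → E) (a b : X) (z : X) : ℝ :=
  L.G (Φ z) (fderiv ℝ Φ z a) (fderiv ℝ Φ z b)

/-- The Gram determinant of a pair of directions. -/
noncomputable def gramDet (L : LocalMetric E) (Φ : X → E) (a b : X) (z : X) : ℝ :=
  L.gram Φ a a z * L.gram Φ b b z - L.gram Φ a b z * L.gram Φ a b z

lemma contDiffOn_fderiv_apply {Φ : X → E} {O : Set X} (hO : IsOpen O)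
    (hΦ : ContDiffOn ℝ ∞ Φ O) (a : X) : ContDiffOn ℝ ∞ (fun z => fderiv ℝ Φ z a) O :=
  (hΦ.fderiv_of_isOpen hO (m := ∞) (by simp)).clm_apply contDiffOn_const

lemma contDiffOn_gram {Φ : X → E} {O : Set X} (hO : IsOpen O)
    (hm : MapsTo Φ O L.dom) (hΦ : ContDiffOn ℝ ∞ Φ O) (a b : X) :
    ContDiffOn ℝ ∞ (L.gram Φ a b) O :=
  contDiffOn_inner hm hΦ (contDiffOn_fderiv_apply hO hΦ a) (contDiffOn_fderiv_apply hO hΦ b)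

lemma contDiffOn_gramDet {Φ : X → E} {O : Set X} (hO : IsOpen O)
    (hm : MapsTo Φ O L.dom) (hΦ : ContDiffOn ℝ ∞ Φ O) (a b : X) :
    ContDiffOn ℝ ∞ (L.gramDet Φ a b) O :=
  ((contDiffOn_gram hO hm hΦ a a).mul (contDiffOn_gram hO hm hΦ b b)).sub
    ((contDiffOn_gram hO hm hΦ a b).mul (contDiffOn_gram hO hm hΦ a b))

/-- `cov_fderiv_comm` exchanges the roles of T and a: the rate of change of the induced metric is
read off from the spatial covariant derivative of the velocity dΦ(T). -/
lemma fderiv_gram {Φ : X → E} {O : Set X} (hO : IsOpen O)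
    (hm : MapsTo Φ O L.dom) (hΦ : ContDiffOn ℝ ∞ Φ O) (T a b : X) {z : X} (hz : z ∈ O) :
    fderiv ℝ (L.gram Φ a b) z T =
      L.G (Φ z) (L.cov Φ (fun z => fderiv ℝ Φ z T) a z) (fderiv ℝ Φ z b)
      + L.G (Φ z) (fderiv ℝ Φ z a) (L.cov Φ (fun z => fderiv ℝ Φ z T) b z) := by
  have hn := hO.mem_nhds hz
  have d (c : X) : DifferentiableAt ℝ (fun z => fderiv ℝ Φ z c) z :=
    ((contDiffOn_fderiv_apply hO hΦ c).contDiffAt hn).differentiableAt (by simp)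
  have hΦd := (hΦ.contDiffAt hn).differentiableAt (by simp)
  have := fderiv_inner (hm hz) hΦd (d a) (d b) T
  rw [cov_fderiv_comm (hm hz) (hΦ.contDiffAt hn) T a,
    cov_fderiv_comm (hm hz) (hΦ.contDiffAt hn) T b] at this
  exact this

/-- A second differentiation produces ∇_T∇_a dΦ(T). The Ricci identity rewrites it as ∇_a of the
acceleration ∇_T dΦ(T) plus curvature; the squared norm comes from differentiating the other factor.
-/
lemma fderiv_fderiv_gram {Φ : X → E} {O : Set X} (hO : IsOpen O)
    (hm : MapsTo Φ O L.dom) (hΦ : ContDiffOn ℝ ∞ Φ O) (T a : X) {z : X} (hz : z ∈ O) :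
    fderiv ℝ (fun z => fderiv ℝ (L.gram Φ a a) z T) z T =
      2 * (L.G (Φ z) (L.cov Φ (L.cov Φ (fun z => fderiv ℝ Φ z T) T) a z) (fderiv ℝ Φ z a)
      + L.G (Φ z) (L.curv (Φ z) (fderiv ℝ Φ z T) (fderiv ℝ Φ z a) (fderiv ℝ Φ z T)) (fderiv ℝ Φ z a)
      + L.G (Φ z) (L.cov Φ (fun z => fderiv ℝ Φ z T) a z)
          (L.cov Φ (fun z => fderiv ℝ Φ z T) a z)) := by
  have hn := hO.mem_nhds hz
  have hT := contDiffOn_fderiv_apply hO hΦ T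
  have ha := contDiffOn_fderiv_apply hO hΦ a
  have hc := contDiffOn_cov hO hm hΦ hT a
  have e : (fun z => fderiv ℝ (L.gram Φ a a) z T) =ᶠ[𝓝 z]
      fun z => 2 * L.G (Φ z) (L.cov Φ (fun z => fderiv ℝ Φ z T) a z) (fderiv ℝ Φ z a) := by
    filter_upwards [hn] with w hw
    rw [fderiv_gram hO hm hΦ T a a hw, L.G_symm _ (hm hw) (fderiv ℝ Φ w a)]
    ring
  have dif {f : X → E} (hf : ContDiffOn ℝ ∞ f O) : DifferentiableAt ℝ f z :=
    (hf.contDiffAt hn).differentiableAt (by simp)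
  have hd : DifferentiableAt ℝ
      (fun z => L.G (Φ z) (L.cov Φ (fun z => fderiv ℝ Φ z T) a z) (fderiv ℝ Φ z a)) z :=
    ((contDiffOn_inner hm hΦ hc ha).contDiffAt hn).differentiableAt (by simp)
  rw [e.fderiv_eq, fderiv_const_mul hd, _root_.smul_apply,
    fderiv_inner (hm hz) (dif hΦ) (dif hc) (dif ha),
    cov_fderiv_comm (hm hz) (hΦ.contDiffAt hn) T a,
    ← cov_cov_sub (hm hz) (hΦ.contDiffAt hn) (hT.contDiffAt hn) T a]
  simp only [map_sub, _root_.sub_apply, smul_eq_mul]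
  ring

lemma fderiv_div_apply {f g : X → ℝ} {z : X} (hf : DifferentiableAt ℝ f z)
    (hg : DifferentiableAt ℝ g z) (h : g z ≠ 0) (T : X) :
    fderiv ℝ (fun w => f w / g w) z T =
      (fderiv ℝ f z T * g z - f z * fderiv ℝ g z T) / g z ^ 2 := by
  have h1 : HasFDerivAt (fun w => (g w)⁻¹) (-(g z ^ 2)⁻¹ • fderiv ℝ g z) z := by
    have h2 : HasDerivAt (fun y : ℝ => y⁻¹) (-(g z ^ 2)⁻¹) (g z) := hasDerivAt_inv h
    exact h2.comp_hasFDerivAt z hg.hasFDerivAt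
  have h2 := hf.hasFDerivAt.mul h1
  have h3 : (f * fun w => (g w)⁻¹) = fun w => f w / g w := by
    ext w; simp [div_eq_mul_inv]
  rw [h3] at h2
  rw [h2.fderiv]
  simp only [_root_.add_apply, _root_.smul_apply, smul_eq_mul]
  field_simp
  ring

lemma fderiv_sqrt_apply {D : X → ℝ} {z : X} (hD : DifferentiableAt ℝ D z) (h : D z ≠ 0) (T : X) :
    fderiv ℝ (fun w => √(D w)) z T = fderiv ℝ D z T / (2 * √(D z)) := by
  rw [(hD.hasFDerivAt.sqrt h).fderiv]
  simp only [_root_.smul_apply, smul_eq_mul]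
  ring

/-- The second derivative of the area density in the direction `T`, at a point where the two
directions `a`, `b` are orthonormal and the first variation vanishes. -/
lemma fderiv_fderiv_sqrt_gramDet {Φ : X → E} {O : Set X} (hO : IsOpen O)
    (hm : MapsTo Φ O L.dom) (hΦ : ContDiffOn ℝ ∞ Φ O) (T a b : X) {x : X} (hx : x ∈ O)
    (haa : L.gram Φ a a x = 1) (hbb : L.gram Φ b b x = 1) (hab : L.gram Φ a b x = 0)
    (htr : L.G (Φ x) (L.cov Φ (fun z => fderiv ℝ Φ z T) a x) (fderiv ℝ Φ x a)
      + L.G (Φ x) (L.cov Φ (fun z => fderiv ℝ Φ z T) b x) (fderiv ℝ Φ x b) = 0)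
    (hsym : L.G (Φ x) (L.cov Φ (fun z => fderiv ℝ Φ z T) a x) (fderiv ℝ Φ x b)
      = L.G (Φ x) (L.cov Φ (fun z => fderiv ℝ Φ z T) b x) (fderiv ℝ Φ x a)) :
    fderiv ℝ (fun z => fderiv ℝ (fun w => √(L.gramDet Φ a b w)) z T) x T =
      L.G (Φ x) (L.cov Φ (L.cov Φ (fun z => fderiv ℝ Φ z T) T) a x) (fderiv ℝ Φ x a)
      + L.G (Φ x) (L.cov Φ (L.cov Φ (fun z => fderiv ℝ Φ z T) T) b x) (fderiv ℝ Φ x b)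
      + L.G (Φ x) (L.curv (Φ x) (fderiv ℝ Φ x T) (fderiv ℝ Φ x a) (fderiv ℝ Φ x T)) (fderiv ℝ Φ x a)
      + L.G (Φ x) (L.curv (Φ x) (fderiv ℝ Φ x T) (fderiv ℝ Φ x b) (fderiv ℝ Φ x T)) (fderiv ℝ Φ x b)
      + L.G (Φ x) (L.cov Φ (fun z => fderiv ℝ Φ z T) a x) (L.cov Φ (fun z => fderiv ℝ Φ z T) a x)
      + L.G (Φ x) (L.cov Φ (fun z => fderiv ℝ Φ z T) b x) (L.cov Φ (fun z => fderiv ℝ Φ z T) b x)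
      - 4 * (L.G (Φ x) (L.cov Φ (fun z => fderiv ℝ Φ z T) a x) (fderiv ℝ Φ x a)) ^ 2
      - 4 * (L.G (Φ x) (L.cov Φ (fun z => fderiv ℝ Φ z T) a x) (fderiv ℝ Φ x b)) ^ 2 := by
  have hn := hO.mem_nhds hx
  have dif {f : X → ℝ} (hf : ContDiffOn ℝ ∞ f O) {z : X} (hz : z ∈ O) : DifferentiableAt ℝ f z :=
    (hf.contDiffAt (hO.mem_nhds hz)).differentiableAt (by simp)
  have hA := contDiffOn_gram hO hm hΦ a a
  have hB := contDiffOn_gram hO hm hΦ b b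
  have hC := contDiffOn_gram hO hm hΦ a b
  have hD := contDiffOn_gramDet hO hm hΦ a b
  have hD1 : L.gramDet Φ a b x = 1 := by simp [gramDet, haa, hbb, hab]
  have e1 : (fun z => fderiv ℝ (fun w => √(L.gramDet Φ a b w)) z T) =ᶠ[𝓝 x]
      fun z => fderiv ℝ (L.gramDet Φ a b) z T / (2 * √(L.gramDet Φ a b z)) := by
    have : ∀ᶠ z in 𝓝 x, L.gramDet Φ a b z ≠ 0 :=
      (dif hD hx).continuousAt.eventually_ne (by rw [hD1]; exact one_ne_zero)
    filter_upwards [this, hn] with z hz hzO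
    exact fderiv_sqrt_apply (dif hD hzO) hz T
  have e2 : (fun z => fderiv ℝ (L.gramDet Φ a b) z T) =ᶠ[𝓝 x] fun z =>
      (fderiv ℝ (L.gram Φ a a) z T * L.gram Φ b b z + L.gram Φ a a z * fderiv ℝ (L.gram Φ b b) z T)
        - 2 * (L.gram Φ a b z * fderiv ℝ (L.gram Φ a b) z T) := by
    filter_upwards [hn] with z hz
    have h1 := ((dif hA hz).hasFDerivAt.mul (dif hB hz).hasFDerivAt).sub
      ((dif hC hz).hasFDerivAt.mul (dif hC hz).hasFDerivAt)
    have h2 : HasFDerivAt (L.gramDet Φ a b) _ z := h1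
    rw [h2.fderiv]
    simp only [_root_.sub_apply, _root_.add_apply, _root_.smul_apply, smul_eq_mul]
    ring
  have hA' := contDiffOn_fderiv_apply hO hA T
  have hB' := contDiffOn_fderiv_apply hO hB T
  have hC' := contDiffOn_fderiv_apply hO hC T
  have hD' := contDiffOn_fderiv_apply hO hD T
  have h3 := (((dif hA' hx).hasFDerivAt.mul (dif hB hx).hasFDerivAt).add
      ((dif hA hx).hasFDerivAt.mul (dif hB' hx).hasFDerivAt)).sub
      (((dif hC hx).hasFDerivAt.mul (dif hC' hx).hasFDerivAt).const_mul 2)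
  have h4 := congrArg (fun l : X →L[ℝ] ℝ => l T) (e2.fderiv_eq.trans h3.fderiv)
  simp only [_root_.sub_apply, _root_.add_apply, _root_.smul_apply, smul_eq_mul, haa, hbb, hab]
    at h4
  have hs : DifferentiableAt ℝ (fun z => 2 * √(L.gramDet Φ a b z)) x :=
    ((dif hD hx).sqrt (by rw [hD1]; exact one_ne_zero)).const_mul 2
  have hs1 : 2 * √(L.gramDet Φ a b x) = 2 := by rw [hD1]; simp
  have h5 : fderiv ℝ (fun z => 2 * √(L.gramDet Φ a b z)) x T = fderiv ℝ (L.gramDet Φ a b) x T := by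
    rw [fderiv_const_mul ((dif hD hx).sqrt (by rw [hD1]; exact one_ne_zero)), _root_.smul_apply,
      fderiv_sqrt_apply (dif hD hx) (by rw [hD1]; exact one_ne_zero), hD1]
    simp only [Real.sqrt_one, smul_eq_mul]
    ring
  rw [e1.fderiv_eq, fderiv_div_apply (dif hD' hx) hs (by rw [hs1]; norm_num), hs1, h5]
  rw [h4, e2.eq_of_nhds]
  simp only [haa, hbb, hab, fderiv_gram hO hm hΦ T _ _ hx, fderiv_fderiv_gram hO hm hΦ T _ hx,
    L.G_symm _ (hm hx) (fderiv ℝ Φ x a), L.G_symm _ (hm hx) (fderiv ℝ Φ x b)]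
  -- Let A, B, C be the Gram entries, p = ⟨∇_a T, a⟩ and r = ⟨∇_a T, b⟩. The trace condition gives
  -- A' = 2p = −B', the symmetry gives C' = 2r, and the first derivative of the determinant is zero.
  -- Half of the second derivative of AB − C² thus contains A'B' − C'² = −4p² − 4r².
  rw [← hsym, eq_neg_of_add_eq_zero_right htr]
  ring

/-- The divergence of the tangential part of a field `Z`, at a point where the mean curvature vector
is tangent to the surface and `a`, `b` are orthonormal. -/
lemma fderiv_tangential {φ Z : Y → E} {O : Set Y} (hO : IsOpen O)
    (hm : MapsTo φ O L.dom) (hφ : ContDiffOn ℝ ∞ φ O) (hZ : ContDiffOn ℝ ∞ Z O) (a b : Y) {x : Y}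
    (hx : x ∈ O)
    (haa : L.gram φ a a x = 1) (hbb : L.gram φ b b x = 1) (hab : L.gram φ a b x = 0)
    (hH : L.cov φ (fun z => fderiv ℝ φ z a) a x + L.cov φ (fun z => fderiv ℝ φ z b) b x =
      L.G (φ x) (L.cov φ (fun z => fderiv ℝ φ z a) a x + L.cov φ (fun z => fderiv ℝ φ z b) b x)
        (fderiv ℝ φ x a) • fderiv ℝ φ x a +
      L.G (φ x) (L.cov φ (fun z => fderiv ℝ φ z a) a x + L.cov φ (fun z => fderiv ℝ φ z b) b x)
        (fderiv ℝ φ x b) • fderiv ℝ φ x b) :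
    fderiv ℝ (fun z => (L.gram φ b b z * L.G (φ z) (Z z) (fderiv ℝ φ z a)
        - L.gram φ a b z * L.G (φ z) (Z z) (fderiv ℝ φ z b)) / √(L.gramDet φ a b z)) x a
    + fderiv ℝ (fun z => (L.gram φ a a z * L.G (φ z) (Z z) (fderiv ℝ φ z b)
        - L.gram φ a b z * L.G (φ z) (Z z) (fderiv ℝ φ z a)) / √(L.gramDet φ a b z)) x b
    = L.G (φ x) (L.cov φ Z a x) (fderiv ℝ φ x a) + L.G (φ x) (L.cov φ Z b x) (fderiv ℝ φ x b) := by
  have hn := hO.mem_nhds hx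
  have dif {f : Y → E} (hf : ContDiffOn ℝ ∞ f O) : DifferentiableAt ℝ f x :=
    (hf.contDiffAt hn).differentiableAt (by simp)
  have difR {f : Y → ℝ} (hf : ContDiffOn ℝ ∞ f O) : DifferentiableAt ℝ f x :=
    (hf.contDiffAt hn).differentiableAt (by simp)
  have ha := contDiffOn_fderiv_apply hO hφ a
  have hb := contDiffOn_fderiv_apply hO hφ b
  have hA := contDiffOn_gram hO hm hφ a a
  have hB := contDiffOn_gram hO hm hφ b b
  have hC := contDiffOn_gram hO hm hφ a b
  have hD := contDiffOn_gramDet hO hm hφ a b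
  have hD1 : L.gramDet φ a b x = 1 := by simp [gramDet, haa, hbb, hab]
  have hZa := contDiffOn_inner hm hφ hZ ha
  have hZb := contDiffOn_inner hm hφ hZ hb
  have hsq : DifferentiableAt ℝ (fun z => √(L.gramDet φ a b z)) x :=
    (difR hD).sqrt (by rw [hD1]; exact one_ne_zero)
  have hs1 : √(L.gramDet φ a b x) = 1 := by rw [hD1]; simp
  have hsd (c : Y) : fderiv ℝ (fun z => √(L.gramDet φ a b z)) x c =
      (fderiv ℝ (L.gram φ a a) x c + fderiv ℝ (L.gram φ b b) x c) / 2 := by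
    rw [fderiv_sqrt_apply (difR hD) (by rw [hD1]; exact one_ne_zero), hD1]
    have h1 := ((difR hA).hasFDerivAt.mul (difR hB).hasFDerivAt).sub
      ((difR hC).hasFDerivAt.mul (difR hC).hasFDerivAt)
    have h2 : HasFDerivAt (L.gramDet φ a b) _ x := h1
    rw [h2.fderiv]
    simp only [_root_.sub_apply, _root_.add_apply, _root_.smul_apply, smul_eq_mul, haa, hbb, hab]
    simp [add_comm]
  -- These numerators divided by the Gram determinant are the components of Z^⊤ in the basis dφ(a),
  -- dφ(b), by inversion of the Gram matrix. Dividing only by its root keeps a factor equal to the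
  -- area density.
  have q1 := (((difR hB).hasFDerivAt.mul (difR hZa).hasFDerivAt).sub
    ((difR hC).hasFDerivAt.mul (difR hZb).hasFDerivAt))
  have q2 := (((difR hA).hasFDerivAt.mul (difR hZb).hasFDerivAt).sub
    ((difR hC).hasFDerivAt.mul (difR hZa).hasFDerivAt))
  have r1 := congrArg (fun l : Y →L[ℝ] ℝ => l a) q1.fderiv
  have r2 := congrArg (fun l : Y →L[ℝ] ℝ => l b) q2.fderiv
  have h10 : √(L.gramDet φ a b x) ≠ 0 := by rw [hs1]; exact one_ne_zero
  refine (congrArg₂ (· + ·) (fderiv_div_apply q1.differentiableAt hsq h10 a)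
    (fderiv_div_apply q2.differentiableAt hsq h10 b)).trans ?_
  rw [r1, r2]
  simp only [_root_.add_apply, _root_.smul_apply, _root_.sub_apply, smul_eq_mul, hs1, hsd, haa, hbb,
    hab, Pi.sub_apply, Pi.mul_apply]
  have g (c d e : Y) : fderiv ℝ (L.gram φ c d) x e =
      L.G (φ x) (L.cov φ (fun z => fderiv ℝ φ z c) e x) (fderiv ℝ φ x d)
      + L.G (φ x) (L.cov φ (fun z => fderiv ℝ φ z d) e x) (fderiv ℝ φ x c) := by
    rw [L.G_symm _ (hm hx) _ (fderiv ℝ φ x c)]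
    exact fderiv_inner (hm hx) (dif hφ) (dif (contDiffOn_fderiv_apply hO hφ c))
      (dif (contDiffOn_fderiv_apply hO hφ d)) e
  have hab' := cov_fderiv_comm (hm hx) (hφ.contDiffAt hn) b a
  rw [g, g, g, g, g, g, fderiv_inner (hm hx) (dif hφ) (dif hZ) (dif ha),
    fderiv_inner (hm hx) (dif hφ) (dif hZ) (dif hb) b, hab']
  -- Derivatives of dφ(a) and dφ(b) contribute ⟨Z, ∇_a dφ(a) + ∇_b dφ(b)⟩. By hypothesis only the
  -- tangential part of this sum occurs, and it cancels against the derivatives of the Gram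
  -- coefficients.
  have hH' := congrArg (fun v => L.G (φ x) (Z x) v) hH
  simp only [map_add, map_smul, _root_.add_apply, smul_eq_mul] at hH'
  linear_combination hH'

end LocalMetric

/-! ### The divergence in the plane -/

/-- The determinant of two vectors of the plane. -/
noncomputable def det2 (u v : Euc 2) : ℝ := u 0 * v 1 - u 1 * v 0

/-- The divergence of a vector field in the plane. -/
noncomputable def div2 (U : Euc 2 → Euc 2) (x : Euc 2) : ℝ :=
  fderiv ℝ U x (stdVec 0) 0 + fderiv ℝ U x (stdVec 1) 1

/-- The determinant of an endomorphism of the plane. -/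
noncomputable def detL (A : Euc 2 →L[ℝ] Euc 2) : ℝ := det2 (A (stdVec 0)) (A (stdVec 1))

lemma eq_stdVec_sum {n : ℕ} (v : Euc n) : v = ∑ i, v i • stdVec i := by
  ext j
  simp [stdVec, Pi.single_apply]

lemma euc2_eq (v : Euc 2) : v = v 0 • stdVec 0 + v 1 • stdVec 1 := by
  conv_lhs => rw [eq_stdVec_sum v]
  rw [Fin.sum_univ_two]

@[simp] lemma stdVec_apply {n : ℕ} (i j : Fin n) : (stdVec i : Euc n) j = if j = i then 1 else 0 := by
  simp [stdVec]

lemma det2_map (A : Euc 2 →L[ℝ] Euc 2) (u v : Euc 2) : det2 (A u) (A v) = detL A * det2 u v := by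
  conv_lhs => rw [euc2_eq u, euc2_eq v]
  simp only [map_add, map_smul, det2, detL, PiLp.add_apply, PiLp.smul_apply, smul_eq_mul]
  ring

/-- The infinitesimal version of `det2_map`. It makes the trace, and so the divergence, computable
from an arbitrary pair of vectors instead of the standard basis. -/
lemma det2_trace (A : Euc 2 →L[ℝ] Euc 2) (u v : Euc 2) :
    det2 (A u) v + det2 u (A v) = (A (stdVec 0) 0 + A (stdVec 1) 1) * det2 u v := by
  have h (w : Euc 2) : A w = w 0 • A (stdVec 0) + w 1 • A (stdVec 1) := by
    conv_lhs => rw [euc2_eq w]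
    simp
  rw [h u, h v]
  simp only [det2, PiLp.add_apply, PiLp.smul_apply, smul_eq_mul]
  ring

/-- The bilinear form `det2` as a continuous bilinear map. -/
noncomputable def det2L : Euc 2 →L[ℝ] Euc 2 →L[ℝ] ℝ :=
  (EuclideanSpace.proj (0 : Fin 2)).smulRight (EuclideanSpace.proj (1 : Fin 2) : Euc 2 →L[ℝ] ℝ) -
    (EuclideanSpace.proj (1 : Fin 2)).smulRight (EuclideanSpace.proj (0 : Fin 2) : Euc 2 →L[ℝ] ℝ)

lemma det2L_apply (u v : Euc 2) : det2L u v = det2 u v := by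
  simp [det2L, det2]

lemma fderiv_det2 {U V : Euc 2 → Euc 2} {x : Euc 2} (hU : DifferentiableAt ℝ U x)
    (hV : DifferentiableAt ℝ V x) (a : Euc 2) :
    fderiv ℝ (fun y => det2 (U y) (V y)) x a =
      det2 (fderiv ℝ U x a) (V x) + det2 (U x) (fderiv ℝ V x a) := by
  have h1 : HasFDerivAt (fun y => det2L (U y)) (det2L.comp (fderiv ℝ U x)) x :=
    det2L.hasFDerivAt.comp x hU.hasFDerivAt
  have h2 := h1.clm_apply hV.hasFDerivAt
  simp only [det2L_apply] at h2
  rw [h2.fderiv]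
  simp only [_root_.add_apply, ContinuousLinearMap.coe_comp, Function.comp, det2L_apply,
    ContinuousLinearMap.flip_apply]
  ring

/-- The divergence expressed through the curl of the contraction with the area form. -/
lemma div2_mul_det2 {U : Euc 2 → Euc 2} {x : Euc 2} (hU : DifferentiableAt ℝ U x) (a b : Euc 2) :
    div2 U x * det2 a b =
      fderiv ℝ (fun y => det2 (U y) b) x a - fderiv ℝ (fun y => det2 (U y) a) x b := by
  rw [fderiv_det2 hU (differentiableAt_const b), fderiv_det2 hU (differentiableAt_const a), div2,
    ← det2_trace]
  simp [det2]
  ring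

/-- The trace is independent of the basis, so the divergence may be taken in the coordinates along
constant vectors a, b. They will be the components of an orthonormal frame at one point. -/
lemma div2_eq_of_basis {U : Euc 2 → Euc 2} {x a b : Euc 2} {u v : Euc 2 → ℝ}
    (hab : det2 a b ≠ 0) (hu : DifferentiableAt ℝ u x) (hv : DifferentiableAt ℝ v x)
    (h : U =ᶠ[𝓝 x] fun y => u y • a + v y • b) :
    div2 U x = fderiv ℝ u x a + fderiv ℝ v x b := by
  have h1 : HasFDerivAt U _ x :=
    ((hu.hasFDerivAt.smul_const a).add (hv.hasFDerivAt.smul_const b)).congr_of_eventuallyEq h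
  have h2 := det2_trace (fderiv ℝ U x) a b
  rw [h1.fderiv] at h2
  rw [div2, h1.fderiv]
  apply mul_right_cancel₀ hab
  rw [← h2]
  simp [det2]
  ring

/-- The Piola identity. -/
lemma div2_of_det2_eq {U V τ : Euc 2 → Euc 2} {x : Euc 2} {c : ℝ} (hτ : ContDiffAt ℝ ∞ τ x)
    (hV : ContDiffAt ℝ 1 V (τ x))
    (h : ∀ᶠ y in 𝓝 x, ∀ w, det2 (U y) w = c * det2 (V (τ y)) (fderiv ℝ τ y w)) :
    ContDiffAt ℝ 1 U x ∧ div2 U x = c * detL (fderiv ℝ τ x) * div2 V (τ x) := by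
  have hd : ContDiffAt ℝ 1 (fderiv ℝ τ) x := hτ.fderiv_right (m := 1) (by norm_cast)
  have hVτ : ContDiffAt ℝ 1 (fun y => V (τ y)) x := hV.comp x (hτ.of_le (by simp))
  have hw (w : Euc 2) : (fun y => det2 (U y) w) =ᶠ[𝓝 x]
      fun y => c * det2 (V (τ y)) (fderiv ℝ τ y w) := h.mono fun y hy => hy w
  -- The components of U are, up to sign, its contractions with the standard vectors. The regularity
  -- of U is therefore read off from the contractions, without inverting the derivative of τ.
  have hsm (w : Euc 2) : ContDiffAt ℝ 1 (fun y => det2 (U y) w) x := by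
    refine ContDiffAt.congr_of_eventuallyEq ?_ (hw w)
    simp only [← det2L_apply]
    exact contDiffAt_const.mul ((contDiffAt_const.clm_apply hVτ).clm_apply
      (hd.clm_apply contDiffAt_const))
  have hU : ContDiffAt ℝ 1 U x := by
    rw [contDiffAt_euclidean]
    intro i
    fin_cases i
    · simpa [det2] using hsm (stdVec 1)
    · simpa [det2] using (hsm (stdVec 0)).neg
  refine ⟨hU, ?_⟩
  have hUd := hU.differentiableAt (by simp)
  have h1 := div2_mul_det2 hUd (stdVec 0) (stdVec 1)
  have hs : IsSymmSndFDerivAt ℝ τ x := hτ.isSymmSndFDerivAt (by simpa using two_le_infty)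
  have hd' : DifferentiableAt ℝ (fderiv ℝ τ) x := hd.differentiableAt (by simp)
  have hVd : DifferentiableAt ℝ (fun y => V (τ y)) x := hVτ.differentiableAt (by simp)
  have key (a w : Euc 2) : fderiv ℝ (fun y => det2 (U y) w) x a =
      c * (det2 (fderiv ℝ V (τ x) (fderiv ℝ τ x a)) (fderiv ℝ τ x w)
        + det2 (V (τ x)) (fderiv ℝ (fderiv ℝ τ) x a w)) := by
    have e1 : DifferentiableAt ℝ (fun y => fderiv ℝ τ y w) x :=
      hd'.clm_apply (differentiableAt_const w)
    have e2 : DifferentiableAt ℝ (fun y => det2 (V (τ y)) (fderiv ℝ τ y w)) x := by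
      simp only [← det2L_apply]
      exact ((differentiableAt_const _).clm_apply hVd).clm_apply e1
    rw [(hw w).fderiv_eq, fderiv_const_mul e2, _root_.smul_apply, fderiv_det2 hVd e1,
      fderiv_fun_comp x (hV.differentiableAt (by simp)) (hτ.differentiableAt (by simp)),
      fderiv_clm_apply hd' (differentiableAt_const w)]
    simp
  -- The second derivative of τ enters both contractions through its mixed value on the standard
  -- vectors, which is symmetric, and drops out of the difference.
  rw [key, key, hs.eq (stdVec 1) (stdVec 0)] at h1
  have h2 := det2_trace (fderiv ℝ V (τ x)) (fderiv ℝ τ x (stdVec 0)) (fderiv ℝ τ x (stdVec 1))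
  have h3 : det2 (stdVec 0) (stdVec 1) = 1 := by simp [det2]
  rw [h3, mul_one] at h1
  rw [h1, div2, detL]
  rw [mul_assoc, mul_comm (det2 _ _), ← h2]
  simp only [det2]
  ring

/-! ### Tangent vectors in charts -/

section Charts

variable {n : ℕ} {M : Type*} [TopologicalSpace M] [ChartedSpace (Euc n) M]
  [IsManifold (𝓡 n) ∞ M]

lemma isManifold_one : IsManifold (𝓡 n) 1 M := IsManifold.of_le (n := ∞) (by simp)

/-- The components of tangent vectors in a chart, as a linear equivalence. -/
noncomputable def chartEquiv (q : M) {x : M} (hx : x ∈ (chartAt (Euc n) q).source) :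
    Tan n x ≃L[ℝ] Euc n :=
  (trivializationAt (Euc n) (fun x : M => TangentSpace (𝓡 n) x) q).continuousLinearEquivAt ℝ x hx

variable {q x : M}

lemma chartEquiv_apply (hx : x ∈ (chartAt (Euc n) q).source) (u : Tan n x) :
    chartEquiv q hx u = toChart q x u := rfl

lemma chartEquiv_symm_apply (hx : x ∈ (chartAt (Euc n) q).source) (v : Euc n) :
    (chartEquiv q hx).symm v = ofChart q x v := rfl

lemma toChart_ofChart (hx : x ∈ (chartAt (Euc n) q).source) (v : Euc n) :
    toChart q x (ofChart q x v) = v := by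
  rw [← chartEquiv_apply hx, ← chartEquiv_symm_apply hx, ContinuousLinearEquiv.apply_symm_apply]

lemma ofChart_toChart (hx : x ∈ (chartAt (Euc n) q).source) (u : Tan n x) :
    ofChart q x (toChart q x u) = u := by
  rw [← chartEquiv_apply hx, ← chartEquiv_symm_apply hx, ContinuousLinearEquiv.symm_apply_apply]

lemma toChart_add (hx : x ∈ (chartAt (Euc n) q).source) (u v : Tan n x) :
    toChart q x (u + v) = toChart q x u + toChart q x v := by
  simp only [← chartEquiv_apply hx, map_add]

lemma toChart_sub (hx : x ∈ (chartAt (Euc n) q).source) (u v : Tan n x) :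
    toChart q x (u - v) = toChart q x u - toChart q x v := by
  simp only [← chartEquiv_apply hx, map_sub]

lemma toChart_smul (hx : x ∈ (chartAt (Euc n) q).source) (c : ℝ) (u : Tan n x) :
    toChart q x (c • u) = c • toChart q x u := by
  simp only [← chartEquiv_apply hx, map_smul]

lemma toChart_zero (hx : x ∈ (chartAt (Euc n) q).source) : toChart q x (0 : Tan n x) = 0 := by
  simp only [← chartEquiv_apply hx, map_zero]

lemma toChart_inj (hx : x ∈ (chartAt (Euc n) q).source) {u v : Tan n x} :
    toChart q x u = toChart q x v ↔ u = v := by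
  simp only [← chartEquiv_apply hx, EmbeddingLike.apply_eq_iff_eq]

lemma ofChart_add (hx : x ∈ (chartAt (Euc n) q).source) (u v : Euc n) :
    ofChart q x (u + v) = ofChart q x u + ofChart q x v := by
  simp only [← chartEquiv_symm_apply hx, map_add]

lemma ofChart_smul (hx : x ∈ (chartAt (Euc n) q).source) (c : ℝ) (u : Euc n) :
    ofChart q x (c • u) = c • ofChart q x u := by
  simp only [← chartEquiv_symm_apply hx, map_smul]

lemma ofChart_zero (hx : x ∈ (chartAt (Euc n) q).source) : ofChart q x (0 : Euc n) = 0 := by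
  simp only [← chartEquiv_symm_apply hx, map_zero]

/-- The link from the bundle trivialization behind `toChart` to the derivative of the chart; it
makes the chain rule available for components of tangent vectors. -/
lemma toChart_eq_mfderiv (hx : x ∈ (chartAt (Euc n) q).source) (u : Tan n x) :
    toChart q x u = mfderiv (𝓡 n) (𝓡 n) (chartAt (Euc n) q) x u := by
  have : IsManifold (𝓡 n) 1 M := isManifold_one
  have h := TangentBundle.continuousLinearMapAt_trivializationAt (I := 𝓡 n) hx
  have h2 := DFunLike.congr_fun h u
  rw [Bundle.Trivialization.continuousLinearMapAt_apply_of_mem (R := ℝ) _ hx] at h2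
  exact h2

lemma ofChart_eq_mfderiv (hx : x ∈ (chartAt (Euc n) q).source) (v : Euc n) :
    ofChart q x v =
      (mfderiv (𝓡 n) (𝓡 n) (chartAt (Euc n) q).symm (chartAt (Euc n) q x) v : Euc n) := by
  have : IsManifold (𝓡 n) 1 M := isManifold_one
  have h := TangentBundle.symmL_trivializationAt (I := 𝓡 n) hx
  have h2 := DFunLike.congr_fun h v
  rw [Bundle.Trivialization.symmL_apply (R := ℝ) _ hx] at h2
  refine h2.trans ?_
  simp only [modelWithCornersSelf_coe, range_id, mfderivWithin_univ]
  rfl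

lemma mdifferentiableAt_chart (hx : x ∈ (chartAt (Euc n) q).source) :
    MDifferentiableAt (𝓡 n) (𝓡 n) (chartAt (Euc n) q) x := by
  have : IsManifold (𝓡 n) 1 M := isManifold_one
  exact mdifferentiableAt_atlas (chart_mem_atlas _ q) hx

lemma mdifferentiableAt_chart_symm {y : Euc n} (hy : y ∈ (chartAt (Euc n) q).target) :
    MDifferentiableAt (𝓡 n) (𝓡 n) (chartAt (Euc n) q).symm y := by
  have : IsManifold (𝓡 n) 1 M := isManifold_one
  exact mdifferentiableAt_atlas_symm (chart_mem_atlas _ q) hy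

variable {F H N : Type*} [NormedAddCommGroup F] [NormedSpace ℝ F] [TopologicalSpace H]
  {I : ModelWithCorners ℝ F H} [TopologicalSpace N] [ChartedSpace H N]

lemma toChart_mfderiv {u : N → M} {p : N} (hu : MDifferentiableAt I (𝓡 n) u p)
    (hx : u p ∈ (chartAt (Euc n) q).source) (X : TangentSpace I p) :
    toChart q (u p) (mfderiv I (𝓡 n) u p X) =
      mfderiv I (𝓡 n) (fun p => chartAt (Euc n) q (u p)) p X := by
  rw [toChart_eq_mfderiv hx]
  have := mfderiv_comp p (mdifferentiableAt_chart hx) hu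
  exact (DFunLike.congr_fun this X).symm

lemma mfderiv_ofChart {v : M → N} (hx : x ∈ (chartAt (Euc n) q).source)
    (hv : MDifferentiableAt (𝓡 n) I v x) (a : Euc n) :
    (mfderiv (𝓡 n) I v x (ofChart q x a) : F) =
      (mfderiv (𝓡 n) I (fun y => v ((chartAt (Euc n) q).symm y)) (chartAt (Euc n) q x) a : F) := by
  -- Writing the base point as the image of its coordinates puts the composite with the inverse
  -- chart at the correct point.
  obtain ⟨y, hy, rfl⟩ : ∃ y ∈ (chartAt (Euc n) q).target, (chartAt (Euc n) q).symm y = x :=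
    ⟨_, (chartAt (Euc n) q).map_source hx, (chartAt (Euc n) q).left_inv hx⟩
  have h1 : chartAt (Euc n) q ((chartAt (Euc n) q).symm y) = y := (chartAt (Euc n) q).right_inv hy
  rw [ofChart_eq_mfderiv hx, h1]
  have := mfderiv_comp (I := 𝓡 n) (I' := 𝓡 n) (I'' := I) (g := v)
    (f := (chartAt (Euc n) q).symm) y hv (mdifferentiableAt_chart_symm hy)
  exact (DFunLike.congr_fun this a).symm

end Charts

/-! ### Coordinate expressions of maps defined on the surface. -/

section Loc

variable {S M : Type*} [TopologicalSpace S] [ChartedSpace (Euc 2) S]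
  [TopologicalSpace M] [ChartedSpace (Euc 4) M]

/-- The coordinate expression of a map. -/
noncomputable def loc (a : S) (m : M) (u : S → M) (x : Euc 2) : Euc 4 :=
  chartAt (Euc 4) m (u ((chartAt (Euc 2) a).symm x))

/-- The set of coordinates where the coordinate expression is meaningful. -/
def locDom (a : S) (m : M) (u : S → M) : Set (Euc 2) :=
  (chartAt (Euc 2) a).target ∩ (chartAt (Euc 2) a).symm ⁻¹' (u ⁻¹' (chartAt (Euc 4) m).source)

lemma isOpen_locDom (a : S) (m : M) {u : S → M} (hu : Continuous u) : IsOpen (locDom a m u) :=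
  (chartAt (Euc 2) a).isOpen_inter_preimage_symm ((chartAt (Euc 4) m).open_source.preimage hu)

variable [IsManifold (𝓡 2) ∞ S] [IsManifold (𝓡 4) ∞ M]

lemma contDiffOn_loc (a : S) (m : M) {u : S → M} (hu : ContMDiff (𝓡 2) (𝓡 4) ∞ u) :
    ContDiffOn ℝ ∞ (loc a m u) (locDom a m u) := by
  rw [← contMDiffOn_iff_contDiffOn]
  have h1 : ContMDiffOn (𝓡 2) (𝓡 2) ∞ (chartAt (Euc 2) a).symm (chartAt (Euc 2) a).target :=
    contMDiffOn_chart_symm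
  have h2 : ContMDiffOn (𝓡 4) (𝓡 4) ∞ (chartAt (Euc 4) m) (chartAt (Euc 4) m).source :=
    contMDiffOn_chart
  exact h2.comp (hu.comp_contMDiffOn (h1.mono inter_subset_left)) fun x hx => hx.2

lemma toChart_mfderiv_ofChart {a : S} {m : M} {u : S → M} {p : S}
    (hu : MDifferentiableAt (𝓡 2) (𝓡 4) u p)
    (hp : p ∈ (chartAt (Euc 2) a).source) (hm : u p ∈ (chartAt (Euc 4) m).source) (v : Euc 2) :
    toChart m (u p) (mfderiv (𝓡 2) (𝓡 4) u p (ofChart a p v)) =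
      fderiv ℝ (loc a m u) (chartAt (Euc 2) a p) v := by
  rw [toChart_mfderiv hu hm]
  have h1 : MDifferentiableAt (𝓡 2) (𝓡 4) (fun p => chartAt (Euc 4) m (u p)) p :=
    (mdifferentiableAt_chart hm).comp p hu
  have h2 := mfderiv_ofChart (I := 𝓡 4) hp h1 v
  refine h2.trans ?_
  rw [mfderiv_eq_fderiv]
  rfl

lemma mfderiv_ofChart_eq_fderiv {F : Type*} [NormedAddCommGroup F] [NormedSpace ℝ F] {a p : S}
    {v : S → F} (hp : p ∈ (chartAt (Euc 2) a).source)
    (hv : MDifferentiableAt (𝓡 2) 𝓘(ℝ, F) v p) (b : Euc 2) :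
    (mfderiv (𝓡 2) 𝓘(ℝ, F) v p (ofChart a p b) : F) =
      fderiv ℝ (fun y => v ((chartAt (Euc 2) a).symm y)) (chartAt (Euc 2) a p) b := by
  refine (mfderiv_ofChart (I := 𝓘(ℝ, F)) hp hv b).trans ?_
  rw [mfderiv_eq_fderiv]
  rfl

end Loc

/-! ### The metric and the Levi-Civita connection in a chart -/

lemma contDiffOn_det {X ι : Type*} [NormedAddCommGroup X] [NormedSpace ℝ X] [Fintype ι]
    [DecidableEq ι] {A : X → Matrix ι ι ℝ} {s : Set X}
    (h : ∀ i j, ContDiffOn ℝ ∞ (fun x => A x i j) s) : ContDiffOn ℝ ∞ (fun x => (A x).det) s := by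
  simp only [Matrix.det_apply]
  refine ContDiffOn.sum fun σ _ => ?_
  exact (contDiffOn_prod fun i _ => h _ _).const_smul _

lemma contDiffOn_inv {X ι : Type*} [NormedAddCommGroup X] [NormedSpace ℝ X] [Fintype ι]
    [DecidableEq ι] {A : X → Matrix ι ι ℝ} {s : Set X}
    (h : ∀ i j, ContDiffOn ℝ ∞ (fun x => A x i j) s) (hd : ∀ x ∈ s, (A x).det ≠ 0) (i j : ι) :
    ContDiffOn ℝ ∞ (fun x => (A x)⁻¹ i j) s := by
  simp only [Matrix.inv_def, Matrix.smul_apply, smul_eq_mul, Ring.inverse_eq_inv']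
  refine ((contDiffOn_det h).inv hd).mul ?_
  simp only [Matrix.adjugate_apply]
  refine contDiffOn_det fun k l => ?_
  simp only [Matrix.updateRow_apply]
  split_ifs
  · exact contDiffOn_const
  · exact h _ _

/-- The bilinear map with the given values on the standard basis. -/
noncomputable def bilinOfBasis {n : ℕ} {F : Type*} [NormedAddCommGroup F] [NormedSpace ℝ F]
    (c : Fin n → Fin n → F) : Euc n →L[ℝ] Euc n →L[ℝ] F :=
  ∑ i, ∑ j, (EuclideanSpace.proj i : Euc n →L[ℝ] ℝ).smulRight
    ((EuclideanSpace.proj j : Euc n →L[ℝ] ℝ).smulRight (c i j))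

lemma bilinOfBasis_apply {n : ℕ} {F : Type*} [NormedAddCommGroup F] [NormedSpace ℝ F]
    (c : Fin n → Fin n → F) (u v : Euc n) :
    bilinOfBasis c u v = ∑ i, ∑ j, u i • v j • c i j := by
  simp [bilinOfBasis]

lemma contDiffOn_bilinOfBasis {X F : Type*} [NormedAddCommGroup X] [NormedSpace ℝ X]
    [NormedAddCommGroup F] [NormedSpace ℝ F] {n : ℕ} {c : X → Fin n → Fin n → F} {s : Set X}
    (h : ∀ i j, ContDiffOn ℝ ∞ (fun x => c x i j) s) :
    ContDiffOn ℝ ∞ (fun x => bilinOfBasis (c x)) s := by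
  unfold bilinOfBasis
  refine ContDiffOn.sum fun i _ => ContDiffOn.sum fun j _ => ?_
  exact contDiffOn_const.smulRight (contDiffOn_const.smulRight (h i j))

/-- A bilinear function is determined by its values on the standard basis. -/
lemma bilin_eq_sum {n : ℕ} {F : Type*} [AddCommGroup F] [Module ℝ F] (B : Euc n → Euc n → F)
    (ha : ∀ u v w, B (u + v) w = B u w + B v w) (hs : ∀ (c : ℝ) u v, B (c • u) v = c • B u v)
    (ha' : ∀ u v w, B u (v + w) = B u v + B u w) (hs' : ∀ (c : ℝ) u v, B u (c • v) = c • B u v)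
    (u v : Euc n) : B u v = ∑ i, ∑ j, u i • v j • B (stdVec i) (stdVec j) := by
  let L : Euc n →ₗ[ℝ] Euc n →ₗ[ℝ] F := LinearMap.mk₂ ℝ B ha hs ha' hs'
  have h : B u v = L u v := rfl
  rw [h]
  conv_lhs => rw [eq_stdVec_sum u, eq_stdVec_sum v]
  simp only [map_sum, map_smul, LinearMap.sum_apply, LinearMap.smul_apply, L, LinearMap.mk₂_apply]
  rw [Finset.sum_congr rfl fun i _ => Finset.smul_sum, Finset.sum_comm]
  refine Finset.sum_congr rfl fun i _ => ?_
  exact Finset.sum_congr rfl fun j _ => smul_comm _ _ _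

variable {n : ℕ} {M : Type*} [TopologicalSpace M] [ChartedSpace (Euc n) M]
  [IsManifold (𝓡 n) ∞ M] (g : SmoothMetric n M) (q : M)

lemma chartMetric_add_left {y : Euc n} (hy : y ∈ (chartAt (Euc n) q).target) (u v w : Euc n) :
    chartMetric g q y (u + v) w = chartMetric g q y u w + chartMetric g q y v w := by
  simp only [chartMetric, ofChart_add ((chartAt (Euc n) q).map_target hy), map_add,
    _root_.add_apply]

lemma chartMetric_smul_left {y : Euc n} (hy : y ∈ (chartAt (Euc n) q).target) (c : ℝ)
    (u w : Euc n) : chartMetric g q y (c • u) w = c • chartMetric g q y u w := by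
  simp only [chartMetric, ofChart_smul ((chartAt (Euc n) q).map_target hy), map_smul,
    _root_.smul_apply]

lemma chartMetric_symm (y u v : Euc n) : chartMetric g q y u v = chartMetric g q y v u :=
  g.symm _ _ _

/-- The metric in the chart at `q`, as a continuous bilinear map. -/
noncomputable def chartG (y : Euc n) : Euc n →L[ℝ] Euc n →L[ℝ] ℝ :=
  bilinOfBasis fun i j => chartMetric g q y (stdVec i) (stdVec j)

lemma chartG_apply {y : Euc n} (hy : y ∈ (chartAt (Euc n) q).target) (u v : Euc n) :
    chartG g q y u v = chartMetric g q y u v := by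
  rw [chartG, bilinOfBasis_apply]
  refine (bilin_eq_sum (chartMetric g q y) (chartMetric_add_left g q hy)
    (chartMetric_smul_left g q hy) (fun u v w => ?_) (fun c u v => ?_) u v).symm
  · simp only [chartMetric_symm g q y u, chartMetric_add_left g q hy]
  · simp only [chartMetric_symm g q y u, chartMetric_smul_left g q hy]

lemma contMDiffOn_ofChart (u : Euc n) :
    ContMDiffOn (𝓡 n) (𝓡 n).tangent ∞
      (fun x => (⟨x, ofChart q x u⟩ : TangentBundle (𝓡 n) M)) (chartAt (Euc n) q).source := by
  have h := Bundle.Trivialization.contMDiffOn_symm (IB := 𝓡 n) (n := ∞)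
    (e := trivializationAt (Euc n) (fun x : M => TangentSpace (𝓡 n) x) q)
  have h2 : ContMDiffOn (𝓡 n) ((𝓡 n).prod 𝓘(ℝ, Euc n)) ∞ (fun x : M => (x, u))
      (chartAt (Euc n) q).source := contMDiffOn_id.prodMk contMDiffOn_const
  have h3 := h.comp h2 (fun x hx => by
    rw [(trivializationAt (Euc n) (fun x : M => TangentSpace (𝓡 n) x) q).target_eq]
    exact ⟨hx, mem_univ _⟩)
  refine h3.congr fun x hx => ?_
  exact (trivializationAt (Euc n) (fun x : M => TangentSpace (𝓡 n) x) q).mk_symm hx u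

lemma contDiffOn_chartMetric (u v : Euc n) :
    ContDiffOn ℝ ∞ (fun y => chartMetric g q y u v) (chartAt (Euc n) q).target := by
  rw [← contMDiffOn_iff_contDiffOn]
  have h1 : ContMDiffOn (𝓡 n) (𝓡 n) ∞ (chartAt (Euc n) q).symm (chartAt (Euc n) q).target :=
    contMDiffOn_chart_symm
  have h2 : ContMDiffOn (𝓡 n) ((𝓡 n).prod 𝓘(ℝ)) ∞
      (fun x : M => Bundle.TotalSpace.mk' ℝ (E := Bundle.Trivial M ℝ) x
        (g.inner x (ofChart q x u) (ofChart q x v))) (chartAt (Euc n) q).source :=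
    ContMDiffOn.clm_bundle_apply₂ (F₁ := Euc n) (F₂ := Euc n) g.contMDiff.contMDiffOn
      (contMDiffOn_ofChart q u) (contMDiffOn_ofChart q v)
  have h3 : ContMDiffOn (𝓡 n) 𝓘(ℝ) ∞ (fun x : M => g.inner x (ofChart q x u) (ofChart q x v))
      (chartAt (Euc n) q).source := by
    intro x hx
    have := h2 x hx
    simp only [Bundle.contMDiffWithinAt_totalSpace] at this
    exact this.2
  exact h3.comp h1 fun y hy => (chartAt (Euc n) q).map_target hy

lemma contDiffOn_chartG : ContDiffOn ℝ ∞ (chartG g q) (chartAt (Euc n) q).target :=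
  contDiffOn_bilinOfBasis fun _ _ => contDiffOn_chartMetric g q _ _

lemma chartG_pos {y : Euc n} (hy : y ∈ (chartAt (Euc n) q).target) {u : Euc n} (hu : u ≠ 0) :
    0 < chartG g q y u u := by
  rw [chartG_apply g q hy]
  refine g.pos _ _ fun h => hu ?_
  rw [← toChart_ofChart ((chartAt (Euc n) q).map_target hy) u, h,
    toChart_zero ((chartAt (Euc n) q).map_target hy)]

/-- Positive definiteness gives nondegeneracy. Properties of the Christoffel symbols are obtained
below by testing against all w with the Koszul formula, not from the inverse matrix in their
definition. -/
lemma chartG_ext {y : Euc n} (hy : y ∈ (chartAt (Euc n) q).target) {u v : Euc n}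
    (h : ∀ w, chartG g q y u w = chartG g q y v w) : u = v := by
  by_contra hne
  have := chartG_pos g q hy (sub_ne_zero.2 hne)
  simp [h] at this

lemma chartMetricDeriv_eq {y : Euc n} (hy : y ∈ (chartAt (Euc n) q).target) (w u v : Euc n) :
    chartMetricDeriv g q y w u v = fderiv ℝ (chartG g q) y w u v := by
  have hn := (chartAt (Euc n) q).open_target.mem_nhds hy
  have e : (fun z => chartMetric g q z u v) =ᶠ[𝓝 y] fun z => chartG g q z u v := by
    filter_upwards [hn] with z hz
    rw [chartG_apply g q hz]
  have hd : DifferentiableAt ℝ (chartG g q) y :=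
    ((contDiffOn_chartG g q).contDiffAt hn).differentiableAt (by simp)
  rw [chartMetricDeriv, e.fderiv_eq]
  have := (hd.hasFDerivAt.clm_apply (hasFDerivAt_const u y)).clm_apply (hasFDerivAt_const v y)
  rw [this.fderiv]
  simp

/-- The metric coefficients in the chart at `q`. -/
noncomputable def metricMatrix (y : Euc n) : Matrix (Fin n) (Fin n) ℝ :=
  Matrix.of fun i j : Fin n => chartMetric g q y (stdVec i) (stdVec j)

/-- A kernel vector of the coefficient matrix would be a vector orthogonal to every other one,
excluded by nondegeneracy. -/
lemma metricMatrix_det_ne_zero {y : Euc n} (hy : y ∈ (chartAt (Euc n) q).target) :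
    (metricMatrix g q y).det ≠ 0 := by
  intro h0
  obtain ⟨v, hv, hv0⟩ := Matrix.exists_mulVec_eq_zero_iff.2 h0
  refine hv ?_
  have : (WithLp.toLp 2 v : Euc n) = 0 := by
    refine chartG_ext g q hy fun w => ?_
    rw [chartG, bilinOfBasis_apply, Finset.sum_comm]
    simp only [map_zero, _root_.zero_apply]
    refine Finset.sum_eq_zero fun j _ => ?_
    have h1 := congrFun hv0 j
    simp only [Matrix.mulVec, dotProduct, metricMatrix, Matrix.of_apply, Pi.zero_apply] at h1
    calc _ = w j * ∑ i, chartMetric g q y (stdVec j) (stdVec i) * v i := by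
          rw [Finset.mul_sum]
          refine Finset.sum_congr rfl fun i _ => ?_
          simp only [smul_eq_mul, chartMetric_symm g q y (stdVec i)]
          ring
      _ = 0 := by rw [h1, mul_zero]
  simpa using congrArg WithLp.ofLp this

/-- The Koszul formula. -/
lemma chartG_christoffel {y : Euc n} (hy : y ∈ (chartAt (Euc n) q).target) (u v w : Euc n) :
    chartG g q y (christoffel g q y u v) w = 1 / 2 * (fderiv ℝ (chartG g q) y u v w
      + fderiv ℝ (chartG g q) y v u w - fderiv ℝ (chartG g q) y w u v) := by
  -- Against a basis vector the metric matrix cancels the inverse matrix in the definition of the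
  -- Christoffel symbols; the general case follows by linearity in w.
  have hbasis (m : Fin n) : chartG g q y (christoffel g q y u v) (stdVec m) =
      1 / 2 * (fderiv ℝ (chartG g q) y u v (stdVec m)
      + fderiv ℝ (chartG g q) y v u (stdVec m) - fderiv ℝ (chartG g q) y (stdVec m) u v) := by
    set c : Fin n → ℝ := fun l => 1 / 2 * (fderiv ℝ (chartG g q) y u v (stdVec l)
      + fderiv ℝ (chartG g q) y v u (stdVec l) - fderiv ℝ (chartG g q) y (stdVec l) u v) with hc
    have h1 : christoffel g q y u v =
        ∑ k, ((metricMatrix g q y)⁻¹.mulVec c) k • stdVec k := by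
      simp only [christoffel, chartMetricDeriv_eq g q hy, Matrix.mulVec, dotProduct, hc]
      rfl
    have h2 : (metricMatrix g q y).mulVec ((metricMatrix g q y)⁻¹.mulVec c) m = c m := by
      rw [Matrix.mulVec_mulVec, Matrix.mul_nonsing_inv _
        (isUnit_iff_ne_zero.2 (metricMatrix_det_ne_zero g q hy)), Matrix.one_mulVec]
    rw [h1, map_sum, _root_.sum_apply]
    refine Eq.trans ?_ h2
    simp only [map_smul, _root_.smul_apply, smul_eq_mul, chartG_apply g q hy]
    rw [Matrix.mulVec, dotProduct]
    refine Finset.sum_congr rfl fun k _ => ?_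
    rw [chartMetric_symm, mul_comm]
    rfl
  rw [eq_stdVec_sum w]
  simp only [map_sum, map_smul, hbasis, smul_eq_mul, _root_.sum_apply,
    _root_.smul_apply]
  rw [← Finset.sum_add_distrib, ← Finset.sum_sub_distrib, Finset.mul_sum]
  refine Finset.sum_congr rfl fun k _ => ?_
  ring

/-- The Christoffel symbols in the chart at `q`, as a continuous bilinear map. -/
noncomputable def chartΓ (y : Euc n) : Euc n →L[ℝ] Euc n →L[ℝ] Euc n :=
  bilinOfBasis fun i j => christoffel g q y (stdVec i) (stdVec j)

/-- Bilinearity of the Christoffel symbols comes from the Koszul formula, whose right side is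
bilinear in u and v for each test vector w. -/
lemma chartΓ_apply {y : Euc n} (hy : y ∈ (chartAt (Euc n) q).target) (u v : Euc n) :
    chartΓ g q y u v = christoffel g q y u v := by
  rw [chartΓ, bilinOfBasis_apply]
  refine (bilin_eq_sum (christoffel g q y) ?_ ?_ ?_ ?_ u v).symm <;>
  · intros
    refine chartG_ext g q hy fun w => ?_
    simp only [chartG_christoffel g q hy, map_add, map_smul, _root_.add_apply, _root_.smul_apply,
      smul_eq_mul]
    ring

lemma contDiffOn_christoffel (u v : Euc n) :
    ContDiffOn ℝ ∞ (fun y => christoffel g q y u v) (chartAt (Euc n) q).target := by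
  have hd (w a b : Euc n) : ContDiffOn ℝ ∞ (fun y => chartMetricDeriv g q y w a b)
      (chartAt (Euc n) q).target :=
    ((contDiffOn_chartMetric g q a b).fderiv_of_isOpen (chartAt (Euc n) q).open_target
      (m := ∞) (by simp)).clm_apply contDiffOn_const
  refine ContDiffOn.sum fun k _ => ContDiffOn.fun_smul (ContDiffOn.sum fun l _ => ?_) contDiffOn_const
  refine ContDiffOn.mul ?_ (contDiffOn_const.mul (((hd _ _ _).add (hd _ _ _)).sub (hd _ _ _)))
  exact contDiffOn_inv (A := metricMatrix g q) (fun i j => contDiffOn_chartMetric g q _ _)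
    (fun y hy => metricMatrix_det_ne_zero g q hy) k l

lemma fderiv_chartG_symm {y : Euc n} (hy : y ∈ (chartAt (Euc n) q).target) (w u v : Euc n) :
    fderiv ℝ (chartG g q) y w u v = fderiv ℝ (chartG g q) y w v u := by
  rw [← chartMetricDeriv_eq g q hy, ← chartMetricDeriv_eq g q hy]
  simp only [chartMetricDeriv, chartMetric_symm g q _ u v]

/-- The metric in the chart at `q`. -/
noncomputable def localMetric : LocalMetric (Euc n) where
  dom := (chartAt (Euc n) q).target
  isOpen_dom := (chartAt (Euc n) q).open_target
  G := chartG g q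
  Γ := chartΓ g q
  smooth_G := contDiffOn_chartG g q
  smooth_Γ := contDiffOn_bilinOfBasis fun _ _ => contDiffOn_christoffel g q _ _
  G_symm y hy u v := by rw [chartG_apply g q hy, chartG_apply g q hy, chartMetric_symm]
  G_pos y hy u hu := chartG_pos g q hy hu
  Γ_symm y hy u v := by
    refine chartG_ext g q hy fun w => ?_
    rw [chartΓ_apply g q hy, chartΓ_apply g q hy, chartG_christoffel g q hy,
      chartG_christoffel g q hy, fderiv_chartG_symm g q hy w u v]
    ring
  compat y hy w u v := by
    have hs : chartG g q y u (chartΓ g q y w v) = chartG g q y (chartΓ g q y w v) u := by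
      rw [chartG_apply g q hy, chartG_apply g q hy, chartMetric_symm]
    rw [hs, chartΓ_apply g q hy, chartΓ_apply g q hy, chartG_christoffel g q hy,
      chartG_christoffel g q hy, fderiv_chartG_symm g q hy w v u, fderiv_chartG_symm g q hy u w v,
      fderiv_chartG_symm g q hy v w u]
    ring

/-! ### Invariance of the covariant derivative -/

namespace LocalMetric

variable {E X : Type*} [NormedAddCommGroup E] [NormedSpace ℝ E]
  [NormedAddCommGroup X] [NormedSpace ℝ X] {L L' : LocalMetric E}

lemma G_ext {y : E} (hy : y ∈ L.dom) {u v : E} (h : ∀ w, L.G y u w = L.G y v w) : u = v := by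
  by_contra hne
  have := L.G_pos y hy _ (sub_ne_zero.2 hne)
  simp [h] at this

/-- A symmetric compatible Γ is determined by the first derivatives of G. This lets the Christoffel
symbols of two charts be compared through their metrics alone. -/
lemma koszul {y : E} (hy : y ∈ L.dom) (u v w : E) :
    2 * L.G y (L.Γ y u v) w =
      fderiv ℝ L.G y u v w + fderiv ℝ L.G y v u w - fderiv ℝ L.G y w u v := by
  rw [L.compat y hy, L.compat y hy, L.compat y hy, L.Γ_symm y hy v u, L.Γ_symm y hy w u,
    L.Γ_symm y hy w v, L.G_symm y hy v, L.G_symm y hy u (L.Γ y v w)]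
  ring

/-- The transformation law of the Christoffel symbols under a local isometry. -/
lemma fderiv_Γ {ψ : E → E} {y : E} (hy : y ∈ L'.dom) (hψy : ψ y ∈ L.dom) (hψ : ContDiffAt ℝ ∞ ψ y)
    (hG : ∀ᶠ z in 𝓝 y, ∀ u v, L'.G z u v = L.G (ψ z) (fderiv ℝ ψ z u) (fderiv ℝ ψ z v))
    (hs : Function.Surjective (fderiv ℝ ψ y)) (u v : E) :
    fderiv ℝ ψ y (L'.Γ y u v) = L.cov ψ (fun z => fderiv ℝ ψ z v) u y := by
  have hd : DifferentiableAt ℝ ψ y := hψ.differentiableAt (by simp)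
  have hdd (u : E) : DifferentiableAt ℝ (fun z => fderiv ℝ ψ z u) y :=
    ((hψ.fderiv_right (m := 1) (by norm_cast)).differentiableAt (by simp)).clm_apply
      (differentiableAt_const u)
  have h1 (w u v : E) : fderiv ℝ L'.G y w u v =
      L.G (ψ y) (L.cov ψ (fun z => fderiv ℝ ψ z u) w y) (fderiv ℝ ψ y v)
      + L.G (ψ y) (fderiv ℝ ψ y u) (L.cov ψ (fun z => fderiv ℝ ψ z v) w y) := by
    rw [← fderiv_inner hψy hd (hdd u) (hdd v)]
    have e : (fun z => L'.G z u v) =ᶠ[𝓝 y]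
        fun z => L.G (ψ z) (fderiv ℝ ψ z u) (fderiv ℝ ψ z v) := hG.mono fun z hz => hz u v
    rw [← e.fderiv_eq]
    have := ((L'.differentiableAt_G hy).hasFDerivAt.clm_apply (hasFDerivAt_const u y)).clm_apply
      (hasFDerivAt_const v y)
    rw [this.fderiv]
    simp
  -- By surjectivity of the derivative of ψ every test vector is an image. Against it, both sides
  -- reduce to the Koszul expression of the pulled-back metric.
  refine G_ext hψy fun w => ?_
  obtain ⟨w, rfl⟩ := hs w
  have h2 := L'.koszul hy u v w
  rw [h1, h1, h1, hG.self_of_nhds] at h2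
  have c (a b : E) := cov_fderiv_comm (L := L) hψy hψ a b
  rw [c v u, c w u, c w v, L.G_symm _ hψy (fderiv ℝ ψ y v),
    L.G_symm _ hψy (fderiv ℝ ψ y u) (L.cov ψ (fun z => fderiv ℝ ψ z w) v y)] at h2
  linarith

/-- Naturality under local isometries: differentiating the push-forward of V produces the second
derivative of ψ, and this is the inhomogeneous term in the transformation law `fderiv_Γ`. -/
lemma cov_eq_fderiv_cov {ψ : E → E} {φ V : X → E} {x : X} (hy : φ x ∈ L'.dom)
    (hψy : ψ (φ x) ∈ L.dom) (hψ : ContDiffAt ℝ ∞ ψ (φ x))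
    (hG : ∀ᶠ z in 𝓝 (φ x), ∀ u v, L'.G z u v = L.G (ψ z) (fderiv ℝ ψ z u) (fderiv ℝ ψ z v))
    (hs : Function.Surjective (fderiv ℝ ψ (φ x))) (hφ : DifferentiableAt ℝ φ x)
    (hV : DifferentiableAt ℝ V x) (b : X) :
    L.cov (fun z => ψ (φ z)) (fun z => fderiv ℝ ψ (φ z) (V z)) b x =
      fderiv ℝ ψ (φ x) (L'.cov φ V b x) := by
  have hd : DifferentiableAt ℝ ψ (φ x) := hψ.differentiableAt (by simp)
  have hdd : DifferentiableAt ℝ (fderiv ℝ ψ) (φ x) :=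
    (hψ.fderiv_right (m := 1) (by norm_cast)).differentiableAt (by simp)
  have h1 : HasFDerivAt (fun z => fderiv ℝ ψ (φ z)) _ x :=
    HasFDerivAt.comp (g := fderiv ℝ ψ) x hdd.hasFDerivAt hφ.hasFDerivAt
  have h2 := h1.clm_apply hV.hasFDerivAt
  have h3 := fderiv_clm_apply hdd (differentiableAt_const (V x))
  simp only [cov, map_add, fderiv_Γ hy hψy hψ hG hs]
  rw [h2.fderiv, fderiv_fun_comp x hd hφ, h3]
  simp only [_root_.add_apply, ContinuousLinearMap.coe_comp, Function.comp,
    ContinuousLinearMap.flip_apply, fderiv_fun_const, Pi.zero_apply, ContinuousLinearMap.comp_zero,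
    zero_add]
  abel

end LocalMetric

/-! ### Transition maps as isometries of coordinate metrics. -/

section Trans

variable {n : ℕ} {M : Type*} [TopologicalSpace M] [ChartedSpace (Euc n) M]

/-- The transition map from the chart at `q` to the chart at `m`. -/
noncomputable def trans (q m : M) (y : Euc n) : Euc n :=
  chartAt (Euc n) m ((chartAt (Euc n) q).symm y)

/-- The domain of the transition map. -/
def transDom (n : ℕ) {M : Type*} [TopologicalSpace M] [ChartedSpace (Euc n) M] (q m : M) :
    Set (Euc n) :=
  (chartAt (Euc n) q).target ∩ (chartAt (Euc n) q).symm ⁻¹' (chartAt (Euc n) m).source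

lemma isOpen_transDom (q m : M) : IsOpen (transDom n q m) :=
  (chartAt (Euc n) q).isOpen_inter_preimage_symm (chartAt (Euc n) m).open_source

variable [IsManifold (𝓡 n) ∞ M]

lemma contDiffOn_trans (q m : M) : ContDiffOn ℝ ∞ (trans q m) (transDom n q m) := by
  rw [← contMDiffOn_iff_contDiffOn]
  have h1 : ContMDiffOn (𝓡 n) (𝓡 n) ∞ (chartAt (Euc n) q).symm (chartAt (Euc n) q).target :=
    contMDiffOn_chart_symm
  have h2 : ContMDiffOn (𝓡 n) (𝓡 n) ∞ (chartAt (Euc n) m) (chartAt (Euc n) m).source :=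
    contMDiffOn_chart
  exact h2.comp (h1.mono inter_subset_left) fun x hx => hx.2

lemma chart_mem_transDom {q m z : M} (hq : z ∈ (chartAt (Euc n) q).source)
    (hm : z ∈ (chartAt (Euc n) m).source) : chartAt (Euc n) q z ∈ transDom n q m :=
  ⟨(chartAt (Euc n) q).map_source hq, by
    rw [mem_preimage, (chartAt (Euc n) q).left_inv hq]; exact hm⟩

lemma toChart_ofChart_trans {q m z : M} (hq : z ∈ (chartAt (Euc n) q).source)
    (hm : z ∈ (chartAt (Euc n) m).source) (u : Euc n) :
    toChart m z (ofChart q z u) = fderiv ℝ (trans q m) (chartAt (Euc n) q z) u := by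
  rw [toChart_eq_mfderiv hm]
  refine (mfderiv_ofChart (I := 𝓡 n) hq (mdifferentiableAt_chart hm) u).trans ?_
  rw [mfderiv_eq_fderiv]
  rfl

lemma toChart_trans {q m z : M} (hq : z ∈ (chartAt (Euc n) q).source)
    (hm : z ∈ (chartAt (Euc n) m).source) (u : Tan n z) :
    toChart m z u = fderiv ℝ (trans q m) (chartAt (Euc n) q z) (toChart q z u) := by
  rw [← toChart_ofChart_trans hq hm, ofChart_toChart hq]

lemma surjective_fderiv_trans {q m z : M} (hq : z ∈ (chartAt (Euc n) q).source)
    (hm : z ∈ (chartAt (Euc n) m).source) :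
    Function.Surjective (fderiv ℝ (trans q m) (chartAt (Euc n) q z)) := fun w =>
  ⟨toChart q z (ofChart m z w), by rw [← toChart_trans hq hm, toChart_ofChart hm]⟩

lemma inner_eq_chartG (g : SmoothMetric n M) {m z : M} (hm : z ∈ (chartAt (Euc n) m).source)
    (u v : Tan n z) : g.inner z u v =
      (localMetric g m).G (chartAt (Euc n) m z) (toChart m z u) (toChart m z v) := by
  obtain ⟨y, hy, rfl⟩ : ∃ y ∈ (chartAt (Euc n) m).target, (chartAt (Euc n) m).symm y = z :=
    ⟨_, (chartAt (Euc n) m).map_source hm, (chartAt (Euc n) m).left_inv hm⟩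
  rw [(chartAt (Euc n) m).right_inv hy]
  change _ = chartG g m y _ _
  rw [chartG_apply g m hy, chartMetric, ofChart_toChart hm, ofChart_toChart hm]

/-- Both coordinate metrics represent the same inner product, so the transition map is an isometry
between them, as `cov_eq_fderiv_cov` requires. -/
lemma chartG_trans (g : SmoothMetric n M) {q m : M} {y : Euc n} (hy : y ∈ transDom n q m)
    (u v : Euc n) : (localMetric g q).G y u v = (localMetric g m).G (trans q m y)
      (fderiv ℝ (trans q m) y u) (fderiv ℝ (trans q m) y v) := by
  have hz := (chartAt (Euc n) q).map_target hy.1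
  have h1 := inner_eq_chartG g hy.2 (ofChart q _ u) (ofChart q _ v)
  rw [toChart_ofChart_trans hz hy.2, toChart_ofChart_trans hz hy.2, inner_eq_chartG g hz,
    toChart_ofChart hz, toChart_ofChart hz, (chartAt (Euc n) q).right_inv hy.1] at h1
  exact h1

lemma toChart_curvature (g : SmoothMetric n M) (q : M) (u v w : Tan n q) :
    toChart q q (curvature g q u v w) = (localMetric g q).curv (chartAt (Euc n) q q)
      (toChart q q u) (toChart q q v) (toChart q q w) := by
  have hq := mem_chart_source (Euc n) q
  have hy := mem_chart_target (Euc n) q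
  have hn := (chartAt (Euc n) q).open_target.mem_nhds hy
  have key (a b c : Euc n) : fderiv ℝ (fun z => christoffel g q z b c) (chartAt (Euc n) q q) a =
      fderiv ℝ (chartΓ g q) (chartAt (Euc n) q q) a b c := by
    have e : (fun z => christoffel g q z b c) =ᶠ[𝓝 (chartAt (Euc n) q q)]
        fun z => chartΓ g q z b c := by
      filter_upwards [hn] with z hz
      rw [chartΓ_apply g q hz]
    rw [e.fderiv_eq]
    have hd : DifferentiableAt ℝ (chartΓ g q) (chartAt (Euc n) q q) :=
      (localMetric g q).differentiableAt_Γ hy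
    have := (hd.hasFDerivAt.clm_apply (hasFDerivAt_const b _)).clm_apply (hasFDerivAt_const c _)
    rw [this.fderiv]
    simp
  simp only [curvature]
  rw [toChart_ofChart hq, key, key, ← chartΓ_apply g q hy, ← chartΓ_apply g q hy,
    ← chartΓ_apply g q hy, ← chartΓ_apply g q hy]
  rfl

end Trans

/-! ### Covariant derivatives along a map in arbitrary charts. -/

section Along

variable {S M : Type*} [TopologicalSpace S] [ChartedSpace (Euc 2) S]
  [TopologicalSpace M] [ChartedSpace (Euc 4) M] [IsManifold (𝓡 4) ∞ M]

/-- The coordinate expression of a field along a map. -/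
noncomputable def locField (a : S) (m : M) (u : S → M) (V : ∀ p : S, Tan 4 (u p)) (x : Euc 2) :
    Euc 4 :=
  toChart m (u ((chartAt (Euc 2) a).symm x)) (V ((chartAt (Euc 2) a).symm x))

lemma locField_chart {a p : S} (m : M) (u : S → M) (V : ∀ p : S, Tan 4 (u p))
    (hp : p ∈ (chartAt (Euc 2) a).source) :
    locField a m u V (chartAt (Euc 2) a p) = toChart m (u p) (V p) := by
  unfold locField
  rw [(chartAt (Euc 2) a).left_inv hp]

lemma loc_chart {a p : S} (m : M) (u : S → M) (hp : p ∈ (chartAt (Euc 2) a).source) :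
    loc a m u (chartAt (Euc 2) a p) = chartAt (Euc 4) m (u p) := by
  unfold loc
  rw [(chartAt (Euc 2) a).left_inv hp]

lemma chart_mem_locDom {a p : S} {m : M} {u : S → M} (hp : p ∈ (chartAt (Euc 2) a).source)
    (hm : u p ∈ (chartAt (Euc 4) m).source) : chartAt (Euc 2) a p ∈ locDom a m u :=
  ⟨(chartAt (Euc 2) a).map_source hp, by
    rw [mem_preimage, (chartAt (Euc 2) a).left_inv hp]; exact hm⟩

lemma mapsTo_loc (g : SmoothMetric 4 M) (a : S) (m : M) (u : S → M) :
    MapsTo (loc a m u) (locDom a m u) (localMetric g m).dom :=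
  fun _ hx => (chartAt (Euc 4) m).map_source hx.2

variable [IsManifold (𝓡 2) ∞ S]

lemma contDiffOn_locField (a : S) (m : M) {u : S → M} {V : ∀ p : S, Tan 4 (u p)}
    (hV : SmoothAlong u V) : ContDiffOn ℝ ∞ (locField a m u V) (locDom a m u) := by
  rw [← contMDiffOn_iff_contDiffOn]
  have h1 : ContMDiffOn (𝓡 2) (𝓡 2) ∞ (chartAt (Euc 2) a).symm (chartAt (Euc 2) a).target :=
    contMDiffOn_chart_symm
  have h2 : ContMDiffOn (𝓡 2) (𝓡 4).tangent ∞
      (fun p => (⟨u p, V p⟩ : TangentBundle (𝓡 4) M)) (u ⁻¹' (chartAt (Euc 4) m).source) :=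
    hV.contMDiffOn
  have h3 := ((trivializationAt (Euc 4) (fun x : M => TangentSpace (𝓡 4) x) m).contMDiffOn_iff
    (IB := 𝓡 4) (n := ∞) (f := fun p => (⟨u p, V p⟩ : TangentBundle (𝓡 4) M))
    (s := u ⁻¹' (chartAt (Euc 4) m).source) (fun p hp => by
      rw [(trivializationAt (Euc 4) (fun x : M => TangentSpace (𝓡 4) x) m).source_eq]
      exact hp)).1 h2
  exact h3.2.comp (h1.mono inter_subset_left) fun x hx => hx.2

/-- The definition of `covAlong` uses the chart of M at f p, a chart that moves with p. This treats
that chart; the general one follows by naturality. -/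
lemma toChart_covAlong_self (g : SmoothMetric 4 M) {f : S → M} (hf : ContMDiff (𝓡 2) (𝓡 4) ∞ f)
    {V : ∀ p : S, Tan 4 (f p)} {a p : S} (hp : p ∈ (chartAt (Euc 2) a).source)
    (hV : DifferentiableAt ℝ (locField a (f p) f V) (chartAt (Euc 2) a p)) (b : Euc 2) :
    toChart (f p) (f p) (covAlong g f V p (ofChart a p b)) =
      (localMetric g (f p)).cov (loc a (f p) f) (locField a (f p) f V) b (chartAt (Euc 2) a p) := by
  have hm := mem_chart_source (Euc 4) (f p)
  have hfp : MDifferentiableAt (𝓡 2) (𝓡 4) f p := hf.mdifferentiableAt (by simp)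
  have hd : MDifferentiableAt (𝓡 2) 𝓘(ℝ, Euc 4) (fun q : S => toChart (f p) (f q) (V q)) p := by
    have h1 : MDifferentiableAt (𝓡 2) 𝓘(ℝ, Euc 4)
        (fun q : S => locField a (f p) f V (chartAt (Euc 2) a q)) p :=
      (mdifferentiableAt_iff_differentiableAt.2 hV).comp p (mdifferentiableAt_chart hp)
    refine h1.congr_of_eventuallyEq ?_
    filter_upwards [(chartAt (Euc 2) a).open_source.mem_nhds hp] with q hq
    rw [locField_chart _ _ _ hq]
  simp only [covAlong]
  rw [toChart_ofChart hm, toChart_mfderiv_ofChart hfp hp hm, LocalMetric.cov,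
    ← chartΓ_apply g (f p) (mem_chart_target (Euc 4) (f p)), locField_chart _ _ _ hp,
    loc_chart _ _ hp]
  congr 1
  exact mfderiv_ofChart_eq_fderiv hp hd b

/-- The covariant derivative along a map, computed in arbitrary charts. -/
lemma toChart_covAlong (g : SmoothMetric 4 M) {f : S → M} (hf : ContMDiff (𝓡 2) (𝓡 4) ∞ f)
    {V : ∀ p : S, Tan 4 (f p)} {a p : S} {m : M} (hp : p ∈ (chartAt (Euc 2) a).source)
    (hm : f p ∈ (chartAt (Euc 4) m).source)
    (hV : DifferentiableAt ℝ (locField a m f V) (chartAt (Euc 2) a p)) (b : Euc 2) :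
    toChart m (f p) (covAlong g f V p (ofChart a p b)) =
      (localMetric g m).cov (loc a m f) (locField a m f V) b (chartAt (Euc 2) a p) := by
  have hself := mem_chart_source (Euc 4) (f p)
  set x := chartAt (Euc 2) a p with hx
  have hxs : x ∈ locDom a (f p) f := chart_mem_locDom hp hself
  have hxm : x ∈ locDom a m f := chart_mem_locDom hp hm
  have hN : locDom a (f p) f ∩ locDom a m f ∈ 𝓝 x :=
    inter_mem ((isOpen_locDom a _ hf.continuous).mem_nhds hxs)
      ((isOpen_locDom a _ hf.continuous).mem_nhds hxm)
  have change {m₁ m₂ : M} {z : Euc 2} (h1 : z ∈ locDom a m₁ f) (h2 : z ∈ locDom a m₂ f) :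
      loc a m₂ f z = trans m₁ m₂ (loc a m₁ f z) ∧ loc a m₁ f z ∈ transDom 4 m₁ m₂ ∧
      locField a m₂ f V z = fderiv ℝ (trans m₁ m₂) (loc a m₁ f z) (locField a m₁ f V z) := by
    refine ⟨?_, chart_mem_transDom h1.2 h2.2, toChart_trans h1.2 h2.2 _⟩
    simp only [trans, loc]
    rw [(chartAt (Euc 4) m₁).left_inv h1.2]
  have hφ {m : M} (hx : x ∈ locDom a m f) : DifferentiableAt ℝ (loc a m f) x :=
    ((contDiffOn_loc a m hf).contDiffAt ((isOpen_locDom a _ hf.continuous).mem_nhds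
      hx)).differentiableAt (by simp)
  have htr {m₁ m₂ : M} (h1 : x ∈ locDom a m₁ f) (h2 : x ∈ locDom a m₂ f) :
      ContDiffAt ℝ ∞ (trans m₁ m₂) (loc a m₁ f x) :=
    (contDiffOn_trans m₁ m₂).contDiffAt ((isOpen_transDom m₁ m₂).mem_nhds (change h1 h2).2.1)
  -- Differentiability is assumed in the chart at m only; the transition map carries it to the chart
  -- at f p, where the covariant derivative is defined.
  have hVs : DifferentiableAt ℝ (locField a (f p) f V) x := by
    have h1 : DifferentiableAt ℝ (fun z => fderiv ℝ (trans m (f p)) (loc a m f z)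
        (locField a m f V z)) x := by
      have h2 : DifferentiableAt ℝ (fderiv ℝ (trans m (f p))) (loc a m f x) :=
        ((htr hxm hxs).fderiv_right (m := 1) (by norm_cast)).differentiableAt (by simp)
      exact (DifferentiableAt.comp (g := fderiv ℝ (trans m (f p))) x h2 (hφ hxm)).clm_apply hV
    refine h1.congr_of_eventuallyEq ?_
    filter_upwards [hN] with z hz
    exact (change hz.2 hz.1).2.2
  have e1 : loc a m f =ᶠ[𝓝 x] fun z => trans (f p) m (loc a (f p) f z) := by
    filter_upwards [hN] with z hz using (change hz.1 hz.2).1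
  have e2 : locField a m f V =ᶠ[𝓝 x]
      fun z => fderiv ℝ (trans (f p) m) (loc a (f p) f z) (locField a (f p) f V z) := by
    filter_upwards [hN] with z hz using (change hz.1 hz.2).2.2
  have e3 : (localMetric g m).cov (loc a m f) (locField a m f V) b x = (localMetric g m).cov
      (fun z => trans (f p) m (loc a (f p) f z))
      (fun z => fderiv ℝ (trans (f p) m) (loc a (f p) f z) (locField a (f p) f V z)) b x := by
    simp only [LocalMetric.cov, e1.fderiv_eq, e2.fderiv_eq, e1.eq_of_nhds, e2.eq_of_nhds]
  have hloc : loc a (f p) f x = chartAt (Euc 4) (f p) (f p) := loc_chart _ _ hp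
  rw [e3, LocalMetric.cov_eq_fderiv_cov (L' := localMetric g (f p)) (L := localMetric g m)
      (mapsTo_loc g a (f p) f hxs) ((change hxs hxm).1 ▸ mapsTo_loc g a m f hxm) (htr hxs hxm) ?_ ?_
      (hφ hxs) hVs,
    ← toChart_covAlong_self g hf hp hVs, toChart_trans hself hm, hloc]
  · filter_upwards [(isOpen_transDom (f p) m).mem_nhds (change hxs hxm).2.1] with y hy u v
    exact chartG_trans g hy u v
  · rw [hloc]
    exact surjective_fderiv_trans hself hm

end Along

/-! ### Orthonormal frames of rank two along a map -/

namespace LocalMetric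

variable {E Y : Type*} [NormedAddCommGroup E] [NormedSpace ℝ E]
  [NormedAddCommGroup Y] [NormedSpace ℝ Y]

/-- Two smooth orthonormal fields along a smooth map. -/
structure IsFramePair (L : LocalMetric E) (φ N P : Y → E) (O : Set Y) : Prop where
  isOpen : IsOpen O
  mapsTo : MapsTo φ O L.dom
  smooth : ContDiffOn ℝ ∞ φ O
  smooth_fst : ContDiffOn ℝ ∞ N O
  smooth_snd : ContDiffOn ℝ ∞ P O
  fst_fst : ∀ x ∈ O, L.G (φ x) (N x) (N x) = 1
  snd_snd : ∀ x ∈ O, L.G (φ x) (P x) (P x) = 1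
  fst_snd : ∀ x ∈ O, L.G (φ x) (N x) (P x) = 0

/-- The connection form of a pair of fields. -/
noncomputable def connForm (L : LocalMetric E) (φ N P : Y → E) (b x : Y) : ℝ :=
  L.G (φ x) (L.cov φ N b x) (P x)

namespace IsFramePair

variable {L : LocalMetric E} {φ N P : Y → E} {O : Set Y}

lemma mono (h : L.IsFramePair φ N P O) {O' : Set Y} (hO' : IsOpen O') (hs : O' ⊆ O) :
    L.IsFramePair φ N P O' where
  isOpen := hO'
  mapsTo := h.mapsTo.mono_left hs
  smooth := h.smooth.mono hs
  smooth_fst := h.smooth_fst.mono hs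
  smooth_snd := h.smooth_snd.mono hs
  fst_fst x hx := h.fst_fst x (hs hx)
  snd_snd x hx := h.snd_snd x (hs hx)
  fst_snd x hx := h.fst_snd x (hs hx)

lemma snd_fst (h : L.IsFramePair φ N P O) {x : Y} (hx : x ∈ O) : L.G (φ x) (P x) (N x) = 0 := by
  rw [L.G_symm _ (h.mapsTo hx), h.fst_snd x hx]

lemma diffAt (h : L.IsFramePair φ N P O) {F : Type*} [NormedAddCommGroup F] [NormedSpace ℝ F]
    {f : Y → F} (hf : ContDiffOn ℝ ∞ f O) {x : Y} (hx : x ∈ O) : DifferentiableAt ℝ f x :=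
  (hf.contDiffAt (h.isOpen.mem_nhds hx)).differentiableAt (by simp)

lemma contDiffOn_connForm (h : L.IsFramePair φ N P O) (b : Y) :
    ContDiffOn ℝ ∞ (L.connForm φ N P b) O :=
  contDiffOn_inner h.mapsTo h.smooth (contDiffOn_cov h.isOpen h.mapsTo h.smooth h.smooth_fst b)
    h.smooth_snd

lemma inner_const {V W : Y → E} {c : ℝ} (h : L.IsFramePair φ N P O) (hV : ContDiffOn ℝ ∞ V O)
    (hW : ContDiffOn ℝ ∞ W O) (hc : ∀ x ∈ O, L.G (φ x) (V x) (W x) = c) {x : Y} (hx : x ∈ O)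
    (b : Y) : L.G (φ x) (L.cov φ V b x) (W x) + L.G (φ x) (V x) (L.cov φ W b x) = 0 := by
  rw [← fderiv_inner (h.mapsTo hx) (h.diffAt h.smooth hx) (h.diffAt hV hx) (h.diffAt hW hx) b]
  have e : (fun z => L.G (φ z) (V z) (W z)) =ᶠ[𝓝 x] fun _ => c := by
    filter_upwards [h.isOpen.mem_nhds hx] with z hz using hc z hz
  rw [e.fderiv_eq]
  simp

lemma cov_fst_fst (h : L.IsFramePair φ N P O) {x : Y} (hx : x ∈ O) (b : Y) :
    L.G (φ x) (L.cov φ N b x) (N x) = 0 := by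
  have := h.inner_const h.smooth_fst h.smooth_fst h.fst_fst hx b
  rw [L.G_symm _ (h.mapsTo hx) (N x)] at this
  linarith

lemma cov_snd_snd (h : L.IsFramePair φ N P O) {x : Y} (hx : x ∈ O) (b : Y) :
    L.G (φ x) (L.cov φ P b x) (P x) = 0 := by
  have := h.inner_const h.smooth_snd h.smooth_snd h.snd_snd hx b
  rw [L.G_symm _ (h.mapsTo hx) (P x)] at this
  linarith

lemma cov_snd_fst (h : L.IsFramePair φ N P O) {x : Y} (hx : x ∈ O) (b : Y) :
    L.G (φ x) (L.cov φ P b x) (N x) = - L.connForm φ N P b x := by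
  have := h.inner_const h.smooth_fst h.smooth_snd h.fst_snd hx b
  rw [L.G_symm _ (h.mapsTo hx) (N x)] at this
  rw [connForm]
  linarith

lemma cov_comb (h : L.IsFramePair φ N P O) {u v : Y → ℝ} (hu : ContDiffOn ℝ ∞ u O)
    (hv : ContDiffOn ℝ ∞ v O) {x : Y} (hx : x ∈ O) (b : Y) :
    L.cov φ (fun z => u z • N z + v z • P z) b x =
      u x • L.cov φ N b x + fderiv ℝ u x b • N x + (v x • L.cov φ P b x + fderiv ℝ v x b • P x) := by
  have hu' := h.diffAt hu hx
  have hv' := h.diffAt hv hx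
  have hN := h.diffAt h.smooth_fst hx
  have hP := h.diffAt h.smooth_snd hx
  rw [cov_add (hu'.fun_smul hN) (hv'.fun_smul hP)]
  congr 1
  · exact cov_smul hu' hN b
  · exact cov_smul hv' hP b

/-- With θ the connection form, N and P differentiate into each other by ±θ inside their span. On
components the projected connection acts as (u, v) ↦ (du − vθ, dv + uθ). -/
lemma inner_cov_comb_fst (h : L.IsFramePair φ N P O) {u v : Y → ℝ} (hu : ContDiffOn ℝ ∞ u O)
    (hv : ContDiffOn ℝ ∞ v O) {x : Y} (hx : x ∈ O) (b : Y) :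
    L.G (φ x) (L.cov φ (fun z => u z • N z + v z • P z) b x) (N x) =
      fderiv ℝ u x b - v x * L.connForm φ N P b x := by
  rw [h.cov_comb hu hv hx]
  simp only [map_add, map_smul, _root_.add_apply, _root_.smul_apply, smul_eq_mul, h.cov_fst_fst hx,
    h.fst_fst x hx, h.cov_snd_fst hx, h.snd_fst hx]
  ring

lemma inner_cov_comb_snd (h : L.IsFramePair φ N P O) {u v : Y → ℝ} (hu : ContDiffOn ℝ ∞ u O)
    (hv : ContDiffOn ℝ ∞ v O) {x : Y} (hx : x ∈ O) (b : Y) :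
    L.G (φ x) (L.cov φ (fun z => u z • N z + v z • P z) b x) (P x) =
      fderiv ℝ v x b + u x * L.connForm φ N P b x := by
  rw [h.cov_comb hu hv hx]
  simp only [map_add, map_smul, _root_.add_apply, _root_.smul_apply, smul_eq_mul, h.cov_snd_snd hx,
    h.snd_snd x hx, h.fst_snd x hx, connForm]
  ring

lemma fderiv_fderiv_comm (h : L.IsFramePair φ N P O) {u : Y → ℝ} (hu : ContDiffOn ℝ ∞ u O)
    {x : Y} (hx : x ∈ O) (a b : Y) :
    fderiv ℝ (fun z => fderiv ℝ u z b) x a = fderiv ℝ (fun z => fderiv ℝ u z a) x b := by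
  have hx' := hu.contDiffAt (h.isOpen.mem_nhds hx)
  have hd : DifferentiableAt ℝ (fderiv ℝ u) x :=
    (hx'.fderiv_right (m := 1) (by norm_cast)).differentiableAt (by simp)
  have hs : IsSymmSndFDerivAt ℝ u x := hx'.isSymmSndFDerivAt (by simpa using two_le_infty)
  rw [fderiv_clm_apply hd (differentiableAt_const a), fderiv_clm_apply hd (differentiableAt_const b)]
  simpa using hs.eq a b

/-- The curvature of the rank two bundle spanned by an orthonormal pair is the differential of its
connection form. -/
lemma curvature_eq (h : L.IsFramePair φ N P O) {u v : Y → ℝ} (hu : ContDiffOn ℝ ∞ u O)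
    (hv : ContDiffOn ℝ ∞ v O) {x : Y} (hx : x ∈ O) (a b : Y) {V : Y → Y → E}
    (hV : ∀ c, ∀ z ∈ O, V c z =
      L.G (φ z) (L.cov φ (fun z => u z • N z + v z • P z) c z) (N z) • N z
      + L.G (φ z) (L.cov φ (fun z => u z • N z + v z • P z) c z) (P z) • P z) :
    L.G (φ x) (L.cov φ (V b) a x) (N x) - L.G (φ x) (L.cov φ (V a) b x) (N x) =
      - v x * (fderiv ℝ (L.connForm φ N P b) x a - fderiv ℝ (L.connForm φ N P a) x b) := by
  have hθ := h.contDiffOn_connForm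
  have hd {w : Y → ℝ} (hw : ContDiffOn ℝ ∞ w O) (c : Y) := contDiffOn_fderiv_apply h.isOpen hw c
  have key (a b : Y) : L.G (φ x) (L.cov φ (V b) a x) (N x) =
      fderiv ℝ (fun z => fderiv ℝ u z b) x a - (fderiv ℝ v x a * L.connForm φ N P b x
        + v x * fderiv ℝ (L.connForm φ N P b) x a)
      - (fderiv ℝ v x b + u x * L.connForm φ N P b x) * L.connForm φ N P a x := by
    have e : V b =ᶠ[𝓝 x] fun z => (fderiv ℝ u z b - v z * L.connForm φ N P b z) • N z +
        (fderiv ℝ v z b + u z * L.connForm φ N P b z) • P z := by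
      filter_upwards [h.isOpen.mem_nhds hx] with z hz
      rw [hV b z hz, h.inner_cov_comb_fst hu hv hz, h.inner_cov_comb_snd hu hv hz]
    rw [cov_congr e, h.inner_cov_comb_fst ((hd hu b).sub (hv.mul (hθ b)))
      ((hd hv b).add (hu.mul (hθ b))) hx]
    rw [fderiv_fun_sub (h.diffAt (hd hu b) hx) ((h.diffAt hv hx).fun_mul (h.diffAt (hθ b) hx)),
      fderiv_fun_mul (h.diffAt hv hx) (h.diffAt (hθ b) hx)]
    simp only [_root_.sub_apply, _root_.add_apply, _root_.smul_apply, smul_eq_mul]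
    ring
  -- Every term of `key` other than −v times the derivative of θ is symmetric in a and b and
  -- cancels.
  rw [key a b, key b a, h.fderiv_fderiv_comm hu hx a b]
  ring

/-- The norm of the covariant derivative of a section `u N + v P`, expressed by the norm of its
Cauchy-Riemann derivative, the curvature, and an exact form. -/
lemma sum_sq_cov (h : L.IsFramePair φ N P O) {u v : Y → ℝ} (hu : ContDiffOn ℝ ∞ u O)
    (hv : ContDiffOn ℝ ∞ v O) {x : Y} (hx : x ∈ O) (a b : Y) {α : Y → Y → ℝ}
    (hα : ∀ c, ∀ z ∈ O, α c z = L.G (φ z) (L.cov φ (fun z => u z • N z + v z • P z) c z)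
      (-v z • N z + u z • P z)) :
    (∀ c, ContDiffOn ℝ ∞ (α c) O) ∧
    fderiv ℝ (α b) x a - fderiv ℝ (α a) x b =
      2 * ((fderiv ℝ u x a - v x * L.connForm φ N P a x) *
          (fderiv ℝ v x b + u x * L.connForm φ N P b x)
        - (fderiv ℝ v x a + u x * L.connForm φ N P a x) *
          (fderiv ℝ u x b - v x * L.connForm φ N P b x))
      + (u x ^ 2 + v x ^ 2) *
        (fderiv ℝ (L.connForm φ N P b) x a - fderiv ℝ (L.connForm φ N P a) x b) := by
  have hθ := h.contDiffOn_connForm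
  have hd {w : Y → ℝ} (hw : ContDiffOn ℝ ∞ w O) (c : Y) := contDiffOn_fderiv_apply h.isOpen hw c
  -- For s = u + iv this one-form is Im(s̄∇s) = u dv − v du + |s|²θ; the second derivatives of u and
  -- v drop out of its exterior derivative.
  have e (c : Y) : ∀ z ∈ O, α c z = u z * fderiv ℝ v z c - v z * fderiv ℝ u z c +
      (u z * u z + v z * v z) * L.connForm φ N P c z := by
    intro z hz
    rw [hα c z hz]
    simp only [map_add, map_smul, smul_eq_mul]
    rw [h.inner_cov_comb_fst hu hv hz, h.inner_cov_comb_snd hu hv hz]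
    ring
  have hsm (c : Y) : ContDiffOn ℝ ∞ (fun z => u z * fderiv ℝ v z c - v z * fderiv ℝ u z c +
      (u z * u z + v z * v z) * L.connForm φ N P c z) O :=
    ((hu.mul (hd hv c)).sub (hv.mul (hd hu c))).add (((hu.mul hu).add (hv.mul hv)).mul (hθ c))
  refine ⟨fun c => (hsm c).congr (e c), ?_⟩
  have key (a b : Y) : fderiv ℝ (α b) x a =
      fderiv ℝ u x a * fderiv ℝ v x b + u x * fderiv ℝ (fun z => fderiv ℝ v z b) x a
      - fderiv ℝ v x a * fderiv ℝ u x b - v x * fderiv ℝ (fun z => fderiv ℝ u z b) x a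
      + 2 * (u x * fderiv ℝ u x a + v x * fderiv ℝ v x a) * L.connForm φ N P b x
      + (u x * u x + v x * v x) * fderiv ℝ (L.connForm φ N P b) x a := by
    have e' : α b =ᶠ[𝓝 x] fun z => u z * fderiv ℝ v z b - v z * fderiv ℝ u z b +
        (u z * u z + v z * v z) * L.connForm φ N P b z := by
      filter_upwards [h.isOpen.mem_nhds hx] with z hz using e b z hz
    have hu' := h.diffAt hu hx
    have hv' := h.diffAt hv hx
    have hub := h.diffAt (hd hu b) hx
    have hvb := h.diffAt (hd hv b) hx
    have hθb := h.diffAt (hθ b) hx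
    rw [e'.fderiv_eq, fderiv_fun_add ((hu'.fun_mul hvb).fun_sub (hv'.fun_mul hub))
      (((hu'.fun_mul hu').fun_add (hv'.fun_mul hv')).fun_mul hθb), fderiv_fun_sub (hu'.fun_mul hvb) (hv'.fun_mul hub),
      fderiv_fun_mul hu' hvb, fderiv_fun_mul hv' hub,
      fderiv_fun_mul ((hu'.fun_mul hu').fun_add (hv'.fun_mul hv')) hθb,
      fderiv_fun_add (hu'.fun_mul hu') (hv'.fun_mul hv'), fderiv_fun_mul hu' hu', fderiv_fun_mul hv' hv']
    simp only [_root_.sub_apply, _root_.add_apply, _root_.smul_apply, smul_eq_mul]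
    ring
  rw [key a b, key b a, h.fderiv_fderiv_comm hu hx a b, h.fderiv_fderiv_comm hv hx a b]
  ring

end IsFramePair

variable {L : LocalMetric E}

/-- Smooth orthonormal frames of the normal bundle exist locally. -/
lemma exists_normal_frame {φ : Y → E} {O : Set Y} (hO : IsOpen O) (hm : MapsTo φ O L.dom)
    (hφ : ContDiffOn ℝ ∞ φ O) (a b : Y) (hD : ∀ x ∈ O, L.gramDet φ a b x ≠ 0) {x : Y} (hx : x ∈ O)
    {n p : E} (hn : L.G (φ x) n n = 1) (hp : L.G (φ x) p p = 1) (hnp : L.G (φ x) n p = 0)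
    (hna : L.G (φ x) n (fderiv ℝ φ x a) = 0) (hnb : L.G (φ x) n (fderiv ℝ φ x b) = 0)
    (hpa : L.G (φ x) p (fderiv ℝ φ x a) = 0) (hpb : L.G (φ x) p (fderiv ℝ φ x b) = 0) :
    ∃ O' ⊆ O, x ∈ O' ∧ ∃ N P : Y → E, L.IsFramePair φ N P O' ∧ N x = n ∧ P x = p ∧
      ∀ z ∈ O', L.G (φ z) (N z) (fderiv ℝ φ z a) = 0 ∧ L.G (φ z) (N z) (fderiv ℝ φ z b) = 0 ∧
        L.G (φ z) (P z) (fderiv ℝ φ z a) = 0 ∧ L.G (φ z) (P z) (fderiv ℝ φ z b) = 0 := by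
  have ha := contDiffOn_fderiv_apply hO hφ a
  have hb := contDiffOn_fderiv_apply hO hφ b
  set A : Y → E := fun z => fderiv ℝ φ z a with hA
  set B : Y → E := fun z => fderiv ℝ φ z b with hB
  -- the normal part of a constant vector
  let π : E → Y → E := fun v z => v
    - ((L.gram φ b b z * L.G (φ z) v (A z) - L.gram φ a b z * L.G (φ z) v (B z)) /
        L.gramDet φ a b z) • A z
    - ((L.gram φ a a z * L.G (φ z) v (B z) - L.gram φ a b z * L.G (φ z) v (A z)) /
        L.gramDet φ a b z) • B z
  have hπs (v : E) : ContDiffOn ℝ ∞ (π v) O := by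
    have hv : ContDiffOn ℝ ∞ (fun _ : Y => v) O := contDiffOn_const
    have hva := contDiffOn_inner hm hφ hv ha
    have hvb := contDiffOn_inner hm hφ hv hb
    have h1 := contDiffOn_gram hO hm hφ b b
    have h2 := contDiffOn_gram hO hm hφ a a
    have h3 := contDiffOn_gram hO hm hφ a b
    have h4 := contDiffOn_gramDet hO hm hφ a b
    exact (hv.sub ((((h1.mul hva).sub (h3.mul hvb)).div h4 hD).smul ha)).sub
      ((((h2.mul hvb).sub (h3.mul hva)).div h4 hD).smul hb)
  have hπn (v : E) : ∀ z ∈ O, L.G (φ z) (π v z) (A z) = 0 ∧ L.G (φ z) (π v z) (B z) = 0 := by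
    intro z hz
    have hz' := hD z hz
    have e1 : L.G (φ z) (B z) (A z) = L.gram φ a b z := L.G_symm _ (hm hz) _ _
    have e2 : L.G (φ z) (A z) (B z) = L.gram φ a b z := rfl
    have e3 : L.G (φ z) (A z) (A z) = L.gram φ a a z := rfl
    have e4 : L.G (φ z) (B z) (B z) = L.gram φ b b z := rfl
    simp only [π, map_sub, map_smul, _root_.sub_apply, _root_.smul_apply, smul_eq_mul, e1, e2, e3,
      e4]
    constructor <;> field_simp <;> rw [gramDet] <;> ring
  have hπx {v : E} (h1 : L.G (φ x) v (A x) = 0) (h2 : L.G (φ x) v (B x) = 0) : π v x = v := by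
    simp [π, h1, h2]
  set n' := π n
  have hn' : ContDiffOn ℝ ∞ (fun z => L.G (φ z) (n' z) (n' z)) O :=
    contDiffOn_inner hm hφ (hπs n) (hπs n)
  have hn'x : n' x = n := hπx hna hnb
  -- At x the projection fixes n, which has length one. The projected field is therefore nonzero
  -- near x and can be normalized there; the same argument yields `O₂` for the second field.
  let O₁ : Set Y := O ∩ (fun z => L.G (φ z) (n' z) (n' z)) ⁻¹' Ioi 0
  have hO₁ : IsOpen O₁ := hn'.continuousOn.isOpen_inter_preimage hO isOpen_Ioi
  have hs₁ : O₁ ⊆ O := inter_subset_left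
  have hx₁ : x ∈ O₁ := ⟨hx, by simp [hn'x, hn]⟩
  let N : Y → E := fun z => (√(L.G (φ z) (n' z) (n' z)))⁻¹ • n' z
  have hNs : ContDiffOn ℝ ∞ N O₁ := by
    refine ContDiffOn.smul (ContDiffOn.inv ?_ ?_) ((hπs n).mono hs₁)
    · exact (hn'.mono hs₁).sqrt fun z hz => (ne_of_gt hz.2)
    · exact fun z hz => (Real.sqrt_pos.2 hz.2).ne'
  have hNN : ∀ z ∈ O₁, L.G (φ z) (N z) (N z) = 1 := by
    intro z hz
    have h1 : 0 < L.G (φ z) (n' z) (n' z) := hz.2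
    have h2 := (Real.sqrt_pos.2 h1).ne'
    simp only [N, map_smul, _root_.smul_apply, smul_eq_mul]
    field_simp
    rw [Real.sq_sqrt h1.le]
  have hNn : ∀ z ∈ O₁, L.G (φ z) (N z) (A z) = 0 ∧ L.G (φ z) (N z) (B z) = 0 := by
    intro z hz
    have h1 : L.G (φ z) (n' z) (A z) = 0 ∧ L.G (φ z) (n' z) (B z) = 0 := hπn n z hz.1
    simp only [N, map_smul, _root_.smul_apply, smul_eq_mul, h1.1, h1.2, mul_zero, and_self]
  have hNx : N x = n := by simp [N, hn'x, hn]
  let p' : Y → E := fun z => π p z - L.G (φ z) (π p z) (N z) • N z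
  have hp's : ContDiffOn ℝ ∞ p' O₁ :=
    ((hπs p).mono hs₁).sub ((contDiffOn_inner (hm.mono_left hs₁) (hφ.mono hs₁)
      ((hπs p).mono hs₁) hNs).smul hNs)
  have hp'x : p' x = p := by
    have h1 : π p x = p := hπx hpa hpb
    have h2 : L.G (φ x) p n = 0 := by rw [L.G_symm _ (hm hx), hnp]
    simp [p', h1, hNx, h2]
  have hp'N : ∀ z ∈ O₁, L.G (φ z) (N z) (p' z) = 0 := by
    intro z hz
    simp only [p', map_sub, map_smul, smul_eq_mul, hNN z hz]
    rw [L.G_symm _ (hm hz.1)]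
    ring
  have hp'n : ∀ z ∈ O₁, L.G (φ z) (p' z) (A z) = 0 ∧ L.G (φ z) (p' z) (B z) = 0 := by
    intro z hz
    simp only [p', map_sub, map_smul, _root_.sub_apply, _root_.smul_apply, smul_eq_mul,
      (hπn p z hz.1).1, (hπn p z hz.1).2, (hNn z hz).1, (hNn z hz).2, mul_zero, sub_zero, and_self]
  have hp' : ContDiffOn ℝ ∞ (fun z => L.G (φ z) (p' z) (p' z)) O₁ :=
    contDiffOn_inner (hm.mono_left hs₁) (hφ.mono hs₁) hp's hp's
  let O₂ : Set Y := O₁ ∩ (fun z => L.G (φ z) (p' z) (p' z)) ⁻¹' Ioi 0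
  have hO₂ : IsOpen O₂ := hp'.continuousOn.isOpen_inter_preimage hO₁ isOpen_Ioi
  have hs₂ : O₂ ⊆ O₁ := inter_subset_left
  let P : Y → E := fun z => (√(L.G (φ z) (p' z) (p' z)))⁻¹ • p' z
  refine ⟨O₂, hs₂.trans hs₁, ⟨hx₁, by simp [hp'x, hp]⟩, N, P, ⟨hO₂, hm.mono_left (hs₂.trans hs₁),
    hφ.mono (hs₂.trans hs₁), hNs.mono hs₂, ?_, fun z hz => hNN z hz.1, ?_, ?_⟩, hNx, ?_, ?_⟩
  · refine ContDiffOn.smul (ContDiffOn.inv ?_ ?_) (hp's.mono hs₂)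
    · exact (hp'.mono hs₂).sqrt fun z hz => (ne_of_gt hz.2)
    · exact fun z hz => (Real.sqrt_pos.2 hz.2).ne'
  · intro z hz
    have h1 : 0 < L.G (φ z) (p' z) (p' z) := hz.2
    have h2 := (Real.sqrt_pos.2 h1).ne'
    simp only [P, map_smul, _root_.smul_apply, smul_eq_mul]
    field_simp
    rw [Real.sq_sqrt h1.le]
  · intro z hz
    simp only [P, map_smul, smul_eq_mul, hp'N z hz.1, mul_zero]
  · simp [P, hp'x, hp]
  · intro z hz
    refine ⟨(hNn z hz.1).1, (hNn z hz.1).2, ?_, ?_⟩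
    · simp only [P, map_smul, _root_.smul_apply, smul_eq_mul]
      rw [(hp'n z hz.1).1, mul_zero]
    · simp only [P, map_smul, _root_.smul_apply, smul_eq_mul]
      rw [(hp'n z hz.1).2, mul_zero]

end LocalMetric

/-! ### Orientations -/

section Orientation

variable {n : ℕ} {V : Type*} [AddCommGroup V] [Module ℝ V]

/-- There are only two orientations, so relative to a reference basis positivity becomes the sign of
a determinant. In this form it is an open condition. -/
lemma isPositiveBasis_iff [Nonempty (Fin n)] (b : Module.Basis (Fin n) ℝ V)
    (o : Orientation ℝ V (Fin n)) (w : Fin n → V) :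
    IsPositiveBasis o w ↔
      (b.orientation = o ∧ 0 < b.det w) ∨ (b.orientation ≠ o ∧ b.det w < 0) := by
  constructor
  · rintro ⟨c, rfl, rfl⟩
    by_cases h : b.orientation = c.orientation
    · exact Or.inl ⟨h, (Module.Basis.orientation_eq_iff_det_pos b c).1 h⟩
    · refine Or.inr ⟨h, lt_of_le_of_ne ?_ (b.isUnit_det c).ne_zero⟩
      exact not_lt.1 fun h' => h ((Module.Basis.orientation_eq_iff_det_pos b c).2 h')
  · intro h
    have hdet : b.det w ≠ 0 := by
      rcases h with h | h
      · exact h.2.ne'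
      · exact h.2.ne
    obtain ⟨hli, hsp⟩ := (Module.Basis.is_basis_iff_det b).2 (isUnit_iff_ne_zero.2 hdet)
    refine ⟨Module.Basis.mk hli hsp.ge, Module.Basis.coe_mk hli hsp.ge, ?_⟩
    have hiff := Module.Basis.orientation_eq_iff_det_pos b (Module.Basis.mk hli hsp.ge)
    rw [Module.Basis.coe_mk] at hiff
    rcases h with h | h
    · rw [← h.1]
      exact (hiff.2 h.2).symm
    · have h1 : b.orientation ≠ (Module.Basis.mk hli hsp.ge).orientation := fun h' =>
        absurd (hiff.1 h') (not_lt.2 h.2.le)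
      have h2 := (Module.Basis.orientation_ne_iff_eq_neg b _).1 h1.symm
      have h3 := (Module.Basis.orientation_ne_iff_eq_neg b o).1 h.1.symm
      rw [h2, h3]

lemma det_comb (b : Module.Basis (Fin n) ℝ V) (P : Matrix (Fin n) (Fin n) ℝ) (w : Fin n → V)
    (hw : ∀ j, w j = ∑ i, P i j • b i) : b.det w = P.det := by
  rw [Module.Basis.det_apply]
  congr 1
  ext i j
  simp [Module.Basis.toMatrix_apply, hw, Finsupp.single_apply]

lemma IsPositiveBasis.comb_iff [Nonempty (Fin n)] {o : Orientation ℝ V (Fin n)} {v : Fin n → V}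
    (hv : IsPositiveBasis o v) (P : Matrix (Fin n) (Fin n) ℝ) (w : Fin n → V)
    (hw : ∀ j, w j = ∑ i, P i j • v i) : IsPositiveBasis o w ↔ 0 < P.det := by
  obtain ⟨b, rfl, hb⟩ := hv
  rw [isPositiveBasis_iff b, det_comb b P w hw]
  simp [hb]

lemma IsPositiveBasis.eq_comb {o : Orientation ℝ V (Fin n)} {v : Fin n → V}
    (hv : IsPositiveBasis o v) (x : V) : ∃ c : Fin n → ℝ, x = ∑ i, c i • v i := by
  obtain ⟨b, rfl, -⟩ := hv
  exact ⟨b.repr x, (b.sum_repr x).symm⟩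

lemma IsPositiveBasis.comb_two {o : Orientation ℝ V (Fin 2)} {v w : V}
    (hv : IsPositiveBasis o ![v, w]) (a b c d : ℝ) :
    IsPositiveBasis o ![a • v + b • w, c • v + d • w] ↔ 0 < a * d - b * c := by
  rw [hv.comb_iff !![a, c; b, d] _ (fun j => by fin_cases j <;> simp), Matrix.det_fin_two_of]
  ring_nf

/-- The change of basis is block diagonal, a tangential block and a normal block. Once the
tangential block has positive determinant, the orientation of the whole fixes the sign of the normal
block. -/
lemma IsPositiveBasis.comb_four {o : Orientation ℝ V (Fin 4)} {v w x y : V}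
    (hv : IsPositiveBasis o ![v, w, x, y]) (a b c d a' b' c' d' : ℝ) :
    IsPositiveBasis o ![a • v + b • w, c • v + d • w, a' • x + b' • y, c' • x + d' • y] ↔
      0 < (a * d - b * c) * (a' * d' - b' * c') := by
  rw [hv.comb_iff !![a, c, 0, 0; b, d, 0, 0; 0, 0, a', c'; 0, 0, b', d'] _
    (fun j => by fin_cases j <;> simp [Fin.sum_univ_four])]
  have : Matrix.det !![a, c, 0, 0; b, d, 0, 0; 0, 0, a', c'; 0, 0, b', d'] =
      (a * d - b * c) * (a' * d' - b' * c') := by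
    simp [Matrix.det_succ_row_zero, Fin.sum_univ_succ, Fin.succAbove]
    ring
  rw [this]

end Orientation

section OrientationField

variable {n : ℕ} {M N : Type*} [TopologicalSpace M] [ChartedSpace (Euc n) M]
  [IsManifold (𝓡 n) ∞ M] [TopologicalSpace N]

/-- The coordinate frame as a basis. -/
noncomputable def chartBasis (q : M) {x : M} (hx : x ∈ (chartAt (Euc n) q).source) :
    Module.Basis (Fin n) ℝ (Tan n x) :=
  (EuclideanSpace.basisFun (Fin n) ℝ).toBasis.map (chartEquiv q hx).symm.toLinearEquiv

lemma coe_chartBasis (q : M) {x : M} (hx : x ∈ (chartAt (Euc n) q).source) :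
    (chartBasis q hx : Fin n → Tan n x) = fun i => ofChart q x (stdVec i) := by
  ext i
  simp only [chartBasis, Module.Basis.map_apply, OrthonormalBasis.coe_toBasis,
    EuclideanSpace.basisFun_apply]
  rfl

lemma chartBasis_det (q : M) {x : M} (hx : x ∈ (chartAt (Euc n) q).source) (w : Fin n → Tan n x) :
    (chartBasis q hx).det w = Matrix.det (Matrix.of fun i j => toChart q x (w j) i) := by
  refine det_comb _ _ _ fun j => ?_
  rw [coe_chartBasis]
  simp only [Matrix.of_apply]
  rw [← toChart_inj hx]
  simp only [← chartEquiv_apply hx, map_sum, map_smul]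
  simp only [chartEquiv_apply hx, toChart_ofChart hx]
  exact eq_stdVec_sum _

lemma isPositiveBasis_chart [Nonempty (Fin n)] (q : M) {x : M}
    (hx : x ∈ (chartAt (Euc n) q).source) (o : Orientation ℝ (Tan n x) (Fin n)) :
    IsPositiveBasis o (fun i => ofChart q x (stdVec i)) ↔ (chartBasis q hx).orientation = o := by
  rw [isPositiveBasis_iff (chartBasis q hx), ← coe_chartBasis q hx, Module.Basis.det_self]
  constructor
  · rintro (h | h)
    · exact h.1
    · exact absurd h.2 (by norm_num)
  · exact fun h => Or.inl ⟨h, one_pos⟩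

/-- Positivity of a continuous frame along a continuous map is an open condition. -/
lemma ManifoldOrientation.eventually_isPositiveBasis [Nonempty (Fin n)]
    (o : ManifoldOrientation n M) {u : N → M} {p : N} (hu : ContinuousAt u p)
    {w : Fin n → ∀ r : N, Tan n (u r)}
    (hw : ∀ i, ContinuousAt (fun r => toChart (u p) (u r) (w i r)) p)
    (hp : IsPositiveBasis (o.orient (u p)) fun i => w i p) :
    ∀ᶠ r in 𝓝 p, IsPositiveBasis (o.orient (u r)) fun i => w i r := by
  have hq := mem_chart_source (Euc n) (u p)
  have hδ : ContinuousAt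
      (fun r => Matrix.det (Matrix.of fun i j => toChart (u p) (u r) (w j r) i)) p := by
    have h1 : ContinuousAt
        (fun r => (Matrix.of fun i j => toChart (u p) (u r) (w j r) i : Matrix (Fin n) (Fin n) ℝ))
        p := by
      refine continuousAt_pi.2 fun i => continuousAt_pi.2 fun j => ?_
      exact ((EuclideanSpace.proj (𝕜 := ℝ) i).continuous.continuousAt).comp (hw j)
    exact (continuous_id.matrix_det).continuousAt.comp h1
  have hsrc : ∀ᶠ r in 𝓝 p, u r ∈ (chartAt (Euc n) (u p)).source :=
    hu.eventually ((chartAt (Euc n) (u p)).open_source.mem_nhds hq)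
  have hor := hu.eventually (o.locally_constant (u p))
  -- The coordinate frame at u p may be positive or negative. In both cases `locally_constant` keeps
  -- its sign, and the determinant, being continuous and nonzero, keeps its own.
  rw [isPositiveBasis_iff (chartBasis (u p) hq), chartBasis_det] at hp
  rcases hp with hp | hp
  · filter_upwards [hsrc, hor, hδ.eventually_const_lt hp.2] with r h1 h2 h3
    rw [isPositiveBasis_chart _ h1, isPositiveBasis_chart _ hq] at h2
    rw [isPositiveBasis_iff (chartBasis (u p) h1), chartBasis_det]
    exact Or.inl ⟨h2.2 hp.1, h3⟩
  · filter_upwards [hsrc, hor, hδ.eventually_lt_const hp.2] with r h1 h2 h3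
    rw [isPositiveBasis_chart _ h1, isPositiveBasis_chart _ hq] at h2
    rw [isPositiveBasis_iff (chartBasis (u p) h1), chartBasis_det]
    exact Or.inr ⟨fun h => hp.1 (h2.1 h), h3⟩

end OrientationField

/-! ### Adapted frames -/

section Frames

variable {S M : Type*} [TopologicalSpace S] [ChartedSpace (Euc 2) S]
  [TopologicalSpace M] [ChartedSpace (Euc 4) M] [IsManifold (𝓡 4) ∞ M]
  (g : SmoothMetric 4 M) {f : S → M} {p : S}

lemma pullForm_comm (X Y : Tan 2 p) : pullForm g f p X Y = pullForm g f p Y X := g.symm _ _ _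

lemma pullForm_add_left (X Y Z : Tan 2 p) :
    pullForm g f p (X + Y) Z = pullForm g f p X Z + pullForm g f p Y Z := by
  simp only [pullForm, map_add, _root_.add_apply]

lemma pullForm_smul_left (c : ℝ) (X Z : Tan 2 p) :
    pullForm g f p (c • X) Z = c * pullForm g f p X Z := by
  simp only [pullForm, map_smul, _root_.smul_apply, smul_eq_mul]

lemma pullForm_add_right (X Y Z : Tan 2 p) :
    pullForm g f p Z (X + Y) = pullForm g f p Z X + pullForm g f p Z Y := by
  simp only [pullForm, map_add]

lemma pullForm_smul_right (c : ℝ) (X Z : Tan 2 p) :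
    pullForm g f p Z (c • X) = c * pullForm g f p Z X := by
  simp only [pullForm, map_smul, smul_eq_mul]

lemma pullForm_pos (hinj : Function.Injective (mfderiv (𝓡 2) (𝓡 4) f p)) {X : Tan 2 p}
    (hX : X ≠ 0) : 0 < pullForm g f p X X :=
  g.pos _ _ fun h => hX (hinj (h.trans (map_zero _).symm))

lemma inner_self_eq_zero_imp {x : M} {v : Tan 4 x} (h : g.inner x v v = 0) : v = 0 := by
  by_contra hv
  exact (g.pos x v hv).ne' h

/-- Two candidates differ by a vector that is both tangent and normal, hence zero. This makes the
choice in the definition harmless. -/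
lemma normalPart_eq {v w : Tan 4 (f p)} (hw : IsNormal g f p w)
    (h : ∃ X : Tan 2 p, v - w = mfderiv (𝓡 2) (𝓡 4) f p X) : normalPart g f p v = w := by
  have h1 : IsNormal g f p (normalPart g f p v) ∧
      ∃ X : Tan 2 p, v - normalPart g f p v = mfderiv (𝓡 2) (𝓡 4) f p X :=
    Classical.epsilon_spec (p := fun w : Tan 4 (f p) =>
      IsNormal g f p w ∧ ∃ X : Tan 2 p, v - w = mfderiv (𝓡 2) (𝓡 4) f p X) ⟨w, hw, h⟩
  obtain ⟨h2, X, hX⟩ := h1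
  obtain ⟨X', hX'⟩ := h
  have h3 : w - normalPart g f p v = mfderiv (𝓡 2) (𝓡 4) f p (X - X') := by
    rw [map_sub, ← hX, ← hX']
    abel
  have h4 : g.inner (f p) (w - normalPart g f p v) (w - normalPart g f p v) = 0 := by
    have h5 : g.inner (f p) (w - normalPart g f p v)
        (mfderiv (𝓡 2) (𝓡 4) f p (X - X')) = 0 := by
      rw [map_sub (g.inner (f p)), _root_.sub_apply, hw, h2, sub_zero]
    rwa [← h3] at h5
  exact (sub_eq_zero.1 (inner_self_eq_zero_imp g h4)).symm

variable [IsManifold (𝓡 2) ∞ S] {oS : ManifoldOrientation 2 S} {oM : ManifoldOrientation 4 M} {g}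
  {e₁ e₂ e₁' e₂' : Tan 2 p} {e₃ e₄ e₃' e₄' : Tan 4 (f p)}

lemma IsTangentFrame.eq_comb (h : IsTangentFrame oS g f p e₁ e₂) (X : Tan 2 p) :
    X = pullForm g f p X e₁ • e₁ + pullForm g f p X e₂ • e₂ := by
  obtain ⟨h1, h2, h3, h4⟩ := h
  obtain ⟨c, hc⟩ := h4.eq_comb X
  simp only [Fin.sum_univ_two, Matrix.cons_val_zero, Matrix.cons_val_one] at hc
  have h3' : pullForm g f p e₂ e₁ = 0 := by rw [pullForm_comm, h3]
  rw [hc]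
  simp only [pullForm_add_left, pullForm_smul_left, h1, h2, h3, h3']
  simp

/-- The transition matrix is orthogonal, so its squared determinant is 1 by Lagrange's identity;
equality of the orientations selects +1, and the matrix is a rotation. -/
lemma IsTangentFrame.rotation (h : IsTangentFrame oS g f p e₁ e₂)
    (h' : IsTangentFrame oS g f p e₁' e₂') : ∃ c s : ℝ, c ^ 2 + s ^ 2 = 1 ∧
      e₁' = c • e₁ + s • e₂ ∧ e₂' = (-s) • e₁ + c • e₂ := by
  have E1 := h.eq_comb e₁'
  have E2 := h.eq_comb e₂'
  generalize pullForm g f p e₁' e₁ = c at E1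
  generalize pullForm g f p e₁' e₂ = s at E1
  generalize pullForm g f p e₂' e₁ = d at E2
  generalize pullForm g f p e₂' e₂ = k at E2
  obtain ⟨h1, h2, h3, h4⟩ := h
  obtain ⟨h1', h2', h3', h4'⟩ := h'
  have h3s : pullForm g f p e₂ e₁ = 0 := by rw [pullForm_comm, h3]
  rw [E1, E2, h4.comb_two] at h4'
  rw [E1] at h1'
  rw [E2] at h2'
  rw [E1, E2] at h3'
  simp only [pullForm_add_left, pullForm_smul_left, pullForm_add_right, pullForm_smul_right, h1,
    h2, h3, h3s] at h1' h2' h3'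
  have hdet : c * k - s * d = 1 := by
    have : (c * k - s * d) ^ 2 = 1 := by linear_combination h1' * (d * d + k * k) + h2' -
      (c * d + s * k) * h3'
    nlinarith
  -- The squared distance between the first row and the second row turned back by a quarter turn is
  -- the sum of their squared lengths minus twice the determinant, here 1 + 1 − 2.
  have hz : (c - k) ^ 2 + (s + d) ^ 2 = 0 := by linear_combination h1' + h2' - 2 * hdet
  have hck : c = k := by nlinarith [sq_nonneg (c - k), sq_nonneg (s + d)]
  have hsd : d = -s := by nlinarith [sq_nonneg (c - k), sq_nonneg (s + d)]
  subst hck hsd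
  exact ⟨c, s, by linear_combination h1', E1, E2⟩

/-- A rotation commutes with the quarter turn, so the frame picked in the definition gives the same
value as any other oriented frame. -/
lemma IsTangentFrame.tangentI_eq (h : IsTangentFrame oS g f p e₁ e₂) (X : Tan 2 p) :
    tangentI oS g f p X = pullForm g f p X e₁ • e₂ - pullForm g f p X e₂ • e₁ := by
  have hspec : ∃ e₁' e₂' : Tan 2 p, IsTangentFrame oS g f p e₁' e₂' ∧
      tangentI oS g f p X = pullForm g f p X e₁' • e₂' - pullForm g f p X e₂' • e₁' :=
    Classical.epsilon_spec (p := fun Y : Tan 2 p => ∃ e₁ e₂ : Tan 2 p,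
      IsTangentFrame oS g f p e₁ e₂ ∧ Y = pullForm g f p X e₁ • e₂ - pullForm g f p X e₂ • e₁)
      ⟨_, e₁, e₂, h, rfl⟩
  obtain ⟨e₁', e₂', h', hI⟩ := hspec
  obtain ⟨c, s, hcs, rfl, rfl⟩ := h.rotation h'
  rw [hI]
  simp only [pullForm_add_right, pullForm_smul_right]
  match_scalars
  · linear_combination (-pullForm g f p X e₂) * hcs
  · linear_combination (pullForm g f p X e₁) * hcs

lemma IsAdaptedFrame.eq_comb (h : IsAdaptedFrame oS oM g f p e₁ e₂ e₃ e₄) (v : Tan 4 (f p)) :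
    v = g.inner (f p) v (mfderiv (𝓡 2) (𝓡 4) f p e₁) • mfderiv (𝓡 2) (𝓡 4) f p e₁ +
      g.inner (f p) v (mfderiv (𝓡 2) (𝓡 4) f p e₂) • mfderiv (𝓡 2) (𝓡 4) f p e₂ +
      g.inner (f p) v e₃ • e₃ + g.inner (f p) v e₄ • e₄ := by
  obtain ⟨⟨h1, h2, h3, -⟩, h5, h6, h7, h8, h9, h10⟩ := h
  obtain ⟨c, hc⟩ := h10.eq_comb v
  simp only [Fin.sum_univ_four, Matrix.cons_val] at hc
  have h3' : pullForm g f p e₂ e₁ = 0 := by rw [pullForm_comm, h3]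
  have h9' : g.inner (f p) e₄ e₃ = 0 := by rw [g.symm, h9]
  have h5' (X : Tan 2 p) : g.inner (f p) (mfderiv (𝓡 2) (𝓡 4) f p X) e₃ = 0 := by rw [g.symm, h5]
  have h6' (X : Tan 2 p) : g.inner (f p) (mfderiv (𝓡 2) (𝓡 4) f p X) e₄ = 0 := by rw [g.symm, h6]
  unfold pullForm at h1 h2 h3 h3'
  unfold IsNormal at h5 h6
  rw [hc]
  simp only [map_add, map_smul, _root_.add_apply, _root_.smul_apply, h1, h2, h3, h3', h5, h6, h5',
    h6', h7, h8, h9, h9', smul_eq_mul]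
  simp

lemma IsAdaptedFrame.normalPart_eq (h : IsAdaptedFrame oS oM g f p e₁ e₂ e₃ e₄) (v : Tan 4 (f p)) :
    normalPart g f p v = g.inner (f p) v e₃ • e₃ + g.inner (f p) v e₄ • e₄ := by
  refine SurfaceVariation.normalPart_eq g (fun X => ?_)
    ⟨g.inner (f p) v (mfderiv (𝓡 2) (𝓡 4) f p e₁) • e₁ +
      g.inner (f p) v (mfderiv (𝓡 2) (𝓡 4) f p e₂) • e₂, ?_⟩
  · simp only [map_add, map_smul, _root_.add_apply, _root_.smul_apply, h.2.1 X, h.2.2.1 X]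
    simp
  · conv_lhs => rw [h.eq_comb v]
    simp only [map_add, map_smul, _root_.add_apply, _root_.smul_apply]
    have E := h.eq_comb v
    rw [sub_eq_iff_eq_add]
    have e3 := congrArg (fun w => g.inner (f p) w e₃) E
    have e4 := congrArg (fun w => g.inner (f p) w e₄) E
    simp only [map_add, map_smul, _root_.add_apply, _root_.smul_apply] at e3 e4
    rw [← e3, ← e4]
    abel

lemma IsAdaptedFrame.eq_comb_of_isNormal (h : IsAdaptedFrame oS oM g f p e₁ e₂ e₃ e₄)
    {v : Tan 4 (f p)} (hv : IsNormal g f p v) :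
    v = g.inner (f p) v e₃ • e₃ + g.inner (f p) v e₄ • e₄ := by
  have := h.eq_comb v
  rw [hv e₁, hv e₂] at this
  simpa using this

/-- The tangential frames of two adapted frames differ by a rotation, of determinant one. By
`comb_four` the normal frames are then equally oriented, so they too differ by a rotation, which
commutes with J. -/
lemma IsAdaptedFrame.normalJ_eq (h : IsAdaptedFrame oS oM g f p e₁ e₂ e₃ e₄) (v : Tan 4 (f p)) :
    normalJ oS oM g f p v = g.inner (f p) v e₃ • e₄ - g.inner (f p) v e₄ • e₃ := by
  have hspec : ∃ (e₁' e₂' : Tan 2 p) (e₃' e₄' : Tan 4 (f p)),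
      IsAdaptedFrame oS oM g f p e₁' e₂' e₃' e₄' ∧
      normalJ oS oM g f p v = g.inner (f p) v e₃' • e₄' - g.inner (f p) v e₄' • e₃' :=
    Classical.epsilon_spec (p := fun w : Tan 4 (f p) => ∃ (e₁ e₂ : Tan 2 p) (e₃ e₄ : Tan 4 (f p)),
      IsAdaptedFrame oS oM g f p e₁ e₂ e₃ e₄ ∧
        w = g.inner (f p) v e₃ • e₄ - g.inner (f p) v e₄ • e₃)
      ⟨_, e₁, e₂, e₃, e₄, h, rfl⟩
  obtain ⟨e₁', e₂', e₃', e₄', h', hJ⟩ := hspec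
  rw [hJ]
  obtain ⟨c, s, hcs, rfl, rfl⟩ := h.1.rotation h'.1
  have E3 := h.eq_comb_of_isNormal h'.2.1
  have E4 := h.eq_comb_of_isNormal h'.2.2.1
  generalize g.inner (f p) e₃' e₃ = a at E3
  generalize g.inner (f p) e₃' e₄ = b at E3
  generalize g.inner (f p) e₄' e₃ = d at E4
  generalize g.inner (f p) e₄' e₄ = k at E4
  obtain ⟨-, -, -, h7', h8', h9', h10'⟩ := h'
  obtain ⟨-, -, -, h7, h8, h9, h10⟩ := h
  have h9s : g.inner (f p) e₄ e₃ = 0 := by rw [g.symm, h9]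
  have hpos := (h10.comb_four c s (-s) c a b d k).1 (by
    rw [E3, E4] at h10'
    simpa only [map_add, map_smul] using h10')
  subst E3 E4
  simp only [map_add, map_smul, _root_.add_apply, _root_.smul_apply, h7, h8, h9, h9s,
    smul_eq_mul] at h7' h8' h9'
  have hpos' : 0 < a * k - b * d := by
    have : c * c - s * -s = 1 := by linear_combination hcs
    rw [this, one_mul] at hpos
    exact hpos
  have hdet : a * k - b * d = 1 := by
    have : (a * k - b * d) ^ 2 = 1 := by linear_combination h7' * (d * d + k * k) + h8' -
      (a * d + b * k) * h9'
    nlinarith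
  have hz : (a - k) ^ 2 + (b + d) ^ 2 = 0 := by linear_combination h7' + h8' - 2 * hdet
  have hck : a = k := by nlinarith [sq_nonneg (a - k), sq_nonneg (b + d)]
  have hsd : d = -b := by nlinarith [sq_nonneg (a - k), sq_nonneg (b + d)]
  subst hck hsd
  simp only [map_add, map_smul, smul_eq_mul]
  match_scalars
  · linear_combination (-g.inner (f p) v e₄) * h7'
  · linear_combination (g.inner (f p) v e₃) * h7'

/-- Gram-Schmidt orthonormalization of a positive basis of the tangent plane. -/
lemma exists_isTangentFrame_of_basis (hinj : Function.Injective (mfderiv (𝓡 2) (𝓡 4) f p))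
    {A B : Tan 2 p} (h : IsPositiveBasis (oS.orient p) ![A, B]) :
    0 < pullForm g f p A A * pullForm g f p B B - pullForm g f p A B ^ 2 ∧
    ∃ a b c : ℝ, 0 < a ∧ 0 < c ∧ IsTangentFrame oS g f p (a • A) (b • A + c • B) := by
  obtain ⟨β, hβ, -⟩ := id h
  have hli : LinearIndependent ℝ ![A, B] := hβ ▸ β.linearIndependent
  rw [LinearIndependent.pair_iff] at hli
  have hA : A ≠ 0 := by
    rintro rfl
    have := hli 1 0 (by simp)
    simp at this
  have hAA := pullForm_pos g hinj hA
  have hC : pullForm g f p A A • B - pullForm g f p A B • A ≠ 0 := by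
    intro h0
    have := hli (-pullForm g f p A B) (pullForm g f p A A) (by rw [← h0]; module)
    exact hAA.ne' this.2
  have hCC := pullForm_pos g hinj hC
  have e1 : pullForm g f p B A = pullForm g f p A B := pullForm_comm g _ _
  have hexp : pullForm g f p (pullForm g f p A A • B - pullForm g f p A B • A)
      (pullForm g f p A A • B - pullForm g f p A B • A) = pullForm g f p A A *
        (pullForm g f p A A * pullForm g f p B B - pullForm g f p A B ^ 2) := by
    rw [sub_eq_add_neg, ← neg_smul]
    simp only [pullForm_add_left, pullForm_smul_left, pullForm_add_right, pullForm_smul_right, e1]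
    ring
  rw [hexp] at hCC
  have hD := (mul_pos_iff_of_pos_left hAA).1 hCC
  refine ⟨hD, ?_⟩
  set α := pullForm g f p A A with hα
  set γ := pullForm g f p A B with hγ
  set δ := α * pullForm g f p B B - γ ^ 2 with hδ
  have hsα := Real.sqrt_pos.2 hAA
  have hsδ := Real.sqrt_pos.2 hD
  have hα2 := Real.sq_sqrt hAA.le
  have hδ2 := Real.sq_sqrt hD.le
  have hBB : pullForm g f p B B = (δ + γ ^ 2) / α := by
    rw [hδ]; field_simp; ring
  -- Gram–Schmidt: the first vector is A/√α. The vector αB − γA is orthogonal to A and has squared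
  -- length αδ, which gives the other two coefficients.
  refine ⟨(√α)⁻¹, -γ / (√α * √δ), α / (√α * √δ), inv_pos.2 hsα, by positivity, ?_, ?_, ?_, ?_⟩
  · simp only [pullForm_smul_left, pullForm_smul_right, ← hα]
    field_simp
    linarith
  · simp only [pullForm_add_left, pullForm_smul_left, pullForm_add_right, pullForm_smul_right, e1,
      ← hα, ← hγ, hBB]
    field_simp
    rw [hα2, hδ2]
    ring
  · simp only [pullForm_smul_left, pullForm_add_right, pullForm_smul_right, ← hα, ← hγ]
    field_simp
    ring
  · have := (h.comb_two (√α)⁻¹ 0 (-γ / (√α * √δ)) (α / (√α * √δ))).2 (by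
      rw [zero_mul, sub_zero]; positivity)
    simpa using this

lemma exists_isTangentFrame (hinj : Function.Injective (mfderiv (𝓡 2) (𝓡 4) f p)) :
    ∃ e₁ e₂ : Tan 2 p, IsTangentFrame oS g f p e₁ e₂ := by
  have hp := mem_chart_source (Euc 2) p
  have hb : ∃ A B : Tan 2 p, IsPositiveBasis (oS.orient p) ![A, B] := by
    by_cases h : (chartBasis p hp).orientation = oS.orient p
    · refine ⟨chartBasis p hp 0, chartBasis p hp 1, chartBasis p hp, ?_, h⟩
      ext i; fin_cases i <;> rfl
    · refine ⟨chartBasis p hp 1, chartBasis p hp 0, (isPositiveBasis_iff (chartBasis p hp) _ _).2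
        (Or.inr ⟨h, ?_⟩)⟩
      rw [det_comb _ !![0, 1; 1, 0] _ (fun j => by fin_cases j <;> simp), Matrix.det_fin_two_of]
      norm_num
  obtain ⟨A, B, h⟩ := hb
  obtain ⟨-, a, b, c, -, -, h'⟩ := exists_isTangentFrame_of_basis (g := g) hinj h
  exact ⟨_, _, h'⟩

/-- Fewer than four orthogonality conditions on a four-dimensional space have a nonzero solution, so
an orthonormal tangent pair can be completed; if the orientation is wrong, the last vector is
reversed. -/
lemma exists_isAdaptedFrame (hinj : Function.Injective (mfderiv (𝓡 2) (𝓡 4) f p)) :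
    ∃ (e₁ e₂ : Tan 2 p) (e₃ e₄ : Tan 4 (f p)), IsAdaptedFrame oS oM g f p e₁ e₂ e₃ e₄ := by
  obtain ⟨e₁, e₂, h⟩ := exists_isTangentFrame (oS := oS) (g := g) hinj
  have hfin : Module.finrank ℝ (Tan 4 (f p)) = 4 := by
    rw [(chartEquiv (f p) (mem_chart_source (Euc 4) (f p))).toLinearEquiv.finrank_eq]
    simp
  have : FiniteDimensional ℝ (Tan 4 (f p)) := Module.finite_of_finrank_eq_succ hfin
  have key (k : ℕ) (hk : k < 4) (u : Fin k → Tan 4 (f p)) :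
      ∃ v : Tan 4 (f p), g.inner (f p) v v = 1 ∧ ∀ i, g.inner (f p) v (u i) = 0 := by
    let T : Tan 4 (f p) →ₗ[ℝ] (Fin k → ℝ) :=
      LinearMap.pi fun i => (g.inner (f p) (u i)).toLinearMap
    have hker := LinearMap.ker_ne_bot_of_finrank_lt (f := T) (by simpa [hfin] using hk)
    obtain ⟨v, hv, hv0⟩ := (Submodule.ne_bot_iff _).1 hker
    have hpos := g.pos _ v hv0
    have hs := Real.sq_sqrt hpos.le
    have hs' := Real.sqrt_pos.2 hpos
    refine ⟨(√(g.inner (f p) v v))⁻¹ • v, ?_, fun i => ?_⟩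
    · simp only [map_smul, _root_.smul_apply, smul_eq_mul]
      field_simp
      linarith
    · have := congrFun (LinearMap.mem_ker.1 hv) i
      simp only [T, LinearMap.pi_apply, ContinuousLinearMap.coe_coe, Pi.zero_apply] at this
      rw [g.symm, map_smul, this, smul_zero]
  have hn (v : Tan 4 (f p)) (h1 : g.inner (f p) v (mfderiv (𝓡 2) (𝓡 4) f p e₁) = 0)
      (h2 : g.inner (f p) v (mfderiv (𝓡 2) (𝓡 4) f p e₂) = 0) : IsNormal g f p v := by
    intro X
    rw [h.eq_comb X, map_add, map_add, map_smul, map_smul, map_smul, map_smul, h1, h2]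
    simp
  obtain ⟨e₃, h33, h3⟩ := key 2 (by norm_num)
    ![mfderiv (𝓡 2) (𝓡 4) f p e₁, mfderiv (𝓡 2) (𝓡 4) f p e₂]
  obtain ⟨e₄, h44, h4⟩ := key 3 (by norm_num)
    ![mfderiv (𝓡 2) (𝓡 4) f p e₁, mfderiv (𝓡 2) (𝓡 4) f p e₂, e₃]
  have hn3 : IsNormal g f p e₃ := hn e₃ (h3 0) (h3 1)
  have hn4 : IsNormal g f p e₄ := hn e₄ (h4 0) (h4 1)
  have h43 : g.inner (f p) e₄ e₃ = 0 := h4 2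
  have h34 : g.inner (f p) e₃ e₄ = 0 := by rw [g.symm, h43]
  obtain ⟨q1, q2, q3, -⟩ := id h
  have q3' : pullForm g f p e₂ e₁ = 0 := by rw [pullForm_comm, q3]
  have h5' (X : Tan 2 p) : g.inner (f p) (mfderiv (𝓡 2) (𝓡 4) f p X) e₃ = 0 := by rw [g.symm, hn3]
  have h6' (X : Tan 2 p) : g.inner (f p) (mfderiv (𝓡 2) (𝓡 4) f p X) e₄ = 0 := by rw [g.symm, hn4]
  unfold pullForm at q1 q2 q3 q3'
  have hli : LinearIndependent ℝ
      ![mfderiv (𝓡 2) (𝓡 4) f p e₁, mfderiv (𝓡 2) (𝓡 4) f p e₂, e₃, e₄] := by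
    rw [Fintype.linearIndependent_iff]
    intro c hc
    simp only [Fin.sum_univ_four, Matrix.cons_val] at hc
    have r (w : Tan 4 (f p)) := congrArg (fun v => g.inner (f p) v w) hc
    have r1 := r (mfderiv (𝓡 2) (𝓡 4) f p e₁)
    have r2 := r (mfderiv (𝓡 2) (𝓡 4) f p e₂)
    have r3 := r e₃
    have r4 := r e₄
    simp only [map_add, map_smul, _root_.add_apply, _root_.smul_apply, q1, q2, q3, q3', hn3 e₁,
      hn3 e₂, hn4 e₁, hn4 e₂, h5', h6', h33, h44, h34, h43, smul_eq_mul, map_zero,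
      _root_.zero_apply, mul_zero, mul_one, add_zero, zero_add] at r1 r2 r3 r4
    intro i
    fin_cases i <;> assumption
  let b := basisOfLinearIndependentOfCardEqFinrank hli (by simp [hfin])
  have hb : (b : Fin 4 → Tan 4 (f p)) =
      ![mfderiv (𝓡 2) (𝓡 4) f p e₁, mfderiv (𝓡 2) (𝓡 4) f p e₂, e₃, e₄] :=
    coe_basisOfLinearIndependentOfCardEqFinrank hli _
  by_cases hor : b.orientation = oM.orient (f p)
  · exact ⟨e₁, e₂, e₃, e₄, h, hn3, hn4, h33, h44, h34, b, hb, hor⟩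
  · refine ⟨e₁, e₂, e₃, -e₄, h, hn3, fun X => ?_, h33, ?_, ?_, ?_⟩
    · simp [hn4 X]
    · simp [h44]
    · simp [h34]
    · rw [isPositiveBasis_iff b]
      refine Or.inr ⟨hor, ?_⟩
      rw [det_comb b !![1, 0, 0, 0; 0, 1, 0, 0; 0, 0, 1, 0; 0, 0, 0, -1] _ (fun j => by
        rw [hb]; fin_cases j <;> simp [Fin.sum_univ_four])]
      simp [Matrix.det_succ_row_zero, Fin.sum_univ_succ, Fin.succAbove]

/-- The vector field obtained from two linear forms, expressed in an arbitrary positive basis. -/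
lemma IsTangentFrame.comb_eq (h : IsTangentFrame oS g f p e₁ e₂) {A B : Tan 2 p}
    (hAB : IsPositiveBasis (oS.orient p) ![A, B]) {ζ α : Tan 2 p → ℝ}
    (hζ : ∀ c d : ℝ, ζ (c • e₁ + d • e₂) = c * ζ e₁ + d * ζ e₂)
    (hα : ∀ c d : ℝ, α (c • e₁ + d • e₂) = c * α e₁ + d * α e₂) {D : ℝ}
    (hD : D = pullForm g f p A A * pullForm g f p B B - pullForm g f p A B * pullForm g f p A B) :
    √D • ((ζ e₁ + α e₂) • e₁ + (ζ e₂ - α e₁) • e₂) =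
      ((pullForm g f p B B * ζ A - pullForm g f p A B * ζ B) / √D + α B) • A +
      ((pullForm g f p A A * ζ B - pullForm g f p A B * ζ A) / √D - α A) • B := by
  have E1 := h.eq_comb A
  have E2 := h.eq_comb B
  generalize pullForm g f p A e₁ = c at E1
  generalize pullForm g f p A e₂ = s at E1
  generalize pullForm g f p B e₁ = d at E2
  generalize pullForm g f p B e₂ = k at E2
  subst E1 E2
  obtain ⟨h1, h2, h3, h4⟩ := h
  have h3s : pullForm g f p e₂ e₁ = 0 := by rw [pullForm_comm, h3]
  rw [h4.comb_two] at hAB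
  simp only [pullForm_add_left, pullForm_smul_left, pullForm_add_right, pullForm_smul_right, h1,
    h2, h3, h3s, hζ, hα] at hD ⊢
  -- Positivity of the basis enters here: √D is the determinant itself, not only its absolute value.
  -- The α-terms would otherwise acquire the wrong sign.
  have hD' : D = (c * k - s * d) ^ 2 := by rw [hD]; ring
  rw [hD', Real.sqrt_sq hAB.le]
  have hne := hAB.ne'
  match_scalars <;> field_simp <;> ring

end Frames

/-! ### Coordinate fields commute -/

section Bracket

variable {n : ℕ} {M : Type*} [TopologicalSpace M] [ChartedSpace (Euc n) M]
  [IsManifold (𝓡 n) ∞ M]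

/-- Both fields are constant in the chart at p. As a consequence the bracket term of
`normalCurvature` disappears. -/
lemma mlieBracket_extendVec (p : M) (u v : Tan n p) :
    VectorField.mlieBracket (𝓡 n) (extendVec p u) (extendVec p v) p = 0 := by
  have key (w : Tan n p) : (VectorField.mpullbackWithin 𝓘(ℝ, Euc n) (𝓡 n)
      (extChartAt (𝓡 n) p).symm (extendVec p w) (range (𝓡 n)) : Euc n → Euc n) =ᶠ[𝓝
        (extChartAt (𝓡 n) p p)] fun _ => toChart p p w := by
    have hr : range (𝓡 n) = univ := by simp
    have ht : (chartAt (Euc n) p).target ∈ 𝓝 (extChartAt (𝓡 n) p p) := by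
      simpa using (chartAt (Euc n) p).open_target.mem_nhds (mem_chart_target (Euc n) p)
    filter_upwards [ht] with y hy
    have hs := (chartAt (Euc n) p).map_target hy
    rw [VectorField.mpullbackWithin_apply, hr, mfderivWithin_univ]
    have hD : (mfderiv (𝓡 n) (𝓡 n) (chartAt (Euc n) p).symm y : Euc n →L[ℝ] Tan n _) =
        ((chartEquiv p hs).symm : Euc n →L[ℝ] Tan n _) := by
      ext w
      have := ofChart_eq_mfderiv hs w
      rw [(chartAt (Euc n) p).right_inv hy] at this
      exact this.symm
    have hinv : (mfderiv (𝓡 n) (𝓡 n) (chartAt (Euc n) p).symm y :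
        Euc n →L[ℝ] Tan n _).inverse (ofChart p _ (toChart p p w)) = toChart p p w := by
      exact (congrArg (fun A : Euc n →L[ℝ] Tan n _ => A.inverse _) hD).trans
        ((congrArg (fun A : Tan n _ →L[ℝ] Euc n => A _)
          (ContinuousLinearMap.inverse_equiv (chartEquiv p hs).symm)).trans (toChart_ofChart hs _))
    exact hinv
  have h0 (V W : Euc n → Euc n) (s : Set (Euc n)) (x u v : Euc n) (hs : s = univ)
      (hV : V =ᶠ[𝓝 x] fun _ => u) (hW : W =ᶠ[𝓝 x] fun _ => v) :
      VectorField.lieBracketWithin ℝ V W s x = 0 := by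
    rw [hs, VectorField.lieBracketWithin_univ, hV.lieBracket_vectorField_eq hW]
    simp [VectorField.lieBracket]
  rw [← VectorField.mlieBracketWithin_univ, VectorField.mlieBracketWithin_apply]
  refine (congrArg _ (h0 _ _ _ _ _ _ ?_ (key u) (key v))).trans (map_zero _)
  simp

end Bracket

section Along

variable {S M : Type*} [TopologicalSpace S] [ChartedSpace (Euc 2) S] [IsManifold (𝓡 2) ∞ S]
  [TopologicalSpace M] [ChartedSpace (Euc 4) M] [IsManifold (𝓡 4) ∞ M]
  {g : SmoothMetric 4 M} {f : S → M}

lemma covAlong_comb (hf : ContMDiff (𝓡 2) (𝓡 4) ∞ f) {V : ∀ p : S, Tan 4 (f p)} {p : S}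
    (hV : DifferentiableAt ℝ (locField p (f p) f V) (chartAt (Euc 2) p p)) (c d : ℝ)
    (X Y : Tan 2 p) :
    covAlong g f V p (c • X + d • Y) = c • covAlong g f V p X + d • covAlong g f V p Y := by
  have hp := mem_chart_source (Euc 2) p
  have hm := mem_chart_source (Euc 4) (f p)
  have key (X : Tan 2 p) := toChart_covAlong g hf hp hm hV (toChart p p X)
  simp only [ofChart_toChart hp] at key
  rw [← toChart_inj hm, toChart_add hm, toChart_smul hm, toChart_smul hm, key, key, key,
    toChart_add hp, toChart_smul hp, toChart_smul hp, LocalMetric.cov_add_dir,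
    LocalMetric.cov_smul_dir, LocalMetric.cov_smul_dir]

/-! ### Local adapted frames -/

/-- A smooth positively oriented orthonormal frame of the normal bundle near `p`, in the charts at
`p` and `f p`. -/
structure IsLocalFrame (oS : ManifoldOrientation 2 S) (oM : ManifoldOrientation 4 M)
    (g : SmoothMetric 4 M) (f : S → M) (p : S) (N P : Euc 2 → Euc 4) (O : Set (Euc 2)) : Prop where
  framePair : (localMetric g (f p)).IsFramePair (loc p (f p) f) N P O
  subset : O ⊆ locDom p (f p) f
  adapted : ∀ z ∈ O, ∃ e₁ e₂ : Tan 2 ((chartAt (Euc 2) p).symm z),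
    IsAdaptedFrame oS oM g f ((chartAt (Euc 2) p).symm z) e₁ e₂ (ofChart (f p) _ (N z))
      (ofChart (f p) _ (P z))

variable {oS : ManifoldOrientation 2 S} {oM : ManifoldOrientation 4 M} {p : S}
  {N P : Euc 2 → Euc 4} {O : Set (Euc 2)}

namespace IsLocalFrame

lemma toChart_normalPart (h : IsLocalFrame oS oM g f p N P O) {z : Euc 2} (hz : z ∈ O)
    (v : Tan 4 (f ((chartAt (Euc 2) p).symm z))) :
    toChart (f p) _ (normalPart g f _ v) =
      (localMetric g (f p)).G (loc p (f p) f z) (toChart (f p) _ v) (N z) • N z +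
      (localMetric g (f p)).G (loc p (f p) f z) (toChart (f p) _ v) (P z) • P z := by
  obtain ⟨e₁, e₂, he⟩ := h.adapted z hz
  have hm := (h.subset hz).2
  rw [he.normalPart_eq, toChart_add hm, toChart_smul hm, toChart_smul hm, toChart_ofChart hm,
    toChart_ofChart hm, inner_eq_chartG g hm, inner_eq_chartG g hm, toChart_ofChart hm,
    toChart_ofChart hm]
  rfl

lemma toChart_normalJ (h : IsLocalFrame oS oM g f p N P O) {z : Euc 2} (hz : z ∈ O)
    (v : Tan 4 (f ((chartAt (Euc 2) p).symm z))) :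
    toChart (f p) _ (normalJ oS oM g f _ v) =
      (localMetric g (f p)).G (loc p (f p) f z) (toChart (f p) _ v) (N z) • P z -
      (localMetric g (f p)).G (loc p (f p) f z) (toChart (f p) _ v) (P z) • N z := by
  obtain ⟨e₁, e₂, he⟩ := h.adapted z hz
  have hm := (h.subset hz).2
  rw [he.normalJ_eq, toChart_sub hm, toChart_smul hm, toChart_smul hm, toChart_ofChart hm,
    toChart_ofChart hm, inner_eq_chartG g hm, inner_eq_chartG g hm, toChart_ofChart hm,
    toChart_ofChart hm]
  rfl

lemma toChart_of_isNormal (h : IsLocalFrame oS oM g f p N P O) {z : Euc 2} (hz : z ∈ O)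
    {v : Tan 4 (f ((chartAt (Euc 2) p).symm z))} (hv : IsNormal g f _ v) :
    toChart (f p) _ v =
      (localMetric g (f p)).G (loc p (f p) f z) (toChart (f p) _ v) (N z) • N z +
      (localMetric g (f p)).G (loc p (f p) f z) (toChart (f p) _ v) (P z) • P z := by
  rw [← h.toChart_normalPart hz, normalPart_eq g hv ⟨0, by simp⟩]

end IsLocalFrame

/-- The normal vectors are extended by projecting fields with constant components and
orthonormalizing; the tangent vectors keep constant components a, b. Positivity of both tuples is
open, so it persists near p. -/
lemma IsAdaptedFrame.exists_isLocalFrame (hf : ContMDiff (𝓡 2) (𝓡 4) ∞ f)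
    (hinj : ∀ p, Function.Injective (mfderiv (𝓡 2) (𝓡 4) f p)) {e₁ e₂ : Tan 2 p}
    {e₃ e₄ : Tan 4 (f p)} (h : IsAdaptedFrame oS oM g f p e₁ e₂ e₃ e₄) :
    ∃ N P O, IsLocalFrame oS oM g f p N P O ∧ chartAt (Euc 2) p p ∈ O ∧
      N (chartAt (Euc 2) p p) = toChart (f p) (f p) e₃ ∧
      P (chartAt (Euc 2) p p) = toChart (f p) (f p) e₄ ∧
      ∀ z ∈ O, IsPositiveBasis (oS.orient ((chartAt (Euc 2) p).symm z))
        ![ofChart p _ (toChart p p e₁), ofChart p _ (toChart p p e₂)] := by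
  have hp := mem_chart_source (Euc 2) p
  have hm := mem_chart_source (Euc 4) (f p)
  set a := toChart p p e₁ with ha
  set b := toChart p p e₂ with hb
  set χ := chartAt (Euc 2) p with hχ
  set L := localMetric g (f p) with hL
  set φ := loc p (f p) f with hφ
  set x := χ p with hx
  have hO := isOpen_locDom p (f p) hf.continuous
  have hxO : x ∈ locDom p (f p) f := chart_mem_locDom hp hm
  have hφs : ContDiffOn ℝ ∞ φ (locDom p (f p) f) := contDiffOn_loc p (f p) hf
  have hdf {r : S} (hr : r ∈ χ.source) (hfr : f r ∈ (chartAt (Euc 4) (f p)).source) (v : Euc 2) :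
      toChart (f p) (f r) (mfderiv (𝓡 2) (𝓡 4) f r (ofChart p r v)) = fderiv ℝ φ (χ r) v :=
    toChart_mfderiv_ofChart ((hf r).mdifferentiableAt (by simp)) hr hfr v
  have hinner {r : S} (hr : r ∈ χ.source) (hfr : f r ∈ (chartAt (Euc 4) (f p)).source)
      (v w : Tan 4 (f r)) : g.inner (f r) v w =
      L.G (φ (χ r)) (toChart (f p) (f r) v) (toChart (f p) (f r) w) := by
    rw [inner_eq_chartG g hfr, hφ, loc_chart _ _ hr]
  obtain ⟨⟨h11, h22, h12, hpos⟩, hn3, hn4, h33, h44, h34, hpos4⟩ := id h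
  have hoa : ofChart p p a = e₁ := ofChart_toChart hp _
  have hob : ofChart p p b = e₂ := ofChart_toChart hp _
  -- positivity of the coordinate pair near `p`
  have hev1 : ∀ᶠ r in 𝓝 p, IsPositiveBasis (oS.orient r) ![ofChart p r a, ofChart p r b] := by
    have := oS.eventually_isPositiveBasis (u := id) (p := p) continuousAt_id
      (w := fun i r => (![ofChart p r a, ofChart p r b] : Fin 2 → Tan 2 r) i) ?_ ?_
    · simpa using this
    · intro i
      have key (v : Euc 2) : ContinuousAt (fun r : S => toChart p r (ofChart p r v)) p := by
        refine (continuousAt_const (y := v)).congr ?_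
        filter_upwards [χ.open_source.mem_nhds hp] with r hr
        rw [toChart_ofChart hr]
      fin_cases i
      · exact key a
      · exact key b
    · have : (fun i => (![ofChart p p a, ofChart p p b] : Fin 2 → Tan 2 p) i) = ![e₁, e₂] := by
        rw [hoa, hob]
      exact this ▸ hpos
  have hsymm : Tendsto χ.symm (𝓝 x) (𝓝 p) := by
    have := χ.continuousAt_symm (χ.map_source hp)
    rwa [ContinuousAt, χ.left_inv hp] at this
  obtain ⟨O₁, hO₁s, hO₁, hxO₁⟩ := mem_nhds_iff.1 (inter_mem (hO.mem_nhds hxO) (hsymm.eventually hev1))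
  have hD : ∀ z ∈ O₁, L.gramDet φ a b z ≠ 0 := by
    intro z hz
    obtain ⟨⟨hzt, hzm⟩, hzp⟩ := hO₁s hz
    have hzs := χ.map_target hzt
    have := (exists_isTangentFrame_of_basis (g := g) (hinj _) hzp).1
    simp only [pullForm, hinner hzs hzm, hdf hzs hzm, χ.right_inv hzt] at this
    rw [LocalMetric.gramDet, LocalMetric.gram, LocalMetric.gram, LocalMetric.gram, ← sq]
    exact this.ne'
  have hin (v w : Tan 4 (f p)) := hinner hp hm v w
  have hna {v : Tan 4 (f p)} (hv : IsNormal g f p v) (c : Euc 2) :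
      L.G (φ x) (toChart (f p) (f p) v) (fderiv ℝ φ x c) = 0 := by
    rw [← hdf hp hm, ← hin]
    exact hv _
  obtain ⟨O₂, hO₂s, hxO₂, N, P, hNP, hN, hP, hort⟩ := LocalMetric.exists_normal_frame hO₁
    (fun z hz => mapsTo_loc g p (f p) f (hO₁s hz).1) (hφs.mono fun z hz => (hO₁s hz).1) a b hD hxO₁
    (n := toChart (f p) (f p) e₃) (p := toChart (f p) (f p) e₄) (by rw [← hin]; exact h33)
    (by rw [← hin]; exact h44) (by rw [← hin]; exact h34) (hna hn3 a) (hna hn3 b) (hna hn4 a)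
    (hna hn4 b)
  have hsub : O₂ ⊆ locDom p (f p) f := fun z hz => (hO₁s (hO₂s hz)).1
  have hχc : ContinuousAt χ p := χ.continuousAt hp
  have hev2 : ∀ᶠ r in 𝓝 p, IsPositiveBasis (oM.orient (f r))
      ![mfderiv (𝓡 2) (𝓡 4) f r (ofChart p r a), mfderiv (𝓡 2) (𝓡 4) f r (ofChart p r b),
        ofChart (f p) (f r) (N (χ r)), ofChart (f p) (f r) (P (χ r))] := by
    have hnb : ∀ᶠ r in 𝓝 p, r ∈ χ.source ∧ f r ∈ (chartAt (Euc 4) (f p)).source :=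
      (χ.open_source.eventually_mem hp).and
        (hf.continuous.continuousAt.eventually_mem ((chartAt (Euc 4) (f p)).open_source.mem_nhds hm))
    have := oM.eventually_isPositiveBasis (u := f) (p := p) hf.continuous.continuousAt
      (w := fun i r => (![mfderiv (𝓡 2) (𝓡 4) f r (ofChart p r a),
        mfderiv (𝓡 2) (𝓡 4) f r (ofChart p r b),
        ofChart (f p) (f r) (N (χ r)), ofChart (f p) (f r) (P (χ r))] : Fin 4 → Tan 4 (f r)) i)
      ?_ ?_
    · simpa using this
    · intro i
      have k1 (v : Euc 2) : ContinuousAt (fun r : S => toChart (f p) (f r)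
          (mfderiv (𝓡 2) (𝓡 4) f r (ofChart p r v))) p := by
        have : ContinuousAt (fun r => fderiv ℝ φ (χ r) v) p :=
          ContinuousAt.comp (g := fun y => fderiv ℝ φ y v)
            (((LocalMetric.contDiffOn_fderiv_apply hO hφs v).contDiffAt
              (hO.mem_nhds hxO)).continuousAt) hχc
        refine this.congr ?_
        filter_upwards [hnb] with r hr
        rw [hdf hr.1 hr.2]
      have k2 {Z : Euc 2 → Euc 4} (hZ : ContDiffOn ℝ ∞ Z O₂) :
          ContinuousAt (fun r : S => toChart (f p) (f r) (ofChart (f p) (f r) (Z (χ r)))) p := by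
        have : ContinuousAt (fun r => Z (χ r)) p :=
          ContinuousAt.comp (g := Z) ((hZ.contDiffAt (hNP.isOpen.mem_nhds hxO₂)).continuousAt) hχc
        refine this.congr ?_
        filter_upwards [hnb] with r hr
        rw [toChart_ofChart hr.2]
      fin_cases i
      · exact k1 a
      · exact k1 b
      · exact k2 hNP.smooth_fst
      · exact k2 hNP.smooth_snd
    · have : (fun i => (![mfderiv (𝓡 2) (𝓡 4) f p (ofChart p p a),
        mfderiv (𝓡 2) (𝓡 4) f p (ofChart p p b),
        ofChart (f p) (f p) (N (χ p)), ofChart (f p) (f p) (P (χ p))] : Fin 4 → Tan 4 (f p)) i) =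
          ![mfderiv (𝓡 2) (𝓡 4) f p e₁, mfderiv (𝓡 2) (𝓡 4) f p e₂, e₃, e₄] := by
        rw [hoa, hob, ← hx, hN, hP, ofChart_toChart hm, ofChart_toChart hm]
      exact this ▸ hpos4
  obtain ⟨O, hOs, hOo, hxO'⟩ := mem_nhds_iff.1
    (inter_mem (hNP.isOpen.mem_nhds hxO₂) (hsymm.eventually hev2))
  refine ⟨N, P, O, ⟨hNP.mono hOo fun z hz => (hOs hz).1, fun z hz => hsub (hOs hz).1, ?_⟩, hxO', hN,
    hP, fun z hz => (hO₁s (hO₂s (hOs hz).1)).2⟩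
  intro z hz
  obtain ⟨hz2, hzp⟩ := hOs hz
  have hzt := (hsub hz2).1
  have hzm := (hsub hz2).2
  have hzs := χ.map_target hzt
  obtain ⟨-, α, β, γ, hα, hγ, hfr⟩ := exists_isTangentFrame_of_basis (g := g) (hinj _)
    (hO₁s (hO₂s hz2)).2
  have hzp' : IsPositiveBasis (oM.orient (f (χ.symm z)))
      ![mfderiv (𝓡 2) (𝓡 4) f (χ.symm z) (ofChart p (χ.symm z) a),
        mfderiv (𝓡 2) (𝓡 4) f (χ.symm z) (ofChart p (χ.symm z) b),
        ofChart (f p) (f (χ.symm z)) (N z), ofChart (f p) (f (χ.symm z)) (P z)] := by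
    have := hzp
    simp only [mem_ofPred_eq] at this
    rwa [χ.right_inv hzt] at this
  have hnormal {n : Euc 4} (hna : L.G (φ z) n (fderiv ℝ φ z a) = 0)
      (hnb : L.G (φ z) n (fderiv ℝ φ z b) = 0) :
      IsNormal g f (χ.symm z) (ofChart (f p) _ n) := by
    intro X
    obtain ⟨c, hc⟩ := (hO₁s (hO₂s hz2)).2.eq_comb X
    rw [hc, hinner hzs hzm, toChart_ofChart hzm]
    simp only [Fin.sum_univ_two, Matrix.cons_val_zero, Matrix.cons_val_one]
    rw [← ofChart_smul hzs, ← ofChart_smul hzs, ← ofChart_add hzs, hdf hzs hzm, χ.right_inv hzt,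
      map_add, map_smul, map_smul, map_add, map_smul, map_smul, hna, hnb]
    simp
  obtain ⟨o1, o2, o3, o4⟩ := hort z hz2
  refine ⟨_, _, hfr, hnormal o1 o2, hnormal o3 o4, ?_, ?_, ?_, ?_⟩
  · rw [hinner hzs hzm, toChart_ofChart hzm, χ.right_inv hzt]
    exact hNP.fst_fst z hz2
  · rw [hinner hzs hzm, toChart_ofChart hzm, χ.right_inv hzt]
    exact hNP.snd_snd z hz2
  · rw [hinner hzs hzm, toChart_ofChart hzm, toChart_ofChart hzm, χ.right_inv hzt]
    exact hNP.fst_snd z hz2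
  -- Orthonormalizing the coordinate pair multiplies by a triangular matrix with positive diagonal
  -- α, γ and leaves the normal pair alone, so the orientation of the four vectors is unchanged.
  · have := (hzp'.comb_four α 0 β γ 1 0 0 1).2 (by simp only [zero_mul, sub_zero]; positivity)
    simpa only [map_add, map_smul, zero_smul, one_smul, add_zero, zero_add] using this

end Along

/-! ### Projection to the normal frame and the curvature of the normal bundle. -/

section

variable {E Y : Type*} [NormedAddCommGroup E] [NormedSpace ℝ E]

/-- The field with components `u`, `v` in the frame `N`, `P`. -/
noncomputable def frameComb (N P : Y → E) (u v : Y → ℝ) (z : Y) : E := u z • N z + v z • P z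

/-- The orthogonal projection of the field `W` to the span of the frame `N`, `P`. -/
noncomputable def frameProj (L : LocalMetric E) (φ N P W : Y → E) : Y → E :=
  frameComb N P (fun z => L.G (φ z) (W z) (N z)) (fun z => L.G (φ z) (W z) (P z))

end

namespace LocalMetric.IsFramePair

variable {E Y : Type*} [NormedAddCommGroup E] [NormedSpace ℝ E]
  [NormedAddCommGroup Y] [NormedSpace ℝ Y] {L : LocalMetric E} {φ N P : Y → E} {O : Set Y}

lemma contDiffOn_comb (h : L.IsFramePair φ N P O) {u v : Y → ℝ} (hu : ContDiffOn ℝ ∞ u O)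
    (hv : ContDiffOn ℝ ∞ v O) : ContDiffOn ℝ ∞ (frameComb N P u v) O :=
  (hu.smul h.smooth_fst).add (hv.smul h.smooth_snd)

lemma contDiffOn_proj (h : L.IsFramePair φ N P O) {W : Y → E} (hW : ContDiffOn ℝ ∞ W O) :
    ContDiffOn ℝ ∞ (frameProj L φ N P W) O :=
  h.contDiffOn_comb (contDiffOn_inner h.mapsTo h.smooth hW h.smooth_fst)
    (contDiffOn_inner h.mapsTo h.smooth hW h.smooth_snd)

lemma curvature_proj (h : L.IsFramePair φ N P O) {u v : Y → ℝ} (hu : ContDiffOn ℝ ∞ u O)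
    (hv : ContDiffOn ℝ ∞ v O) {x : Y} (hx : x ∈ O) (a b : Y) :
    L.G (φ x) (L.cov φ (frameProj L φ N P (L.cov φ (frameComb N P u v) b)) a x) (N x) -
      L.G (φ x) (L.cov φ (frameProj L φ N P (L.cov φ (frameComb N P u v) a)) b x) (N x) =
      - v x * (fderiv ℝ (L.connForm φ N P b) x a - fderiv ℝ (L.connForm φ N P a) x b) :=
  h.curvature_eq hu hv hx a b (V := fun c => frameProj L φ N P (L.cov φ (frameComb N P u v) c))
    fun _ _ _ => rfl

end LocalMetric.IsFramePair

section Along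

variable {S M : Type*} [TopologicalSpace S] [ChartedSpace (Euc 2) S] [IsManifold (𝓡 2) ∞ S]
  [TopologicalSpace M] [ChartedSpace (Euc 4) M] [IsManifold (𝓡 4) ∞ M]
  {g : SmoothMetric 4 M} {f : S → M} {oS : ManifoldOrientation 2 S} {oM : ManifoldOrientation 4 M}
  {p : S} {e₁ e₂ : Tan 2 p} {e₃ e₄ : Tan 4 (f p)}

lemma IsAdaptedFrame.inner_normalPart_fst (h : IsAdaptedFrame oS oM g f p e₁ e₂ e₃ e₄)
    (v : Tan 4 (f p)) : g.inner (f p) (normalPart g f p v) e₃ = g.inner (f p) v e₃ := by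
  have h43 : g.inner (f p) e₄ e₃ = 0 := (g.symm _ _ _).trans h.2.2.2.2.2.1
  rw [h.normalPart_eq, map_add, _root_.add_apply, map_smul, map_smul, _root_.smul_apply,
    _root_.smul_apply, h.2.2.2.1, h43]
  simp

lemma IsAdaptedFrame.inner_normalPart_snd (h : IsAdaptedFrame oS oM g f p e₁ e₂ e₃ e₄)
    (v : Tan 4 (f p)) : g.inner (f p) (normalPart g f p v) e₄ = g.inner (f p) v e₄ := by
  rw [h.normalPart_eq, map_add, _root_.add_apply, map_smul, map_smul, _root_.smul_apply,
    _root_.smul_apply, h.2.2.2.2.1, h.2.2.2.2.2.1]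
  simp

/-- Pythagoras' theorem in an adapted frame. -/
lemma IsAdaptedFrame.inner_self (h : IsAdaptedFrame oS oM g f p e₁ e₂ e₃ e₄) (v : Tan 4 (f p)) :
    g.inner (f p) v v = g.inner (f p) v (mfderiv (𝓡 2) (𝓡 4) f p e₁) ^ 2 +
      g.inner (f p) v (mfderiv (𝓡 2) (𝓡 4) f p e₂) ^ 2 +
      g.inner (f p) v e₃ ^ 2 + g.inner (f p) v e₄ ^ 2 := by
  conv_lhs => rw [congrArg (g.inner (f p) v) (h.eq_comb v)]
  simp only [map_add, map_smul, smul_eq_mul]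
  ring

lemma toChart_covAlong_symm (hf : ContMDiff (𝓡 2) (𝓡 4) ∞ f) {V : ∀ p : S, Tan 4 (f p)} {m : M}
    {z : Euc 2} (hz : z ∈ locDom p m f) (hV : DifferentiableAt ℝ (locField p m f V) z)
    (b : Euc 2) :
    toChart m _ (covAlong g f V ((chartAt (Euc 2) p).symm z) (ofChart p _ b)) =
      (localMetric g m).cov (loc p m f) (locField p m f V) b z := by
  have h := toChart_covAlong g hf ((chartAt (Euc 2) p).map_target hz.1) hz.2 (V := V)
    (by rwa [(chartAt (Euc 2) p).right_inv hz.1]) b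
  rwa [(chartAt (Euc 2) p).right_inv hz.1] at h

namespace IsLocalFrame

variable {N P : Euc 2 → Euc 4} {O : Set (Euc 2)}

lemma differentiableAt (h : IsLocalFrame oS oM g f p N P O) {F : Type*} [NormedAddCommGroup F]
    [NormedSpace ℝ F] {V : Euc 2 → F} (hV : ContDiffOn ℝ ∞ V O) {z : Euc 2} (hz : z ∈ O) :
    DifferentiableAt ℝ V z := h.framePair.diffAt hV hz

/-- The coordinate expression of the normal covariant derivative in a local frame. -/
lemma locField_normalCov (h : IsLocalFrame oS oM g f p N P O) (hf : ContMDiff (𝓡 2) (𝓡 4) ∞ f)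
    {V : ∀ p : S, Tan 4 (f p)} {W : Euc 2 → Euc 4} (hW : ContDiffOn ℝ ∞ W O)
    (hVW : ∀ z ∈ O, locField p (f p) f V z = W z) {z : Euc 2} (hz : z ∈ O) (c : Euc 2) :
    locField p (f p) f (fun r => normalCov g f V r (ofChart p r c)) z =
      frameProj (localMetric g (f p)) (loc p (f p) f) N P
        ((localMetric g (f p)).cov (loc p (f p) f) W c) z := by
  have he : locField p (f p) f V =ᶠ[𝓝 z] W := by
    filter_upwards [h.framePair.isOpen.mem_nhds hz] with y hy using hVW y hy
  rw [locField, normalCov, h.toChart_normalPart hz, toChart_covAlong_symm hf (h.subset hz)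
    ((h.differentiableAt hW hz).congr_of_eventuallyEq he), LocalMetric.cov_congr he]
  rfl

/-- The curvature of the normal bundle is minus the differential of the connection form. -/
lemma inner_normalCurvature (h : IsLocalFrame oS oM g f p N P O)
    (hf : ContMDiff (𝓡 2) (𝓡 4) ∞ f) (ha : IsAdaptedFrame oS oM g f p e₁ e₂ e₃ e₄)
    (hx : chartAt (Euc 2) p p ∈ O) (hN : N (chartAt (Euc 2) p p) = toChart (f p) (f p) e₃)
    (hP : P (chartAt (Euc 2) p p) = toChart (f p) (f p) e₄) :
    g.inner (f p) (normalCurvature g f p e₁ e₂ e₄) e₃ =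
      - (fderiv ℝ ((localMetric g (f p)).connForm (loc p (f p) f) N P (toChart p p e₂))
            (chartAt (Euc 2) p p) (toChart p p e₁)
        - fderiv ℝ ((localMetric g (f p)).connForm (loc p (f p) f) N P (toChart p p e₁))
            (chartAt (Euc 2) p p) (toChart p p e₂)) := by
  have hp := mem_chart_source (Euc 2) p
  have hm := mem_chart_source (Euc 4) (f p)
  set L := localMetric g (f p) with hL
  set φ := loc p (f p) f with hφ
  set x := chartAt (Euc 2) p p with hxdef
  set c₄ := toChart (f p) (f p) e₄ with hc₄
  set Z : ∀ q : S, Tan 4 (f q) := fun q => normalPart g f q (extendVec (f p) e₄ (f q)) with hZ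
  -- The extension of e₄ used by `normalCurvature` is the normal part of the field with constant
  -- components c₄; its components in the frame are u and v.
  obtain ⟨u, hu⟩ : ∃ u : Euc 2 → ℝ, u = fun z => L.G (φ z) c₄ (N z) := ⟨_, rfl⟩
  obtain ⟨v, hv⟩ : ∃ v : Euc 2 → ℝ, v = fun z => L.G (φ z) c₄ (P z) := ⟨_, rfl⟩
  have F := h.framePair
  have hus : ContDiffOn ℝ ∞ u O := hu ▸
    LocalMetric.contDiffOn_inner F.mapsTo F.smooth contDiffOn_const F.smooth_fst
  have hvs : ContDiffOn ℝ ∞ v O := hv ▸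
    LocalMetric.contDiffOn_inner F.mapsTo F.smooth contDiffOn_const F.smooth_snd
  have hWs : ContDiffOn ℝ ∞ (frameComb N P u v) O :=
    F.contDiffOn_comb hus hvs
  have hZW : ∀ z ∈ O, locField p (f p) f Z z = frameComb N P u v z := by
    intro z hz
    rw [frameComb]
    have := h.toChart_normalPart hz (extendVec (f p) e₄ (f ((chartAt (Euc 2) p).symm z)))
    rwa [extendVec, toChart_ofChart (h.subset hz).2, ← congrFun hu z, ← congrFun hv z] at this
  have hVs (c : Euc 2) := F.contDiffOn_proj
    (LocalMetric.contDiffOn_cov F.isOpen F.mapsTo F.smooth hWs c)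
  have hVW (c : Euc 2) : locField p (f p) f (fun r => normalCov g f Z r (ofChart p r c)) =ᶠ[𝓝 x]
      frameProj L φ N P (L.cov φ (frameComb N P u v) c) :=
    Filter.eventuallyEq_of_mem (F.isOpen.mem_nhds hx) fun z hz =>
      h.locField_normalCov hf hWs hZW hz c
  have hd {W : ∀ q : S, Tan 4 (f q)} {Y : Euc 2 → Euc 4} (hY : ContDiffOn ℝ ∞ Y O)
      (hWY : locField p (f p) f W =ᶠ[𝓝 x] Y) : DifferentiableAt ℝ (locField p (f p) f W) x :=
    (h.differentiableAt hY hx).congr_of_eventuallyEq hWY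
  have key (c : Euc 2) (X : Tan 2 p) : g.inner (f p)
      (normalCov g f (fun r => normalCov g f Z r (ofChart p r c)) p X) e₃ =
        L.G (φ x) (L.cov φ (frameProj L φ N P (L.cov φ (frameComb N P u v) c)) (toChart p p X) x) (N x) := by
    have h1 := toChart_covAlong g hf hp hm (hd (hVs c) (hVW c)) (toChart p p X)
    rw [ofChart_toChart hp, LocalMetric.cov_congr (hVW c)] at h1
    rw [normalCov, ha.inner_normalPart_fst, inner_eq_chartG g hm, h1, hN, hφ, loc_chart _ _ hp]
  have hzero : covAlong g f Z p 0 = 0 := by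
    have := covAlong_comb (g := g) hf (V := Z) (p := p) (hd hWs
      (Filter.eventuallyEq_of_mem (F.isOpen.mem_nhds hx) hZW)) 0 0 0 0
    simpa using this
  -- At p the extended field is e₄, which is P at x. The factor −v in `curvature_proj` is therefore
  -- −1.
  have hv1 : v x = 1 := by
    rw [hv]
    simp only []
    rw [← hP]
    exact F.snd_snd x hx
  have hc := F.curvature_proj hus hvs hx (toChart p p e₁) (toChart p p e₂)
  rw [hv1, neg_one_mul] at hc
  have hzero' : normalCov g f Z p 0 = 0 := by
    rw [normalCov, hzero, normalPart_eq g (w := 0) (fun X => by simp) ⟨0, by simp⟩]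
  have hR : normalCurvature g f p e₁ e₂ e₄ =
      normalCov g f (fun r => normalCov g f Z r (ofChart p r (toChart p p e₂))) p
        (extendVec p e₁ p) -
      normalCov g f (fun r => normalCov g f Z r (ofChart p r (toChart p p e₁))) p
        (extendVec p e₂ p) -
      normalCov g f Z p (VectorField.mlieBracket (𝓡 2) (extendVec p e₁) (extendVec p e₂) p) := rfl
  have hself (X : Tan 2 p) : extendVec p X p = X := ofChart_toChart hp X
  rw [← hc, ← key, ← key, hR, mlieBracket_extendVec, hzero', sub_zero, hself, hself, map_sub,
    _root_.sub_apply]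

end IsLocalFrame

/-- At a point of a minimal immersion the trace of the second derivatives is tangential. -/
lemma IsMinimalImmersion.cov_add_cov (hf : IsMinimalImmersion g f)
    (h : IsAdaptedFrame oS oM g f p e₁ e₂ e₃ e₄) {L : LocalMetric (Euc 4)} {φ : Euc 2 → Euc 4}
    {x a b : Euc 2} {H : Euc 4} (hL : L = localMetric g (f p)) (hφ : φ = loc p (f p) f)
    (hx : x = chartAt (Euc 2) p p) (ha : a = toChart p p e₁) (hb : b = toChart p p e₂)
    (hH : H = L.cov φ (fun z => fderiv ℝ φ z a) a x + L.cov φ (fun z => fderiv ℝ φ z b) b x) :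
    H = L.G (φ x) H (fderiv ℝ φ x a) • fderiv ℝ φ x a +
      L.G (φ x) H (fderiv ℝ φ x b) • fderiv ℝ φ x b := by
  have hp := mem_chart_source (Euc 2) p
  have hm := mem_chart_source (Euc 4) (f p)
  have hO := isOpen_locDom p (f p) hf.smooth.continuous
  have hxO : x ∈ locDom p (f p) f := hx ▸ chart_mem_locDom hp hm
  have hφs : ContDiffOn ℝ ∞ φ (locDom p (f p) f) := hφ ▸ contDiffOn_loc p (f p) hf.smooth
  have hdf (r : S) (hr : r ∈ (chartAt (Euc 2) p).source)
      (hfr : f r ∈ (chartAt (Euc 4) (f p)).source) (v : Euc 2) :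
      toChart (f p) (f r) (mfderiv (𝓡 2) (𝓡 4) f r (ofChart p r v)) =
        fderiv ℝ φ (chartAt (Euc 2) p r) v := by
    rw [hφ]
    exact toChart_mfderiv_ofChart ((hf.smooth r).mdifferentiableAt (by simp)) hr hfr v
  have key (X : Tan 2 p) : toChart (f p) (f p) (covAlong g f
      (fun q => mfderiv (𝓡 2) (𝓡 4) f q (extendVec p X q)) p X) =
      L.cov φ (fun z => fderiv ℝ φ z (toChart p p X)) (toChart p p X) x := by
    have he : locField p (f p) f (fun q => mfderiv (𝓡 2) (𝓡 4) f q (extendVec p X q)) =ᶠ[𝓝 x]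
        fun z => fderiv ℝ φ z (toChart p p X) := by
      filter_upwards [hO.mem_nhds hxO] with z hz
      rw [locField, extendVec, hdf _ ((chartAt (Euc 2) p).map_target hz.1) hz.2,
        (chartAt (Euc 2) p).right_inv hz.1]
    have hd := ((LocalMetric.contDiffOn_fderiv_apply hO hφs (toChart p p X)).contDiffAt
      (hO.mem_nhds hxO)).differentiableAt (by simp)
    have := toChart_covAlong g hf.smooth hp hm (hx ▸ hd.congr_of_eventuallyEq he) (toChart p p X)
    rw [ofChart_toChart hp, ← hx, ← hφ, ← hL, LocalMetric.cov_congr he] at this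
    exact this
  have hmin := hf.minimal p e₁ e₂ h.1.1 h.1.2.1 h.1.2.2.1
  rw [secondForm, secondForm] at hmin
  set B₁ := covAlong g f (fun q => mfderiv (𝓡 2) (𝓡 4) f q (extendVec p e₁ q)) p e₁
  set B₂ := covAlong g f (fun q => mfderiv (𝓡 2) (𝓡 4) f q (extendVec p e₂ q)) p e₂
  have h3 : g.inner (f p) (B₁ + B₂) e₃ = 0 := by
    rw [map_add, _root_.add_apply, ← h.inner_normalPart_fst B₁, ← h.inner_normalPart_fst B₂,
      ← _root_.add_apply, ← map_add, hmin]
    simp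
  have h4 : g.inner (f p) (B₁ + B₂) e₄ = 0 := by
    rw [map_add, _root_.add_apply, ← h.inner_normalPart_snd B₁, ← h.inner_normalPart_snd B₂,
      ← _root_.add_apply, ← map_add, hmin]
    simp
  have hB := h.eq_comb (B₁ + B₂)
  rw [h3, h4, zero_smul, zero_smul, add_zero, add_zero] at hB
  have hHB : toChart (f p) (f p) (B₁ + B₂) = H := by
    rw [toChart_add hm, key, key, hH, ha, hb]
  have hda : toChart (f p) (f p) (mfderiv (𝓡 2) (𝓡 4) f p e₁) = fderiv ℝ φ x a := by
    have := hdf p hp hm a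
    rwa [ha, ofChart_toChart hp, ← hx, ← ha] at this
  have hdb : toChart (f p) (f p) (mfderiv (𝓡 2) (𝓡 4) f p e₂) = fderiv ℝ φ x b := by
    have := hdf p hp hm b
    rwa [hb, ofChart_toChart hp, ← hx, ← hb] at this
  have := congrArg (toChart (f p) (f p)) hB
  rw [hHB, toChart_add hm, toChart_smul hm, toChart_smul hm, inner_eq_chartG g hm,
    inner_eq_chartG g hm, hHB, hda, hdb] at this
  rw [hL, hφ, hx, loc_chart _ _ hp, ← hφ, ← hx]
  exact this

end Along

namespace LocalMetric

variable {E : Type*} [NormedAddCommGroup E] [NormedSpace ℝ E] (L : LocalMetric E)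

/-- The sum of the curvature terms over an orthonormal pair is invariant under rotations. -/
lemma curv_rotation (y u v a b : E) {c s : ℝ} (h : c ^ 2 + s ^ 2 = 1) :
    L.G y (L.curv y u (c • a + s • b) (c • a + s • b)) v +
      L.G y (L.curv y u (c • b - s • a) (c • b - s • a)) v =
      L.G y (L.curv y u a a) v + L.G y (L.curv y u b b) v := by
  simp only [curv, map_add, map_sub, map_smul, _root_.add_apply, _root_.sub_apply,
    _root_.smul_apply, smul_eq_mul]
  generalize L.G y ((fderiv ℝ L.Γ y u) a a) v = x1
  generalize L.G y ((fderiv ℝ L.Γ y u) a b) v = x2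
  generalize L.G y ((fderiv ℝ L.Γ y u) b a) v = x3
  generalize L.G y ((fderiv ℝ L.Γ y u) b b) v = x4
  generalize L.G y ((fderiv ℝ L.Γ y a) u a) v = x5
  generalize L.G y ((fderiv ℝ L.Γ y a) u b) v = x6
  generalize L.G y ((fderiv ℝ L.Γ y b) u a) v = x7
  generalize L.G y ((fderiv ℝ L.Γ y b) u b) v = x8
  generalize L.G y (L.Γ y u (L.Γ y a a)) v = x9
  generalize L.G y (L.Γ y u (L.Γ y a b)) v = x10
  generalize L.G y (L.Γ y u (L.Γ y b a)) v = x11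
  generalize L.G y (L.Γ y u (L.Γ y b b)) v = x12
  generalize L.G y (L.Γ y a (L.Γ y u a)) v = x13
  generalize L.G y (L.Γ y a (L.Γ y u b)) v = x14
  generalize L.G y (L.Γ y b (L.Γ y u a)) v = x15
  generalize L.G y (L.Γ y b (L.Γ y u b)) v = x16
  linear_combination (x1 - x5 + x9 - x13 + x4 - x8 + x12 - x16) * h

end LocalMetric

/-! ### The integrand in an adapted frame. -/

section Along

variable {S M : Type*} [TopologicalSpace S] [ChartedSpace (Euc 2) S] [IsManifold (𝓡 2) ∞ S]
  [TopologicalSpace M] [ChartedSpace (Euc 4) M] [IsManifold (𝓡 4) ∞ M]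
  {g : SmoothMetric 4 M} {f : S → M} {oS : ManifoldOrientation 2 S} {oM : ManifoldOrientation 4 M}
  {p : S} {e₁ e₂ : Tan 2 p} {e₃ e₄ : Tan 4 (f p)} {σ : ∀ p : S, Tan 4 (f p)}

/-- The integrand of the second variation formula. -/
noncomputable def integrand (oS : ManifoldOrientation 2 S) (oM : ManifoldOrientation 4 M)
    (g : SmoothMetric 4 M) (f : S → M) (σ : ∀ p : S, Tan 4 (f p)) (p : S) (e : Tan 2 p) : ℝ :=
  2 * dbarSq oS oM g f σ p e
    + (normalK oS oM g f p
        - sectional g (f p) (σ p) (mfderiv (𝓡 2) (𝓡 4) f p e)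
        - sectional g (f p) (σ p) (mfderiv (𝓡 2) (𝓡 4) f p (tangentI oS g f p e)))
      * g.inner (f p) (σ p) (σ p)
    - shapeSq oS g f σ p e

lemma IsAdaptedFrame.isNormal_normalPart (h : IsAdaptedFrame oS oM g f p e₁ e₂ e₃ e₄)
    (v : Tan 4 (f p)) : IsNormal g f p (normalPart g f p v) := by
  intro X
  rw [h.normalPart_eq, map_add, _root_.add_apply, map_smul, map_smul, _root_.smul_apply,
    _root_.smul_apply, h.2.1 X, h.2.2.1 X]
  simp

lemma IsTangentFrame.exists_rotation (h : IsTangentFrame oS g f p e₁ e₂) {e : Tan 2 p}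
    (he : pullForm g f p e e = 1) : ∃ c s : ℝ, c ^ 2 + s ^ 2 = 1 ∧ e = c • e₁ + s • e₂ ∧
      tangentI oS g f p e = c • e₂ - s • e₁ := by
  refine ⟨_, _, ?_, h.eq_comb e, h.tangentI_eq e⟩
  have h21 : pullForm g f p e₂ e₁ = 0 := (pullForm_comm g _ _).trans h.2.2.1
  have e0 := h.eq_comb e
  generalize pullForm g f p e e₁ = c at *
  generalize pullForm g f p e e₂ = s at *
  rw [e0] at he
  simp only [pullForm_add_left, pullForm_smul_left, pullForm_add_right, pullForm_smul_right, h.1,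
    h.2.1, h.2.2.1, h21] at he
  linear_combination he

/-- D and D' stand for ∇σ and ∇(Jσ); the hypotheses on D' say that J is parallel for the normal
connection. A rotation of e multiplies the Cauchy–Riemann expression by a unit complex number, so
its norm can be evaluated at e₁. -/
lemma IsAdaptedFrame.two_mul_dbarSq (h : IsAdaptedFrame oS oM g f p e₁ e₂ e₃ e₄)
    {D D' : Tan 2 p → Tan 4 (f p)} (hD : ∀ X, covAlong g f σ p X = D X)
    (hD' : ∀ X, covAlong g f (fun q => normalJ oS oM g f q (σ q)) p X = D' X)
    (hl : ∀ (c d : ℝ) (X Y : Tan 2 p), D (c • X + d • Y) = c • D X + d • D Y)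
    (hJ₃ : ∀ X, g.inner (f p) (D' X) e₃ = - g.inner (f p) (D X) e₄)
    (hJ₄ : ∀ X, g.inner (f p) (D' X) e₄ = g.inner (f p) (D X) e₃) {e : Tan 2 p}
    (he : pullForm g f p e e = 1) :
    2 * dbarSq oS oM g f σ p e =
      (g.inner (f p) (D e₁) e₃ - g.inner (f p) (D e₂) e₄) ^ 2 +
      (g.inner (f p) (D e₁) e₄ + g.inner (f p) (D e₂) e₃) ^ 2 := by
  obtain ⟨c, s, hcs, he', hI⟩ := h.1.exists_rotation he
  have h1 : D e = c • D e₁ + s • D e₂ := by rw [he', hl]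
  have h2 : D (tangentI oS g f p e) = (-s) • D e₁ + c • D e₂ := by
    rw [hI, ← hl, neg_smul, neg_add_eq_sub]
  rw [dbarSq, h.inner_self, normalCov, normalCov, hD, hD']
  simp only [map_add, _root_.add_apply, h.isNormal_normalPart _ _, h.inner_normalPart_fst,
    h.inner_normalPart_snd, hJ₃, hJ₄, h1, h2, map_smul, _root_.smul_apply, smul_eq_mul]
  generalize g.inner (f p) (D e₁) e₃ = x1
  generalize g.inner (f p) (D e₁) e₄ = x2
  generalize g.inner (f p) (D e₂) e₃ = x3
  generalize g.inner (f p) (D e₂) e₄ = x4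
  linear_combination ((x1 - x4) ^ 2 + (x2 + x3) ^ 2) * hcs

/-- The sum is a Hilbert–Schmidt norm of the tangential part of ∇σ and hence the same for the
orthonormal pairs e, Ie and e₁, e₂. -/
lemma IsAdaptedFrame.shapeSq_eq (h : IsAdaptedFrame oS oM g f p e₁ e₂ e₃ e₄)
    {D : Tan 2 p → Tan 4 (f p)} (hD : ∀ X, covAlong g f σ p X = D X)
    (hl : ∀ (c d : ℝ) (X Y : Tan 2 p), D (c • X + d • Y) = c • D X + d • D Y) {e : Tan 2 p}
    (he : pullForm g f p e e = 1) :
    shapeSq oS g f σ p e =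
      g.inner (f p) (D e₁) (mfderiv (𝓡 2) (𝓡 4) f p e₁) ^ 2 +
      g.inner (f p) (D e₁) (mfderiv (𝓡 2) (𝓡 4) f p e₂) ^ 2 +
      g.inner (f p) (D e₂) (mfderiv (𝓡 2) (𝓡 4) f p e₁) ^ 2 +
      g.inner (f p) (D e₂) (mfderiv (𝓡 2) (𝓡 4) f p e₂) ^ 2 := by
  obtain ⟨c, s, hcs, he', hI⟩ := h.1.exists_rotation he
  have h1 : D e = c • D e₁ + s • D e₂ := by rw [he', hl]
  have h2 : D (tangentI oS g f p e) = (-s) • D e₁ + c • D e₂ := by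
    rw [hI, ← hl, neg_smul, neg_add_eq_sub]
  rw [shapeSq, h.inner_self, h.inner_self (shapeOperator g f σ p (tangentI oS g f p e))]
  simp only [shapeOperator, normalCov, hD, map_neg, map_sub, _root_.neg_apply, _root_.sub_apply,
    h.isNormal_normalPart _ _, h.inner_normalPart_fst, h.inner_normalPart_snd]
  simp only [h1, h2, map_add, map_smul, _root_.add_apply, _root_.smul_apply, smul_eq_mul]
  generalize g.inner (f p) (D e₁) (mfderiv (𝓡 2) (𝓡 4) f p e₁) = x1
  generalize g.inner (f p) (D e₁) (mfderiv (𝓡 2) (𝓡 4) f p e₂) = x2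
  generalize g.inner (f p) (D e₂) (mfderiv (𝓡 2) (𝓡 4) f p e₁) = x3
  generalize g.inner (f p) (D e₂) (mfderiv (𝓡 2) (𝓡 4) f p e₂) = x4
  linear_combination (x1 ^ 2 + x2 ^ 2 + x3 ^ 2 + x4 ^ 2) * hcs

/-- For orthogonal u and unit v the denominator of the sectional curvature is |u|², which cancels.
At u = 0 both sides vanish, in accordance with the convention of the theorem. -/
lemma sectional_mul {x : M} {u v : Tan 4 x} (hv : g.inner x v v = 1) (huv : g.inner x u v = 0) :
    sectional g x u v * g.inner x u u = g.inner x (curvature g x u v v) u := by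
  rw [sectional, hv, huv]
  by_cases hu : u = 0
  · simp [hu]
  · rw [mul_one, zero_pow two_ne_zero, sub_zero, div_mul_cancel₀ _ (g.pos x u hu).ne']

/-- The sum is the trace over the tangent plane of the quadratic form X ↦ ⟨R(σ, X)X, σ⟩, so the unit
vector e may be replaced by the frame. -/
lemma IsAdaptedFrame.sectional_add (h : IsAdaptedFrame oS oM g f p e₁ e₂ e₃ e₄)
    (hn : IsNormal g f p (σ p)) {e : Tan 2 p} (he : pullForm g f p e e = 1) :
    (sectional g (f p) (σ p) (mfderiv (𝓡 2) (𝓡 4) f p e) +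
      sectional g (f p) (σ p) (mfderiv (𝓡 2) (𝓡 4) f p (tangentI oS g f p e))) *
        g.inner (f p) (σ p) (σ p) =
    g.inner (f p) (curvature g (f p) (σ p) (mfderiv (𝓡 2) (𝓡 4) f p e₁)
      (mfderiv (𝓡 2) (𝓡 4) f p e₁)) (σ p) +
    g.inner (f p) (curvature g (f p) (σ p) (mfderiv (𝓡 2) (𝓡 4) f p e₂)
      (mfderiv (𝓡 2) (𝓡 4) f p e₂)) (σ p) := by
  have hm := mem_chart_source (Euc 4) (f p)
  obtain ⟨c, s, hcs, he', hI⟩ := h.1.exists_rotation he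
  have h21 : pullForm g f p e₂ e₁ = 0 := (pullForm_comm g _ _).trans h.1.2.2.1
  have hI1 : pullForm g f p (tangentI oS g f p e) (tangentI oS g f p e) = 1 := by
    rw [hI, sub_eq_add_neg, ← neg_smul]
    simp only [pullForm_add_left, pullForm_smul_left, pullForm_add_right, pullForm_smul_right,
      h.1.1, h.1.2.1, h.1.2.2.1, h21]
    linear_combination hcs
  rw [add_mul, sectional_mul he (hn _), sectional_mul hI1 (hn _), inner_eq_chartG g hm,
    inner_eq_chartG g hm, inner_eq_chartG g hm, inner_eq_chartG g hm]
  simp only [toChart_curvature]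
  rw [hI, he', map_add, map_sub, map_smul, map_smul, map_smul, map_smul, toChart_add hm,
    toChart_sub hm, toChart_smul hm, toChart_smul hm, toChart_smul hm, toChart_smul hm]
  rw [LocalMetric.curv_rotation _ _ _ _ _ _ hcs]

end Along

namespace LocalMetric.IsFramePair

variable {E Y : Type*} [NormedAddCommGroup E] [NormedSpace ℝ E]
  [NormedAddCommGroup Y] [NormedSpace ℝ Y] {L : LocalMetric E} {φ N P : Y → E} {O : Set Y}

/-- The connection commutes with the rotation of the plane spanned by the frame. -/
lemma inner_cov_comb_rotate (h : L.IsFramePair φ N P O) {u v : Y → ℝ} (hu : ContDiffOn ℝ ∞ u O)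
    (hv : ContDiffOn ℝ ∞ v O) {x : Y} (hx : x ∈ O) (b : Y) :
    L.G (φ x) (L.cov φ (frameComb N P (fun z => - v z) u) b x) (N x) =
      - L.G (φ x) (L.cov φ (frameComb N P u v) b x) (P x) ∧
    L.G (φ x) (L.cov φ (frameComb N P (fun z => - v z) u) b x) (P x) =
      L.G (φ x) (L.cov φ (frameComb N P u v) b x) (N x) := by
  have e1 := h.inner_cov_comb_fst hv.neg hu hx b
  have e2 := h.inner_cov_comb_snd hv.neg hu hx b
  have e3 := h.inner_cov_comb_fst hu hv hx b
  have e4 := h.inner_cov_comb_snd hu hv hx b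
  rw [fderiv_fun_neg, _root_.neg_apply] at e1
  refine ⟨e1.trans ?_, e2.trans ?_⟩
  · rw [show L.G (φ x) (L.cov φ (frameComb N P u v) b x) (P x) = _ from e4]; ring
  · rw [show L.G (φ x) (L.cov φ (frameComb N P u v) b x) (N x) = _ from e3]; ring

/-- The differential of `b ↦ ⟨∇_b s, Js⟩` for a section `s` of the plane bundle. -/
lemma fderiv_inner_cov_rotate (h : L.IsFramePair φ N P O) {u v : Y → ℝ} (hu : ContDiffOn ℝ ∞ u O)
    (hv : ContDiffOn ℝ ∞ v O) {x : Y} (hx : x ∈ O) (a b : Y) {α : Y → Y → ℝ}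
    (hα : ∀ c, ∀ z ∈ O, α c z =
      L.G (φ z) (L.cov φ (frameComb N P u v) c z) (frameComb N P (fun z => - v z) u z)) :
    (∀ c, ContDiffOn ℝ ∞ (α c) O) ∧
    fderiv ℝ (α b) x a - fderiv ℝ (α a) x b =
      2 * (L.G (φ x) (L.cov φ (frameComb N P u v) a x) (N x) *
          L.G (φ x) (L.cov φ (frameComb N P u v) b x) (P x)
        - L.G (φ x) (L.cov φ (frameComb N P u v) a x) (P x) *
          L.G (φ x) (L.cov φ (frameComb N P u v) b x) (N x))
      + (u x ^ 2 + v x ^ 2) *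
        (fderiv ℝ (L.connForm φ N P b) x a - fderiv ℝ (L.connForm φ N P a) x b) := by
  have h1 := h.sum_sq_cov hu hv hx a b hα
  refine ⟨h1.1, h1.2.trans ?_⟩
  rw [show L.G (φ x) (L.cov φ (frameComb N P u v) a x) (N x) = _ from h.inner_cov_comb_fst hu hv hx a,
    show L.G (φ x) (L.cov φ (frameComb N P u v) b x) (N x) = _ from h.inner_cov_comb_fst hu hv hx b,
    show L.G (φ x) (L.cov φ (frameComb N P u v) a x) (P x) = _ from h.inner_cov_comb_snd hu hv hx a,
    show L.G (φ x) (L.cov φ (frameComb N P u v) b x) (P x) = _ from h.inner_cov_comb_snd hu hv hx b]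

lemma eq_comb_neg {Z : Type*} (N P : Z → E) (u v : Z → ℝ) (z : Z) {w : E} (h : w = u z • P z - v z • N z) :
    w = frameComb N P (fun z => - v z) u z := by
  rw [h, frameComb]
  module

end LocalMetric.IsFramePair

section Along

variable {S M : Type*} [TopologicalSpace S] [ChartedSpace (Euc 2) S] [IsManifold (𝓡 2) ∞ S]
  [TopologicalSpace M] [ChartedSpace (Euc 4) M] [IsManifold (𝓡 4) ∞ M]
  {g : SmoothMetric 4 M} {f : S → M} {oS : ManifoldOrientation 2 S} {oM : ManifoldOrientation 4 M}
  {σ : ∀ p : S, Tan 4 (f p)}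

/-- The integrand of the second variation formula in terms of the covariant derivative of `σ` in
a suitable adapted frame. -/
lemma exists_integrand_eq (hf : ContMDiff (𝓡 2) (𝓡 4) ∞ f)
    (hinj : ∀ p, Function.Injective (mfderiv (𝓡 2) (𝓡 4) f p)) (hσ : SmoothAlong f σ)
    (hn : ∀ p, IsNormal g f p (σ p)) (p : S) :
    ∃ e₁ e₂ e₃ e₄, IsAdaptedFrame oS oM g f p e₁ e₂ e₃ e₄ ∧
    ∃ O : Set (Euc 2), IsOpen O ∧ O ⊆ locDom p (f p) f ∧ chartAt (Euc 2) p p ∈ O ∧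
    (∀ z ∈ O, IsPositiveBasis (oS.orient ((chartAt (Euc 2) p).symm z))
        ![ofChart p _ (toChart p p e₁), ofChart p _ (toChart p p e₂)]) ∧
    ∀ α : Euc 2 → Euc 2 → ℝ, (∀ c z, α c z = g.inner _
      (covAlong g f σ ((chartAt (Euc 2) p).symm z) (ofChart p _ c))
      (normalJ oS oM g f _ (σ ((chartAt (Euc 2) p).symm z)))) →
    (∀ c, ContDiffOn ℝ ∞ (α c) O) ∧
    ∀ e, pullForm g f p e e = 1 → integrand oS oM g f σ p e =
      g.inner (f p) (covAlong g f σ p e₁) e₃ ^ 2 + g.inner (f p) (covAlong g f σ p e₁) e₄ ^ 2 +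
      g.inner (f p) (covAlong g f σ p e₂) e₃ ^ 2 + g.inner (f p) (covAlong g f σ p e₂) e₄ ^ 2 -
      (g.inner (f p) (covAlong g f σ p e₁) (mfderiv (𝓡 2) (𝓡 4) f p e₁) ^ 2 +
        g.inner (f p) (covAlong g f σ p e₁) (mfderiv (𝓡 2) (𝓡 4) f p e₂) ^ 2 +
        g.inner (f p) (covAlong g f σ p e₂) (mfderiv (𝓡 2) (𝓡 4) f p e₁) ^ 2 +
        g.inner (f p) (covAlong g f σ p e₂) (mfderiv (𝓡 2) (𝓡 4) f p e₂) ^ 2) -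
      (g.inner (f p) (curvature g (f p) (σ p) (mfderiv (𝓡 2) (𝓡 4) f p e₁)
        (mfderiv (𝓡 2) (𝓡 4) f p e₁)) (σ p) +
      g.inner (f p) (curvature g (f p) (σ p) (mfderiv (𝓡 2) (𝓡 4) f p e₂)
        (mfderiv (𝓡 2) (𝓡 4) f p e₂)) (σ p)) -
      (fderiv ℝ (α (toChart p p e₂)) (chartAt (Euc 2) p p) (toChart p p e₁) -
        fderiv ℝ (α (toChart p p e₁)) (chartAt (Euc 2) p p) (toChart p p e₂)) := by
  have hp := mem_chart_source (Euc 2) p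
  have hm := mem_chart_source (Euc 4) (f p)
  -- The frame is the one chosen in the definition of `normalK`, so that independence of K^⊥ from
  -- the frame is not needed.
  obtain ⟨e₁, e₂, e₃, e₄, h, hk⟩ : ∃ (e₁ e₂ : Tan 2 p) (e₃ e₄ : Tan 4 (f p)),
      IsAdaptedFrame oS oM g f p e₁ e₂ e₃ e₄ ∧
        normalK oS oM g f p = g.inner (f p) (normalCurvature g f p e₁ e₂ e₄) e₃ := by
    obtain ⟨e₁, e₂, e₃, e₄, h⟩ := exists_isAdaptedFrame (oS := oS) (oM := oM) (g := g) (hinj p)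
    exact Classical.epsilon_spec (p := fun k : ℝ => ∃ (e₁ e₂ : Tan 2 p) (e₃ e₄ : Tan 4 (f p)),
      IsAdaptedFrame oS oM g f p e₁ e₂ e₃ e₄ ∧
        k = g.inner (f p) (normalCurvature g f p e₁ e₂ e₄) e₃) ⟨_, e₁, e₂, e₃, e₄, h, rfl⟩
  obtain ⟨N, P, O, hl, hx, hN, hP, hpos⟩ := h.exists_isLocalFrame hf hinj
  have F := hl.framePair
  refine ⟨e₁, e₂, e₃, e₄, h, O, F.isOpen, hl.subset, hx, hpos, fun α hα => ?_⟩
  have hs : ContDiffOn ℝ ∞ (locField p (f p) f σ) O :=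
    (contDiffOn_locField p (f p) hσ).mono hl.subset
  obtain ⟨u, hu⟩ : ∃ u : Euc 2 → ℝ, ∀ z, u z =
      (localMetric g (f p)).G (loc p (f p) f z) (locField p (f p) f σ z) (N z) := ⟨_, fun _ => rfl⟩
  obtain ⟨v, hv⟩ : ∃ v : Euc 2 → ℝ, ∀ z, v z =
      (localMetric g (f p)).G (loc p (f p) f z) (locField p (f p) f σ z) (P z) := ⟨_, fun _ => rfl⟩
  have hus : ContDiffOn ℝ ∞ u O := (LocalMetric.contDiffOn_inner F.mapsTo F.smooth hs
    F.smooth_fst).congr fun z _ => hu z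
  have hvs : ContDiffOn ℝ ∞ v O := (LocalMetric.contDiffOn_inner F.mapsTo F.smooth hs
    F.smooth_snd).congr fun z _ => hv z
  have hσc : ∀ z ∈ O, locField p (f p) f σ z = frameComb N P u v z := by
    intro z hz
    have := hl.toChart_of_isNormal hz (hn _)
    rw [frameComb, hu, hv]
    exact this
  have hJc : ∀ z ∈ O, toChart (f p) _ (normalJ oS oM g f _ (σ ((chartAt (Euc 2) p).symm z))) =
      frameComb N P (fun z => - v z) u z := by
    intro z hz
    refine LocalMetric.IsFramePair.eq_comb_neg N P u v z ?_
    rw [hu, hv]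
    exact hl.toChart_normalJ hz _
  have hev {V : ∀ q : S, Tan 4 (f q)} {W : Euc 2 → Euc 4}
      (h : ∀ z ∈ O, locField p (f p) f V z = W z) {z : Euc 2} (hz : z ∈ O) :
      locField p (f p) f V =ᶠ[𝓝 z] W := Filter.eventuallyEq_of_mem (F.isOpen.mem_nhds hz) h
  have hJs : ∀ z ∈ O, locField p (f p) f (fun q => normalJ oS oM g f q (σ q)) z =
      frameComb N P (fun z => - v z) u z := hJc
  have hd {V : ∀ q : S, Tan 4 (f q)} {W : Euc 2 → Euc 4} (hW : ContDiffOn ℝ ∞ W O)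
      (h : ∀ z ∈ O, locField p (f p) f V z = W z) {z : Euc 2} (hz : z ∈ O) :
      DifferentiableAt ℝ (locField p (f p) f V) z :=
    (hl.differentiableAt hW hz).congr_of_eventuallyEq (hev h hz)
  have hcs := F.contDiffOn_comb hus hvs
  have hcJ := F.contDiffOn_comb hvs.neg hus
  have hD (X : Tan 2 p) : toChart (f p) (f p) (covAlong g f σ p X) =
      (localMetric g (f p)).cov (loc p (f p) f) (frameComb N P u v) (toChart p p X)
        (chartAt (Euc 2) p p) := by
    have := toChart_covAlong g hf hp hm (hd hcs hσc hx) (toChart p p X)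
    rwa [ofChart_toChart hp, LocalMetric.cov_congr (hev hσc hx)] at this
  have hD' (X : Tan 2 p) : toChart (f p) (f p)
      (covAlong g f (fun q => normalJ oS oM g f q (σ q)) p X) =
      (localMetric g (f p)).cov (loc p (f p) f) (frameComb N P (fun z => - v z) u) (toChart p p X)
        (chartAt (Euc 2) p p) := by
    have := toChart_covAlong g hf hp hm (hd hcJ hJs hx) (toChart p p X)
    rwa [ofChart_toChart hp, LocalMetric.cov_congr (hev hJs hx)] at this
  have hin (w n : Tan 4 (f p)) : g.inner (f p) w n = (localMetric g (f p)).G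
      (loc p (f p) f (chartAt (Euc 2) p p)) (toChart (f p) (f p) w) (toChart (f p) (f p) n) := by
    rw [inner_eq_chartG g hm, loc_chart _ _ hp]
  have hJ₃ (X : Tan 2 p) : g.inner (f p)
      (covAlong g f (fun q => normalJ oS oM g f q (σ q)) p X) e₃ =
        - g.inner (f p) (covAlong g f σ p X) e₄ := by
    rw [hin, hin, hD, hD', ← hN, ← hP, (F.inner_cov_comb_rotate hus hvs hx _).1]
  have hJ₄ (X : Tan 2 p) : g.inner (f p)
      (covAlong g f (fun q => normalJ oS oM g f q (σ q)) p X) e₄ =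
        g.inner (f p) (covAlong g f σ p X) e₃ := by
    rw [hin, hin, hD, hD', ← hN, ← hP, (F.inner_cov_comb_rotate hus hvs hx _).2]
  have hlin (c d : ℝ) (X Y : Tan 2 p) := covAlong_comb (g := g) hf (hd hcs hσc hx) c d X Y
  obtain ⟨hα1, hα2⟩ := F.fderiv_inner_cov_rotate hus hvs hx (toChart p p e₁) (toChart p p e₂)
    (α := α) (by
      intro c z hz
      have hzm := (hl.subset hz).2
      rw [hα, inner_eq_chartG g hzm, hJc z hz, toChart_covAlong_symm hf (hl.subset hz)
        (hd hcs hσc hz), LocalMetric.cov_congr (hev hσc hz)]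
      rfl)
  refine ⟨hα1, fun e he => ?_⟩
  have hsq : g.inner (f p) (σ p) (σ p) =
      u (chartAt (Euc 2) p p) ^ 2 + v (chartAt (Euc 2) p p) ^ 2 := by
    rw [h.inner_self, hn p, hn p, hin _ e₃, hin _ e₄, ← hN, ← hP, hu, hv,
      locField_chart _ _ _ hp]
    ring
  have hsec := h.sectional_add (hn p) he
  rw [hα2, integrand, h.two_mul_dbarSq (D := fun X => covAlong g f σ p X) (fun _ => rfl)
    (fun _ => rfl) hlin hJ₃ hJ₄ he, h.shapeSq_eq (D := fun X => covAlong g f σ p X)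
    (fun _ => rfl) hlin he, hk, hl.inner_normalCurvature hf h hx hN hP, ← hD, ← hD, hN, hP, ← hin,
    ← hin, ← hin, ← hin, ← hsq]
  -- The products mixing ∇_{e₁}σ and ∇_{e₂}σ in 2‖∂̄^⊥σ‖², together with K^⊥|σ|² = −|σ|²dθ(e₁, e₂),
  -- add up to −dα(e₁, e₂). The sectional curvatures are what remains.
  linear_combination -hsec

end Along

lemma LocalMetric.cov_congr' {E X : Type*} [NormedAddCommGroup E] [NormedSpace ℝ E]
    [NormedAddCommGroup X] [NormedSpace ℝ X] {L : LocalMetric E} {Φ Φ' V V' : X → E} {x : X}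
    (hΦ : Φ =ᶠ[𝓝 x] Φ') (hV : V =ᶠ[𝓝 x] V') (a : X) : L.cov Φ V a x = L.cov Φ' V' a x := by
  rw [cov, cov, hV.fderiv_eq, hV.eq_of_nhds, hΦ.fderiv_eq, hΦ.eq_of_nhds]

section Variation

variable {S M : Type*} [TopologicalSpace S] [ChartedSpace (Euc 2) S]
  [TopologicalSpace M] [ChartedSpace (Euc 4) M]

/-! ### Variations in coordinates -/

/-- The coordinate expression of a family of maps. -/
noncomputable def locVar (q : S) (m : M) (F : ℝ → S → M) (z : ℝ × Euc 2) : Euc 4 :=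
  loc q m (F z.1) z.2

/-- The set where the coordinate expression of a family of maps is meaningful. -/
def varDom (ε : ℝ) (q : S) (m : M) (F : ℝ → S → M) : Set (ℝ × Euc 2) :=
  {z | z ∈ Ioo (-ε) ε ×ˢ (chartAt (Euc 2) q).target ∧
    F z.1 ((chartAt (Euc 2) q).symm z.2) ∈ (chartAt (Euc 4) m).source}

variable [IsManifold (𝓡 2) ∞ S] [IsManifold (𝓡 4) ∞ M] {ε : ℝ} {F : ℝ → S → M}

lemma contMDiffOn_varSymm (ε : ℝ) (q : S)
    (hF : ContMDiffOn (𝓘(ℝ, ℝ).prod (𝓡 2)) (𝓡 4) ∞ (fun z : ℝ × S => F z.1 z.2)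
      (Ioo (-ε) ε ×ˢ (univ : Set S))) :
    ContMDiffOn 𝓘(ℝ, ℝ × Euc 2) (𝓡 4) ∞
      (fun z : ℝ × Euc 2 => F z.1 ((chartAt (Euc 2) q).symm z.2))
      (Ioo (-ε) ε ×ˢ (chartAt (Euc 2) q).target) := by
  have h1 : ContMDiffOn (𝓡 2) (𝓡 2) ∞ (chartAt (Euc 2) q).symm (chartAt (Euc 2) q).target :=
    contMDiffOn_chart_symm
  have h2 : ContMDiffOn 𝓘(ℝ, ℝ × Euc 2) (𝓡 2) ∞
      (fun z : ℝ × Euc 2 => (chartAt (Euc 2) q).symm z.2)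
      (Ioo (-ε) ε ×ˢ (chartAt (Euc 2) q).target) :=
    h1.comp (contDiff_snd.contMDiff.contMDiffOn) fun z hz => hz.2
  have h3 : ContMDiffOn 𝓘(ℝ, ℝ × Euc 2) 𝓘(ℝ, ℝ) ∞ (fun z : ℝ × Euc 2 => z.1)
      (Ioo (-ε) ε ×ˢ (chartAt (Euc 2) q).target) := contDiff_fst.contMDiff.contMDiffOn
  exact hF.comp (h3.prodMk h2) fun z hz => ⟨hz.1, mem_univ _⟩

lemma isOpen_varDom (q : S) (m : M)
    (hF : ContMDiffOn (𝓘(ℝ, ℝ).prod (𝓡 2)) (𝓡 4) ∞ (fun z : ℝ × S => F z.1 z.2)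
      (Ioo (-ε) ε ×ˢ (univ : Set S))) : IsOpen (varDom ε q m F) :=
  (contMDiffOn_varSymm ε q hF).continuousOn.isOpen_inter_preimage
    (isOpen_Ioo.prod (chartAt (Euc 2) q).open_target) (chartAt (Euc 4) m).open_source

lemma contDiffOn_locVar (q : S) (m : M)
    (hF : ContMDiffOn (𝓘(ℝ, ℝ).prod (𝓡 2)) (𝓡 4) ∞ (fun z : ℝ × S => F z.1 z.2)
      (Ioo (-ε) ε ×ˢ (univ : Set S))) : ContDiffOn ℝ ∞ (locVar q m F) (varDom ε q m F) := by
  rw [← contMDiffOn_iff_contDiffOn]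
  have h2 : ContMDiffOn (𝓡 4) (𝓡 4) ∞ (chartAt (Euc 4) m) (chartAt (Euc 4) m).source :=
    contMDiffOn_chart
  exact h2.comp ((contMDiffOn_varSymm ε q hF).mono fun z hz => hz.1) fun z hz => hz.2

lemma contMDiff_of_variation
    (hF : ContMDiffOn (𝓘(ℝ, ℝ).prod (𝓡 2)) (𝓡 4) ∞ (fun z : ℝ × S => F z.1 z.2)
      (Ioo (-ε) ε ×ˢ (univ : Set S))) {t : ℝ} (ht : t ∈ Ioo (-ε) ε) :
    ContMDiff (𝓡 2) (𝓡 4) ∞ (F t) := by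
  rw [← contMDiffOn_univ]
  exact hF.comp ((contMDiff_const (c := t)).prodMk contMDiff_id).contMDiffOn
    fun r _ => ⟨ht, mem_univ _⟩

lemma mem_varDom {t : ℝ} (ht : t ∈ Ioo (-ε) ε) {q r : S} {m : M}
    (hr : r ∈ (chartAt (Euc 2) q).source) (hm : F t r ∈ (chartAt (Euc 4) m).source) :
    (t, chartAt (Euc 2) q r) ∈ varDom ε q m F := by
  refine ⟨⟨ht, (chartAt (Euc 2) q).map_source hr⟩, ?_⟩
  simp only [(chartAt (Euc 2) q).left_inv hr, hm]

lemma fderiv_locVar_snd {q : S} {m : M}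
    (hF : ContMDiffOn (𝓘(ℝ, ℝ).prod (𝓡 2)) (𝓡 4) ∞ (fun z : ℝ × S => F z.1 z.2)
      (Ioo (-ε) ε ×ˢ (univ : Set S))) {z : ℝ × Euc 2} (hz : z ∈ varDom ε q m F) (a : Euc 2) :
    fderiv ℝ (loc q m (F z.1)) z.2 a = fderiv ℝ (locVar q m F) z (0, a) := by
  have h1 : HasFDerivAt (locVar q m F) (fderiv ℝ (locVar q m F) z) (z.1, z.2) :=
    (((contDiffOn_locVar q m hF).contDiffAt ((isOpen_varDom q m hF).mem_nhds
      hz)).differentiableAt (by simp)).hasFDerivAt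
  have h2 : HasFDerivAt (fun y : Euc 2 => (z.1, y)) (ContinuousLinearMap.inr ℝ ℝ (Euc 2)) z.2 :=
    hasFDerivAt_prodMk_right z.1 z.2
  have h3 := HasFDerivAt.comp (g := locVar q m F) z.2 h1 h2
  exact DFunLike.congr_fun (h3.fderiv) a

lemma hasFDerivAt_locVar_fst {q : S} {m : M}
    (hF : ContMDiffOn (𝓘(ℝ, ℝ).prod (𝓡 2)) (𝓡 4) ∞ (fun z : ℝ × S => F z.1 z.2)
      (Ioo (-ε) ε ×ˢ (univ : Set S))) {t : ℝ} {r : S} (hr : r ∈ (chartAt (Euc 2) q).source)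
    (hz : (t, chartAt (Euc 2) q r) ∈ varDom ε q m F) :
    fderiv ℝ (fun t => chartAt (Euc 4) m (F t r)) t 1 =
      fderiv ℝ (locVar q m F) (t, chartAt (Euc 2) q r) (1, 0) := by
  have h1 : HasFDerivAt (locVar q m F) (fderiv ℝ (locVar q m F) (t, chartAt (Euc 2) q r))
      (t, chartAt (Euc 2) q r) :=
    (((contDiffOn_locVar q m hF).contDiffAt ((isOpen_varDom q m hF).mem_nhds
      hz)).differentiableAt (by simp)).hasFDerivAt
  have h2 : HasFDerivAt (fun t : ℝ => (t, chartAt (Euc 2) q r))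
      (ContinuousLinearMap.inl ℝ ℝ (Euc 2)) t := hasFDerivAt_prodMk_left t _
  have h3 := HasFDerivAt.comp (g := locVar q m F) t h1 h2
  have e : (fun t => chartAt (Euc 4) m (F t r)) =
      locVar q m F ∘ fun t : ℝ => (t, chartAt (Euc 2) q r) := by
    funext t
    simp only [locVar, Function.comp_apply, loc_chart _ _ hr]
  rw [e, h3.fderiv]
  simp

variable (g : SmoothMetric 4 M)

lemma mapsTo_locVar (ε : ℝ) (q : S) (m : M) (F : ℝ → S → M) :
    MapsTo (locVar q m F) (varDom ε q m F) (localMetric g m).dom := fun _ hz =>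
  (chartAt (Euc 4) m).map_source hz.2

lemma toChart_mfderiv_variation {q r : S} {m : M} {t : ℝ} (ht : t ∈ Ioo (-ε) ε)
    (hF : ContMDiffOn (𝓘(ℝ, ℝ).prod (𝓡 2)) (𝓡 4) ∞ (fun z : ℝ × S => F z.1 z.2)
      (Ioo (-ε) ε ×ˢ (univ : Set S))) (hr : r ∈ (chartAt (Euc 2) q).source)
    (hm : F t r ∈ (chartAt (Euc 4) m).source) (a : Euc 2) :
    toChart m (F t r) (mfderiv (𝓡 2) (𝓡 4) (F t) r (ofChart q r a)) =
      fderiv ℝ (locVar q m F) (t, chartAt (Euc 2) q r) (0, a) := by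
  rw [toChart_mfderiv_ofChart ((contMDiff_of_variation hF ht r).mdifferentiableAt (by simp)) hr hm,
    ← fderiv_locVar_snd hF (mem_varDom ht hr hm)]

lemma pullForm_variation {q r : S} {m : M} {t : ℝ} (ht : t ∈ Ioo (-ε) ε)
    (hF : ContMDiffOn (𝓘(ℝ, ℝ).prod (𝓡 2)) (𝓡 4) ∞ (fun z : ℝ × S => F z.1 z.2)
      (Ioo (-ε) ε ×ˢ (univ : Set S))) (hr : r ∈ (chartAt (Euc 2) q).source)
    (hm : F t r ∈ (chartAt (Euc 4) m).source) (a b : Euc 2) :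
    pullForm g (F t) r (ofChart q r a) (ofChart q r b) =
      (localMetric g m).gram (locVar q m F) (0, a) (0, b) (t, chartAt (Euc 2) q r) := by
  rw [pullForm, inner_eq_chartG g hm, toChart_mfderiv_variation ht hF hr hm,
    toChart_mfderiv_variation ht hF hr hm, LocalMetric.gram, locVar, loc_chart _ _ hr]

lemma toChart_velocity {q r : S} {m : M} (hε : 0 < ε)
    (hF : ContMDiffOn (𝓘(ℝ, ℝ).prod (𝓡 2)) (𝓡 4) ∞ (fun z : ℝ × S => F z.1 z.2)
      (Ioo (-ε) ε ×ˢ (univ : Set S))) (hr : r ∈ (chartAt (Euc 2) q).source)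
    (hm : F 0 r ∈ (chartAt (Euc 4) m).source) :
    toChart m (F 0 r) (mfderiv 𝓘(ℝ, ℝ) (𝓡 4) (fun t : ℝ => F t r) 0 (1 : ℝ)) =
      fderiv ℝ (locVar q m F) (0, chartAt (Euc 2) q r) (1, 0) := by
  have h0 : (0 : ℝ) ∈ Ioo (-ε) ε := ⟨neg_neg_of_pos hε, hε⟩
  have h1 : ContMDiffOn 𝓘(ℝ, ℝ) (𝓡 4) ∞ (fun t : ℝ => F t r) (Ioo (-ε) ε) :=
    hF.comp (contMDiff_id.prodMk (contMDiff_const (c := r))).contMDiffOn fun t ht => ⟨ht, mem_univ _⟩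
  have h2 : MDifferentiableAt 𝓘(ℝ, ℝ) (𝓡 4) (fun t : ℝ => F t r) 0 :=
    (h1.contMDiffAt (isOpen_Ioo.mem_nhds h0)).mdifferentiableAt (by simp)
  rw [← hasFDerivAt_locVar_fst hF hr (mem_varDom h0 hr hm)]
  refine (toChart_mfderiv h2 hm (1 : ℝ)).trans ?_
  have := mfderiv_eq_fderiv (𝕜 := ℝ) (f := fun t : ℝ => chartAt (Euc 4) m (F t r)) (x := 0)
  exact DFunLike.congr_fun this (1 : ℝ)

/-- The covariant acceleration at time `0` of a family of maps. -/
noncomputable def timeAccel (F : ℝ → S → M) (r : S) : Tan 4 (F 0 r) :=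
  ofChart (F 0 r) (F 0 r) ((localMetric g (F 0 r)).cov
    (fun t : ℝ => chartAt (Euc 4) (F 0 r) (F t r))
    (fun t => fderiv ℝ (fun t : ℝ => chartAt (Euc 4) (F 0 r) (F t r)) t 1) 1 0)

/-- The acceleration at r is defined in the chart at F 0 r, which changes with r. To differentiate
it in space it must be expressed in one fixed chart, where it is ∇_T T of the space-time map;
naturality under transition maps gives this. -/
lemma toChart_timeAccel {q r : S} {m : M} (hε : 0 < ε)
    (hF : ContMDiffOn (𝓘(ℝ, ℝ).prod (𝓡 2)) (𝓡 4) ∞ (fun z : ℝ × S => F z.1 z.2)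
      (Ioo (-ε) ε ×ˢ (univ : Set S))) (hr : r ∈ (chartAt (Euc 2) q).source)
    (hm : F 0 r ∈ (chartAt (Euc 4) m).source) :
    toChart m (F 0 r) (timeAccel g F r) =
      (localMetric g m).cov (locVar q m F) (fun z => fderiv ℝ (locVar q m F) z (1, 0)) (1, 0)
        (0, chartAt (Euc 2) q r) := by
  have h0 : (0 : ℝ) ∈ Ioo (-ε) ε := ⟨neg_neg_of_pos hε, hε⟩
  have hm₀ := mem_chart_source (Euc 4) (F 0 r)
  have hι : ∀ t : ℝ, fderiv ℝ (fun t : ℝ => (t, chartAt (Euc 2) q r)) t 1 = (1, 0) := by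
    intro t
    rw [(hasFDerivAt_prodMk_left t _).fderiv]
    simp
  have hc (m : M) : (fun t => chartAt (Euc 4) m (F t r)) =
      fun t : ℝ => locVar q m F (t, chartAt (Euc 2) q r) := by
    funext t
    simp only [locVar, loc_chart _ _ hr]
  have hιc : Continuous (fun t : ℝ => (t, chartAt (Euc 2) q r)) := by fun_prop
  have hev {m : M} (hm : F 0 r ∈ (chartAt (Euc 4) m).source) :
      ∀ᶠ t : ℝ in 𝓝 0, (t, chartAt (Euc 2) q r) ∈ varDom ε q m F :=
    hιc.continuousAt.eventually_mem ((isOpen_varDom q m hF).mem_nhds (mem_varDom h0 hr hm))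
  have hsm {m : M} {t : ℝ} (h : (t, chartAt (Euc 2) q r) ∈ varDom ε q m F) :
      ContDiffAt ℝ ∞ (locVar q m F) (t, chartAt (Euc 2) q r) :=
    (contDiffOn_locVar q m hF).contDiffAt ((isOpen_varDom q m hF).mem_nhds h)
  have hdir {m : M} (hm : F 0 r ∈ (chartAt (Euc 4) m).source) :
      (localMetric g m).cov (fun t : ℝ => chartAt (Euc 4) m (F t r))
        (fun t => fderiv ℝ (fun t : ℝ => chartAt (Euc 4) m (F t r)) t 1) 1 0 =
      (localMetric g m).cov (locVar q m F) (fun z => fderiv ℝ (locVar q m F) z (1, 0)) (1, 0)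
        (0, chartAt (Euc 2) q r) := by
    have hs := hsm (mem_varDom h0 hr hm)
    have h1 := LocalMetric.cov_comp (L := localMetric g m) (Φ := locVar q m F)
      (V := fun z => fderiv ℝ (locVar q m F) z (1, 0))
      (ι := fun t : ℝ => (t, chartAt (Euc 2) q r)) (y := 0) (hs.differentiableAt (by simp))
      (((hs.fderiv_right (m := 1) (by norm_cast)).differentiableAt (by simp)).clm_apply
        (differentiableAt_const _)) (by fun_prop) 1
    rw [hι 0] at h1
    rw [← h1, ← hc m]
    refine LocalMetric.cov_congr ?_ 1
    filter_upwards [hev hm] with t ht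
    exact hasFDerivAt_locVar_fst hF hr ht
  set m₀ := F 0 r with hm₀def
  have hcurve {m : M} {t : ℝ} (h : (t, chartAt (Euc 2) q r) ∈ varDom ε q m F) :
      ContDiffAt ℝ ∞ (fun t => chartAt (Euc 4) m (F t r)) t := by
    rw [hc m]
    exact ContDiffAt.comp (g := locVar q m F) t (hsm h) (by fun_prop)
  have htr {t : ℝ} (h₀ : (t, chartAt (Euc 2) q r) ∈ varDom ε q m₀ F)
      (h : (t, chartAt (Euc 2) q r) ∈ varDom ε q m F) :
      chartAt (Euc 4) m₀ (F t r) ∈ transDom 4 m₀ m ∧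
      chartAt (Euc 4) m (F t r) = trans m₀ m (chartAt (Euc 4) m₀ (F t r)) := by
    have h1 : F t r ∈ (chartAt (Euc 4) m₀).source := by
      simpa only [(chartAt (Euc 2) q).left_inv hr] using h₀.2
    have h2 : F t r ∈ (chartAt (Euc 4) m).source := by
      simpa only [(chartAt (Euc 2) q).left_inv hr] using h.2
    exact ⟨chart_mem_transDom h1 h2, by rw [trans, (chartAt (Euc 4) m₀).left_inv h1]⟩
  have hev1 : ∀ᶠ t in 𝓝 (0 : ℝ), chartAt (Euc 4) m (F t r) =
      trans m₀ m (chartAt (Euc 4) m₀ (F t r)) := by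
    filter_upwards [hev hm₀, hev hm] with t h₀ h using (htr h₀ h).2
  have hev2 : (fun t => fderiv ℝ (fun t : ℝ => chartAt (Euc 4) m (F t r)) t 1) =ᶠ[𝓝 0]
      fun t => fderiv ℝ (trans m₀ m) (chartAt (Euc 4) m₀ (F t r))
        (fderiv ℝ (fun t : ℝ => chartAt (Euc 4) m₀ (F t r)) t 1) := by
    filter_upwards [hev1.eventually_nhds, hev hm₀, hev hm] with t ht h₀ h
    have hT := ((contDiffOn_trans m₀ m).contDiffAt ((isOpen_transDom m₀ m).mem_nhds
      (htr h₀ h).1)).differentiableAt (by simp)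
    rw [Filter.EventuallyEq.fderiv_eq ht,
      fderiv_fun_comp t hT ((hcurve h₀).differentiableAt (by simp))]
    rfl
  have h₀ := mem_varDom h0 hr hm₀
  have hz := htr h₀ (mem_varDom h0 hr hm)
  have e3 : (localMetric g m).cov (fun t : ℝ => chartAt (Euc 4) m (F t r))
        (fun t => fderiv ℝ (fun t : ℝ => chartAt (Euc 4) m (F t r)) t 1) 1 0 =
      (localMetric g m).cov (fun t : ℝ => trans m₀ m (chartAt (Euc 4) m₀ (F t r)))
        (fun t => fderiv ℝ (trans m₀ m) (chartAt (Euc 4) m₀ (F t r))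
          (fderiv ℝ (fun t : ℝ => chartAt (Euc 4) m₀ (F t r)) t 1)) 1 0 :=
    LocalMetric.cov_congr' hev1 hev2 1
  rw [← hdir hm, e3, LocalMetric.cov_eq_fderiv_cov (L' := localMetric g m₀) (L := localMetric g m)
    (φ := fun t : ℝ => chartAt (Euc 4) m₀ (F t r)) ((chartAt (Euc 4) m₀).map_source hm₀)
    (hz.2 ▸ (chartAt (Euc 4) m).map_source hm)
    ((contDiffOn_trans m₀ m).contDiffAt ((isOpen_transDom m₀ m).mem_nhds hz.1)) ?_ ?_
    ((hcurve h₀).differentiableAt (by simp))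
    ((((hcurve h₀).fderiv_right (m := 1) (by norm_cast)).differentiableAt (by simp)).clm_apply
        (differentiableAt_const _)), toChart_trans hm₀ hm, timeAccel, toChart_ofChart hm₀]
  · filter_upwards [(isOpen_transDom m₀ m).mem_nhds hz.1] with y hy u v
    exact chartG_trans g hy u v
  · exact surjective_fderiv_trans hm₀ hm

end Variation

/-- The second time derivative as an iterated directional derivative. -/
lemma deriv_deriv_eq_fderiv_fderiv {X : Type*} [NormedAddCommGroup X] [NormedSpace ℝ X]
    {s : ℝ × X → ℝ} {t : ℝ} {x : X} (h : ContDiffAt ℝ 2 s (t, x)) :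
    deriv (deriv fun t => s (t, x)) t =
      fderiv ℝ (fun z => fderiv ℝ s z (1, 0)) (t, x) (1, 0) := by
  have key {u : ℝ × X → ℝ} {t : ℝ} (hu : DifferentiableAt ℝ u (t, x)) :
      deriv (fun t => u (t, x)) t = fderiv ℝ u (t, x) (1, 0) := by
    have h2 : HasFDerivAt (fun t : ℝ => (t, x)) (ContinuousLinearMap.inl ℝ ℝ X) t :=
      hasFDerivAt_prodMk_left t x
    have h3 := HasFDerivAt.comp (g := u) t hu.hasFDerivAt h2
    rw [← fderiv_apply_one_eq_deriv]
    refine (DFunLike.congr_fun h3.fderiv 1).trans ?_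
    simp
  have hc : ContinuousAt (fun t : ℝ => (t, x)) t := by fun_prop
  have hev : deriv (fun t => s (t, x)) =ᶠ[𝓝 t] fun t => fderiv ℝ s (t, x) (1, 0) := by
    have := hc.eventually (h.eventually (by simp))
    filter_upwards [this] with t ht
    exact key (ht.differentiableAt (by simp))
  rw [hev.deriv_eq]
  exact key (u := fun z => fderiv ℝ s z (1, 0)) (((h.fderiv_right (m := 1)
    (by norm_num)).differentiableAt (by simp)).clm_apply (differentiableAt_const _))

/-! ### The area density and its smooth dependence on time. -/

section Density

variable {S M : Type*} [TopologicalSpace S] [ChartedSpace (Euc 2) S] [IsManifold (𝓡 2) ∞ S]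
  [TopologicalSpace M] [ChartedSpace (Euc 4) M] [IsManifold (𝓡 4) ∞ M] (g : SmoothMetric 4 M)

/-- The density of the area measure of `u` in the chart at `q`. -/
noncomputable def areaDensity (u : S → M) (q r : S) : ℝ :=
  √(Matrix.det (Matrix.of fun i j : Fin 2 =>
    pullForm g u r (ofChart q r (stdVec i)) (ofChart q r (stdVec j))))

/-- The area of the parallelogram spanned by two tangent vectors. -/
noncomputable def pairArea (u : S → M) (r : S) (A B : Tan 2 r) : ℝ :=
  √(pullForm g u r A A * pullForm g u r B B - pullForm g u r A B * pullForm g u r A B)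

lemma areaDensity_eq (u : S → M) (q r : S) : areaDensity g u q r =
    pairArea g u r (ofChart q r (stdVec 0)) (ofChart q r (stdVec 1)) := by
  rw [areaDensity, pairArea, Matrix.det_fin_two]
  simp only [Matrix.of_apply]
  rw [pullForm_comm g (ofChart q r (stdVec 1)) (ofChart q r (stdVec 0))]

lemma pairArea_eq (u : S → M) {q r : S} (hr : r ∈ (chartAt (Euc 2) q).source) (A B : Tan 2 r) :
    pairArea g u r A B = |det2 (toChart q r A) (toChart q r B)| * areaDensity g u q r := by
  have key (X : Tan 2 r) : X = toChart q r X 0 • ofChart q r (stdVec 0) +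
      toChart q r X 1 • ofChart q r (stdVec 1) := by
    rw [← ofChart_smul hr, ← ofChart_smul hr, ← ofChart_add hr, ← euc2_eq, ofChart_toChart hr]
  rw [areaDensity_eq, pairArea, pairArea, ← Real.sqrt_sq_eq_abs, ← Real.sqrt_mul (sq_nonneg _),
    det2]
  conv_lhs => rw [key A, key B]
  congr 1
  simp only [pullForm_add_left, pullForm_smul_left, pullForm_add_right, pullForm_smul_right,
    pullForm_comm g (ofChart q r (stdVec 1)) (ofChart q r (stdVec 0))]
  ring

/-- An orthonormal frame spans area one, and by `pairArea_eq` this area is a multiple of the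
density. -/
lemma areaDensity_pos (oS : ManifoldOrientation 2 S) {u : S → M} {q r : S}
    (hr : r ∈ (chartAt (Euc 2) q).source)
    (hinj : Function.Injective (mfderiv (𝓡 2) (𝓡 4) u r)) : 0 < areaDensity g u q r := by
  obtain ⟨e₁, e₂, h⟩ := exists_isTangentFrame (oS := oS) (g := g) hinj
  have := pairArea_eq g u hr e₁ e₂
  rw [pairArea, h.1, h.2.1, h.2.2.1] at this
  refine (Real.sqrt_nonneg _).lt_of_ne fun h0 => ?_
  rw [areaDensity, ← h0] at this
  norm_num at this

variable {ε : ℝ} {F : ℝ → S → M}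

lemma pairArea_variation {q r : S} {m : M} {t : ℝ} (ht : t ∈ Ioo (-ε) ε)
    (hF : ContMDiffOn (𝓘(ℝ, ℝ).prod (𝓡 2)) (𝓡 4) ∞ (fun z : ℝ × S => F z.1 z.2)
      (Ioo (-ε) ε ×ˢ (univ : Set S))) (hr : r ∈ (chartAt (Euc 2) q).source)
    (hm : F t r ∈ (chartAt (Euc 4) m).source) (a b : Euc 2) :
    pairArea g (F t) r (ofChart q r a) (ofChart q r b) =
      √((localMetric g m).gramDet (locVar q m F) (0, a) (0, b) (t, chartAt (Euc 2) q r)) := by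
  rw [pairArea, LocalMetric.gramDet, pullForm_variation g ht hF hr hm,
    pullForm_variation g ht hF hr hm, pullForm_variation g ht hF hr hm]

/-- The area density depends smoothly on time and the coordinates. -/
lemma contDiffAt_pairArea (hε : 0 < ε)
    (hF : ContMDiffOn (𝓘(ℝ, ℝ).prod (𝓡 2)) (𝓡 4) ∞ (fun z : ℝ × S => F z.1 z.2)
      (Ioo (-ε) ε ×ˢ (univ : Set S))) {q r : S} (hr : r ∈ (chartAt (Euc 2) q).source) (a b : Euc 2)
    (h : pairArea g (F 0) r (ofChart q r a) (ofChart q r b) ≠ 0) :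
    ContDiffAt ℝ ∞ (fun z : ℝ × Euc 2 => pairArea g (F z.1) ((chartAt (Euc 2) q).symm z.2)
      (ofChart q _ a) (ofChart q _ b)) (0, chartAt (Euc 2) q r) := by
  have h0 : (0 : ℝ) ∈ Ioo (-ε) ε := ⟨neg_neg_of_pos hε, hε⟩
  have hm := mem_chart_source (Euc 4) (F 0 r)
  have hD := isOpen_varDom q (F 0 r) hF
  have hz := mem_varDom h0 hr hm
  have hs : ContDiffAt ℝ ∞ ((localMetric g (F 0 r)).gramDet (locVar q (F 0 r) F) (0, a) (0, b))
      (0, chartAt (Euc 2) q r) :=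
    (LocalMetric.contDiffOn_gramDet hD (mapsTo_locVar g ε q _ F)
      (contDiffOn_locVar q _ hF) _ _).contDiffAt (hD.mem_nhds hz)
  rw [pairArea_variation g h0 hF hr hm] at h
  refine (hs.sqrt fun h' => h (by rw [h', Real.sqrt_zero])).congr_of_eventuallyEq ?_
  filter_upwards [hD.mem_nhds hz] with z hz
  rw [pairArea_variation g hz.1.1 hF ((chartAt (Euc 2) q).map_target hz.1.2) hz.2,
    (chartAt (Euc 2) q).right_inv hz.1.2]

end Density

/-! ### The tangential field whose divergence is the error term. -/

section Field

variable {S M : Type*} [TopologicalSpace S] [ChartedSpace (Euc 2) S] [IsManifold (𝓡 2) ∞ S]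
  [TopologicalSpace M] [ChartedSpace (Euc 4) M] [IsManifold (𝓡 4) ∞ M]

/-- The tangential field whose divergence is the difference between the second derivative of the
area density and the integrand of the second variation formula. -/
noncomputable def variationField (oS : ManifoldOrientation 2 S) (oM : ManifoldOrientation 4 M)
    (g : SmoothMetric 4 M) (F : ℝ → S → M) (σ : ∀ p : S, Tan 4 (F 0 p)) (r : S) : Tan 2 r :=
  Classical.epsilon fun W : Tan 2 r => ∃ e₁ e₂ : Tan 2 r, IsTangentFrame oS g (F 0) r e₁ e₂ ∧
    W = (g.inner (F 0 r) (timeAccel g F r) (mfderiv (𝓡 2) (𝓡 4) (F 0) r e₁)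
        + g.inner (F 0 r) (covAlong g (F 0) σ r e₂) (normalJ oS oM g (F 0) r (σ r))) • e₁
      + (g.inner (F 0 r) (timeAccel g F r) (mfderiv (𝓡 2) (𝓡 4) (F 0) r e₂)
        - g.inner (F 0 r) (covAlong g (F 0) σ r e₁) (normalJ oS oM g (F 0) r (σ r))) • e₂

variable {oS : ManifoldOrientation 2 S} {oM : ManifoldOrientation 4 M} {g : SmoothMetric 4 M}
  {F : ℝ → S → M} {σ : ∀ p : S, Tan 4 (F 0 p)}

lemma exists_variationField_eq {r : S}
    (hinj : Function.Injective (mfderiv (𝓡 2) (𝓡 4) (F 0) r)) :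
    ∃ e₁ e₂ : Tan 2 r, IsTangentFrame oS g (F 0) r e₁ e₂ ∧ variationField oS oM g F σ r =
      (g.inner (F 0 r) (timeAccel g F r) (mfderiv (𝓡 2) (𝓡 4) (F 0) r e₁)
        + g.inner (F 0 r) (covAlong g (F 0) σ r e₂) (normalJ oS oM g (F 0) r (σ r))) • e₁
      + (g.inner (F 0 r) (timeAccel g F r) (mfderiv (𝓡 2) (𝓡 4) (F 0) r e₂)
        - g.inner (F 0 r) (covAlong g (F 0) σ r e₁) (normalJ oS oM g (F 0) r (σ r))) • e₂ := by
  obtain ⟨e₁, e₂, h⟩ := exists_isTangentFrame (oS := oS) (g := g) hinj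
  exact Classical.epsilon_spec (p := fun W : Tan 2 r => ∃ e₁ e₂ : Tan 2 r,
    IsTangentFrame oS g (F 0) r e₁ e₂ ∧
    W = (g.inner (F 0 r) (timeAccel g F r) (mfderiv (𝓡 2) (𝓡 4) (F 0) r e₁)
        + g.inner (F 0 r) (covAlong g (F 0) σ r e₂) (normalJ oS oM g (F 0) r (σ r))) • e₁
      + (g.inner (F 0 r) (timeAccel g F r) (mfderiv (𝓡 2) (𝓡 4) (F 0) r e₂)
        - g.inner (F 0 r) (covAlong g (F 0) σ r e₁) (normalJ oS oM g (F 0) r (σ r))) • e₂)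
    ⟨_, e₁, e₂, h, rfl⟩

lemma timeAccel_eq_zero {S : Type*} {F : ℝ → S → M} {r : S} (h : ∀ᶠ t in 𝓝 (0 : ℝ), F t r = F 0 r) : timeAccel g F r = 0 := by
  have h1 : (fun t : ℝ => chartAt (Euc 4) (F 0 r) (F t r)) =ᶠ[𝓝 0]
      fun _ => chartAt (Euc 4) (F 0 r) (F 0 r) := by
    filter_upwards [h] with t ht
    rw [ht]
  have h2 : (fun t => fderiv ℝ (fun t : ℝ => chartAt (Euc 4) (F 0 r) (F t r)) t 1) =ᶠ[𝓝 0]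
      fun _ => 0 := by
    filter_upwards [h1.eventually_nhds] with t ht
    rw [Filter.EventuallyEq.fderiv_eq ht]
    simp
  rw [timeAccel, LocalMetric.cov_congr' h1 h2, LocalMetric.cov]
  simp [ofChart_zero (mem_chart_source (Euc 4) (F 0 r))]

lemma variationField_eq_zero {r : S} (hinj : Function.Injective (mfderiv (𝓡 2) (𝓡 4) (F 0) r))
    (h : ∀ᶠ t in 𝓝 (0 : ℝ), F t r = F 0 r) (hσ : σ r = 0) :
    variationField oS oM g F σ r = 0 := by
  obtain ⟨e₁, e₂, -, h'⟩ := exists_variationField_eq (oS := oS) (oM := oM) (σ := σ) (g := g) hinj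
  obtain ⟨f₁, f₂, f₃, f₄, hf⟩ := exists_isAdaptedFrame (oS := oS) (oM := oM) (g := g) hinj
  have hJ : normalJ oS oM g (F 0) r (σ r) = 0 := by
    rw [hf.normalJ_eq, hσ]
    simp
  rw [h', timeAccel_eq_zero h, hJ]
  simp

end Field

lemma LocalMetric.cov_slice {E X : Type*} [NormedAddCommGroup E] [NormedSpace ℝ E]
    [NormedAddCommGroup X] [NormedSpace ℝ X] {L : LocalMetric E} {Φ V : ℝ × X → E} {t : ℝ} {x : X}
    (hΦ : DifferentiableAt ℝ Φ (t, x)) (hV : DifferentiableAt ℝ V (t, x)) (c : X) :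
    L.cov (fun y => Φ (t, y)) (fun y => V (t, y)) c x = L.cov Φ V (0, c) (t, x) := by
  rw [LocalMetric.cov_comp (ι := fun y => (t, y)) hΦ hV (by fun_prop),
    (hasFDerivAt_prodMk_right t x).fderiv]
  simp

/-- Symmetry and trace of the shape operator of a field normal to an immersed surface. -/
lemma LocalMetric.cov_normal {E Y : Type*} [NormedAddCommGroup E] [NormedSpace ℝ E]
    [NormedAddCommGroup Y] [NormedSpace ℝ Y] {L : LocalMetric E} {φ s : Y → E} {O : Set Y}
    (hO : IsOpen O) (hm : MapsTo φ O L.dom) (hφ : ContDiffOn ℝ ∞ φ O) (hs : ContDiffOn ℝ ∞ s O)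
    (hn : ∀ z ∈ O, ∀ c, L.G (φ z) (s z) (fderiv ℝ φ z c) = 0) {x : Y} (hx : x ∈ O) (c d : Y) :
    L.G (φ x) (L.cov φ s c x) (fderiv ℝ φ x d) =
      - L.G (φ x) (s x) (L.cov φ (fun z => fderiv ℝ φ z d) c x) := by
  have hd {f : Y → E} (h : ContDiffOn ℝ ∞ f O) : DifferentiableAt ℝ f x :=
    ((h x hx).contDiffAt (hO.mem_nhds hx)).differentiableAt (by simp)
  have h1 := LocalMetric.fderiv_inner (L := L) (hm hx) (hd hφ) (hd hs)
    (hd (LocalMetric.contDiffOn_fderiv_apply hO hφ d)) c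
  have h2 : (fun z => L.G (φ z) (s z) (fderiv ℝ φ z d)) =ᶠ[𝓝 x] fun _ => 0 :=
    Filter.eventuallyEq_of_mem (hO.mem_nhds hx) fun z hz => hn z hz d
  rw [h2.fderiv_eq, fderiv_fun_const] at h1
  simp only [Pi.zero_apply, _root_.zero_apply] at h1
  linarith

/-! ### The pointwise identity in the chart at the given point. -/

section Identity

variable {S M : Type*} [TopologicalSpace S] [ChartedSpace (Euc 2) S] [IsManifold (𝓡 2) ∞ S]
  [TopologicalSpace M] [ChartedSpace (Euc 4) M] [IsManifold (𝓡 4) ∞ M]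
  {oS : ManifoldOrientation 2 S} {oM : ManifoldOrientation 4 M} {g : SmoothMetric 4 M}
  {F : ℝ → S → M} {σ : ∀ p : S, Tan 4 (F 0 p)} {ε : ℝ}

set_option maxHeartbeats 800000 in
/-- The second time derivative of the area density at `p` is, up to a divergence, the integrand of
the second variation formula. -/
lemma exists_deriv_deriv_pairArea (hf : IsMinimalImmersion g (F 0)) (hσ : SmoothAlong (F 0) σ)
    (hn : ∀ p, IsNormal g (F 0) p (σ p)) (hε : 0 < ε)
    (hF : ContMDiffOn (𝓘(ℝ, ℝ).prod (𝓡 2)) (𝓡 4) ∞ (fun z : ℝ × S => F z.1 z.2)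
      (Ioo (-ε) ε ×ˢ (univ : Set S)))
    (hvel : ∀ p, mfderiv 𝓘(ℝ, ℝ) (𝓡 4) (fun t : ℝ => F t p) 0 (1 : ℝ) = σ p) (p : S) :
    ∃ a b : Euc 2, det2 a b ≠ 0 ∧ pairArea g (F 0) p (ofChart p p a) (ofChart p p b) = 1 ∧
      ∃ V : Euc 2 → Euc 2, (∀ z, V z = pairArea g (F 0) ((chartAt (Euc 2) p).symm z)
          (ofChart p _ a) (ofChart p _ b) • toChart p _ (variationField oS oM g F σ
            ((chartAt (Euc 2) p).symm z))) ∧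
        ContDiffAt ℝ 1 V (chartAt (Euc 2) p p) ∧
        ∀ e, pullForm g (F 0) p e e = 1 →
          deriv (deriv fun t => pairArea g (F t) p (ofChart p p a) (ofChart p p b)) 0 =
            integrand oS oM g (F 0) σ p e + div2 V (chartAt (Euc 2) p p) := by
  have h0 : (0 : ℝ) ∈ Ioo (-ε) ε := ⟨neg_neg_of_pos hε, hε⟩
  have hp := mem_chart_source (Euc 2) p
  have hm := mem_chart_source (Euc 4) (F 0 p)
  obtain ⟨e₁, e₂, e₃, e₄, h, O, hO, hOs, hxO, hpos, hint⟩ :=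
    exists_integrand_eq (oS := oS) (oM := oM) (g := g) hf.smooth hf.immersion hσ hn p
  obtain ⟨α, hα⟩ : ∃ α : Euc 2 → Euc 2 → ℝ, ∀ c z, α c z = g.inner _
      (covAlong g (F 0) σ ((chartAt (Euc 2) p).symm z) (ofChart p _ c))
      (normalJ oS oM g (F 0) _ (σ ((chartAt (Euc 2) p).symm z))) := ⟨_, fun _ _ => rfl⟩
  obtain ⟨hαs, hQ⟩ := hint α hα
  obtain ⟨a, ha⟩ : ∃ a, a = toChart p p e₁ := ⟨_, rfl⟩
  obtain ⟨b, hb⟩ : ∃ b, b = toChart p p e₂ := ⟨_, rfl⟩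
  have hoa : ofChart p p a = e₁ := ha ▸ ofChart_toChart hp _
  have hob : ofChart p p b = e₂ := hb ▸ ofChart_toChart hp _
  simp only [← ha, ← hb] at hQ hpos
  obtain ⟨L, hL⟩ : ∃ L, L = localMetric g (F 0 p) := ⟨_, rfl⟩
  obtain ⟨Φ, hΦ⟩ : ∃ Φ, Φ = locVar p (F 0 p) F := ⟨_, rfl⟩
  obtain ⟨φ, hφ⟩ : ∃ φ, φ = loc p (F 0 p) (F 0) := ⟨_, rfl⟩
  obtain ⟨x, hx⟩ : ∃ x, x = chartAt (Euc 2) p p := ⟨_, rfl⟩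
  obtain ⟨s, hs⟩ : ∃ s, s = locField p (F 0 p) (F 0) σ := ⟨_, rfl⟩
  have hΦφ : (fun y => Φ (0, y)) = φ := by rw [hΦ, hφ]; rfl
  have hD : IsOpen (varDom ε p (F 0 p) F) := isOpen_varDom p _ hF
  have hmD : MapsTo Φ (varDom ε p (F 0 p) F) L.dom := hL ▸ hΦ ▸ mapsTo_locVar g ε p _ F
  have hΦs : ContDiffOn ℝ ∞ Φ (varDom ε p (F 0 p) F) := hΦ ▸ contDiffOn_locVar p _ hF
  have hmO : MapsTo φ O L.dom := hL ▸ hφ ▸ (mapsTo_loc g p _ (F 0)).mono_left hOs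
  have hφs : ContDiffOn ℝ ∞ φ O := hφ ▸ (contDiffOn_loc p _ hf.smooth).mono hOs
  have hss : ContDiffOn ℝ ∞ s O := hs ▸ (contDiffOn_locField p _ hσ).mono hOs
  have hOD {z : Euc 2} (hz : z ∈ O) : ((0 : ℝ), z) ∈ varDom ε p (F 0 p) F :=
    ⟨⟨h0, (hOs hz).1⟩, (hOs hz).2⟩
  rw [← hx] at hxO
  have hxD := hOD hxO
  have hφx : φ x = Φ (0, x) := by rw [← hΦφ]
  have hdφ {z : Euc 2} (hz : z ∈ O) (c : Euc 2) : fderiv ℝ φ z c = fderiv ℝ Φ (0, z) (0, c) := by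
    rw [hφ, hΦ]
    exact fderiv_locVar_snd hF (hOD hz) c
  -- the intrinsic objects in coordinates
  have hin {z : Euc 2} (hz : z ∈ O) (w n : Tan 4 (F 0 ((chartAt (Euc 2) p).symm z))) :
      g.inner _ w n = L.G (φ z) (toChart (F 0 p) _ w) (toChart (F 0 p) _ n) := by
    rw [inner_eq_chartG g (hOs hz).2, hL, hφ]
    rfl
  have hdf {z : Euc 2} (hz : z ∈ O) (c : Euc 2) : toChart (F 0 p) _
      (mfderiv (𝓡 2) (𝓡 4) (F 0) ((chartAt (Euc 2) p).symm z) (ofChart p _ c)) = fderiv ℝ φ z c := by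
    rw [toChart_mfderiv_ofChart ((hf.smooth _).mdifferentiableAt (by simp))
      ((chartAt (Euc 2) p).map_target (hOs hz).1) (hOs hz).2, hφ,
      (chartAt (Euc 2) p).right_inv (hOs hz).1]
  have hsT : ∀ z ∈ O, s z = fderiv ℝ Φ (0, z) (1, 0) := by
    intro z hz
    have := toChart_velocity hε hF ((chartAt (Euc 2) p).map_target (hOs hz).1) (hOs hz).2
    rw [hvel, (chartAt (Euc 2) p).right_inv (hOs hz).1] at this
    rw [hs, hΦ, ← this]
    rfl
  have hnO : ∀ z ∈ O, ∀ c, L.G (φ z) (s z) (fderiv ℝ φ z c) = 0 := by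
    intro z hz c
    rw [← hdf hz, hs, locField, ← hin hz]
    exact hn _ _
  have hgram {z : Euc 2} (hz : z ∈ O) (c d : Euc 2) :
      pullForm g (F 0) ((chartAt (Euc 2) p).symm z) (ofChart p _ c) (ofChart p _ d) =
        L.gram φ c d z := by
    rw [pullForm, hin hz, hdf hz, hdf hz, LocalMetric.gram]
  have hT := LocalMetric.contDiffOn_fderiv_apply hD hΦs ((1, 0) : ℝ × Euc 2)
  have hdD {z : Euc 2} (hz : z ∈ O) {G : Type _} [NormedAddCommGroup G] [NormedSpace ℝ G]
      {f : ℝ × Euc 2 → G} (hf : ContDiffOn ℝ ∞ f (varDom ε p (F 0 p) F)) :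
      DifferentiableAt ℝ f (0, z) :=
    ((hf _ (hOD hz)).contDiffAt (hD.mem_nhds (hOD hz))).differentiableAt (by simp)
  have hcovs (c : Euc 2) : L.cov φ s c x = L.cov Φ (fun z => fderiv ℝ Φ z (1, 0)) (0, c) (0, x) := by
    rw [← LocalMetric.cov_slice (hdD hxO hΦs) (hdD hxO hT), hΦφ]
    exact LocalMetric.cov_congr (Filter.eventuallyEq_of_mem (hO.mem_nhds hxO) hsT) c
  have hxp : (chartAt (Euc 2) p).symm x = p := by rw [hx, (chartAt (Euc 2) p).left_inv hp]
  have hinp (w n : Tan 4 (F 0 p)) :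
      g.inner (F 0 p) w n = L.G (φ x) (toChart (F 0 p) _ w) (toChart (F 0 p) _ n) := by
    rw [inner_eq_chartG g hm, hL, hφ, hx, loc_chart _ _ hp]
  have hdfp (c : Euc 2) : toChart (F 0 p) _
      (mfderiv (𝓡 2) (𝓡 4) (F 0) p (ofChart p p c)) = fderiv ℝ φ x c := by
    rw [toChart_mfderiv_ofChart ((hf.smooth _).mdifferentiableAt (by simp)) hp hm, hφ, hx]
  have hgramp (c d : Euc 2) : pullForm g (F 0) p (ofChart p p c) (ofChart p p d) =
      L.gram φ c d x := by
    rw [pullForm, hinp, hdfp, hdfp, LocalMetric.gram]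
  have hcovp (c : Euc 2) :
      toChart (F 0 p) (F 0 p) (covAlong g (F 0) σ p (ofChart p p c)) = L.cov φ s c x := by
    have := toChart_covAlong g hf.smooth (V := σ) hp hm (by
      rw [← hs, ← hx]
      exact ((hss x hxO).contDiffAt (hO.mem_nhds hxO)).differentiableAt (by simp)) c
    rw [this, hL, hφ, hs, hx]
  have hsp : toChart (F 0 p) (F 0 p) (σ p) = s x := by
    rw [hs, hx, locField_chart _ _ _ hp]
  have haa : L.gram φ a a x = 1 := by rw [← hgramp, hoa]; exact h.1.1
  have hbb : L.gram φ b b x = 1 := by rw [← hgramp, hob]; exact h.1.2.1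
  have hab : L.gram φ a b x = 0 := by rw [← hgramp, hoa, hob]; exact h.1.2.2.1
  have hgΦ (c d : Euc 2) : L.gram Φ (0, c) (0, d) (0, x) = L.gram φ c d x := by
    rw [LocalMetric.gram, LocalMetric.gram, hdφ hxO, hdφ hxO, hφx]
  -- minimality
  have hH := hf.cov_add_cov h hL hφ hx ha hb rfl
  have hsh := fun c d => LocalMetric.cov_normal hO hmO hφs hss hnO hxO c d
  have hsym : L.G (φ x) (L.cov φ s a x) (fderiv ℝ φ x b) =
      L.G (φ x) (L.cov φ s b x) (fderiv ℝ φ x a) := by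
    rw [hsh, hsh, LocalMetric.cov_fderiv_comm (hmO hxO)
      ((hφs x hxO).contDiffAt (hO.mem_nhds hxO))]
  have htr : L.G (φ x) (L.cov φ s a x) (fderiv ℝ φ x a) +
      L.G (φ x) (L.cov φ s b x) (fderiv ℝ φ x b) = 0 := by
    rw [hsh, hsh, ← neg_add, ← map_add, hH, map_add, map_smul, map_smul, hnO x hxO, hnO x hxO]
    simp
  -- the second derivative of the area density
  have hsec := LocalMetric.fderiv_fderiv_sqrt_gramDet hD hmD hΦs ((1, 0) : ℝ × Euc 2) (0, a)
    (0, b) hxD (by rw [hgΦ, haa]) (by rw [hgΦ, hbb]) (by rw [hgΦ, hab])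
    (by rw [← hcovs, ← hcovs, ← hdφ hxO, ← hdφ hxO, ← hφx, htr])
    (by rw [← hcovs, ← hcovs, ← hdφ hxO, ← hdφ hxO, ← hφx, hsym])
  -- the acceleration
  obtain ⟨Z, hZ⟩ : ∃ Z : Euc 2 → Euc 4, Z = fun z =>
    L.cov Φ (fun z => fderiv ℝ Φ z (1, 0)) (1, 0) (0, z) := ⟨_, rfl⟩
  have hcT := LocalMetric.contDiffOn_cov hD hmD hΦs hT ((1, 0) : ℝ × Euc 2)
  have hZs : ContDiffOn ℝ ∞ Z O := hZ ▸ hcT.comp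
    ((contDiff_const.prodMk contDiff_id).contDiffOn) fun z hz => hOD hz
  have hcovZ (c : Euc 2) : L.cov Φ (L.cov Φ (fun z => fderiv ℝ Φ z (1, 0)) (1, 0)) (0, c) (0, x) =
      L.cov φ Z c x := by
    rw [← LocalMetric.cov_slice (hdD hxO hΦs) (hdD hxO hcT), hΦφ, hZ]
  have hacc {z : Euc 2} (hz : z ∈ O) :
      toChart (F 0 p) _ (timeAccel g F ((chartAt (Euc 2) p).symm z)) = Z z := by
    rw [toChart_timeAccel g hε hF ((chartAt (Euc 2) p).map_target (hOs hz).1) (hOs hz).2,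
      (chartAt (Euc 2) p).right_inv (hOs hz).1, hZ, hL, hΦ]
  have hdiv := LocalMetric.fderiv_tangential hO hmO hφs hZs a b hxO haa hbb hab hH
  have hdet1 : L.gramDet φ a b x = 1 := by
    rw [LocalMetric.gramDet, haa, hbb, hab]
    norm_num
  have hat {G : Type _} [NormedAddCommGroup G] [NormedSpace ℝ G]
      {f : Euc 2 → G} (hf : ContDiffOn ℝ ∞ f O) : ContDiffAt ℝ ∞ f x :=
    (hf x hxO).contDiffAt (hO.mem_nhds hxO)
  have hgs (c d : Euc 2) := hat (LocalMetric.contDiffOn_gram hO hmO hφs c d)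
  have hsq : ContDiffAt ℝ ∞ (fun z => √(L.gramDet φ a b z)) x :=
    (hat (LocalMetric.contDiffOn_gramDet hO hmO hφs a b)).sqrt (by rw [hdet1]; exact one_ne_zero)
  have hsq0 : √(L.gramDet φ a b x) ≠ 0 := by rw [hdet1, Real.sqrt_one]; exact one_ne_zero
  have hζs (c : Euc 2) : ContDiffAt ℝ ∞ (fun z => L.G (φ z) (Z z) (fderiv ℝ φ z c)) x :=
    hat (LocalMetric.contDiffOn_inner hmO hφs hZs (LocalMetric.contDiffOn_fderiv_apply hO hφs c))
  obtain ⟨u, hu⟩ : ∃ u : Euc 2 → ℝ, u = fun z => (L.gram φ b b z * L.G (φ z) (Z z) (fderiv ℝ φ z a)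
    - L.gram φ a b z * L.G (φ z) (Z z) (fderiv ℝ φ z b)) / √(L.gramDet φ a b z) := ⟨_, rfl⟩
  obtain ⟨v, hv⟩ : ∃ v : Euc 2 → ℝ, v = fun z => (L.gram φ a a z * L.G (φ z) (Z z) (fderiv ℝ φ z b)
    - L.gram φ a b z * L.G (φ z) (Z z) (fderiv ℝ φ z a)) / √(L.gramDet φ a b z) := ⟨_, rfl⟩
  have hus : ContDiffAt ℝ ∞ u x :=
    hu ▸ (((hgs b b).mul (hζs a)).sub ((hgs a b).mul (hζs b))).div hsq hsq0
  have hvs : ContDiffAt ℝ ∞ v x :=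
    hv ▸ (((hgs a a).mul (hζs b)).sub ((hgs a b).mul (hζs a))).div hsq hsq0
  rw [← hu, ← hv] at hdiv
  have hpair {z : Euc 2} (hz : z ∈ O) : pairArea g (F 0) ((chartAt (Euc 2) p).symm z)
      (ofChart p _ a) (ofChart p _ b) = √(L.gramDet φ a b z) := by
    rw [pairArea, hgram hz, hgram hz, hgram hz, LocalMetric.gramDet]
  have hpair1 : pairArea g (F 0) p (ofChart p p a) (ofChart p p b) = 1 := by
    rw [hoa, hob, pairArea, h.1.1, h.1.2.1, h.1.2.2.1]
    norm_num
  have hdet : det2 a b ≠ 0 := by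
    intro h'
    have := pairArea_eq g (F 0) hp (ofChart p p a) (ofChart p p b)
    rw [hpair1, toChart_ofChart hp, toChart_ofChart hp, h', abs_zero, zero_mul] at this
    exact one_ne_zero this
  refine ⟨a, b, hdet, hpair1, _, fun _ => rfl, ?_⟩
  have hV : (fun z => pairArea g (F 0) ((chartAt (Euc 2) p).symm z)
          (ofChart p _ a) (ofChart p _ b) • toChart p _ (variationField oS oM g F σ
            ((chartAt (Euc 2) p).symm z))) =ᶠ[𝓝 x]
      fun z => (u z + α b z) • a + (v z - α a z) • b := by
    refine Filter.eventuallyEq_of_mem (hO.mem_nhds hxO) fun z hz => ?_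
    have hzs := (chartAt (Euc 2) p).map_target (hOs hz).1
    obtain ⟨f₁, f₂, hfr, hW⟩ := exists_variationField_eq (oS := oS) (oM := oM) (σ := σ) (g := g)
      (F := F) (hf.immersion ((chartAt (Euc 2) p).symm z))
    -- The field is defined with an arbitrarily chosen frame at each point. Re-expressed in the
    -- positive pair with constant components a, b, its coefficients are visibly smooth.
    have hcomb := hfr.comb_eq (hpos z hz)
      (ζ := fun X => g.inner _ (timeAccel g F _) (mfderiv (𝓡 2) (𝓡 4) (F 0) _ X))
      (α := fun X => g.inner _ (covAlong g (F 0) σ _ X) (normalJ oS oM g (F 0) _ (σ _)))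
      (fun c d => by simp only [map_add, map_smul, smul_eq_mul]) (fun c d => by
        rw [covAlong_comb hf.smooth]
        · simp only [map_add, map_smul, smul_eq_mul, _root_.add_apply, _root_.smul_apply]
        · exact ((contDiffOn_locField _ _ hσ).contDiffAt ((isOpen_locDom _ _
            hf.smooth.continuous).mem_nhds (chart_mem_locDom (mem_chart_source _ _)
              (mem_chart_source _ _)))).differentiableAt (by simp)) rfl
    have hcomb' := congrArg (toChart p _) hcomb
    rw [← hW, toChart_smul hzs, toChart_add hzs, toChart_smul hzs, toChart_smul hzs,
      toChart_ofChart hzs, toChart_ofChart hzs] at hcomb'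
    simp only [← hα, hin hz, hdf hz, hacc hz, hgram hz] at hcomb'
    simp only [hpair hz, hu, hv]
    exact hcomb'
  have hαa (c : Euc 2) := hat (hαs c)
  have hV1 : ContDiffAt ℝ ∞ (fun z => (u z + α b z) • a + (v z - α a z) • b) x :=
    ((hus.add (hαa b)).smul contDiffAt_const).add ((hvs.sub (hαa a)).smul contDiffAt_const)
  rw [← hx]
  refine ⟨(hV1.congr_of_eventuallyEq hV).of_le (by norm_cast), fun e he => ?_⟩
  have d1 {w : Euc 2 → ℝ} (hw : ContDiffAt ℝ ∞ w x) : DifferentiableAt ℝ w x :=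
    hw.differentiableAt (by simp)
  rw [div2_eq_of_basis hdet ((d1 hus).fun_add (d1 (hαa b))) ((d1 hvs).fun_sub (d1 (hαa a))) hV,
    fderiv_fun_add (d1 hus) (d1 (hαa b)), fderiv_fun_sub (d1 hvs) (d1 (hαa a)),
    _root_.add_apply, _root_.sub_apply, hQ e he, ← hx]
  have hev : (fun t => pairArea g (F t) p (ofChart p p a) (ofChart p p b)) =ᶠ[𝓝 0]
      fun t => √(L.gramDet Φ (0, a) (0, b) (t, x)) := by
    have hc : ContinuousAt (fun t : ℝ => (t, x)) 0 := by fun_prop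
    filter_upwards [hc.eventually_mem (hD.mem_nhds hxD)] with t ht
    have hmt : F t p ∈ (chartAt (Euc 4) (F 0 p)).source := by
      have := ht.2
      simp only [hxp] at this
      exact this
    rw [pairArea_variation g ht.1.1 hF hp hmt, ← hL, ← hΦ, ← hx]
  have hΦdet : L.gramDet Φ (0, a) (0, b) (0, x) = 1 := by
    rw [LocalMetric.gramDet, hgΦ, hgΦ, hgΦ, haa, hbb, hab]
    norm_num
  have hsqΦ : ContDiffAt ℝ 2 (fun z => √(L.gramDet Φ (0, a) (0, b) z)) (0, x) :=
    (((LocalMetric.contDiffOn_gramDet hD hmD hΦs _ _).contDiffAt (hD.mem_nhds hxD)).sqrt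
      (by rw [hΦdet]; exact one_ne_zero)).of_le (by norm_cast)
  rw [hev.deriv.deriv_eq, deriv_deriv_eq_fderiv_fderiv
    (s := fun z => √(L.gramDet Φ (0, a) (0, b) z)) hsqΦ, hsec]
  have hnorm (e : Tan 2 p) (c : Euc 2) (hc : ofChart p p c = e) :
      L.G (φ x) (L.cov φ s c x) (L.cov φ s c x) =
      g.inner (F 0 p) (covAlong g (F 0) σ p e) (mfderiv (𝓡 2) (𝓡 4) (F 0) p e₁) ^ 2 +
      g.inner (F 0 p) (covAlong g (F 0) σ p e) (mfderiv (𝓡 2) (𝓡 4) (F 0) p e₂) ^ 2 +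
      g.inner (F 0 p) (covAlong g (F 0) σ p e) e₃ ^ 2 +
      g.inner (F 0 p) (covAlong g (F 0) σ p e) e₄ ^ 2 := by
    rw [← h.inner_self, hinp, ← hc, hcovp]
  have htan (c d : Euc 2) : L.G (φ x) (L.cov φ s c x) (fderiv ℝ φ x d) =
      g.inner (F 0 p) (covAlong g (F 0) σ p (ofChart p p c))
        (mfderiv (𝓡 2) (𝓡 4) (F 0) p (ofChart p p d)) := by
    rw [hinp, hcovp, hdfp]
  have hcurv (c : Euc 2) : g.inner (F 0 p) (curvature g (F 0 p) (σ p)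
      (mfderiv (𝓡 2) (𝓡 4) (F 0) p (ofChart p p c)) (mfderiv (𝓡 2) (𝓡 4) (F 0) p (ofChart p p c)))
        (σ p) = - L.G (φ x) (L.curv (φ x) (s x) (fderiv ℝ φ x c) (s x)) (fderiv ℝ φ x c) := by
    rw [hinp, toChart_curvature, hdfp, hsp, ← hL, show chartAt (Euc 4) (F 0 p) (F 0 p) = φ x by
      rw [hφ, hx, loc_chart _ _ hp], L.curv_skew (hmO hxO), L.G_symm _ (hmO hxO)]
  have hca := hcurv a
  have hcb := hcurv b
  rw [hcovZ, hcovZ, ← hcovs, ← hcovs, ← hdφ hxO, ← hdφ hxO, ← hφx, ← hsT x hxO, ← hdiv,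
    hnorm e₁ a hoa, hnorm e₂ b hob]
  rw [htan, htan] at hsym htr
  rw [htan, htan]
  rw [hoa, hob] at *
  generalize g.inner (F 0 p) (covAlong g (F 0) σ p e₁) (mfderiv (𝓡 2) (𝓡 4) (F 0) p e₁) = t₁₁ at *
  generalize g.inner (F 0 p) (covAlong g (F 0) σ p e₁) (mfderiv (𝓡 2) (𝓡 4) (F 0) p e₂) = t₁₂ at *
  generalize g.inner (F 0 p) (covAlong g (F 0) σ p e₂) (mfderiv (𝓡 2) (𝓡 4) (F 0) p e₁) = t₂₁ at *
  generalize g.inner (F 0 p) (covAlong g (F 0) σ p e₂) (mfderiv (𝓡 2) (𝓡 4) (F 0) p e₂) = t₂₂ at *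
  -- The squared norms of ∇σ contain the shape operator once, as the sum of all t². Trace zero and
  -- symmetry make −4t₁₁² − 4t₁₂² equal to minus twice this sum, which leaves −|A^σ|². The two
  -- hypotheses `hca`, `hcb` convert the curvature terms.
  linear_combination hca + hcb + 2 * (t₂₂ - t₁₁) * htr - 2 * (t₁₂ + t₂₁) * hsym

end Identity

lemma det2_smul_left (c : ℝ) (u v : Euc 2) : det2 (c • u) v = c * det2 u v := by
  simp only [det2, PiLp.smul_apply, smul_eq_mul]
  ring

/-- Charts of S are not required to be positively oriented. Locally the sign of a transition
determinant is a constant s, which can be absorbed into the constant of the Piola identity. -/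
lemma eventually_abs_eq_mul {X : Type*} [TopologicalSpace X] {δ : X → ℝ} {x : X}
    (hc : ContinuousAt δ x) (h : δ x ≠ 0) : ∃ s : ℝ, ∀ᶠ y in 𝓝 x, |δ y| = s * δ y := by
  rcases h.lt_or_gt with h | h
  · exact ⟨-1, (hc.eventually_lt continuousAt_const h).mono fun y hy => by
      rw [abs_of_neg hy, neg_one_mul]⟩
  · exact ⟨1, (continuousAt_const.eventually_lt hc h).mono fun y hy => by
      rw [abs_of_pos hy, one_mul]⟩

/-! ### Transfer of the pointwise identity to an arbitrary chart. -/

section Identity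

variable {S M : Type*} [TopologicalSpace S] [ChartedSpace (Euc 2) S] [IsManifold (𝓡 2) ∞ S]
  [TopologicalSpace M] [ChartedSpace (Euc 4) M] [IsManifold (𝓡 4) ∞ M]
  {oS : ManifoldOrientation 2 S} {oM : ManifoldOrientation 4 M} {g : SmoothMetric 4 M}
  {F : ℝ → S → M} {σ : ∀ p : S, Tan 4 (F 0 p)} {ε : ℝ}

lemma det2_toChart {p q r : S} (hp : r ∈ (chartAt (Euc 2) p).source)
    (hq : r ∈ (chartAt (Euc 2) q).source) (A B : Tan 2 r) :
    det2 (toChart p r A) (toChart p r B) =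
      detL (fderiv ℝ (trans q p) (chartAt (Euc 2) q r)) * det2 (toChart q r A) (toChart q r B) := by
  rw [toChart_trans hq hp, toChart_trans hq hp, det2_map]

lemma abs_det2_mul_areaDensity (g : SmoothMetric 4 M) (u : S → M) {p q r : S}
    (hp : r ∈ (chartAt (Euc 2) p).source) (hq : r ∈ (chartAt (Euc 2) q).source) (a b : Euc 2) :
    |det2 a b| * areaDensity g u q r = |detL (fderiv ℝ (trans q p) (chartAt (Euc 2) q r))| *
      pairArea g u r (ofChart p r a) (ofChart p r b) := by
  have h := det2_toChart hp hq (ofChart p r a) (ofChart p r b)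
  rw [toChart_ofChart hp, toChart_ofChart hp] at h
  rw [h, pairArea_eq g u hq, abs_mul]
  ring

/-- The second time derivative of the area density is, up to a divergence, the integrand of
the second variation formula times the density, in every chart. -/
lemma deriv_deriv_areaDensity (hf : IsMinimalImmersion g (F 0)) (hσ : SmoothAlong (F 0) σ)
    (hn : ∀ p, IsNormal g (F 0) p (σ p)) (hε : 0 < ε)
    (hF : ContMDiffOn (𝓘(ℝ, ℝ).prod (𝓡 2)) (𝓡 4) ∞ (fun z : ℝ × S => F z.1 z.2)
      (Ioo (-ε) ε ×ˢ (univ : Set S)))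
    (hvel : ∀ p, mfderiv 𝓘(ℝ, ℝ) (𝓡 4) (fun t : ℝ => F t p) 0 (1 : ℝ) = σ p) {p q : S}
    (hq : p ∈ (chartAt (Euc 2) q).source) {U : Euc 2 → Euc 2}
    (hU : ∀ y, U y = areaDensity g (F 0) q ((chartAt (Euc 2) q).symm y) •
      toChart q _ (variationField oS oM g F σ ((chartAt (Euc 2) q).symm y))) :
    ContDiffAt ℝ 1 U (chartAt (Euc 2) q p) ∧ ∀ e, pullForm g (F 0) p e e = 1 →
      deriv (deriv fun t => areaDensity g (F t) q p) 0 =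
        integrand oS oM g (F 0) σ p e * areaDensity g (F 0) q p
          + div2 U (chartAt (Euc 2) q p) := by
  have hp := mem_chart_source (Euc 2) p
  obtain ⟨a, b, hab, hone, V, hV, hVs, hid⟩ :=
    exists_deriv_deriv_pairArea (oS := oS) (oM := oM) hf hσ hn hε hF hvel p
  have hab' : |det2 a b| ≠ 0 := abs_ne_zero.2 hab
  set δ : Euc 2 → ℝ := fun y => detL (fderiv ℝ (trans q p) y) with hδ
  set y₀ := chartAt (Euc 2) q p with hy₀
  have hdom := (isOpen_transDom (n := 2) q p).mem_nhds (chart_mem_transDom hq hp)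
  have hτ : ContDiffAt ℝ ∞ (trans q p) y₀ := (contDiffOn_trans q p).contDiffAt hdom
  have hτ0 : trans q p y₀ = chartAt (Euc 2) p p := by
    rw [trans, hy₀, (chartAt (Euc 2) q).left_inv hq]
  have hδ0 : δ y₀ ≠ 0 := by
    intro h0
    have := det2_toChart hp hq (ofChart p p a) (ofChart p p b)
    rw [toChart_ofChart hp, toChart_ofChart hp] at this
    exact hab (this.trans (by rw [show detL (fderiv ℝ (trans q p) (chartAt (Euc 2) q p)) = 0
      from h0, zero_mul]))
  have hδc : ContinuousAt δ y₀ := by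
    have h1 : ContinuousAt (fderiv ℝ (trans q p)) y₀ :=
      (hτ.fderiv_right (m := 0) (by norm_cast)).continuousAt
    have h2 (w : Euc 2) (i : Fin 2) : ContinuousAt (fun y => fderiv ℝ (trans q p) y w i) y₀ :=
      (EuclideanSpace.proj i).continuous.continuousAt.comp (h1.clm_apply continuousAt_const)
    exact ((h2 _ 0).mul (h2 _ 1)).sub ((h2 _ 1).mul (h2 _ 0))
  obtain ⟨s, hs⟩ := eventually_abs_eq_mul hδc hδ0
  have hdens {y : Euc 2} (hy : y ∈ transDom 2 q p) (u : S → M) :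
      areaDensity g u q ((chartAt (Euc 2) q).symm y) = |δ y| / |det2 a b| *
        pairArea g u ((chartAt (Euc 2) q).symm y) (ofChart p _ a) (ofChart p _ b) := by
    have := abs_det2_mul_areaDensity g u hy.2 ((chartAt (Euc 2) q).map_target hy.1) a b
    rw [(chartAt (Euc 2) q).right_inv hy.1] at this
    field_simp
    linarith
  -- The density in the chart at q is |δ|/|det2 a b| times the area of the pair a, b. Since |δ| = sδ
  -- near the point, the two fields correspond with constant s/|det2 a b|, and the factor δ comes
  -- from `det2_map`.
  have key := div2_of_det2_eq (U := U) (V := V) (τ := trans q p) (x := y₀) (c := s / |det2 a b|)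
    hτ (hτ0 ▸ hVs) (by
      filter_upwards [hdom, hs] with y hy hsy w
      have hr := (chartAt (Euc 2) q).map_target hy.1
      have hsymm : (chartAt (Euc 2) p).symm (trans q p y) = (chartAt (Euc 2) q).symm y :=
        (chartAt (Euc 2) p).left_inv hy.2
      have hW := toChart_trans hr hy.2
        (variationField oS oM g F σ ((chartAt (Euc 2) q).symm y))
      rw [(chartAt (Euc 2) q).right_inv hy.1] at hW
      rw [hU, hV, hsymm, hW, det2_smul_left, det2_smul_left, det2_map, hdens hy, hsy]
      ring)
  refine ⟨key.1, fun e he => ?_⟩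
  have hκ : areaDensity g (F 0) q p = |δ y₀| / |det2 a b| := by
    have := hdens (mem_of_mem_nhds hdom) (F 0)
    rw [(chartAt (Euc 2) q).left_inv hq, hone, mul_one] at this
    rw [this]
  have hfun : (fun t => areaDensity g (F t) q p) = fun t => |δ y₀| / |det2 a b| *
      pairArea g (F t) p (ofChart p p a) (ofChart p p b) := by
    funext t
    have := hdens (mem_of_mem_nhds hdom) (F t)
    rwa [(chartAt (Euc 2) q).left_inv hq] at this
  rw [hfun, deriv_const_mul_field', deriv_const_mul_field, hid e he, key.2, hκ, hτ0,
    hs.self_of_nhds]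
  ring

end Identity

/-! ### The area measure -/

lemma det_eq_detL (A : Euc 2 →L[ℝ] Euc 2) : A.det = detL A := by
  rw [ContinuousLinearMap.det, ← LinearMap.det_toMatrix (EuclideanSpace.basisFun (Fin 2) ℝ).toBasis,
    Matrix.det_fin_two]
  simp [LinearMap.toMatrix_apply, detL, det2, stdVec]
  ring

section

variable {S : Type*} [TopologicalSpace S] [ChartedSpace (Euc 2) S] [MeasurableSpace S] [BorelSpace S]

lemma measurableSet_chart_preimage (q : S) {s : Set S} (hs : MeasurableSet s) :
    MeasurableSet ((chartAt (Euc 2) q).symm ⁻¹' s ∩ (chartAt (Euc 2) q).target) := by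
  have hc := continuousOn_iff_continuous_domRestrict.1 (chartAt (Euc 2) q).continuousOn_symm
  have := (chartAt (Euc 2) q).open_target.measurableSet.subtype_image (hc.measurable hs)
  convert this using 1
  ext y
  simp only [mem_inter_iff, mem_preimage, mem_image, Set.domRestrict_apply, Subtype.exists]
  constructor
  · rintro ⟨h1, h2⟩
    exact ⟨y, h2, h1, rfl⟩
  · rintro ⟨y, h2, h1, rfl⟩
    exact ⟨h1, h2⟩

lemma aemeasurable_chart_symm (q : S) (d : Euc 2 → ENNReal) :
    AEMeasurable (chartAt (Euc 2) q).symm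
      ((volume.restrict (chartAt (Euc 2) q).target).withDensity d) :=
  ((chartAt (Euc 2) q).continuousOn_symm.aemeasurable
    (chartAt (Euc 2) q).open_target.measurableSet).mono_ac (withDensity_absolutelyContinuous _ _)

end

section Area

variable {S M : Type*} [TopologicalSpace S] [ChartedSpace (Euc 2) S] [IsManifold (𝓡 2) ∞ S]
  [TopologicalSpace M] [ChartedSpace (Euc 4) M] [IsManifold (𝓡 4) ∞ M] (g : SmoothMetric 4 M)
  {u : S → M}

lemma continuousOn_areaDensity (hu : ContMDiff (𝓡 2) (𝓡 4) ∞ u) (q : S) :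
    ContinuousOn (fun y => areaDensity g u q ((chartAt (Euc 2) q).symm y))
      (chartAt (Euc 2) q).target := by
  intro y hy
  refine ContinuousAt.continuousWithinAt ?_
  set m := u ((chartAt (Euc 2) q).symm y) with hm
  have hO := isOpen_locDom q m hu.continuous
  have hyO : y ∈ locDom q m u := ⟨hy, mem_chart_source (Euc 4) _⟩
  have hs := LocalMetric.contDiffOn_gramDet (L := localMetric g m) hO (mapsTo_loc g q m u)
    (contDiffOn_loc q m hu) (stdVec 0) (stdVec 1)
  have hc : ContinuousAt (fun y => √((localMetric g m).gramDet (loc q m u) (stdVec 0)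
      (stdVec 1) y)) y :=
    ((hs y hyO).contDiffAt (hO.mem_nhds hyO)).continuousAt.sqrt
  refine hc.congr (Filter.eventuallyEq_of_mem (hO.mem_nhds hyO) fun z hz => ?_)
  have hr := (chartAt (Euc 2) q).map_target hz.1
  have key (a b : Euc 2) : pullForm g u ((chartAt (Euc 2) q).symm z) (ofChart q _ a)
      (ofChart q _ b) = (localMetric g m).gram (loc q m u) a b z := by
    rw [pullForm, inner_eq_chartG g hz.2,
      toChart_mfderiv_ofChart ((hu _).mdifferentiableAt (by simp)) hr hz.2,
      toChart_mfderiv_ofChart ((hu _).mdifferentiableAt (by simp)) hr hz.2,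
      (chartAt (Euc 2) q).right_inv hz.1]
    rfl
  rw [areaDensity_eq, pairArea, key, key, key, LocalMetric.gramDet]

lemma areaDensity_trans {q q' r : S} (hq : r ∈ (chartAt (Euc 2) q).source)
    (hq' : r ∈ (chartAt (Euc 2) q').source) : areaDensity g u q r =
      |detL (fderiv ℝ (trans q q') (chartAt (Euc 2) q r))| * areaDensity g u q' r := by
  have h := abs_det2_mul_areaDensity g u hq' hq (stdVec 0) (stdVec 1)
  rw [← areaDensity_eq] at h
  rw [← h]
  simp [det2, stdVec]

variable [MeasurableSpace S] [BorelSpace S]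

lemma chartAreaMeasure_apply (q : S) {s : Set S} (hs : MeasurableSet s) :
    chartAreaMeasure (pullForm g u) q s =
      ∫⁻ y in (chartAt (Euc 2) q).symm ⁻¹' s ∩ (chartAt (Euc 2) q).target,
        ENNReal.ofReal (areaDensity g u q ((chartAt (Euc 2) q).symm y)) := by
  rw [chartAreaMeasure, Measure.map_apply_of_aemeasurable (aemeasurable_chart_symm q _) hs,
    withDensity_apply' _ _, Measure.restrict_restrict'
      (chartAt (Euc 2) q).open_target.measurableSet]
  rfl

lemma chartAreaMeasure_inter_source (q : S) {s : Set S} (hs : MeasurableSet s) :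
    chartAreaMeasure (pullForm g u) q (s ∩ (chartAt (Euc 2) q).source) =
      chartAreaMeasure (pullForm g u) q s := by
  rw [chartAreaMeasure_apply g q hs,
    chartAreaMeasure_apply g q (hs.inter (chartAt (Euc 2) q).open_source.measurableSet)]
  congr 2
  ext y
  simp only [mem_inter_iff, mem_preimage]
  exact ⟨fun h => ⟨h.1.1, h.2⟩, fun h => ⟨⟨h.1, (chartAt (Euc 2) q).map_target h.2⟩, h.2⟩⟩

/-- The change of variables formula. -/
lemma chartAreaMeasure_eq (q q' : S) {s : Set S} (hs : MeasurableSet s)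
    (hq : s ⊆ (chartAt (Euc 2) q).source) (hq' : s ⊆ (chartAt (Euc 2) q').source) :
    chartAreaMeasure (pullForm g u) q s = chartAreaMeasure (pullForm g u) q' s := by
  rw [chartAreaMeasure_apply g q hs, chartAreaMeasure_apply g q' hs]
  set E := (chartAt (Euc 2) q).symm ⁻¹' s ∩ (chartAt (Euc 2) q).target with hE
  have hEdom : E ⊆ transDom 2 q q' := fun y hy => ⟨hy.2, hq' hy.1⟩
  have himg : (chartAt (Euc 2) q').symm ⁻¹' s ∩ (chartAt (Euc 2) q').target = trans q q' '' E := by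
    ext z
    constructor
    · rintro ⟨h1, h2⟩
      refine ⟨chartAt (Euc 2) q ((chartAt (Euc 2) q').symm z), ⟨?_, ?_⟩, ?_⟩
      · rw [mem_preimage, (chartAt (Euc 2) q).left_inv (hq h1)]
        exact h1
      · exact (chartAt (Euc 2) q).map_source (hq h1)
      · rw [trans, (chartAt (Euc 2) q).left_inv (hq h1), (chartAt (Euc 2) q').right_inv h2]
    · rintro ⟨y, hy, rfl⟩
      have hy' := hEdom hy
      refine ⟨?_, (chartAt (Euc 2) q').map_source hy'.2⟩
      rw [mem_preimage, trans, (chartAt (Euc 2) q').left_inv hy'.2]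
      exact hy.1
  have hinj : InjOn (trans q q') E := by
    intro y hy z hz h
    have := congrArg (chartAt (Euc 2) q').symm h
    rw [trans, trans, (chartAt (Euc 2) q').left_inv (hEdom hy).2,
      (chartAt (Euc 2) q').left_inv (hEdom hz).2] at this
    exact (chartAt (Euc 2) q).symm.injOn hy.2 hz.2 this
  have hd : ∀ y ∈ E, HasFDerivWithinAt (trans q q') (fderiv ℝ (trans q q') y) E y := fun y hy =>
    (((contDiffOn_trans q q').contDiffAt ((isOpen_transDom q q').mem_nhds
      (hEdom hy))).differentiableAt (by simp)).hasFDerivAt.hasFDerivWithinAt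
  have hEm : MeasurableSet E := measurableSet_chart_preimage q hs
  rw [himg, lintegral_image_eq_lintegral_abs_det_fderiv_mul volume hEm hd hinj]
  refine setLIntegral_congr_fun hEm fun y hy => ?_
  have hr := (chartAt (Euc 2) q).map_target hy.2
  have hsymm : (chartAt (Euc 2) q').symm (trans q q' y) = (chartAt (Euc 2) q).symm y := by
    rw [trans, (chartAt (Euc 2) q').left_inv (hEdom hy).2]
  simp only [hsymm]
  rw [areaDensity_trans g hr (hEdom hy).2, (chartAt (Euc 2) q).right_inv hy.2, det_eq_detL,
    ENNReal.ofReal_mul (abs_nonneg _)]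

variable [SecondCountableTopology S]

/-- The area measure is given by the local formula in every chart domain. -/
lemma areaMeasure_apply (q : S) {s : Set S} (hs : MeasurableSet s)
    (hq : s ⊆ (chartAt (Euc 2) q).source) :
    areaMeasure (pullForm g u) s = chartAreaMeasure (pullForm g u) q s := by
  refine le_antisymm ?_ (Measure.le_iff'.1 (le_iSup (chartAreaMeasure (pullForm g u)) q) s)
  obtain ⟨c, hc, hcov⟩ := TopologicalSpace.countable_cover_nhds
    fun r : S => (chartAt (Euc 2) r).open_source.mem_nhds (mem_chart_source (Euc 2) r)
  have hne : c.Nonempty := by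
    by_contra h
    rw [not_nonempty_iff_eq_empty.1 h] at hcov
    rw [biUnion_empty] at hcov
    exact (hcov ▸ mem_univ q : q ∈ (∅ : Set S))
  obtain ⟨e, he⟩ := hc.exists_eq_range hne
  -- Disjoint measurable pieces of countably many chart domains. Gluing the chart measures along
  -- them gives a measure that dominates every chart measure, hence the supremum, and that agrees
  -- with the local formula.
  set D : ℕ → Set S := disjointed fun n => (chartAt (Euc 2) (e n)).source with hD
  have hDm (n : ℕ) : MeasurableSet (D n) :=
    .disjointed (fun n => (chartAt (Euc 2) (e n)).open_source.measurableSet) n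
  have hDs (n : ℕ) : D n ⊆ (chartAt (Euc 2) (e n)).source := disjointed_subset _ n
  have hDd : Pairwise (Function.onFun Disjoint D) := disjoint_disjointed _
  have hDu : ⋃ n, D n = univ := by
    rw [hD, iUnion_disjointed, ← hcov, he, biUnion_range]
  have hsplit (ν : Measure S) {s : Set S} (hs : MeasurableSet s) : ν s = ∑' n, ν (s ∩ D n) := by
    rw [← measure_iUnion (fun i j hij => (hDd hij).mono inter_subset_right inter_subset_right)
      fun n => hs.inter (hDm n), ← inter_iUnion, hDu, inter_univ]
  have hle : areaMeasure (pullForm g u) ≤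
      Measure.sum fun n => (chartAreaMeasure (pullForm g u) (e n)).restrict (D n) := by
    refine iSup_le fun q' => Measure.le_iff.2 fun s hs => ?_
    rw [Measure.sum_apply _ hs, hsplit _ hs]
    refine ENNReal.tsum_le_tsum fun n => ?_
    rw [Measure.restrict_apply hs, ← chartAreaMeasure_inter_source g q' (hs.inter (hDm n)),
      chartAreaMeasure_eq g q' (e n) ((hs.inter (hDm n)).inter
        (chartAt (Euc 2) q').open_source.measurableSet) inter_subset_right
        ((inter_subset_left.trans inter_subset_right).trans (hDs n))]
    exact measure_mono inter_subset_left
  refine (Measure.le_iff'.1 hle s).trans ?_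
  rw [Measure.sum_apply _ hs, hsplit (chartAreaMeasure (pullForm g u) q) hs]
  refine ENNReal.tsum_le_tsum fun n => ?_
  rw [Measure.restrict_apply hs, chartAreaMeasure_eq g q (e n) (hs.inter (hDm n))
    (inter_subset_left.trans hq) (inter_subset_right.trans (hDs n))]

lemma areaMeasure_restrict (q : S) :
    (areaMeasure (pullForm g u)).restrict (chartAt (Euc 2) q).source =
      chartAreaMeasure (pullForm g u) q := by
  ext s hs
  have ho := (chartAt (Euc 2) q).open_source.measurableSet
  rw [Measure.restrict_apply hs, areaMeasure_apply g q (hs.inter ho) inter_subset_right,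
    chartAreaMeasure_inter_source g q hs]

/-- Integrals of functions supported in a chart domain. -/
lemma integral_areaMeasure (hu : ContMDiff (𝓡 2) (𝓡 4) ∞ u) (q : S) {ψ : S → ℝ}
    (hψ : Measurable ψ) (h0 : ∀ r ∉ (chartAt (Euc 2) q).source, ψ r = 0) :
    ∫ r, ψ r ∂(areaMeasure (pullForm g u)) = ∫ y in (chartAt (Euc 2) q).target,
      areaDensity g u q ((chartAt (Euc 2) q).symm y) * ψ ((chartAt (Euc 2) q).symm y) := by
  rw [← setIntegral_eq_integral_of_forall_compl_eq_zero h0, areaMeasure_restrict, chartAreaMeasure,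
    integral_map (aemeasurable_chart_symm q _) hψ.aestronglyMeasurable]
  have hm : AEMeasurable (fun y => ENNReal.ofReal
      (areaDensity g u q ((chartAt (Euc 2) q).symm y)))
        (volume.restrict (chartAt (Euc 2) q).target) :=
    ((continuousOn_areaDensity g hu q).aemeasurable
      (chartAt (Euc 2) q).open_target.measurableSet).ennreal_ofReal
  refine (integral_withDensity_eq_integral_toReal_smul₀ hm (Filter.Eventually.of_forall
    fun _ => ENNReal.ofReal_lt_top) _).trans ?_
  refine integral_congr_ae (Filter.Eventually.of_forall fun y => ?_)
  simp only [ENNReal.toReal_ofReal (Real.sqrt_nonneg _), areaDensity, smul_eq_mul]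

/-- Each point has a neighbourhood whose coordinates lie in a compact ball inside the chart, where
the density is continuous, hence integrable. -/
lemma areaMeasure_lt_top (hu : ContMDiff (𝓡 2) (𝓡 4) ∞ u) {K : Set S} (hK : IsCompact K) :
    areaMeasure (pullForm g u) K < ⊤ := by
  refine hK.measure_lt_top_of_nhdsWithin fun p _ => ?_
  have hp := mem_chart_source (Euc 2) p
  obtain ⟨r, hr, hball⟩ := Metric.nhds_basis_closedBall.mem_iff.1
    ((chartAt (Euc 2) p).open_target.mem_nhds ((chartAt (Euc 2) p).map_source hp))
  set s := (chartAt (Euc 2) p).source ∩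
    chartAt (Euc 2) p ⁻¹' (Metric.ball (chartAt (Euc 2) p p) r) with hs
  have hso : IsOpen s := (chartAt (Euc 2) p).isOpen_inter_preimage Metric.isOpen_ball
  refine ⟨s, mem_nhdsWithin_of_mem_nhds (hso.mem_nhds ⟨hp, Metric.mem_ball_self hr⟩), ?_⟩
  rw [areaMeasure_apply g p hso.measurableSet inter_subset_left,
    chartAreaMeasure_apply g p hso.measurableSet]
  have hsub : (chartAt (Euc 2) p).symm ⁻¹' s ∩ (chartAt (Euc 2) p).target ⊆
      Metric.closedBall (chartAt (Euc 2) p p) r := by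
    rintro y ⟨h1, h2⟩
    have := h1.2
    rw [mem_preimage, (chartAt (Euc 2) p).right_inv h2] at this
    exact Metric.ball_subset_closedBall this
  refine (lintegral_mono_set hsub).trans_lt ?_
  have hint : IntegrableOn (fun y => areaDensity g u p ((chartAt (Euc 2) p).symm y))
      (Metric.closedBall (chartAt (Euc 2) p p) r) :=
    ((continuousOn_areaDensity g hu p).mono hball).integrableOn_compact
      (isCompact_closedBall _ _)
  exact hint.lintegral_lt_top

end Area

/-! ### Differentiation under the integral sign and integrals of derivatives -/

lemma HasSecondDerivAt.sum {ι : Type*} {u : Finset ι} {a : ι → ℝ → ℝ} {c : ι → ℝ} {t : ℝ}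
    (h : ∀ i ∈ u, HasSecondDerivAt (a i) (c i) t) :
    HasSecondDerivAt (fun s => ∑ i ∈ u, a i s) (∑ i ∈ u, c i) t := by
  choose! a' h1 h2 using h
  exact ⟨fun s => ∑ i ∈ u, a' i s,
    ((Filter.eventually_all_finset u).2 h1).mono fun s hs => HasDerivAt.fun_sum hs,
    HasDerivAt.fun_sum h2⟩

lemma HasSecondDerivAt.congr {a b : ℝ → ℝ} {c t : ℝ} (h : HasSecondDerivAt a c t)
    (hab : b =ᶠ[𝓝 t] a) : HasSecondDerivAt b c t := by
  obtain ⟨a', h1, h2⟩ := h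
  refine ⟨a', ?_, h2⟩
  filter_upwards [h1, hab.eventuallyEq_nhds] with s h3 h4
  exact h3.congr_of_eventuallyEq h4

lemma integrableOn_mul_of_continuousOn {X : Type*} [TopologicalSpace X] [T2Space X]
    [MeasurableSpace X] [BorelSpace X] {μ : Measure X} [IsFiniteMeasureOnCompacts μ] {C : Set X}
    {r : X → ℝ} (hC : IsCompact C) {h : X → ℝ} (hh : ContinuousOn h C)
    (hr : Measurable r) (hb : ∀ y, |r y| ≤ 1) : IntegrableOn (fun y => h y * r y) C μ :=
  (hh.integrableOn_compact hC).mul_bdd hr.aestronglyMeasurable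
    (Filter.Eventually.of_forall hb)

section Parametric

variable {X : Type*} [NormedAddCommGroup X] [NormedSpace ℝ X] [MeasurableSpace X] [BorelSpace X]
  {μ : Measure X} [IsFiniteMeasureOnCompacts μ] {s : ℝ × X → ℝ} {C : Set X} {r : X → ℝ}

/-- The time derivative of s is continuous, so bounded, on a closed time interval times the compact
set C. With |r| ≤ 1 this bound is the dominating constant, and r need only be measurable. -/
lemma hasDerivAt_setIntegral (hC : IsCompact C) {δ : ℝ}
    (hs : ∀ t ∈ Ioo (-δ) δ, ∀ y ∈ C, ContDiffAt ℝ 1 s (t, y)) (hr : Measurable r)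
    (hb : ∀ y, |r y| ≤ 1) {t : ℝ} (ht : t ∈ Ioo (-δ) δ) :
    HasDerivAt (fun t => ∫ y in C, s (t, y) * r y ∂μ)
      (∫ y in C, fderiv ℝ s (t, y) (1, 0) * r y ∂μ) t := by
  obtain ⟨η, hη, hsub⟩ := Metric.nhds_basis_closedBall.mem_iff.1 (isOpen_Ioo.mem_nhds ht)
  have hcont : ContinuousOn (fun z => fderiv ℝ s z (1, 0)) (Ioo (-δ) δ ×ˢ C) := fun z hz =>
    (((hs z.1 hz.1 z.2 hz.2).fderiv_right (m := 0) le_rfl).continuousAt.clm_apply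
      continuousAt_const).continuousWithinAt
  have hslice (t' : ℝ) : Continuous fun y : X => (t', y) := by fun_prop
  obtain ⟨B, hB⟩ := ((isCompact_closedBall t η).prod hC).exists_bound_of_continuousOn
    (hcont.mono (prod_mono hsub Subset.rfl))
  have hs0 (t' : ℝ) (ht' : t' ∈ Ioo (-δ) δ) : ContinuousOn (fun y => s (t', y)) C := fun y hy =>
    ((hs t' ht' y hy).continuousAt.comp (hslice t').continuousAt).continuousWithinAt
  refine (hasDerivAt_integral_of_dominated_loc_of_deriv_le (μ := μ.restrict C)
    (F := fun t y => s (t, y) * r y) (F' := fun t y => fderiv ℝ s (t, y) (1, 0) * r y)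
    (bound := fun _ => B) (Metric.closedBall_mem_nhds t hη) ?_ ?_ ?_ ?_ ?_ ?_).2
  · filter_upwards [isOpen_Ioo.mem_nhds ht] with t' ht'
    exact (integrableOn_mul_of_continuousOn hC (hs0 t' ht') hr hb).aestronglyMeasurable
  · exact integrableOn_mul_of_continuousOn hC (hs0 t ht) hr hb
  · refine (integrableOn_mul_of_continuousOn hC (h := fun y => fderiv ℝ s (t, y) (1, 0))
      ?_ hr hb).aestronglyMeasurable
    exact hcont.comp (hslice t).continuousOn fun y hy => ⟨ht, hy⟩
  · refine (ae_restrict_iff' hC.measurableSet).2 (Filter.Eventually.of_forall fun y hy t' ht' => ?_)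
    rw [norm_mul]
    have h0 := hB (t', y) ⟨ht', hy⟩
    exact (mul_le_of_le_one_right (norm_nonneg _) (hb y)).trans h0
  · exact integrableOn_const hC.measure_lt_top.ne
  · refine (ae_restrict_iff' hC.measurableSet).2 (Filter.Eventually.of_forall fun y hy t' ht' => ?_)
    have h0 := ((hs t' (hsub ht') y hy).differentiableAt one_ne_zero).hasFDerivAt
    have h1 : HasDerivAt (fun t : ℝ => (t, y)) ((1 : ℝ), (0 : X)) t' :=
      (hasDerivAt_id t').prodMk (hasDerivAt_const t' y)
    exact (h0.comp_hasDerivAt t' h1).mul_const (r y)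

lemma hasSecondDerivAt_setIntegral (hC : IsCompact C)
    (hs : ∀ y ∈ C, ContDiffAt ℝ 2 s (0, y)) (hr : Measurable r) (hb : ∀ y, |r y| ≤ 1) :
    HasSecondDerivAt (fun t => ∫ y in C, s (t, y) * r y ∂μ)
      (∫ y in C, deriv (deriv fun t => s (t, y)) 0 * r y ∂μ) 0 := by
  -- Regularity is assumed at time 0 only. It is an open condition, so the tube lemma extends it
  -- over C to a common time interval.
  have hU : IsOpen {z | ContDiffAt ℝ 2 s z} :=
    isOpen_iff_mem_nhds.2 fun z hz => ContDiffAt.eventually hz (by simp)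
  obtain ⟨A, B, hA, hB, h0, hCB, hsub⟩ := generalized_tube_lemma (isCompact_singleton (x := (0 : ℝ)))
    hC hU (by rintro ⟨t, y⟩ ⟨rfl, hy⟩; exact hs y hy)
  obtain ⟨δ, hδ, hδA⟩ := Metric.isOpen_iff.1 hA 0 (h0 rfl)
  rw [Real.ball_eq_Ioo, zero_sub, zero_add] at hδA
  have hs2 : ∀ t ∈ Ioo (-δ) δ, ∀ y ∈ C, ContDiffAt ℝ 2 s (t, y) := fun t ht y hy =>
    hsub ⟨hδA ht, hCB hy⟩
  have h0δ : (0 : ℝ) ∈ Ioo (-δ) δ := ⟨by linarith, hδ⟩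
  have hs' : ∀ t ∈ Ioo (-δ) δ, ∀ y ∈ C, ContDiffAt ℝ 1 (fun z => fderiv ℝ s z (1, 0)) (t, y) :=
    fun t ht y hy => ((hs2 t ht y hy).fderiv_right (m := 1) le_rfl).clm_apply contDiffAt_const
  refine ⟨fun t => ∫ y in C, fderiv ℝ s (t, y) (1, 0) * r y ∂μ, ?_, ?_⟩
  · filter_upwards [isOpen_Ioo.mem_nhds h0δ] with t ht
    exact hasDerivAt_setIntegral hC (fun t ht y hy => (hs2 t ht y hy).of_le (by simp)) hr hb ht
  · have := hasDerivAt_setIntegral (μ := μ) hC hs' hr hb h0δ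
    convert this using 1
    refine setIntegral_congr_fun hC.measurableSet fun y hy => ?_
    rw [deriv_deriv_eq_fderiv_fderiv (hs y hy)]

end Parametric

/-- Integration by parts against the constant function 1. -/
lemma integral_fderiv_of_hasCompactSupport {P : Euc 2 → ℝ} (hP : ContDiff ℝ 1 P)
    (hc : HasCompactSupport P) (v : Euc 2) : ∫ y, fderiv ℝ P y v = 0 := by
  have hd : Continuous fun y => fderiv ℝ P y v :=
    (hP.continuous_fderiv one_ne_zero).clm_apply continuous_const
  have hdc : HasCompactSupport fun y => fderiv ℝ P y v := hc.fderiv_apply ℝ v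
  have := integral_mul_fderiv_eq_neg_fderiv_mul_of_integrable (μ := volume) (𝕜 := ℝ)
    (f := fun _ : Euc 2 => (1 : ℝ)) (g := P) (v := v) (by simp)
    (by simpa using hd.integrable_of_hasCompactSupport hdc)
    (by simpa using hP.continuous.integrable_of_hasCompactSupport hc)
    (fun x _ => differentiableAt_const _) (fun x _ => hP.differentiable one_ne_zero x)
  simpa using this

/-- The divergence theorem for `ρ U`, with `ρ` compactly supported in the domain of `U`. -/
lemma integral_mul_div2 {ρ : Euc 2 → ℝ} {U : Euc 2 → Euc 2} {O C : Set (Euc 2)} (hO : IsOpen O)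
    (hC : IsCompact C) (hCO : C ⊆ O) (hρ : ContDiffOn ℝ 1 ρ O) (h0 : ∀ y ∉ C, ρ y = 0)
    (hU : ContDiffOn ℝ 1 U O) :
    ∫ y in O, (ρ y * div2 U y + fderiv ℝ ρ y (U y)) = 0 := by
  -- U is regular on O only, but ρ vanishes off the compact set C inside O, so the product is C¹ on
  -- the whole plane.
  have hsm (i : Fin 2) : ContDiff ℝ 1 fun y => ρ y * U y i := by
    rw [contDiff_iff_contDiffAt]
    intro y
    by_cases hy : y ∈ C
    · have hi : ContDiffAt ℝ 1 (fun y => U y i) y :=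
        (contDiffAt_euclidean.1 ((hU y (hCO hy)).contDiffAt (hO.mem_nhds (hCO hy)))) i
      exact ((hρ y (hCO hy)).contDiffAt (hO.mem_nhds (hCO hy))).mul hi
    · refine contDiffAt_const (c := (0 : ℝ)) |>.congr_of_eventuallyEq ?_
      filter_upwards [hC.isClosed.isOpen_compl.mem_nhds hy] with z hz
      rw [h0 z hz, zero_mul]
  have hsupp (i : Fin 2) : HasCompactSupport fun y => ρ y * U y i :=
    HasCompactSupport.intro hC fun y hy => by rw [h0 y hy, zero_mul]
  have hint (i : Fin 2) : Integrable fun y => fderiv ℝ (fun y => ρ y * U y i) y (stdVec i) :=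
    (((hsm i).continuous_fderiv one_ne_zero).clm_apply continuous_const).integrable_of_hasCompactSupport
      ((hsupp i).fderiv_apply ℝ _)
  have key : ∀ y ∈ O, ρ y * div2 U y + fderiv ℝ ρ y (U y) =
      ∑ i, fderiv ℝ (fun y => ρ y * U y i) y (stdVec i) := by
    intro y hy
    have hUy : DifferentiableAt ℝ U y :=
      ((hU y hy).contDiffAt (hO.mem_nhds hy)).differentiableAt one_ne_zero
    have hρy : DifferentiableAt ℝ ρ y :=
      ((hρ y hy).contDiffAt (hO.mem_nhds hy)).differentiableAt one_ne_zero
    have hi (i : Fin 2) : fderiv ℝ (fun y => ρ y * U y i) y (stdVec i) =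
        ρ y * (fderiv ℝ U y (stdVec i)) i + U y i * fderiv ℝ ρ y (stdVec i) := by
      have h1 : HasFDerivAt (fun y => U y i) ((EuclideanSpace.proj i).comp (fderiv ℝ U y)) y :=
        (EuclideanSpace.proj (𝕜 := ℝ) i).hasFDerivAt.comp y hUy.hasFDerivAt
      rw [(hρy.hasFDerivAt.fun_mul h1).fderiv]
      simp
    have hl : fderiv ℝ ρ y (U y) =
        U y 0 * fderiv ℝ ρ y (stdVec 0) + U y 1 * fderiv ℝ ρ y (stdVec 1) := by
      conv_lhs => rw [euc2_eq (U y)]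
      simp
    rw [hl, Fin.sum_univ_two, hi, hi, div2]
    ring
  rw [setIntegral_congr_fun hO.measurableSet key, setIntegral_eq_integral_of_forall_compl_eq_zero,
    integral_finsetSum _ fun i _ => hint i, Finset.sum_eq_zero]
  · exact fun i _ => integral_fderiv_of_hasCompactSupport (hsm i) (hsupp i) _
  · intro y hy
    refine Finset.sum_eq_zero fun i _ => ?_
    have hz : (fun y => ρ y * U y i) =ᶠ[𝓝 y] fun _ => 0 := by
      filter_upwards [hC.isClosed.isOpen_compl.mem_nhds fun h => hy (hCO h)] with z hz
      rw [h0 z hz, zero_mul]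
    rw [hz.fderiv_eq]
    simp

/-! ### The second variation formula -/

/-- Compactness of K reduces to finitely many sets. Each is first replaced by the interior of a
compact neighbourhood, which makes the supports compact. -/
lemma exists_finite_partition {n : ℕ} {S : Type*} [TopologicalSpace S] [T2Space S]
    [SecondCountableTopology S] [ChartedSpace (Euc n) S] [IsManifold (𝓡 n) ∞ S] {K : Set S}
    (hK : IsCompact K) (V : S → Set S) (hV : ∀ q, V q ∈ 𝓝 q) :
    ∃ (u : Finset S) (ρ : S → S → ℝ), (∀ q, ContMDiff (𝓡 n) 𝓘(ℝ, ℝ) ∞ (ρ q)) ∧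
      (∀ q x, 0 ≤ ρ q x) ∧ (∀ q x, ρ q x ≤ 1) ∧ (∀ q, IsCompact (tsupport (ρ q))) ∧
      (∀ q, tsupport (ρ q) ⊆ V q) ∧ ∀ x ∈ K, ∑ q ∈ u, ρ q x = 1 := by
  have : LocallyCompactSpace S := ChartedSpace.locallyCompactSpace (Euc n) S
  choose C hC hCV hCc using fun q : S => exists_compact_subset isOpen_interior
    (mem_interior_iff_mem_nhds.2 (hV q))
  obtain ⟨u, -, hu⟩ := hK.elim_nhds_subcover (fun q => interior (C q))
    fun q _ => isOpen_interior.mem_nhds (hCV q)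
  classical
  -- Indices outside u are assigned the empty set, so their functions vanish and the sum over u is
  -- the full sum.
  obtain ⟨ρ, hρ⟩ := SmoothPartitionOfUnity.exists_isSubordinate (𝓡 n) hK.isClosed
    (fun q => if q ∈ u then interior (C q) else ∅)
    (fun q => by split_ifs; exacts [isOpen_interior, isOpen_empty]) (fun x hx => by
      obtain ⟨q, hq, hxq⟩ := mem_iUnion₂.1 (hu hx)
      exact mem_iUnion.2 ⟨q, by simpa [hq] using hxq⟩)
  have hsub (q : S) : tsupport (ρ q) ⊆ C q := by
    refine (hρ q).trans ?_
    beta_reduce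
    split_ifs
    exacts [interior_subset, empty_subset _]
  refine ⟨u, fun q => ρ q, fun q => (ρ q).contMDiff, fun q => ρ.nonneg q, fun q => ρ.le_one q,
    fun q => (hC q).of_isClosed_subset (isClosed_tsupport _) (hsub q),
    fun q => (hsub q).trans ((hCc q).trans interior_subset), fun x hx => ?_⟩
  refine ρ.sum_finsupport' x hx fun q hq => ?_
  by_contra hqu
  have h1 := hρ q (subset_tsupport _ ((ρ.mem_finsupport x).1 hq))
  simp [hqu] at h1

lemma pullForm_congr {S M : Type*} [TopologicalSpace S] [ChartedSpace (Euc 2) S]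
    [TopologicalSpace M] [ChartedSpace (Euc 4) M] [IsManifold (𝓡 4) ∞ M] (g : SmoothMetric 4 M) {u v : S → M} {r : S} (h : u =ᶠ[𝓝 r] v)
    (X Y : Tan 2 r) : pullForm g u r X Y = pullForm g v r X Y := by
  have hg : ∀ x x' : M, x = x' → ∀ a b : Euc 4, g.inner x a b = g.inner x' a b := by
    rintro x _ rfl a b
    rfl
  have hD : (mfderiv (𝓡 2) (𝓡 4) u r : Euc 2 →L[ℝ] Euc 4) = mfderiv (𝓡 2) (𝓡 4) v r :=
    h.mfderiv_eq
  refine (hg _ _ h.eq_of_nhds _ _).trans ?_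
  exact congrArg₂ (fun a b : Euc 4 => g.inner (v r) a b) (DFunLike.congr_fun hD X)
    (DFunLike.congr_fun hD Y)

/-! ### Consequences of the pointwise identity for a normal variation. -/

section

variable {S M : Type*} [TopologicalSpace S] [ChartedSpace (Euc 2) S] [IsManifold (𝓡 2) ∞ S]
  [TopologicalSpace M] [ChartedSpace (Euc 4) M] [IsManifold (𝓡 4) ∞ M]

/-- `F` is a variation, smooth for `|t| < ε` and fixed outside `K`, of the minimal immersion `F 0`
with normal velocity `σ`. -/
structure IsNormalVariation (g : SmoothMetric 4 M) (K : Set S) (ε : ℝ) (F : ℝ → S → M)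
    (σ : ∀ p : S, Tan 4 (F 0 p)) : Prop where
  minimal : IsMinimalImmersion g (F 0)
  smooth_field : SmoothAlong (F 0) σ
  normal : ∀ p, IsNormal g (F 0) p (σ p)
  pos : 0 < ε
  smooth : ContMDiffOn (𝓘(ℝ, ℝ).prod (𝓡 2)) (𝓡 4) ∞ (fun z : ℝ × S => F z.1 z.2)
    (Ioo (-ε) ε ×ˢ (univ : Set S))
  velocity : ∀ p, mfderiv 𝓘(ℝ, ℝ) (𝓡 4) (fun t : ℝ => F t p) 0 (1 : ℝ) = σ p
  fixed : ∀ t ∈ Ioo (-ε) ε, ∀ p ∉ K, F t p = F 0 p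
  field_eq_zero : ∀ p ∉ K, σ p = 0

/-- The variation field times the area density, in the chart `chartAt q`. -/
noncomputable def chartField (oS : ManifoldOrientation 2 S) (oM : ManifoldOrientation 4 M)
    (g : SmoothMetric 4 M) (F : ℝ → S → M) (σ : ∀ p : S, Tan 4 (F 0 p)) (q : S) (y : Euc 2) :
    Euc 2 :=
  areaDensity g (F 0) q ((chartAt (Euc 2) q).symm y) •
    toChart q _ (variationField oS oM g F σ ((chartAt (Euc 2) q).symm y))

namespace IsNormalVariation

variable {oS : ManifoldOrientation 2 S} {oM : ManifoldOrientation 4 M} {g : SmoothMetric 4 M}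
  {F : ℝ → S → M} {σ : ∀ p : S, Tan 4 (F 0 p)} {ε : ℝ} {K : Set S}

lemma areaDensity_pos (h : IsNormalVariation g K ε F σ) (oS : ManifoldOrientation 2 S) {q : S}
    {y : Euc 2} (hy : y ∈ (chartAt (Euc 2) q).target) :
    0 < areaDensity g (F 0) q ((chartAt (Euc 2) q).symm y) :=
  SurfaceVariation.areaDensity_pos g oS ((chartAt (Euc 2) q).map_target hy) (h.minimal.immersion _)

lemma contDiffAt_areaDensity (h : IsNormalVariation g K ε F σ) (oS : ManifoldOrientation 2 S)
    {q : S} {y : Euc 2} (hy : y ∈ (chartAt (Euc 2) q).target) :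
    ContDiffAt ℝ ∞ (fun z : ℝ × Euc 2 => areaDensity g (F z.1) q ((chartAt (Euc 2) q).symm z.2))
      (0, y) := by
  have hr := (chartAt (Euc 2) q).map_target hy
  have h0 := h.areaDensity_pos oS hy
  simp only [areaDensity_eq] at h0 ⊢
  have := contDiffAt_pairArea g h.pos h.smooth hr (stdVec 0) (stdVec 1) h0.ne'
  rwa [(chartAt (Euc 2) q).right_inv hy] at this

lemma contDiffOn_chartField (h : IsNormalVariation g K ε F σ) (oS : ManifoldOrientation 2 S)
    (oM : ManifoldOrientation 4 M) (q : S) :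
    ContDiffOn ℝ 1 (chartField oS oM g F σ q) (chartAt (Euc 2) q).target := by
  intro y hy
  have := (deriv_deriv_areaDensity h.minimal h.smooth_field h.normal h.pos h.smooth h.velocity
    ((chartAt (Euc 2) q).map_target hy) (U := chartField oS oM g F σ q) fun _ => rfl).1
  rw [(chartAt (Euc 2) q).right_inv hy] at this
  exact this.contDiffWithinAt

lemma deriv_deriv_eq (h : IsNormalVariation g K ε F σ) (oS : ManifoldOrientation 2 S)
    (oM : ManifoldOrientation 4 M) {q : S} {y : Euc 2} (hy : y ∈ (chartAt (Euc 2) q).target)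
    {e : Tan 2 ((chartAt (Euc 2) q).symm y)}
    (he : pullForm g (F 0) ((chartAt (Euc 2) q).symm y) e e = 1) :
    deriv (deriv fun t => areaDensity g (F t) q ((chartAt (Euc 2) q).symm y)) 0 =
      integrand oS oM g (F 0) σ _ e * areaDensity g (F 0) q ((chartAt (Euc 2) q).symm y)
        + div2 (chartField oS oM g F σ q) y := by
  have := (deriv_deriv_areaDensity h.minimal h.smooth_field h.normal h.pos h.smooth h.velocity
    ((chartAt (Euc 2) q).map_target hy) (U := chartField oS oM g F σ q) fun _ => rfl).2 e he
  rwa [(chartAt (Euc 2) q).right_inv hy] at this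

lemma continuousOn_div2 {U : Euc 2 → Euc 2} {O : Set (Euc 2)} (hO : IsOpen O)
    (hU : ContDiffOn ℝ 1 U O) : ContinuousOn (div2 U) O := by
  have hc (v : Euc 2) : ContinuousOn (fun y => fderiv ℝ U y v) O :=
    (hU.continuousOn_fderiv_of_isOpen hO le_rfl).clm_apply continuousOn_const
  have hp (v : Euc 2) (i : Fin 2) : ContinuousOn (fun y => fderiv ℝ U y v i) O :=
    (EuclideanSpace.proj (𝕜 := ℝ) i).continuous.comp_continuousOn (hc v)
  exact (hp _ _).add (hp _ _)

lemma continuousOn_deriv_deriv (h : IsNormalVariation g K ε F σ) (oS : ManifoldOrientation 2 S)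
    (q : S) : ContinuousOn
      (fun y => deriv (deriv fun t => areaDensity g (F t) q ((chartAt (Euc 2) q).symm y)) 0)
      (chartAt (Euc 2) q).target := by
  set s : ℝ × Euc 2 → ℝ := fun z => areaDensity g (F z.1) q ((chartAt (Euc 2) q).symm z.2) with hs
  have h2 : ∀ y ∈ (chartAt (Euc 2) q).target, ContDiffAt ℝ 2 s (0, y) := fun y hy =>
    (h.contDiffAt_areaDensity oS hy).of_le ENat.LEInfty.out
  have hc : ContinuousOn (fun y => fderiv ℝ (fun z => fderiv ℝ s z (1, 0)) (0, y) (1, 0))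
      (chartAt (Euc 2) q).target := by
    intro y hy
    have h1 : ContDiffAt ℝ 1 (fun z => fderiv ℝ s z (1, 0)) (0, y) :=
      ((h2 y hy).fderiv_right (m := 1) le_rfl).clm_apply contDiffAt_const
    have h0 : ContinuousAt (fun z => fderiv ℝ (fun z => fderiv ℝ s z (1, 0)) z (1, 0)) (0, y) :=
      ((h1.fderiv_right (m := 0) le_rfl).continuousAt).clm_apply continuousAt_const
    exact (ContinuousAt.comp (f := fun y : Euc 2 => ((0 : ℝ), y)) h0
      (by fun_prop)).continuousWithinAt
  exact hc.congr fun y hy => deriv_deriv_eq_fderiv_fderiv (h2 y hy)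

/-- The unit vectors e are chosen pointwise, without continuity. The pointwise identity expresses
the integrand through the second time derivative of the density, the divergence and the density, all
continuous in a chart and free of e. -/
lemma continuous_integrand (h : IsNormalVariation g K ε F σ) (oS : ManifoldOrientation 2 S)
    (oM : ManifoldOrientation 4 M) {e : ∀ p : S, Tan 2 p}
    (he : ∀ p, pullForm g (F 0) p (e p) (e p) = 1) :
    Continuous fun p => integrand oS oM g (F 0) σ p (e p) := by
  rw [continuous_iff_continuousAt]
  intro q
  set χ := chartAt (Euc 2) q with hχ
  have hq : q ∈ χ.source := mem_chart_source _ q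
  have hden := continuousOn_areaDensity g h.minimal.smooth q
  have hc : ContinuousOn (fun y => (deriv (deriv fun t => areaDensity g (F t) q (χ.symm y)) 0
      - div2 (chartField oS oM g F σ q) y) / areaDensity g (F 0) q (χ.symm y)) χ.target :=
    ((h.continuousOn_deriv_deriv oS q).sub (continuousOn_div2 χ.open_target
      (h.contDiffOn_chartField oS oM q))).div hden fun y hy => (h.areaDensity_pos oS hy).ne'
  have hc' : ContinuousOn (fun y => integrand oS oM g (F 0) σ (χ.symm y) (e (χ.symm y)))
      χ.target := hc.congr fun y hy => by
    simp only [hχ]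
    rw [h.deriv_deriv_eq oS oM hy (he _), add_sub_cancel_right,
      mul_div_cancel_right₀ _ (h.areaDensity_pos oS hy).ne']
  have h1 := (hc'.continuousAt (χ.open_target.mem_nhds (χ.map_source hq))).comp
    (χ.continuousAt hq)
  refine h1.congr (Filter.eventuallyEq_of_mem (χ.open_source.mem_nhds hq) fun z hz => ?_)
  simp only [Function.comp_apply]
  rw [χ.left_inv hz]

lemma field_zero (h : IsNormalVariation g K ε F σ) (oS : ManifoldOrientation 2 S)
    (oM : ManifoldOrientation 4 M) {r : S} (hr : r ∉ K) : variationField oS oM g F σ r = 0 :=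
  variationField_eq_zero (h.minimal.immersion r)
    (Filter.mem_of_superset (isOpen_Ioo.mem_nhds ⟨neg_lt_zero.2 h.pos, h.pos⟩)
      fun t ht => h.fixed t ht r hr) (h.field_eq_zero r hr)

lemma chartField_eq_zero (h : IsNormalVariation g K ε F σ) (oS : ManifoldOrientation 2 S)
    (oM : ManifoldOrientation 4 M) {q : S} {y : Euc 2} (hy : y ∈ (chartAt (Euc 2) q).target)
    (hr : (chartAt (Euc 2) q).symm y ∉ K) : chartField oS oM g F σ q y = 0 := by
  rw [chartField, h.field_zero oS oM hr, toChart_zero ((chartAt (Euc 2) q).map_target hy), smul_zero]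

lemma div2_chartField_eq_zero (h : IsNormalVariation g K ε F σ) (oS : ManifoldOrientation 2 S)
    (oM : ManifoldOrientation 4 M) (hK : IsClosed K) {q : S} {y : Euc 2}
    (hy : y ∈ (chartAt (Euc 2) q).target) (hr : (chartAt (Euc 2) q).symm y ∉ K) :
    div2 (chartField oS oM g F σ q) y = 0 := by
  have : chartField oS oM g F σ q =ᶠ[𝓝 y] fun _ => 0 :=
    Filter.eventuallyEq_of_mem (((chartAt (Euc 2) q).symm.isOpen_inter_preimage
      hK.isOpen_compl).mem_nhds ⟨hy, hr⟩) fun z hz => h.chartField_eq_zero oS oM hz.1 hz.2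
  rw [div2, this.fderiv_eq]
  simp

/-- Near a point off the closed set K the maps do not depend on time and the variation field
vanishes. The identity then reads 0 = integrand · density, and the density is positive. -/
lemma integrand_eq_zero (h : IsNormalVariation g K ε F σ) (oS : ManifoldOrientation 2 S)
    (oM : ManifoldOrientation 4 M) (hK : IsClosed K) {p : S} (hp : p ∉ K) {e : Tan 2 p}
    (he : pullForm g (F 0) p e e = 1) : integrand oS oM g (F 0) σ p e = 0 := by
  have hs := mem_chart_source (Euc 2) p
  have h1 := (deriv_deriv_areaDensity h.minimal h.smooth_field h.normal h.pos h.smooth h.velocity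
    hs (U := chartField oS oM g F σ p) fun _ => rfl).2 e he
  have hy := (chartAt (Euc 2) p).map_source hs
  have hinv := (chartAt (Euc 2) p).left_inv hs
  rw [h.div2_chartField_eq_zero oS oM hK hy (by rwa [hinv]), add_zero] at h1
  have hc : (fun t => areaDensity g (F t) p p) =ᶠ[𝓝 0] fun _ => areaDensity g (F 0) p p := by
    refine Filter.eventuallyEq_of_mem (isOpen_Ioo.mem_nhds ⟨neg_lt_zero.2 h.pos, h.pos⟩)
      fun t ht => ?_
    have : F t =ᶠ[𝓝 p] F 0 := Filter.eventuallyEq_of_mem (hK.isOpen_compl.mem_nhds hp)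
      fun r hr => h.fixed t ht r hr
    simp only [areaDensity, pullForm_congr g this]
  have hd : deriv (deriv fun t => areaDensity g (F t) p p) 0 = 0 := by
    rw [hc.deriv.deriv_eq]
    simp
  have hpos := h.areaDensity_pos oS hy
  rw [hinv] at hpos
  rw [hd, eq_comm, mul_eq_zero] at h1
  exact h1.resolve_right hpos.ne'

/-- The field is continuous and vanishes off K, so it can be nonzero only at interior points of K.
No regularity of the boundary of K is needed, and the partition functions sum to 1 near such a
point. -/
lemma field_ne_zero (h : IsNormalVariation g K ε F σ) (oS : ManifoldOrientation 2 S)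
    (oM : ManifoldOrientation 4 M) {r : S} (hr : variationField oS oM g F σ r ≠ 0) :
    K ∈ 𝓝 r := by
  set χ := chartAt (Euc 2) r with hχ
  have hs : r ∈ χ.source := mem_chart_source (Euc 2) r
  have hy := χ.map_source hs
  have hU := ((h.contDiffOn_chartField oS oM r).continuousOn.continuousAt
    (χ.open_target.mem_nhds hy))
  have hne : chartField oS oM g F σ r (χ r) ≠ 0 := by
    rw [chartField, ← hχ, χ.left_inv hs]
    have hpos := h.areaDensity_pos oS hy
    rw [χ.left_inv hs] at hpos
    refine smul_ne_zero hpos.ne' fun h0 => hr ?_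
    rw [← ofChart_toChart hs (variationField oS oM g F σ r), h0, ofChart_zero hs]
  have h2 := (ContinuousAt.comp (f := χ) hU (χ.continuousAt hs)).eventually_ne hne
  filter_upwards [h2, χ.open_source.mem_nhds hs] with z hz hzs
  by_contra hzK
  refine hz ?_
  exact h.chartField_eq_zero oS oM (χ.map_source hzs) (by rwa [χ.left_inv hzs])

end IsNormalVariation

end

section

variable {S : Type*} [TopologicalSpace S] [ChartedSpace (Euc 2) S]

lemma isCompact_chart_image {q : S} {C : Set S} (hC : IsCompact C)
    (hs : C ⊆ (chartAt (Euc 2) q).source) : IsCompact (chartAt (Euc 2) q '' C) :=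
  hC.image_of_continuousOn ((chartAt (Euc 2) q).continuousOn.mono hs)

lemma chart_image_subset {q : S} {C : Set S} (hs : C ⊆ (chartAt (Euc 2) q).source) :
    chartAt (Euc 2) q '' C ⊆ (chartAt (Euc 2) q).target := by
  rintro _ ⟨p, hp, rfl⟩
  exact (chartAt (Euc 2) q).map_source (hs hp)

lemma symm_notMem {q : S} {C : Set S} {y : Euc 2} (hy : y ∈ (chartAt (Euc 2) q).target)
    (h : y ∉ chartAt (Euc 2) q '' C) : (chartAt (Euc 2) q).symm y ∉ C := fun hC =>
  h ⟨_, hC, (chartAt (Euc 2) q).right_inv hy⟩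

lemma symm_mem {q : S} {C : Set S} (hs : C ⊆ (chartAt (Euc 2) q).source) {y : Euc 2}
    (h : y ∈ chartAt (Euc 2) q '' C) : (chartAt (Euc 2) q).symm y ∈ C := by
  obtain ⟨p, hp, rfl⟩ := h
  rwa [(chartAt (Euc 2) q).left_inv (hs hp)]

end

/-! ### Integration by parts for the divergence term. -/

namespace IsNormalVariation

variable {S M : Type*} [TopologicalSpace S] [ChartedSpace (Euc 2) S] [IsManifold (𝓡 2) ∞ S]
  [TopologicalSpace M] [ChartedSpace (Euc 4) M] [IsManifold (𝓡 4) ∞ M]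
  {oS : ManifoldOrientation 2 S} {oM : ManifoldOrientation 4 M} {g : SmoothMetric 4 M}
  {F : ℝ → S → M} {σ : ∀ p : S, Tan 4 (F 0 p)} {ε : ℝ} {K : Set S}

/-- The derivative of `ρ` along the variation field. -/
noncomputable def derivAlong (oS : ManifoldOrientation 2 S) (oM : ManifoldOrientation 4 M)
    (g : SmoothMetric 4 M) (F : ℝ → S → M) (σ : ∀ p : S, Tan 4 (F 0 p)) (ρ : S → ℝ) (r : S) : ℝ :=
  mfderiv (𝓡 2) 𝓘(ℝ, ℝ) ρ r (variationField oS oM g F σ r)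

lemma contDiffOn_comp_symm {ρ : S → ℝ} (hρ : ContMDiff (𝓡 2) 𝓘(ℝ, ℝ) ∞ ρ) (q : S) :
    ContDiffOn ℝ ∞ (fun y => ρ ((chartAt (Euc 2) q).symm y)) (chartAt (Euc 2) q).target := by
  rw [← contMDiffOn_iff_contDiffOn]
  have h1 : ContMDiffOn (𝓡 2) (𝓡 2) ∞ (chartAt (Euc 2) q).symm (chartAt (Euc 2) q).target :=
    contMDiffOn_chart_symm
  exact hρ.comp_contMDiffOn h1

lemma fderiv_comp_symm_chartField (oS : ManifoldOrientation 2 S) (oM : ManifoldOrientation 4 M)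
    (g : SmoothMetric 4 M) (σ : ∀ p : S, Tan 4 (F 0 p)) {ρ : S → ℝ}
    (hρ : ContMDiff (𝓡 2) 𝓘(ℝ, ℝ) ∞ ρ) {q : S} {y : Euc 2}
    (hy : y ∈ (chartAt (Euc 2) q).target) :
    fderiv ℝ (fun y => ρ ((chartAt (Euc 2) q).symm y)) y (chartField oS oM g F σ q y) =
      areaDensity g (F 0) q ((chartAt (Euc 2) q).symm y) *
        derivAlong oS oM g F σ ρ ((chartAt (Euc 2) q).symm y) := by
  have hr := (chartAt (Euc 2) q).map_target hy
  have h1 := mfderiv_ofChart_eq_fderiv hr ((hρ _).mdifferentiableAt (by simp))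
    (toChart q _ (variationField oS oM g F σ ((chartAt (Euc 2) q).symm y)))
  rw [ofChart_toChart hr, (chartAt (Euc 2) q).right_inv hy] at h1
  rw [chartField, map_smul, smul_eq_mul, derivAlong]
  exact congrArg _ h1.symm

lemma derivAlong_eq_zero (oS : ManifoldOrientation 2 S) (oM : ManifoldOrientation 4 M)
    (g : SmoothMetric 4 M) (σ : ∀ p : S, Tan 4 (F 0 p)) {ρ : S → ℝ} {r : S} (hr : r ∉ tsupport ρ) :
    derivAlong oS oM g F σ ρ r = 0 := by
  have : ρ =ᶠ[𝓝 r] fun _ => 0 := notMem_tsupport_iff_eventuallyEq.1 hr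
  have h1 := this.mfderiv_eq (I := 𝓡 2) (I' := 𝓘(ℝ, ℝ))
  rw [mfderiv_const] at h1
  exact DFunLike.congr_fun h1 _

lemma continuous_derivAlong (h : IsNormalVariation g K ε F σ) (oS : ManifoldOrientation 2 S)
    (oM : ManifoldOrientation 4 M) {ρ : S → ℝ} (hρ : ContMDiff (𝓡 2) 𝓘(ℝ, ℝ) ∞ ρ) :
    Continuous (derivAlong oS oM g F σ ρ) := by
  rw [continuous_iff_continuousAt]
  intro q
  have hq := mem_chart_source (Euc 2) q
  have hy := (chartAt (Euc 2) q).map_source hq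
  have hc : ContinuousOn (fun y => fderiv ℝ (fun y => ρ ((chartAt (Euc 2) q).symm y)) y
      (chartField oS oM g F σ q y) / areaDensity g (F 0) q ((chartAt (Euc 2) q).symm y))
      (chartAt (Euc 2) q).target :=
    (((contDiffOn_comp_symm hρ q).continuousOn_fderiv_of_isOpen (chartAt (Euc 2) q).open_target
      (by simp)).clm_apply (h.contDiffOn_chartField oS oM q).continuousOn).div
      (continuousOn_areaDensity g h.minimal.smooth q) fun y hy => (h.areaDensity_pos oS hy).ne'
  have h1 := (hc.continuousAt ((chartAt (Euc 2) q).open_target.mem_nhds hy)).comp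
    ((chartAt (Euc 2) q).continuousAt hq)
  refine h1.congr (Filter.eventuallyEq_of_mem ((chartAt (Euc 2) q).open_source.mem_nhds hq)
    fun z hz => ?_)
  have hz' := (chartAt (Euc 2) q).map_source hz
  simp only [Function.comp_apply]
  rw [fderiv_comp_symm_chartField oS oM g σ hρ hz', mul_div_cancel_left₀ _
    (h.areaDensity_pos oS hz').ne', (chartAt (Euc 2) q).left_inv hz]

variable [SecondCountableTopology S] [MeasurableSpace S] [BorelSpace S]

lemma integrable_of_isCompact [T2Space S] {g : SmoothMetric 4 M} {u : S → M} (hu : ContMDiff (𝓡 2) (𝓡 4) ∞ u)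
    {C : Set S} (hC : IsCompact C) {φ : S → ℝ} (hφ : Measurable φ) (hφC : ContinuousOn φ C)
    (h0 : ∀ p ∉ C, φ p = 0) : Integrable φ (areaMeasure (pullForm g u)) := by
  obtain ⟨B, hB⟩ := hC.exists_bound_of_continuousOn hφC
  refine (integrableOn_iff_integrable_of_support_subset (s := C) fun p hp => ?_).1
    (Measure.integrableOn_of_bounded (M := B) (areaMeasure_lt_top g hu hC).ne
      hφ.aestronglyMeasurable ((ae_restrict_iff' hC.measurableSet).2 (Filter.Eventually.of_forall hB)))
  by_contra hpC
  exact hp (h0 p hpC)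

/-- The divergence theorem in the chart moves the derivative onto ρ. The result, the derivative of ρ
along the variation field, is intrinsic, so the contributions of different charts can be added. -/
lemma integral_mul_div2_chartField (h : IsNormalVariation g K ε F σ) (oS : ManifoldOrientation 2 S)
    (oM : ManifoldOrientation 4 M) {q : S} {ρ : S → ℝ}
    (hρ : ContMDiff (𝓡 2) 𝓘(ℝ, ℝ) ∞ ρ) (hc : IsCompact (tsupport ρ))
    (hs : tsupport ρ ⊆ (chartAt (Euc 2) q).source) :
    ∫ y in (chartAt (Euc 2) q).target,
        ρ ((chartAt (Euc 2) q).symm y) * div2 (chartField oS oM g F σ q) y =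
      - ∫ r, derivAlong oS oM g F σ ρ r ∂(areaMeasure (pullForm g (F 0))) := by
  set C := chartAt (Euc 2) q '' tsupport ρ with hC
  have hCc : IsCompact C := isCompact_chart_image hc hs
  have hCt : C ⊆ (chartAt (Euc 2) q).target := chart_image_subset hs
  have ho := (chartAt (Euc 2) q).open_target
  have hρ' := contDiffOn_comp_symm hρ q
  -- The inverse chart has arbitrary values outside its target, where ρ composed with it may be
  -- nonzero. The indicator removes these values and changes nothing inside the target.
  have hdiv := integral_mul_div2 (ρ := C.indicator fun y => ρ ((chartAt (Euc 2) q).symm y)) ho hCc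
    hCt ?_ (fun y hy => indicator_of_notMem hy _) (h.contDiffOn_chartField oS oM q)
  swap
  · refine (hρ'.of_le (by simp)).congr fun y hy => ?_
    by_cases hyC : y ∈ C
    · rw [indicator_of_mem hyC]
    · rw [indicator_of_notMem hyC, image_eq_zero_of_notMem_tsupport (symm_notMem hy hyC)]
  have heq : ∀ y ∈ (chartAt (Euc 2) q).target,
      C.indicator (fun y => ρ ((chartAt (Euc 2) q).symm y)) y = ρ ((chartAt (Euc 2) q).symm y) := by
    intro y hy
    by_cases hyC : y ∈ C
    · rw [indicator_of_mem hyC]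
    · rw [indicator_of_notMem hyC, image_eq_zero_of_notMem_tsupport (symm_notMem hy hyC)]
  have heq' : ∀ y ∈ (chartAt (Euc 2) q).target,
      C.indicator (fun y => ρ ((chartAt (Euc 2) q).symm y)) y * div2 (chartField oS oM g F σ q) y
        + fderiv ℝ (C.indicator fun y => ρ ((chartAt (Euc 2) q).symm y)) y
          (chartField oS oM g F σ q y) =
      ρ ((chartAt (Euc 2) q).symm y) * div2 (chartField oS oM g F σ q) y +
        areaDensity g (F 0) q ((chartAt (Euc 2) q).symm y) *
          derivAlong oS oM g F σ ρ ((chartAt (Euc 2) q).symm y) := by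
    intro y hy
    have he : C.indicator (fun y => ρ ((chartAt (Euc 2) q).symm y)) =ᶠ[𝓝 y]
        fun y => ρ ((chartAt (Euc 2) q).symm y) :=
      Filter.eventuallyEq_of_mem (ho.mem_nhds hy) heq
    rw [heq y hy, he.fderiv_eq, fderiv_comp_symm_chartField oS oM g σ hρ hy]
  have hcont := h.continuous_derivAlong oS oM hρ
  have hsupp {φ : Euc 2 → ℝ} (hφ : ContinuousOn φ (chartAt (Euc 2) q).target)
      (h0 : ∀ y ∈ (chartAt (Euc 2) q).target, y ∉ C → φ y = 0) :
      IntegrableOn φ (chartAt (Euc 2) q).target := by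
    refine IntegrableOn.of_forall_sdiff_eq_zero ((hφ.mono hCt).integrableOn_compact hCc)
      ho.measurableSet fun y hy => h0 y hy.1 hy.2
  rw [setIntegral_congr_fun ho.measurableSet heq', integral_add] at hdiv
  · rw [integral_areaMeasure g h.minimal.smooth q hcont.measurable fun r hr =>
      derivAlong_eq_zero oS oM g σ fun hr' => hr (hs hr')]
    linarith
  · refine hsupp (hρ'.continuousOn.mul (continuousOn_div2 ho (h.contDiffOn_chartField oS oM q)))
      fun y hy hyC => ?_
    rw [image_eq_zero_of_notMem_tsupport (symm_notMem hy hyC), zero_mul]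
  · refine hsupp ((continuousOn_areaDensity g h.minimal.smooth q).mul
      (hcont.comp_continuousOn (chartAt (Euc 2) q).continuousOn_symm)) fun y hy hyC => ?_
    rw [derivAlong_eq_zero oS oM g σ (symm_notMem hy hyC), mul_zero]

/-- The divergence of the variation field does not contribute to the second variation. -/
lemma sum_integral_mul_div2_eq_zero [T2Space S] (h : IsNormalVariation g K ε F σ)
    (oS : ManifoldOrientation 2 S) (oM : ManifoldOrientation 4 M) {u : Finset S} {ρ : S → S → ℝ}
    (hρ : ∀ q, ContMDiff (𝓡 2) 𝓘(ℝ, ℝ) ∞ (ρ q)) (hc : ∀ q, IsCompact (tsupport (ρ q)))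
    (hs : ∀ q, tsupport (ρ q) ⊆ (chartAt (Euc 2) q).source) (h1 : ∀ x ∈ K, ∑ q ∈ u, ρ q x = 1) :
    ∑ q ∈ u, ∫ y in (chartAt (Euc 2) q).target,
        ρ q ((chartAt (Euc 2) q).symm y) * div2 (chartField oS oM g F σ q) y = 0 := by
  have hcont (q : S) := h.continuous_derivAlong oS oM (hρ q)
  rw [Finset.sum_congr rfl fun q _ => h.integral_mul_div2_chartField oS oM (hρ q) (hc q) (hs q),
    Finset.sum_neg_distrib, ← integral_finsetSum]
  swap
  · exact fun q _ => integrable_of_isCompact h.minimal.smooth (hc q) (hcont q).measurable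
      (hcont q).continuousOn fun p hp => derivAlong_eq_zero oS oM g σ hp
  rw [neg_eq_zero]
  refine integral_eq_zero_of_ae (Filter.Eventually.of_forall fun r => ?_)
  simp only [Pi.zero_apply, derivAlong]
  -- Where the field is nonzero, the sum of the partition functions is 1 on a neighbourhood, so the
  -- sum of their differentials vanishes there.
  by_cases hr : variationField oS oM g F σ r = 0
  · refine Finset.sum_eq_zero fun q _ => ?_
    rw [hr]
    exact map_zero _
  · have hs := mem_chart_source (Euc 2) r
    have hy := (chartAt (Euc 2) r).map_source hs
    have hd (q : S) : (mfderiv (𝓡 2) 𝓘(ℝ, ℝ) (ρ q) r (variationField oS oM g F σ r) : ℝ) =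
        fderiv ℝ (fun y => ρ q ((chartAt (Euc 2) r).symm y)) (chartAt (Euc 2) r r)
          (toChart r r (variationField oS oM g F σ r)) := by
      have := mfderiv_ofChart_eq_fderiv hs ((hρ q r).mdifferentiableAt (by simp))
        (toChart r r (variationField oS oM g F σ r))
      rwa [ofChart_toChart hs] at this
    have hdiff (q : S) : DifferentiableAt ℝ (fun y => ρ q ((chartAt (Euc 2) r).symm y))
        (chartAt (Euc 2) r r) :=
      ((contDiffOn_comp_symm (hρ q) r _ hy).contDiffAt ((chartAt (Euc 2) r).open_target.mem_nhds
        hy)).differentiableAt (by simp)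
    have hsum : (fun y => ∑ q ∈ u, ρ q ((chartAt (Euc 2) r).symm y)) =ᶠ[𝓝 (chartAt (Euc 2) r r)]
        fun _ => 1 := by
      have hc := (chartAt (Euc 2) r).continuousAt_symm hy
      rw [ContinuousAt, (chartAt (Euc 2) r).left_inv hs] at hc
      exact Filter.eventuallyEq_of_mem (hc (h.field_ne_zero oS oM hr)) fun y hy => h1 _ hy
    refine (Finset.sum_congr rfl fun q _ => hd q).trans ?_
    rw [← _root_.sum_apply, ← fderiv_fun_sum fun q _ => hdiff q, hsum.fderiv_eq]
    simp

end IsNormalVariation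

/-! ### Integrals and areas through a partition of unity. -/

section

variable {S M : Type*} [TopologicalSpace S] [ChartedSpace (Euc 2) S] [IsManifold (𝓡 2) ∞ S]
  [TopologicalSpace M] [ChartedSpace (Euc 4) M] [IsManifold (𝓡 4) ∞ M]
  [T2Space S] [SecondCountableTopology S] [MeasurableSpace S] [BorelSpace S] {K : Set S}

/-- Integration over a compact set with the help of a partition of unity. -/
lemma integral_eq_sum {g : SmoothMetric 4 M} {w : S → M} (hw : ContMDiff (𝓡 2) (𝓡 4) ∞ w)
    (hK : IsCompact K) {u : Finset S} {ρ : S → S → ℝ} (hρ : ∀ q, Continuous (ρ q))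
    (hs : ∀ q, tsupport (ρ q) ⊆ (chartAt (Euc 2) q).source) (h1 : ∀ x ∈ K, ∑ q ∈ u, ρ q x = 1)
    {φ : S → ℝ} (hφ : Measurable φ) (hφK : ContinuousOn φ K) (h0 : ∀ p ∉ K, φ p = 0) :
    ∫ p, φ p ∂(areaMeasure (pullForm g w)) =
      ∑ q ∈ u, ∫ y in chartAt (Euc 2) q '' (tsupport (ρ q) ∩ K),
        areaDensity g w q ((chartAt (Euc 2) q).symm y) *
          (ρ q ((chartAt (Euc 2) q).symm y) * φ ((chartAt (Euc 2) q).symm y)) := by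
  have hsum : ∀ p, φ p = ∑ q ∈ u, ρ q p * φ p := by
    intro p
    by_cases hp : p ∈ K
    · rw [← Finset.sum_mul, h1 p hp, one_mul]
    · simp [h0 p hp]
  rw [integral_congr_ae (Filter.Eventually.of_forall hsum), integral_finsetSum]
  swap
  · exact fun q _ => IsNormalVariation.integrable_of_isCompact hw hK ((hρ q).measurable.mul hφ)
      ((hρ q).continuousOn.mul hφK) fun p hp => by simp [h0 p hp]
  refine Finset.sum_congr rfl fun q _ => ?_
  have hsub : tsupport (ρ q) ∩ K ⊆ (chartAt (Euc 2) q).source := inter_subset_left.trans (hs q)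
  rw [integral_areaMeasure g hw q (ψ := fun p => ρ q p * φ p) ((hρ q).measurable.mul hφ)]
  · refine (setIntegral_eq_of_subset_of_forall_sdiff_eq_zero
      (chartAt (Euc 2) q).open_target.measurableSet (chart_image_subset hsub) fun y hy => ?_)
    have hy' := symm_notMem hy.1 hy.2
    rw [mem_inter_iff, not_and_or] at hy'
    rcases hy' with h | h
    · simp [image_eq_zero_of_notMem_tsupport h]
    · simp [h0 _ h]
  · intro r hr
    simp [image_eq_zero_of_notMem_tsupport fun h => hr (hs q h)]

/-- The partition functions and the domains of integration are independent of the map w. For w = F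
t, time therefore enters only through the density. -/
lemma area_eq_sum {g : SmoothMetric 4 M} {w : S → M} (hw : ContMDiff (𝓡 2) (𝓡 4) ∞ w)
    (hK : IsCompact K) {u : Finset S} {ρ : S → S → ℝ} (hρ : ∀ q, Continuous (ρ q))
    (hs : ∀ q, tsupport (ρ q) ⊆ (chartAt (Euc 2) q).source) (h1 : ∀ x ∈ K, ∑ q ∈ u, ρ q x = 1) :
    area g K w = ∑ q ∈ u, ∫ y in chartAt (Euc 2) q '' (tsupport (ρ q) ∩ K),
      areaDensity g w q ((chartAt (Euc 2) q).symm y) * ρ q ((chartAt (Euc 2) q).symm y) := by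
  have hKm := hK.measurableSet
  rw [area, ← Measure.real, ← integral_indicator_one hKm,
    integral_eq_sum hw hK hρ hs h1 (measurable_one.indicator hKm)
      ((continuousOn_const (c := (1 : ℝ))).congr fun p hp => by simp [hp])
      fun p hp => by simp [hp]]
  refine Finset.sum_congr rfl fun q _ => ?_
  have hsub : tsupport (ρ q) ∩ K ⊆ (chartAt (Euc 2) q).source := inter_subset_left.trans (hs q)
  refine setIntegral_congr_fun (isCompact_chart_image
    (hK.inter_left (isClosed_tsupport _)) hsub).measurableSet fun y hy => ?_
  rw [indicator_of_mem (symm_mem hsub hy).2, Pi.one_apply, mul_one]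

end

/-! ### The second derivative of area. -/

namespace IsNormalVariation

variable {S M : Type*} [TopologicalSpace S] [ChartedSpace (Euc 2) S] [IsManifold (𝓡 2) ∞ S]
  [TopologicalSpace M] [ChartedSpace (Euc 4) M] [IsManifold (𝓡 4) ∞ M]
  [T2Space S] [SecondCountableTopology S] [MeasurableSpace S] [BorelSpace S]
  {oS : ManifoldOrientation 2 S} {oM : ManifoldOrientation 4 M} {g : SmoothMetric 4 M}
  {F : ℝ → S → M} {σ : ∀ p : S, Tan 4 (F 0 p)} {ε : ℝ} {K : Set S}

lemma integrable_integrand (h : IsNormalVariation g K ε F σ) (oS : ManifoldOrientation 2 S)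
    (oM : ManifoldOrientation 4 M) (hK : IsCompact K) {e : ∀ p : S, Tan 2 p}
    (he : ∀ p, pullForm g (F 0) p (e p) (e p) = 1) :
    Integrable (fun p => integrand oS oM g (F 0) σ p (e p)) (areaMeasure (pullForm g (F 0))) :=
  integrable_of_isCompact h.minimal.smooth hK (h.continuous_integrand oS oM he).measurable
    (h.continuous_integrand oS oM he).continuousOn
    fun p hp => h.integrand_eq_zero oS oM hK.isClosed hp (he p)

/-- Each chart integral of the density is differentiated twice under the integral sign. The
pointwise identity splits the result into the integrand and a divergence, whose total over all
charts is zero. -/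
lemma hasSecondDerivAt_area (h : IsNormalVariation g K ε F σ) (oS : ManifoldOrientation 2 S)
    (oM : ManifoldOrientation 4 M) (hK : IsCompact K) {e : ∀ p : S, Tan 2 p}
    (he : ∀ p, pullForm g (F 0) p (e p) (e p) = 1) :
    HasSecondDerivAt (fun t => area g K (F t))
      (∫ p, integrand oS oM g (F 0) σ p (e p) ∂(areaMeasure (pullForm g (F 0)))) 0 := by
  obtain ⟨u, ρ, hρ, hρ0, hρ1, hc, hs, h1⟩ := exists_finite_partition (n := 2) hK
    (fun q => (chartAt (Euc 2) q).source)
    fun q => (chartAt (Euc 2) q).open_source.mem_nhds (mem_chart_source _ q)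
  set C : S → Set (Euc 2) := fun q => chartAt (Euc 2) q '' (tsupport (ρ q) ∩ K) with hC
  have hsub (q : S) : tsupport (ρ q) ∩ K ⊆ (chartAt (Euc 2) q).source :=
    inter_subset_left.trans (hs q)
  have hCc (q : S) : IsCompact (C q) :=
    isCompact_chart_image (hK.inter_left (isClosed_tsupport _)) (hsub q)
  have hCt (q : S) : C q ⊆ (chartAt (Euc 2) q).target := chart_image_subset (hsub q)
  have hρc (q : S) : ContinuousOn (fun y => ρ q ((chartAt (Euc 2) q).symm y))
      (chartAt (Euc 2) q).target := (contDiffOn_comp_symm (hρ q) q).continuousOn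
  -- Cutting off the weight outside the compact set makes it measurable and bounded by 1 on the
  -- whole plane, as differentiation under the integral sign requires.
  set r : S → Euc 2 → ℝ := fun q =>
    (C q).indicator fun y => ρ q ((chartAt (Euc 2) q).symm y) with hr
  have hrm (q : S) : Measurable (r q) := by
    classical
    exact (((hρc q).mono (hCt q)).measurable_piecewise (g := fun _ => (0 : ℝ)) continuousOn_const
      (hCc q).measurableSet)
  have hrb (q : S) (y : Euc 2) : |r q y| ≤ 1 := by
    by_cases hy : y ∈ C q
    · rw [hr]
      simp only [indicator_of_mem hy]
      rw [abs_of_nonneg (hρ0 _ _)]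
      exact hρ1 _ _
    · simp [hr, indicator_of_notMem hy]
  have harea : (fun t => area g K (F t)) =ᶠ[𝓝 0] fun t => ∑ q ∈ u, ∫ y in C q,
      areaDensity g (F t) q ((chartAt (Euc 2) q).symm y) * r q y := by
    refine Filter.eventuallyEq_of_mem (isOpen_Ioo.mem_nhds ⟨neg_lt_zero.2 h.pos, h.pos⟩)
      fun t ht => ?_
    beta_reduce
    rw [area_eq_sum (contMDiff_of_variation h.smooth ht) hK (fun q => (hρ q).continuous) hs h1]
    refine Finset.sum_congr rfl fun q _ => setIntegral_congr_fun (hCc q).measurableSet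
      fun y hy => ?_
    simp only [hr]
    rw [indicator_of_mem hy]
  have hmain := HasSecondDerivAt.sum (u := u) fun q _ => hasSecondDerivAt_setIntegral
    (μ := volume) (hCc q) (s := fun z : ℝ × Euc 2 => areaDensity g (F z.1) q
      ((chartAt (Euc 2) q).symm z.2)) (fun y hy => (h.contDiffAt_areaDensity oS
        (hCt q hy)).of_le ENat.LEInfty.out) (hrm q) (hrb q)
  refine cast (congrArg (HasSecondDerivAt _ · 0) ?_) (hmain.congr harea)
  have hQ := h.continuous_integrand oS oM he
  rw [integral_eq_sum h.minimal.smooth hK (fun q => (hρ q).continuous) hs h1 hQ.measurable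
    hQ.continuousOn fun p hp => h.integrand_eq_zero oS oM hK.isClosed hp (he p)]
  have hdiv := h.sum_integral_mul_div2_eq_zero oS oM hρ hc hs h1
  refine sub_eq_zero.1 (Eq.trans ?_ hdiv)
  rw [← Finset.sum_sub_distrib]
  refine Finset.sum_congr rfl fun q _ => ?_
  have hdivc := continuousOn_div2 (chartAt (Euc 2) q).open_target (h.contDiffOn_chartField oS oM q)
  have hA : IntegrableOn (fun y => deriv (deriv fun t =>
      areaDensity g (F t) q ((chartAt (Euc 2) q).symm y)) 0 * r q y) (C q) :=
    integrableOn_mul_of_continuousOn (hCc q) ((h.continuousOn_deriv_deriv oS q).mono (hCt q))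
      (hrm q) (hrb q)
  have hB : IntegrableOn (fun y => areaDensity g (F 0) q ((chartAt (Euc 2) q).symm y) *
      (ρ q ((chartAt (Euc 2) q).symm y) * integrand oS oM g (F 0) σ ((chartAt (Euc 2) q).symm y)
        (e ((chartAt (Euc 2) q).symm y)))) (C q) :=
    (((continuousOn_areaDensity g h.minimal.smooth q).mul ((hρc q).mul
      (hQ.comp_continuousOn (chartAt (Euc 2) q).continuousOn_symm))).mono
        (hCt q)).integrableOn_compact (hCc q)
  refine (integral_sub hA hB).symm.trans ?_
  -- The domain of the divergence integral can be enlarged to the whole chart: off the compact set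
  -- either ρ vanishes, or the point lies off K and the divergence does.
  rw [setIntegral_eq_of_subset_of_forall_sdiff_eq_zero
    (chartAt (Euc 2) q).open_target.measurableSet (hCt q)
    (f := fun y => ρ q ((chartAt (Euc 2) q).symm y) * div2 (chartField oS oM g F σ q) y)]
  · refine setIntegral_congr_fun (hCc q).measurableSet fun y hy => ?_
    rw [h.deriv_deriv_eq oS oM (hCt q hy) (he _)]
    simp only [hr, indicator_of_mem hy]
    ring
  · intro y hy
    have hy' := symm_notMem hy.1 hy.2
    rw [mem_inter_iff, not_and_or] at hy'
    rcases hy' with h' | h'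
    · simp [image_eq_zero_of_notMem_tsupport h']
    · simp [h.div2_chartField_eq_zero oS oM hK.isClosed hy.1 h']

end IsNormalVariation

/-! ### Existence of variations -/

section

variable {M : Type*} [TopologicalSpace M] [ChartedSpace (Euc 4) M] [IsManifold (𝓡 4) ∞ M]

/-- The velocity of a curve, read in a chart. -/
lemma velocity_eq_iff {γ : ℝ → M} (hγ : MDifferentiableAt 𝓘(ℝ, ℝ) (𝓡 4) γ 0) {x : M} (hx : γ 0 = x)
    {m : M} (hm : x ∈ (chartAt (Euc 4) m).source) (v : Tan 4 x) :
    (⟨γ 0, mfderiv 𝓘(ℝ, ℝ) (𝓡 4) γ 0 (1 : ℝ)⟩ : TangentBundle (𝓡 4) M) = ⟨x, v⟩ ↔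
      HasDerivAt (fun t => chartAt (Euc 4) m (γ t)) (toChart m x v) 0 := by
  subst hx
  have h1 := toChart_mfderiv hγ hm (1 : ℝ)
  have h2 : MDifferentiableAt 𝓘(ℝ, ℝ) 𝓘(ℝ, Euc 4) (fun t => chartAt (Euc 4) m (γ t)) 0 :=
    (mdifferentiableAt_chart hm).comp 0 hγ
  have h3 : toChart m (γ 0) (mfderiv 𝓘(ℝ, ℝ) (𝓡 4) γ 0 (1 : ℝ)) =
      deriv (fun t => chartAt (Euc 4) m (γ t)) 0 := by
    refine h1.trans ?_
    rw [mfderiv_eq_fderiv]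
    rfl
  have h4 := h2.differentiableAt.hasDerivAt
  rw [Bundle.TotalSpace.mk_inj, ← toChart_inj hm, h3]
  exact ⟨fun h => h ▸ h4, fun h => h.deriv⟩

variable {S : Type*} [TopologicalSpace S] [ChartedSpace (Euc 2) S]

lemma contMDiffOn_toChart {f : S → M} {σ : ∀ p : S, Tan 4 (f p)} (hσ : SmoothAlong f σ) (m : M) :
    ContMDiffOn (𝓡 2) 𝓘(ℝ, Euc 4) ∞ (fun p => toChart m (f p) (σ p))
      (f ⁻¹' (chartAt (Euc 4) m).source) := by
  have h2 : ContMDiffOn (𝓡 2) (𝓡 4).tangent ∞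
      (fun p => (⟨f p, σ p⟩ : TangentBundle (𝓡 4) M)) (f ⁻¹' (chartAt (Euc 4) m).source) :=
    hσ.contMDiffOn
  exact (((trivializationAt (Euc 4) (fun x : M => TangentSpace (𝓡 4) x) m).contMDiffOn_iff
    (IB := 𝓡 4) (n := ∞) (f := fun p => (⟨f p, σ p⟩ : TangentBundle (𝓡 4) M))
    (s := f ⁻¹' (chartAt (Euc 4) m).source) (fun p hp => by
      rw [(trivializationAt (Euc 4) (fun x : M => TangentSpace (𝓡 4) x) m).source_eq]
      exact hp)).1 h2).2

/-- Displacement of a variation in the direction `σ`, by an amount `t ρ`, in a chart of `M`. -/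
lemma exists_displacement {f : S → M} {σ : ∀ p : S, Tan 4 (f p)} (hf : Continuous f)
    (hσ : SmoothAlong f σ) {K : Set S} (hσK : ∀ p ∉ K, σ p = 0) {ρ : S → ℝ}
    (hρ : ContMDiff (𝓡 2) 𝓘(ℝ, ℝ) ∞ ρ) (hc : IsCompact (tsupport ρ)) {m : M}
    (hs : tsupport ρ ⊆ f ⁻¹' (chartAt (Euc 4) m).source) {s : S → ℝ} {F : ℝ → S → M}
    (hF : IsVariation f K (fun p => s p • σ p) F) :
    ∃ F', IsVariation f K (fun p => (s p + ρ p) • σ p) F' := by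
  obtain ⟨rfl, hv, ε, hε, hsm, hfix⟩ := hF
  classical
  set c := chartAt (Euc 4) m with hcdef
  set G : ℝ × S → Euc 4 := fun z => c (F z.1 z.2) + (z.1 * ρ z.2) • toChart m (F 0 z.2) (σ z.2)
    with hG
  have hO : IsOpen (Ioo (-ε) ε ×ˢ (univ : Set S)) := isOpen_Ioo.prod isOpen_univ
  set A : Set (ℝ × S) := (Ioo (-ε) ε ×ˢ univ) ∩
    ((fun z : ℝ × S => F z.1 z.2) ⁻¹' c.source ∩ (fun z : ℝ × S => F 0 z.2) ⁻¹' c.source) with hA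
  have hAo : IsOpen A := by
    rw [hA, ← inter_assoc]
    exact (hsm.continuousOn.isOpen_inter_preimage hO c.open_source).inter
      (c.open_source.preimage (hf.comp continuous_snd))
  have hGA : ContMDiffOn (𝓘(ℝ, ℝ).prod (𝓡 2)) 𝓘(ℝ, Euc 4) ∞ G A := by
    have h1 : ContMDiffOn (𝓘(ℝ, ℝ).prod (𝓡 2)) 𝓘(ℝ, Euc 4) ∞ (fun z : ℝ × S => c (F z.1 z.2)) A :=
      (contMDiffOn_chart (I := 𝓡 4) (n := ∞) (x := m)).comp (hsm.mono inter_subset_left)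
        fun z hz => hz.2.1
    have h2 : ContMDiffOn (𝓘(ℝ, ℝ).prod (𝓡 2)) 𝓘(ℝ, ℝ) ∞ (fun z : ℝ × S => z.1 * ρ z.2) A :=
      (contMDiff_fst.mul (hρ.comp contMDiff_snd)).contMDiffOn
    have h3 : ContMDiffOn (𝓘(ℝ, ℝ).prod (𝓡 2)) 𝓘(ℝ, Euc 4) ∞
        (fun z : ℝ × S => toChart m (F 0 z.2) (σ z.2)) A :=
      (contMDiffOn_toChart hσ m).comp contMDiff_snd.contMDiffOn fun z hz => hz.2.2
    exact h1.add (h2.smul h3)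
  set B : Set (ℝ × S) := A ∩ G ⁻¹' c.target with hB
  have hBo : IsOpen B := hGA.continuousOn.isOpen_inter_preimage hAo c.open_target
  have hsymm : ContMDiffOn (𝓘(ℝ, ℝ).prod (𝓡 2)) (𝓡 4) ∞ (fun z => c.symm (G z)) B :=
    (contMDiffOn_chart_symm (I := 𝓡 4) (n := ∞) (x := m)).comp (hGA.mono inter_subset_left)
      fun z hz => hz.2
  have h0 : (0 : ℝ) ∈ Ioo (-ε) ε := ⟨neg_lt_zero.2 hε, hε⟩
  have hG0 (p : S) : G (0, p) = c (F 0 p) := by simp [hG]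
  -- At time 0 the displacement is zero and stays in the chart over the compact support of ρ. The
  -- tube lemma gives a common time interval and a neighbourhood W of the support where this
  -- persists.
  obtain ⟨T, W, hT, hW, h0T, hLW, hsub⟩ := generalized_tube_lemma
    (isCompact_singleton (x := (0 : ℝ))) hc hBo (by
      rintro ⟨t, p⟩ ⟨rfl, hp⟩
      refine ⟨⟨⟨h0, mem_univ _⟩, hs hp, hs hp⟩, ?_⟩
      rw [mem_preimage, hG0]
      exact c.map_source (hs hp))
  obtain ⟨δ, hδ, hδT⟩ := Metric.isOpen_iff.1 (hT.inter isOpen_Ioo) 0 ⟨h0T rfl, h0⟩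
  rw [Real.ball_eq_Ioo, zero_sub, zero_add] at hδT
  have hmem {t : ℝ} (ht : t ∈ Ioo (-δ) δ) {p : S} (hp : p ∈ W) : (t, p) ∈ B :=
    hsub ⟨(hδT ht).1, hp⟩
  have h0δ : (0 : ℝ) ∈ Ioo (-δ) δ := ⟨neg_lt_zero.2 hδ, hδ⟩
  set F' : ℝ → S → M := fun t p => if p ∈ tsupport ρ then c.symm (G (t, p)) else F t p with hF'
  have hnot {t : ℝ} {p : S} (hp : p ∉ tsupport ρ) : F' t p = F t p := if_neg hp
  -- Where ρσ = 0 the displaced map agrees with the old one. Off the support of ρ this allows smooth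
  -- gluing; off K, where σ = 0, it keeps the map fixed.
  have hGF {t : ℝ} {p : S} (hz : (t, p) ∈ B) (hp : ρ p • σ p = 0) : c.symm (G (t, p)) = F t p := by
    have hsrc : F 0 p ∈ c.source := hz.1.2.2
    have : G (t, p) = c (F t p) := by
      simp only [hG]
      rw [mul_smul, ← toChart_smul hsrc, hp, toChart_zero hsrc, smul_zero, add_zero]
    rw [this, c.left_inv hz.1.2.1]
  have hW' {t : ℝ} (ht : t ∈ Ioo (-δ) δ) {p : S} (hp : p ∈ W) : F' t p = c.symm (G (t, p)) := by
    by_cases hpL : p ∈ tsupport ρ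
    · exact if_pos hpL
    · rw [hnot hpL, hGF (hmem ht hp) (by rw [image_eq_zero_of_notMem_tsupport hpL, zero_smul])]
  have hzero (p : S) : F' 0 p = F 0 p := by
    by_cases hpL : p ∈ tsupport ρ
    · rw [hW' h0δ (hLW hpL), hG0, c.left_inv (hs hpL)]
    · exact hnot hpL
  have hcurve {ε : ℝ} (hε : 0 < ε) {F : ℝ → S → M} (hF : ContMDiffOn (𝓘(ℝ, ℝ).prod (𝓡 2)) (𝓡 4) ∞
      (fun z : ℝ × S => F z.1 z.2) (Ioo (-ε) ε ×ˢ (univ : Set S))) (p : S) :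
      MDifferentiableAt 𝓘(ℝ, ℝ) (𝓡 4) (fun t => F t p) 0 := by
    have h1 : ContMDiffAt (𝓘(ℝ, ℝ).prod (𝓡 2)) (𝓡 4) ∞ (fun z : ℝ × S => F z.1 z.2) (0, p) :=
      hF.contMDiffAt ((isOpen_Ioo.prod isOpen_univ).mem_nhds
        ⟨⟨neg_lt_zero.2 hε, hε⟩, mem_univ _⟩)
    have h2 : ContMDiffAt 𝓘(ℝ, ℝ) (𝓘(ℝ, ℝ).prod (𝓡 2)) ∞ (fun t : ℝ => (t, p)) 0 :=
      contMDiffAt_id.prodMk contMDiffAt_const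
    exact (ContMDiffAt.comp (0 : ℝ) (g := fun z : ℝ × S => F z.1 z.2) h1 h2).mdifferentiableAt
      (by simp)
  have hsm' : ContMDiffOn (𝓘(ℝ, ℝ).prod (𝓡 2)) (𝓡 4) ∞ (fun z : ℝ × S => F' z.1 z.2)
      (Ioo (-δ) δ ×ˢ (univ : Set S)) := by
    rintro ⟨t, p⟩ ⟨ht, -⟩
    refine ContMDiffAt.contMDiffWithinAt ?_
    by_cases hpL : p ∈ tsupport ρ
    · have hz := hmem ht (hLW hpL)
      refine (hsymm.contMDiffAt (hBo.mem_nhds hz)).congr_of_eventuallyEq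
        (Filter.eventuallyEq_of_mem ((isOpen_Ioo.prod hW).mem_nhds ⟨ht, hLW hpL⟩) ?_)
      exact fun z hz => hW' hz.1 hz.2
    · refine (hsm.contMDiffAt (hO.mem_nhds ⟨(hδT ht).2, mem_univ p⟩)).congr_of_eventuallyEq
        (Filter.eventuallyEq_of_mem ((isOpen_univ.prod
          (isClosed_tsupport ρ).isOpen_compl).mem_nhds ⟨mem_univ t, hpL⟩) ?_)
      exact fun z hz => hnot hz.2
  refine ⟨F', funext hzero, fun p => ?_, δ, hδ, hsm', fun t ht p hp => ?_⟩
  · by_cases hpL : p ∈ tsupport ρ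
    · have hsrc : F 0 p ∈ c.source := hs hpL
      refine (velocity_eq_iff (hcurve hδ hsm' p) (hzero p) hsrc _).2 ?_
      have h1 := (velocity_eq_iff (hcurve hε hsm p) rfl hsrc _).1 (hv p)
      have h2 : HasDerivAt (fun t : ℝ => (t * ρ p) • toChart m (F 0 p) (σ p))
          ((1 * ρ p) • toChart m (F 0 p) (σ p)) 0 :=
        ((hasDerivAt_id (0 : ℝ)).mul_const (ρ p)).smul_const _
      have h3 := h1.add h2
      rw [one_mul, ← toChart_smul hsrc, ← toChart_add hsrc, ← add_smul] at h3
      refine h3.congr_of_eventuallyEq (Filter.eventuallyEq_of_mem (isOpen_Ioo.mem_nhds h0δ)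
        fun t ht => ?_)
      have hz := hmem ht (hLW hpL)
      beta_reduce
      rw [hW' ht (hLW hpL), c.right_inv hz.2]
      rfl
    · have h1 : (fun t => F' t p) = fun t => F t p := funext fun t => hnot hpL
      have h2 : ∀ γ γ' : ℝ → M, γ = γ' →
          (⟨γ 0, mfderiv 𝓘(ℝ, ℝ) (𝓡 4) γ 0 (1 : ℝ)⟩ : TangentBundle (𝓡 4) M) =
            ⟨γ' 0, mfderiv 𝓘(ℝ, ℝ) (𝓡 4) γ' 0 (1 : ℝ)⟩ := by
        rintro γ _ rfl
        rfl
      rw [image_eq_zero_of_notMem_tsupport hpL, add_zero, ← hv p]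
      exact h2 _ _ h1
  · by_cases hpL : p ∈ tsupport ρ
    · rw [hW' ht (hLW hpL), hGF (hmem ht (hLW hpL)) (by rw [hσK p hp, smul_zero])]
      exact hfix t (hδT ht).2 p hp
    · rw [hnot hpL]
      exact hfix t (hδT ht).2 p hp

/-- Since σ is the sum of the fields ρ_q σ, the velocity can be built up one chart at a time,
starting from the constant family. Linear displacement in charts of M replaces the exponential map.
-/
lemma exists_isVariation [IsManifold (𝓡 2) ∞ S] [T2Space S] [SecondCountableTopology S] {f : S → M}
    {σ : ∀ p : S, Tan 4 (f p)} (hf : ContMDiff (𝓡 2) (𝓡 4) ∞ f) (hσ : SmoothAlong f σ) {K : Set S}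
    (hK : IsCompact K) (hσK : ∀ p ∉ K, σ p = 0) : ∃ F, IsVariation f K σ F := by
  classical
  obtain ⟨u, ρ, hρ, -, -, hc, hs, h1⟩ := exists_finite_partition (n := 2) hK
    (fun q => f ⁻¹' (chartAt (Euc 4) (f q)).source) fun q =>
      ((chartAt (Euc 4) (f q)).open_source.preimage hf.continuous).mem_nhds (mem_chart_source _ _)
  have key : ∀ w : Finset S, ∃ F, IsVariation f K (fun p => (∑ q ∈ w, ρ q p) • σ p) F := by
    intro w
    induction w using Finset.induction_on with
    | empty =>
      refine ⟨fun _ => f, rfl, fun p => ?_, 1, one_pos,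
        (hf.comp contMDiff_snd).contMDiffOn, fun _ _ _ _ => rfl⟩
      rw [mfderiv_const, Finset.sum_empty, zero_smul]
      rfl
    | insert q w hq ih =>
      obtain ⟨F, hF⟩ := ih
      obtain ⟨F', hF'⟩ := exists_displacement hf.continuous hσ hσK (hρ q) (hc q) (hs q) hF
      refine ⟨F', ?_⟩
      simp only [Finset.sum_insert hq, add_comm (ρ q _)]
      exact hF'
  obtain ⟨F, hF⟩ := key u
  refine ⟨F, ?_⟩
  convert hF using 2 with p
  by_cases hp : p ∈ K
  · rw [h1 p hp, one_smul]
  · rw [hσK p hp, smul_zero]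

end

end SurfaceVariation

theorem theorem3p13
    {S : Type*} [TopologicalSpace S] [T2Space S] [SecondCountableTopology S]
    [ChartedSpace (Euc 2) S] [IsManifold (𝓡 2) ∞ S] [MeasurableSpace S] [BorelSpace S]
    {M : Type*} [TopologicalSpace M] [T2Space M]
    [ChartedSpace (Euc 4) M] [IsManifold (𝓡 4) ∞ M]
    (oS : ManifoldOrientation 2 S) (oM : ManifoldOrientation 4 M)
    (g : SmoothMetric 4 M) (f : S → M) (hf : IsMinimalImmersion g f)
    (σ : ∀ p : S, Tan 4 (f p)) (hσ : SmoothAlong f σ) (hnormal : ∀ p, IsNormal g f p (σ p))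
    (K : Set S) (hK : IsCompact K) (hσK : ∀ p ∉ K, σ p = 0)
    (e : ∀ p : S, Tan 2 p) (he : ∀ p, pullForm g f p (e p) (e p) = 1)
    (Q : S → ℝ)
    (hQ : ∀ p, Q p =
      2 * dbarSq oS oM g f σ p (e p)
        + (normalK oS oM g f p
            - sectional g (f p) (σ p) (mfderiv (𝓡 2) (𝓡 4) f p (e p))
            - sectional g (f p) (σ p) (mfderiv (𝓡 2) (𝓡 4) f p (tangentI oS g f p (e p))))
          * g.inner (f p) (σ p) (σ p)
        - shapeSq oS g f σ p (e p)) :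
    Integrable Q (areaMeasure (pullForm g f)) ∧
      IsSecondVariation g f K σ (∫ p, Q p ∂(areaMeasure (pullForm g f))) := by
  have hQ' : Q = fun p => integrand oS oM g f σ p (e p) := funext hQ
  subst hQ'
  -- A variation is needed for integrability as well: continuity and support of the integrand are
  -- read off from the second derivative of the density along some variation.
  obtain ⟨F₀, hF₀⟩ := exists_isVariation hf.smooth hσ hK hσK
  have key : ∀ F : ℝ → S → M, IsVariation f K σ F →
      Integrable (fun p => integrand oS oM g f σ p (e p)) (areaMeasure (pullForm g f)) ∧
        HasSecondDerivAt (fun t => area g K (F t))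
          (∫ p, integrand oS oM g f σ p (e p) ∂(areaMeasure (pullForm g f))) 0 := by
    rintro F ⟨rfl, hv, ε, hε, hsm, hfix⟩
    have h : IsNormalVariation g K ε F σ :=
      ⟨hf, hσ, hnormal, hε, hsm, fun p => Bundle.TotalSpace.mk_inj.1 (hv p), hfix, hσK⟩
    exact ⟨h.integrable_integrand oS oM hK he, h.hasSecondDerivAt_area oS oM hK he⟩
  exact ⟨(key F₀ hF₀).1, ⟨F₀, hF₀⟩, fun F hF => (key F hF).2⟩
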